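/- Let $\Sigma=\{0,1,\#\}$. For $x,y\in\{0,1\}^n$ let $DISJ_n(x,y)=\bigwedge_{i=0}^{n-1}(\neg x_i\vee\neg y_i)$, and let $$L_{DISJ}=\bigl\{\,1^k\#(x\#y\#x\#)^{2^k}\ :\ k\ge 1,\ x,y\in\{0,1\}^{2^{2k}},\ DISJ_{2^{2k}}(x,y)=1\,\bigr\}\subseteq\Sigma^*.$$ An online probabilistic Turing machine (OPTM) is a probabilistic Turing machine (one fair coin flip per step) with a one-way read-only input tape, one read-write work tape and a one-way write-only output tape, all over the alphabet $\Sigma$; its space is the number of work-tape cells scanned. Let $G_0=H$ (Hadamard), $G_1=T=\mathrm{diag}(1,e^{i\pi/4})$ and $G_2=\mathrm{CNOT}$. For qubits $a,b$, let $G_c^{[a,b]}$ be $G_c$ applied to qubit $a$ (if $c\in\{0,1\}$) or to the control qubit $a$ and the target qubit $b$ (if $c=2$) when $a\ne b$, and the identity when $a=b$. For $s:\mathbb N\to\mathbb N$, let $OQRSPACE(s)$ be the class of languages $L\subseteq\Sigma^*$ for which there is an OPTM $M$ such that for every $w\in\Sigma^*$, with $m=s(|w|)$: 1. whatever the outcomes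 of the coin flips, $M$ halts on $w$ after at most $2^{m}$ steps and uses at most $m$ space; 2. whatever the outcomes of the coin flips, the content of the output tape when $M$ halts is of the form $a_1\#b_1\#c_1\#\cdots\#a_r\#b_r\#c_r$ for some $r\ge 1$, $a_i,b_i\in\{0,\dots,m-1\}$ and $c_i\in\{0,1,2\}$, written in binary; 3. if $w\in L$, then with probability at least $1/4$ over the coin flips, measuring the first qubit (qubit $0$) of the $m$-qubit state $G_{c_r}^{[a_r,b_r]}\cdots G_{c_1}^{[a_1,b_1]}|0\rangle^{\otimes m}$ in the computational basis gives $1$ with probability at least $1/4$; 4. if $w\notin L$, then with probability $1$ over the coin flips, this measurement gives $0$ with probability $1$. Let $OQRL=\bigcup_{c>0}OQRSPACE(c\log n)$, where $c$ ranges over the positive integers and $c\log n$ stands for $n\mapsto c\lfloor\log_2\max(n,2)\rfloor$. **Theorem.** The complement $\overline{L_{DISJ}}=\Sigma^*\setminus L_{DISJ}$ belongs to $OQRL$. -/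

import Mathlib

namespace OnlineQuantum

/-! ### Words and the disjointness language -/

/-- The ternary alphabet `{0, 1, #}`. -/
inductive Letter where
  | zero
  | one
  | hash
  deriving DecidableEq

/-- A bit as a letter. -/
def Letter.ofBool (b : Bool) : Letter := if b then .one else .zero

/-- The disjointness function `DISJ_n (x, y) = ⋀ i, (¬ x_i) ∨ (¬ y_i)`. -/
def DISJ {n : ℕ} (x y : Fin n → Bool) : Bool :=
  decide (∀ i, (!x i || !y i) = true)

/-- A bit string `x_0 ⋯ x_{n-1}` as a word over `{0, 1, #}`. -/
def bitWord {n : ℕ} (x : Fin n → Bool) : List Letter :=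
  List.ofFn fun i => Letter.ofBool (x i)

/-- The word `1^k # (x # y # x #)^(2^k)`. -/
def disjWord (k : ℕ) (x y : Fin (2 ^ (2 * k)) → Bool) : List Letter :=
  List.replicate k Letter.one ++ [Letter.hash] ++
    (List.replicate (2 ^ k)
      (bitWord x ++ [Letter.hash] ++ bitWord y ++ [Letter.hash] ++
        bitWord x ++ [Letter.hash])).flatten

/-- The language `L_DISJ`. -/
def LDISJ : Language Letter :=
  {w | ∃ k : ℕ, 1 ≤ k ∧ ∃ x y : Fin (2 ^ (2 * k)) → Bool,
    DISJ x y = true ∧ w = disjWord k x y}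

/-! ### Online probabilistic Turing machines with an output tape -/

/-- What a machine does in one step: new control state, letter written on the scanned cell of the
work tape, move of the work-tape head (`-1`, `0` or `1`), whether the input head moves one cell to
the right (it never moves left), and the letter, if any, appended to the output tape. -/
structure Action (Q : Type) where
  state : Q
  write : Letter
  move : SignType
  advance : Bool
  output : Option Letter

/-- An online probabilistic Turing machine computing a function: a finite control, a one-way
read-only input tape, one read-write work tape, and a one-way write-only output tape, all over
`{0, 1, #}`. A step depends on the control state, the scanned input letter (`none` beyond the end
of the input), the scanned work-tape letter (`none` on a cell not yet written), and one fair
coin flip. -/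
structure OPTM where
  Q : Type
  [finQ : Fintype Q]
  start : Q
  halting : Q → Bool
  δ : Q → Option Letter → Option Letter → Bool → Action Q

/-- A configuration. The input is represented by its part from the scanned letter on; `visited` is
the set of the work-tape cells scanned so far, and `output` the contents of the output tape. -/
structure Config (Q : Type) where
  state : Q
  input : List Letter
  work : ℤ → Option Letter
  head : ℤ
  visited : Finset ℤ
  output : List Letter

namespace OPTM

variable (M : OPTM)

/-- The initial configuration on the input `w`. -/
def init (w : List Letter) : Config M.Q where
  state := M.start
  input := w
  work := fun _ => none
  head := 0
  visited := {0}
  output := []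

/-- One computational step with the given outcome of the coin flip; a halted machine stays put. -/
def step (c : Config M.Q) (coin : Bool) : Config M.Q :=
  if M.halting c.state then c
  else
    let a := M.δ c.state c.input.head? (c.work c.head) coin
    let head' : ℤ := c.head + (a.move : ℤ)
    { state := a.state
      input := if a.advance then c.input.tail else c.input
      work := Function.update c.work c.head (some a.write)
      head := head'
      visited := insert head' c.visited
      output := c.output ++ a.output.toList }

/-- The configuration reached on the input `w` after `T` steps, with coin flips `ρ`. -/
def run (w : List Letter) {T : ℕ} (ρ : Fin T → Bool) : Config M.Q :=
  (List.ofFn ρ).foldl M.step (M.init w)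

end OPTM

/-- The probability of an event over `T` independent fair coin flips. -/
noncomputable def coinProb {T : ℕ} (E : (Fin T → Bool) → Prop) : ℝ :=
  (Nat.card {ρ : Fin T → Bool // E ρ} : ℝ) / 2 ^ T

/-! ### Quantum circuits over `{H, T, CNOT}` -/

/-- A vector in the state space of `m` qubits, in the computational basis. -/
abbrev QState (m : ℕ) : Type := (Fin m → Bool) → ℂ

/-- The state `|0⟩^{⊗ m}`. -/
def zeroState (m : ℕ) : QState m := Pi.single (fun _ => false) 1

/-- The Hadamard gate. -/
noncomputable def hadamard : Matrix Bool Bool ℂ :=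
  Matrix.of fun p q => ((1 / Real.sqrt 2 : ℝ) : ℂ) * (if p && q then -1 else 1)

/-- The `π/8` gate `T = diag (1, exp (iπ/4))`. -/
noncomputable def tGate : Matrix Bool Bool ℂ :=
  Matrix.diagonal fun p => if p then Complex.exp (Complex.I * Real.pi / 4) else 1

/-- The one-qubit gate `U` applied to the qubit `a`. -/
def applyOne {m : ℕ} (U : Matrix Bool Bool ℂ) (a : Fin m) (ψ : QState m) : QState m :=
  fun v => ∑ q : Bool, U (v a) q * ψ (Function.update v a q)

/-- The CNOT gate with control qubit `a` and target qubit `b` (for `a ≠ b`). -/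
def applyCNOT {m : ℕ} (a b : Fin m) (ψ : QState m) : QState m :=
  fun v => ψ (Function.update v b (xor (v a) (v b)))

/-- The description `a, b, c` of the gate `G_c^{[a,b]}` on `m` qubits. -/
structure Gate (m : ℕ) where
  a : Fin m
  b : Fin m
  c : Fin 3

/-- The action of `G_c^{[a,b]}`, where `G_0 = H`, `G_1 = T`, `G_2 = CNOT`, and where the gate is
the identity if `a = b`. -/
noncomputable def Gate.apply {m : ℕ} (g : Gate m) (ψ : QState m) : QState m :=
  if g.a = g.b then ψ
  else if g.c = 0 then applyOne hadamard g.a ψ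
  else if g.c = 1 then applyOne tGate g.a ψ
  else applyCNOT g.a g.b ψ

/-- The state `G_r ⋯ G_1 |0⟩^{⊗ m}` for the circuit `[G_1, …, G_r]`. -/
noncomputable def circuitState {m : ℕ} (gs : List (Gate m)) : QState m :=
  gs.foldl (fun ψ g => g.apply ψ) (zeroState m)

open Classical in
/-- The probability that measuring the first qubit (number `0`) in the computational basis
yields `β`. -/
noncomputable def measureFirst {m : ℕ} (ψ : QState m) (β : Bool) : ℝ :=
  ∑ v : Fin m → Bool, if ∃ h : 0 < m, v ⟨0, h⟩ = β then ‖ψ v‖ ^ 2 else 0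

/-- A natural number in binary, most significant bit first, without superfluous zeros. -/
def binary (n : ℕ) : List Letter :=
  if n = 0 then [Letter.zero]
  else (Nat.digits 2 n).reverse.map fun d => Letter.ofBool (d == 1)

/-- The word `a_1#b_1#c_1#⋯#a_r#b_r#c_r` describing a circuit. -/
def encodeCircuit {m : ℕ} (gs : List (Gate m)) : List Letter :=
  [Letter.hash].intercalate
    (gs.flatMap fun g => [binary g.a.val, binary g.b.val, binary g.c.val])

/-- The word `u` describes a nonempty circuit on `m` qubits whose final state satisfies `P`. -/
def DescribesCircuit (m : ℕ) (u : List Letter) (P : QState m → Prop) : Prop :=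
  ∃ gs : List (Gate m), gs ≠ [] ∧ u = encodeCircuit gs ∧ P (circuitState gs)

/-! ### The one-sided-error quantum online classes -/

/-- The class of languages recognized with one-sided error by quantum online machines using
space (classical and quantum) `s(n)` and time `2 ^ s(n)` on inputs of length `n`. -/
def OQRSPACE (s : ℕ → ℕ) : Set (Language Letter) :=
  {L | ∃ M : OPTM, ∀ w : List Letter,
    (∀ ρ : Fin (2 ^ s w.length) → Bool,
      M.halting (M.run w ρ).state = true ∧
      (M.run w ρ).visited.card ≤ s w.length ∧
      DescribesCircuit (s w.length) (M.run w ρ).output fun _ => True) ∧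
    (w ∈ L →
      1 / 4 ≤ coinProb fun ρ : Fin (2 ^ s w.length) → Bool =>
        DescribesCircuit (s w.length) (M.run w ρ).output fun ψ =>
          1 / 4 ≤ measureFirst ψ true) ∧
    (w ∉ L →
      coinProb (fun ρ : Fin (2 ^ s w.length) → Bool =>
        DescribesCircuit (s w.length) (M.run w ρ).output fun ψ =>
          measureFirst ψ false = 1) = 1)}

/-- The logarithmic space bound `c · ⌊log₂ n⌋`, read as `c` for `n ≤ 1`. -/
def logSpace (c n : ℕ) : ℕ := c * Nat.log 2 (max n 2)

/-- The class `OQRL = ⋃_{c > 0} OQRSPACE (c log n)`. -/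
def OQRL : Set (Language Letter) := ⋃ c : ℕ, ⋃ _ : 0 < c, OQRSPACE (logSpace c)

end OnlineQuantum

/-!
The words in `LDISJ` are recognized as follows by a one-way machine with logarithmic space that may
write a quantum circuit.

The shape `1^k # u₀ # u₁ # ⋯` with `3 * 2 ^ k` blocks of length `4 ^ k` is checked with counters.
That the blocks are `x, y, x, x, y, x, …` is checked with fingerprints: a block is hashed by the
value of a polynomial, with its bits as coefficients, at a random point modulo a prime. As the
machine does not know the length of the first blocks in advance, the prime grows with the position
in the block: the scales are `2, 4, 16, …`, each with its own prime, and the values at the smaller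
scales are kept. Two different blocks differ by a nonzero polynomial at one of the scales
(`exists_polynomial_of_ne`), which has few roots, so that their hash values agree with probability
at most `1 / 2` (`coinProb_hashVal_eq_le`).

In the same pass the machine writes a circuit for Grover's search of a common element of `x` and
`y`, with `2 * k` address qubits and a random number `J < 2 ^ (k - 1)` of iterations. The first
repetition of the three blocks reveals the lengths, and each later one gives one iteration. For each
`1` at the position `i` of a block, the machine writes a gate that is controlled by the comparison
of the address with `i`: for the first `x` a `NOT` on an auxiliary qubit, for `y` a sign change
controlled by the auxiliary qubit, and for the second `x` once more the `NOT`, which restores the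
auxiliary qubit. The diffusion follows. The repetition after the `J` iterations flags the common
elements in a further qubit instead, which is copied to the qubit `0` at the end. So the `2 ^ k`
repetitions of the input provide the number of iterations that is needed for `4 ^ k` addresses. The
state of this circuit is computed in `circOp_segsGates` in terms of `addrState`. With `θ` the angle
for which `sin θ ^ 2` is the fraction of the common elements, `J` iterations succeed with
probability `sin ((2 * J + 1) * θ) ^ 2` (`sin_mul_groverAmp`), and this is at least `1 / 4` for a
quarter of the possible `J` (`le_four_mul_card_sin`), although the number of the common elements is
unknown.

If a check fails, the machine writes nothing more but a `NOT` on the qubit `0`, which then has the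
value `1`. For words in `LDISJ` no check fails and no address is flagged, so that the qubit `0` has
the value `0` with certainty (`describesCircuit_of_mem`). For other words either a check fails
always, or a check fails with probability at least `1 / 2`, or the search succeeds
(`le_coinProb_of_not_mem`).

The machine is written as a structured program `mainProgram` over natural numbers. Such programs are
compiled to register machines and these to Turing machines with the registers in binary on the work
tape, so that numbers of polynomial size need logarithmic space (`StreamProgram.exists_optm`). A
program uses coins only on demand, while the machine flips one in each step; both give the same
distribution of outputs (`coinProb_foldl_step_eq`).
-/

namespace OnlineQuantum

/-! ### Probabilities of coin events -/

theorem coinProb_eq_sum {T : ℕ} (E : (Fin T → Bool) → Prop) [DecidablePred E] :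
    coinProb E = (∑ ρ : Fin T → Bool, if E ρ then (1 : ℝ) else 0) / 2 ^ T := by
  rw [coinProb, Nat.card_eq_fintype_card, Fintype.card_subtype]
  simp

theorem coinProb_zero (E : (Fin 0 → Bool) → Prop) [Decidable (E Fin.elim0)] :
    coinProb E = if E Fin.elim0 then 1 else 0 := by
  classical
  rw [coinProb_eq_sum]
  have : ∀ ρ : Fin 0 → Bool, ρ = Fin.elim0 := fun ρ => Subsingleton.elim _ _
  simp [this]

/-- The first coin is fixed, and the two probabilities are averaged. -/
theorem coinProb_succ {T : ℕ} (E : (Fin (T + 1) → Bool) → Prop) :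
    coinProb E = (coinProb (fun ρ : Fin T → Bool => E (Fin.cons false ρ)) +
      coinProb (fun ρ : Fin T → Bool => E (Fin.cons true ρ))) / 2 := by
  classical
  simp only [coinProb_eq_sum]
  rw [← (Fin.consEquiv (fun _ : Fin (T + 1) => Bool)).sum_comp, Fintype.sum_prod_type]
  simp only [Fintype.sum_bool]
  rw [pow_succ, ← add_div, div_div, add_comm]
  rfl

theorem coinProb_of_forall {T : ℕ} {E : (Fin T → Bool) → Prop} (h : ∀ ρ, E ρ) :
    coinProb E = 1 := by
  classical
  simp [coinProb_eq_sum, h]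

theorem forall_of_coinProb_eq_one {T : ℕ} {E : (Fin T → Bool) → Prop} (h : coinProb E = 1)
    (ρ : Fin T → Bool) : E ρ := by
  classical
  rw [coinProb, div_eq_one_iff_eq (by positivity), Nat.card_eq_fintype_card] at h
  have h2 : Fintype.card {ρ // E ρ} = Fintype.card (Fin T → Bool) := by
    have : (Fintype.card {ρ // E ρ} : ℝ) = (2 ^ T : ℕ) := by rw [h]; push_cast; rfl
    rw [Nat.cast_inj] at this
    simpa using this
  by_contra hρ
  exact (Fintype.card_subtype_lt (p := E) hρ).ne h2

theorem coinProb_mono {T : ℕ} {E E' : (Fin T → Bool) → Prop} (h : ∀ ρ, E ρ → E' ρ) :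
    coinProb E ≤ coinProb E' := by
  classical
  simp only [coinProb_eq_sum]
  gcongr with ρ
  split_ifs with h1 h2 <;> simp_all

theorem coinProb_not {T : ℕ} (E : (Fin T → Bool) → Prop) :
    coinProb (fun ρ => ¬ E ρ) = 1 - coinProb E := by
  classical
  simp only [coinProb_eq_sum]
  rw [eq_sub_iff_add_eq, ← add_div, ← Finset.sum_add_distrib, div_eq_one_iff_eq (by positivity)]
  rw [Finset.sum_congr rfl (g := fun _ => (1 : ℝ)) (fun ρ _ => by split_ifs <;> simp_all)]
  simp

/-! ### Coins consumed on demand -/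

namespace OPTM

variable (M : OPTM)

variable {M} in
theorem step_congr {c : Config M.Q} {b b' : Bool}
    (h : M.δ c.state c.input.head? (c.work c.head) b =
      M.δ c.state c.input.head? (c.work c.head) b') :
    M.step c b = M.step c b' := by
  simp only [step, h]

/-- One step of a machine that takes a coin from a list only in the states marked by `isFlip`;
in the other states the coin is taken to be `false`. -/
def demandStep (isFlip : M.Q → Bool) (x : Config M.Q × List Bool) : Config M.Q × List Bool :=
  if isFlip x.1.state then (M.step x.1 (x.2.headD false), x.2.tail)
  else (M.step x.1 false, x.2)

/-- If the coin only matters in the marked states, then it makes no difference for the distribution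
of the configuration after `T` steps whether a coin is flipped in every step or only when it is
needed. -/
theorem coinProb_foldl_step_eq (isFlip : M.Q → Bool)
    (hflip : ∀ c : Config M.Q, isFlip c.state = false → M.step c true = M.step c false)
    (E : Config M.Q → Prop) (T A : ℕ) (hTA : T ≤ A) (c : Config M.Q) :
    coinProb (fun ρ : Fin T → Bool => E ((List.ofFn ρ).foldl M.step c)) =
      coinProb (fun σ : Fin A → Bool => E ((M.demandStep isFlip)^[T] (c, List.ofFn σ)).1) := by
  classical
  induction T generalizing A c with
  | zero =>
    by_cases h : E c
    · simp [h, coinProb_of_forall]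
    · simp [h, coinProb]
  | succ T ih =>
    obtain ⟨A, rfl⟩ : ∃ A', A = A' + 1 := ⟨A - 1, by omega⟩
    rw [coinProb_succ]
    simp only [List.ofFn_succ, Fin.cons_zero, Fin.cons_succ, List.foldl_cons]
    -- In a marked state both experiments use their next coin. In any other state the two outcomes
    -- of the coin of this step lead to the same configuration, and the list of coins is left
    -- untouched, so that the average is over two equal probabilities.
    by_cases hc : isFlip c.state
    · rw [coinProb_succ (T := A)]
      rw [ih A (by omega), ih A (by omega)]
      simp [demandStep, hc]
    · simp only [Bool.not_eq_true] at hc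
      rw [hflip c hc, ih (A + 1) (by omega)]
      simp only [Function.iterate_succ_apply]
      simp only [List.ofFn_succ, demandStep, hc, Bool.false_eq_true, if_false]
      ring

end OPTM

/-! ### Register machines with labelled instructions -/

/-- An instruction of a register machine with labels in `L`: it names the labels at which the
execution continues. `jz` tests a register for zero, `flip` branches on a coin, and `read` consumes
a letter of the input and branches on it. -/
inductive Instr (L : Type) where
  | inc (r : ℕ) (l : L)
  | dec (r : ℕ) (l : L)
  | jz (r : ℕ) (lz lnz : L)
  | flip (l0 l1 : L)
  | out (a : Letter) (l : L)
  | read (lend : L) (f : Letter → L)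
  | halt

/-- The memory of a register machine, with the rest of the input, the coins not used so far, and
the output. -/
@[ext] structure Store where
  reg : ℕ → ℕ
  input : List Letter
  coins : List Bool
  out : List Letter

/-- The memory after an assignment to a register. -/
def Store.set (s : Store) (r v : ℕ) : Store := { s with reg := Function.update s.reg r v }

/-- The effect of an instruction. A register that holds `0` cannot be decremented. -/
inductive Instr.Step {L : Type} : Instr L → Store → L → Store → Prop
  | inc (r : ℕ) (l : L) (s : Store) : Step (.inc r l) s l (s.set r (s.reg r + 1))
  | dec (r : ℕ) (l : L) (s : Store) (h : s.reg r ≠ 0) : Step (.dec r l) s l (s.set r (s.reg r - 1))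
  | jz_zero (r : ℕ) (lz lnz : L) (s : Store) (h : s.reg r = 0) : Step (.jz r lz lnz) s lz s
  | jz_pos (r : ℕ) (lz lnz : L) (s : Store) (h : s.reg r ≠ 0) : Step (.jz r lz lnz) s lnz s
  | flip (l0 l1 : L) (s : Store) : Step (.flip l0 l1) s (if s.coins.headD false then l1 else l0)
      { s with coins := s.coins.tail }
  | out (a : Letter) (l : L) (s : Store) : Step (.out a l) s l { s with out := s.out ++ [a] }
  | read_nil (le : L) (f : Letter → L) (s : Store) (h : s.input = []) : Step (.read le f) s le s
  | read_cons (le : L) (f : Letter → L) (s : Store) (a : Letter) (u : List Letter)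
      (h : s.input = a :: u) : Step (.read le f) s (f a) { s with input := u }

/-- `Flow prog n l s l' s'`: in `n` steps the program leads from the label `l` and the memory `s`
to `l'` and `s'`. -/
inductive Flow {L : Type} (prog : L → Instr L) : ℕ → L → Store → L → Store → Prop
  | refl (l : L) (s : Store) : Flow prog 0 l s l s
  | head {n : ℕ} {l l' l'' : L} {s s' s'' : Store} (h : (prog l).Step s l' s')
      (h' : Flow prog n l' s' l'' s'') : Flow prog (n + 1) l s l'' s''

theorem Flow.trans {L : Type} {prog : L → Instr L} {n m : ℕ} {l l' l'' : L} {s s' s'' : Store}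
    (h : Flow prog n l s l' s') (h' : Flow prog m l' s' l'' s'') :
    Flow prog (n + m) l s l'' s'' := by
  induction h with
  | refl => simpa using h'
  | head h1 _ ih => rw [Nat.add_right_comm]; exact .head h1 (ih h')

/-- The register an instruction works on is below `R`. -/
def Instr.Bdd {L : Type} (R : ℕ) : Instr L → Prop
  | .inc r _ | .dec r _ | .jz r _ _ => r < R
  | _ => True

/-! ### Counters on a single tape -/

/-- The micro-states in which an instruction is performed on the tape: `home` on the cell `0`,
`right t` at distance `t` to the left of a digit of the register, and `left t b` at distance `t` to
the right of the first cell of a column, on the way home with the outcome `b`. -/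
inductive Micro (R : ℕ) where
  | home
  | right (t : Fin (R + 1))
  | left (t : Fin (R + 1)) (b : Bool)
  deriving DecidableEq, Fintype

namespace Instr

variable {L : Type}

/-- What an instruction does on a binary digit, where `#` stands for the end of the number: the new
digit, and the outcome if the remaining digits do not matter. -/
def onDigit : Instr L → Letter → Letter × Option Bool
  | .inc _ _, .one => (.zero, none)
  | .inc _ _, _ => (.one, some true)
  | .dec _ _, .zero => (.one, none)
  | .dec _ _, _ => (.zero, some true)
  | .jz _ _ _, .zero => (.zero, none)
  | .jz _ _ _, .one => (.one, some true)
  | .jz _ _ _, .hash => (.hash, some false)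
  | _, c => (c, some false)

/-- The register of an instruction. -/
def register : Instr L → ℕ
  | .inc r _ | .dec r _ | .jz r _ _ => r
  | _ => 0

/-- The label at which the execution continues after a pass over the tape with outcome `b`. -/
def target (l : L) (b : Bool) : Instr L → L
  | .inc _ l' | .dec _ l' => l'
  | .jz _ lz lnz => if b then lnz else lz
  | _ => l

/-- The instruction flips a coin. -/
def isFlip : Instr L → Bool
  | .flip _ _ => true
  | _ => false

/-- The instruction halts. -/
def isHalt : Instr L → Bool
  | .halt => true
  | _ => false

end Instr

section Machine

variable {L : Type} (R : ℕ) (prog : L → Instr L)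

/-- The transition function of the Turing machine that simulates a register machine with the
registers `0, …, R - 1`. A cell not yet written counts as `#`. The tape is divided into columns of
`R + 1` cells; the column `q` holds the `q`-th binary digits of all registers, behind a cell that
holds `1` only in the column `0`. -/
def counterAction : L × Micro R → Option Letter → Letter → Bool → Action (L × Micro R)
  | (l, .home), inp, c, coin =>
    match prog l with
    | .flip l0 l1 => ⟨(if coin then l1 else l0, .home), c, 0, false, none⟩
    | .out a l' => ⟨(l', .home), c, 0, false, some a⟩
    | .read le f =>
      match inp with
      | none => ⟨(le, .home), c, 0, false, none⟩
      | some a => ⟨(f a, .home), c, 0, true, none⟩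
    | .halt => ⟨(l, .home), c, 0, false, none⟩
    | i => ⟨(l, .right (Fin.ofNat (R + 1) i.register)), .one, 1, false, none⟩
  | (l, .right t), _, c, _ =>
    if t = 0 then
      match (prog l).onDigit c with
      | (c', none) => ⟨(l, .right (Fin.last R)), c', 1, false, none⟩
      | (c', some b) => ⟨(l, .left (Fin.ofNat (R + 1) (prog l).register) b), c', -1, false, none⟩
    else ⟨(l, .right (t - 1)), c, 1, false, none⟩
  | (l, .left t b), _, c, _ =>
    if t = 0 then
      if c = .one then ⟨((prog l).target l b, .home), c, 0, false, none⟩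
      else ⟨(l, .left (Fin.last R) b), c, -1, false, none⟩
    else ⟨(l, .left (t - 1) b), c, -1, false, none⟩

/-- The Turing machine that simulates a register machine. -/
abbrev counterMachine [Fintype L] (start : L) : OPTM where
  Q := L × Micro R
  start := (start, .home)
  halting := fun q => decide (q.2 = .home) && (prog q.1).isHalt
  δ := fun q inp c coin => counterAction R prog q inp (c.getD .hash) coin

/-- The states of the simulating machine in which a coin is used. -/
def coinState (q : L × Micro R) : Bool := decide (q.2 = .home) && (prog q.1).isFlip

theorem counterAction_coin (q : L × Micro R) (hq : coinState R prog q = false)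
    (inp : Option Letter) (c : Letter) :
    counterAction R prog q inp c true = counterAction R prog q inp c false := by
  obtain ⟨l, m⟩ := q
  cases m with
  | home =>
    simp only [coinState, decide_true, Bool.true_and] at hq
    simp only [counterAction]
    cases h : prog l <;> simp_all [Instr.isFlip]
  | right t => rfl
  | left t b => rfl

theorem counterMachine_step_coin [Fintype L] (start : L)
    (c : Config (counterMachine R prog start).Q) (hc : coinState R prog c.state = false) :
    (counterMachine R prog start).step c true = (counterMachine R prog start).step c false :=
  OPTM.step_congr (counterAction_coin R prog c.state hc _ _)

end Machine

end OnlineQuantum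

namespace OnlineQuantum

section Simulation

variable {L : Type} [Fintype L] {R : ℕ} {prog : L → Instr L} {start : L}

/-- A configuration of the simulating machine, with the remaining coins: control state, head position,
contents of the tape (with `#` for a cell not yet written), rest of the input, output and coins, and
a bound for the cells scanned so far. -/
structure At (X : ℕ) (q : L × Micro R) (h : ℤ) (ct : ℤ → Letter) (inp out : List Letter)
    (σ : List Bool) (x : Config (L × Micro R) × List Bool) : Prop where
  state : x.1.state = q
  head : x.1.head = h
  work : ∀ p, (x.1.work p).getD .hash = ct p
  input : x.1.input = inp
  output : x.1.output = out
  coins : x.2 = σ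
  visited : x.1.visited ⊆ Finset.Icc 0 (X : ℤ)

/-- The step function of the simulating machine, with coins on demand. -/
def simStep (R : ℕ) (prog : L → Instr L) (start : L) :
    Config (L × Micro R) × List Bool → Config (L × Micro R) × List Bool :=
  (counterMachine R prog start).demandStep (coinState R prog)

/-- A step with the action `a`, which has to keep the head between the cells `0` and `X`. -/
theorem At.step_of_eq {X : ℕ} {q : L × Micro R} {h : ℤ} {ct : ℤ → Letter} {inp out : List Letter}
    {σ : List Bool} {x : Config (L × Micro R) × List Bool} (hx : At X q h ct inp out σ x)
    (hq : (counterMachine R prog start).halting q = false) {a : Action (L × Micro R)}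
    (ha : counterAction R prog q inp.head? (ct h)
      (if coinState R prog q then σ.headD false else false) = a)
    (h0 : 0 ≤ h + (a.move : ℤ)) (hX : h + (a.move : ℤ) ≤ X) :
    At X a.state (h + (a.move : ℤ)) (Function.update ct h a.write)
      (if a.advance then inp.tail else inp) (out ++ a.output.toList)
      (if coinState R prog q then σ.tail else σ) (simStep R prog start x) := by
  obtain ⟨c, σ'⟩ := x
  obtain ⟨rfl, rfl, hw, rfl, rfl, hσ, hv⟩ := hx
  simp only at hσ hw hv ha hq h0 hX ⊢
  subst hσ
  have key : ∀ b, counterAction R prog c.state c.input.head? (ct c.head) b = a →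
      ∀ σ₂, At X a.state (c.head + (a.move : ℤ)) (Function.update ct c.head a.write)
      (if a.advance then c.input.tail else c.input) (c.output ++ a.output.toList) σ₂
      ((counterMachine R prog start).step c b, σ₂) := by
    intro b hb σ₂
    have hδ : (counterMachine R prog start).δ c.state c.input.head? (c.work c.head) b = a := by
      rw [← hb, ← hw]
    have hs : (counterMachine R prog start).step c b =
      { state := a.state
        input := if a.advance then c.input.tail else c.input
        work := Function.update c.work c.head (some a.write)
        head := c.head + (a.move : ℤ)
        visited := insert (c.head + (a.move : ℤ)) c.visited
        output := c.output ++ a.output.toList } := by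
      rw [OPTM.step, if_neg (by show ¬ (decide _ && _) = true; rw [hq]; simp)]
      subst hδ
      rfl
    rw [hs]
    refine ⟨rfl, rfl, fun p => ?_, rfl, rfl, rfl, ?_⟩
    · by_cases hp : p = c.head
      · subst hp; simp
      · simp [Function.update_of_ne hp, hw]
    · intro p hp
      rcases Finset.mem_insert.1 hp with rfl | hp
      · exact Finset.mem_Icc.2 ⟨h0, hX⟩
      · exact hv hp
  by_cases hc : coinState R prog c.state = true
  · rw [if_pos hc] at ha ⊢
    simpa [simStep, OPTM.demandStep, hc] using key _ ha _
  · rw [if_neg hc] at ha ⊢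
    simpa [simStep, OPTM.demandStep, hc] using key _ ha _

/-- A step that neither reads, nor writes to the output, nor flips a coin. -/
theorem At.step_work {X : ℕ} {l : L} {m : Micro R} {h : ℤ} {ct : ℤ → Letter}
    {inp out : List Letter} {σ : List Bool} {x : Config (L × Micro R) × List Bool}
    (hx : At X (l, m) h ct inp out σ x)
    (hhalt : m ≠ .home ∨ (prog l).isHalt = false) (hcoin : m ≠ .home ∨ (prog l).isFlip = false)
    {q' : L × Micro R} {c' : Letter} {mv : SignType}
    (ha : ∀ coin, counterAction R prog (l, m) inp.head? (ct h) coin = ⟨q', c', mv, false, none⟩)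
    (h0 : 0 ≤ h + (mv : ℤ)) (hX : h + (mv : ℤ) ≤ X) :
    At X q' (h + (mv : ℤ)) (Function.update ct h c') inp out σ (simStep R prog start x) := by
  have h1 := hx.step_of_eq (prog := prog) (start := start)
    (by rcases hhalt with h | h <;> simp [h]) (ha _) h0 hX
  have hc : coinState R prog (l, m) = false := by rcases hcoin with h | h <;> simp [coinState, h]
  simpa [hc] using h1

/-- The head moves to the right by `t` cells, up to a digit of the register. -/
theorem At.right {X : ℕ} {l : L} {ct : ℤ → Letter} {inp out : List Letter} {σ : List Bool} (t : ℕ)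
    (ht : t < R + 1) {h : ℤ} {x : Config (L × Micro R) × List Bool}
    (hx : At X (l, .right ⟨t, ht⟩) h ct inp out σ x) (h0 : 0 ≤ h) (hX : h + t ≤ X) :
    At X (l, .right 0) (h + t) ct inp out σ ((simStep R prog start)^[t] x) := by
  induction t generalizing h x with
  | zero => simpa using hx
  | succ t ih =>
    have hne : (⟨t + 1, ht⟩ : Fin (R + 1)) ≠ 0 := by simp [Fin.ext_iff]
    have hpred : (⟨t + 1, ht⟩ : Fin (R + 1)) - 1 = ⟨t, by omega⟩ := by
      rw [sub_eq_iff_eq_add, Fin.ext_iff, Fin.val_add, Fin.val_one']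
      simp only [Nat.add_mod_mod]
      rw [Nat.mod_eq_of_lt ht]
    have h1 := hx.step_work (prog := prog) (start := start) (.inl (by simp)) (.inl (by simp))
      (q' := (l, .right ⟨t, by omega⟩)) (c' := ct h) (mv := 1)
      (fun _ => by simp [counterAction, hne, hpred]) (by simp; omega)
        (by push_cast at hX; simp; omega)
    rw [Function.update_eq_self] at h1
    have h2 := ih (by omega) h1 (by simp; omega) (by push_cast at hX; simp; omega)
    rw [Function.iterate_succ_apply]
    convert h2 using 1
    push_cast
    simp
    ring

/-- The head moves to the left by `t` cells, up to the first cell of a column. -/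
theorem At.left {X : ℕ} {l : L} {b : Bool} {ct : ℤ → Letter} {inp out : List Letter}
    {σ : List Bool} (t : ℕ)
    (ht : t < R + 1) {h : ℤ} {x : Config (L × Micro R) × List Bool}
    (hx : At X (l, .left ⟨t, ht⟩ b) h ct inp out σ x) (h0 : 0 ≤ h - t) (hX : h ≤ X) :
    At X (l, .left 0 b) (h - t) ct inp out σ ((simStep R prog start)^[t] x) := by
  induction t generalizing h x with
  | zero => simpa using hx
  | succ t ih =>
    have hne : (⟨t + 1, ht⟩ : Fin (R + 1)) ≠ 0 := by simp [Fin.ext_iff]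
    have hpred : (⟨t + 1, ht⟩ : Fin (R + 1)) - 1 = ⟨t, by omega⟩ := by
      rw [sub_eq_iff_eq_add, Fin.ext_iff, Fin.val_add, Fin.val_one']
      simp only [Nat.add_mod_mod]
      rw [Nat.mod_eq_of_lt ht]
    have h1 := hx.step_work (prog := prog) (start := start) (.inl (by simp)) (.inl (by simp))
      (q' := (l, .left ⟨t, by omega⟩ b)) (c' := ct h) (mv := -1)
      (fun _ => by simp [counterAction, hne, hpred]) (by push_cast at h0; simp; omega)
      (by simp; omega)
    rw [Function.update_eq_self] at h1
    have h2 := ih (by omega) h1 (by push_cast at h0; simp; omega) (by simp; omega)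
    rw [Function.iterate_succ_apply]
    convert h2 using 1
    push_cast
    simp
    ring

/-- The way home: the marker `1` in the cell `0` is found. -/
theorem At.return_home {X : ℕ} {l : L} {b : Bool} {ct : ℤ → Letter} {inp out : List Letter}
    {σ : List Bool} (q : ℕ) {x : Config (L × Micro R) × List Bool}
    (hx : At X (l, .left 0 b) ((R + 1) * q : ℤ) ct inp out σ x) (hX : ((R + 1) * q : ℤ) ≤ X)
    (h0 : ct 0 = .one) (h1 : ∀ j : ℕ, 1 ≤ j → ct ((R + 1) * j) ≠ .one) :
    At X ((prog l).target l b, .home) 0 ct inp out σ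
      ((simStep R prog start)^[(R + 1) * q + 1] x) := by
  induction q generalizing x with
  | zero =>
    have hs := hx.step_work (prog := prog) (start := start) (.inl (by simp)) (.inl (by simp))
      (q' := ((prog l).target l b, .home)) (c' := ct ((R + 1) * (0 : ℕ))) (mv := 0)
      (fun _ => by simp [counterAction, h0]) (by simp) (by simp)
    rw [Function.update_eq_self] at hs
    simpa using hs
  | succ q ih =>
    have hn := h1 (q + 1) (by omega)
    push_cast at hn hX
    have hR : (0 : ℤ) ≤ (R + 1) * q := by positivity
    have hs := hx.step_work (prog := prog) (start := start) (.inl (by simp)) (.inl (by simp))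
      (q' := (l, .left (Fin.last R) b)) (c' := ct ((R + 1) * (q + 1 : ℕ))) (mv := -1)
      (fun _ => by simp [counterAction, hn]) (by push_cast; simp; nlinarith)
      (by push_cast; simp; linarith)
    rw [Function.update_eq_self] at hs
    have h2 := At.left (prog := prog) (start := start) R (by omega) hs
      (by push_cast; simp) (by push_cast; simp; linarith)
    have h3 := ih (x := (simStep R prog start)^[R] (simStep R prog start x))
      (by convert h2 using 1; push_cast; simp; ring) (by linarith)
    rw [← Function.iterate_succ_apply, ← Function.iterate_add_apply] at h3
    convert h3 using 2
    rw [Nat.succ_eq_add_one]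
    ring

end Simulation

/-! ### Binary counters -/

/-- The value of a list of bits, least significant bit first. -/
def bitsVal : List Bool → ℕ
  | [] => 0
  | b :: l => b.toNat + 2 * bitsVal l

/-- The `q`-th letter of a binary number that is terminated by `#`. -/
def digitLetter (l : List Bool) (q : ℕ) : Letter := (l[q]?).elim .hash Letter.ofBool

@[simp] theorem digitLetter_nil (q : ℕ) : digitLetter [] q = .hash := rfl
@[simp] theorem digitLetter_cons_zero (b : Bool) (l : List Bool) :
    digitLetter (b :: l) 0 = Letter.ofBool b := rfl
@[simp] theorem digitLetter_cons_succ (b : Bool) (l : List Bool) (q : ℕ) :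
    digitLetter (b :: l) (q + 1) = digitLetter l q := rfl

/-- A pass over the digits of a number according to the function `f`, with an outcome. -/
inductive Ripple (f : Letter → Letter × Option Bool) : List Bool → List Bool → Bool → Prop
  | nil_hash (b : Bool) (h : f .hash = (.hash, some b)) : Ripple f [] [] b
  | nil_one (b : Bool) (h : f .hash = (.one, some b)) : Ripple f [] [true] b
  | terminal (x y : Bool) (l : List Bool) (b : Bool)
      (h : f (.ofBool x) = (.ofBool y, some b)) : Ripple f (x :: l) (y :: l) b
  | next (x y : Bool) (l l' : List Bool) (b : Bool)
      (h : f (.ofBool x) = (.ofBool y, none)) (h' : Ripple f l l' b) :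
      Ripple f (x :: l) (y :: l') b

/-- A digit is appended only if the value needs it, so that the number of digits stays within any
`W` for which the new value is below `2 ^ W`. -/
theorem ripple_inc {L : Type} (r : ℕ) (l' : L) (l : List Bool) :
    ∃ m, Ripple (Instr.inc r l').onDigit l m true ∧ bitsVal m = bitsVal l + 1 ∧
      ∀ W, l.length ≤ W → bitsVal m < 2 ^ W → m.length ≤ W := by
  induction l with
  | nil =>
    refine ⟨[true], .nil_one _ rfl, rfl, fun W _ h => ?_⟩
    rcases W with _ | W
    · simp [bitsVal] at h
    · simp
  | cons b l ih =>
    obtain ⟨m, h1, h2, h3⟩ := ih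
    cases b with
    | false => exact ⟨true :: l, .terminal _ _ _ _ rfl, by simp [bitsVal]; omega, fun W h _ => by
        simpa using h⟩
    | true =>
      refine ⟨false :: m, .next _ _ _ _ _ rfl h1, by simp [bitsVal]; omega, fun W h h' => ?_⟩
      rcases W with _ | W
      · simp at h
      · simp only [bitsVal, Bool.toNat_false, pow_succ] at h'
        simp only [List.length_cons] at h ⊢
        have := h3 W (by omega) (by omega)
        omega

theorem ripple_dec {L : Type} (r : ℕ) (l' : L) (l : List Bool) (hl : bitsVal l ≠ 0) :
    ∃ m, Ripple (Instr.dec r l').onDigit l m true ∧ bitsVal m = bitsVal l - 1 ∧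
      m.length = l.length := by
  induction l with
  | nil => simp [bitsVal] at hl
  | cons b l ih =>
    cases b with
    | true => exact ⟨false :: l, .terminal _ _ _ _ rfl, by simp [bitsVal], rfl⟩
    | false =>
      have hl' : bitsVal l ≠ 0 := by simpa [bitsVal] using hl
      obtain ⟨m, h1, h2, h3⟩ := ih hl'
      exact ⟨true :: m, .next _ _ _ _ _ rfl h1, by simp [bitsVal]; omega, by simp [h3]⟩

theorem ripple_jz {L : Type} (r : ℕ) (lz lnz : L) (l : List Bool) :
    Ripple (Instr.jz r lz lnz).onDigit l l (decide (bitsVal l ≠ 0)) := by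
  induction l with
  | nil => exact .nil_hash _ rfl
  | cons b l ih =>
    cases b with
    | true =>
      have : decide (bitsVal (true :: l) ≠ 0) = true := by simp [bitsVal]
      rw [this]
      exact .terminal _ _ _ _ rfl
    | false =>
      have : decide (bitsVal (false :: l) ≠ 0) = decide (bitsVal l ≠ 0) := by simp [bitsVal]
      rw [this]
      exact .next _ _ _ _ _ rfl ih

/-- The position of the digit `q` of the register `r` on the tape. -/
def digitPos (R r q : ℕ) : ℤ := 1 + r + (R + 1) * q

theorem digitPos_inj {R r r' q q' : ℕ} (hr : r < R) (hr' : r' < R)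
    (h : digitPos R r q = digitPos R r' q') : r = r' ∧ q = q' := by
  simp only [digitPos] at h
  have h' : (r + 1) + (R + 1) * q = (r' + 1) + (R + 1) * q' := by
    zify; linarith
  have h1 : ((r + 1) + (R + 1) * q) % (R + 1) = r + 1 := by
    rw [Nat.add_mul_mod_self_left, Nat.mod_eq_of_lt (by omega)]
  have h2 : ((r' + 1) + (R + 1) * q') % (R + 1) = r' + 1 := by
    rw [Nat.add_mul_mod_self_left, Nat.mod_eq_of_lt (by omega)]
  have h3 : r = r' := by rw [h'] at h1; omega
  subst h3
  refine ⟨rfl, ?_⟩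
  have : (R + 1) * q = (R + 1) * q' := by omega
  exact Nat.eq_of_mul_eq_mul_left (by omega) this

/-- The first cells of the columns hold no digits. -/
theorem digitPos_ne_marker {R r q : ℕ} (hr : r < R) (j : ℕ) :
    digitPos R r q ≠ (R + 1) * j := by
  intro h
  simp only [digitPos] at h
  have h' : (r + 1) + (R + 1) * q = (R + 1) * j := by zify; linarith
  have h1 : ((r + 1) + (R + 1) * q) % (R + 1) = r + 1 := by
    rw [Nat.add_mul_mod_self_left, Nat.mod_eq_of_lt (by omega)]
  rw [h'] at h1
  simp at h1

section Simulation

variable {L : Type} [Fintype L] {R : ℕ} {prog : L → Instr L} {start : L}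

/-- The head runs over the digits of the register `r` from the column `q` on, replaces `d` by `d'`,
and turns round in a column `q'`. Nothing else on the tape changes. -/
theorem At.ripple {X W : ℕ} {l : L} {inp out : List Letter} {σ : List Bool} {d d' : List Bool}
    {b : Bool} (hd : Ripple (prog l).onDigit d d' b) (r : ℕ) (hr : (prog l).register = r)
    (hrR : r < R) (hXW : (R + 1) * (W + 1) ≤ X) (q : ℕ)
    (hq : q + d.length ≤ W) (ct : ℤ → Letter)
    (hct : ∀ j, ct (digitPos R r (q + j)) = digitLetter d j)
    {x : Config (L × Micro R) × List Bool}
    (hx : At X (l, .right 0) (digitPos R r q) ct inp out σ x) :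
    ∃ n q' ct', n ≤ (R + 1) * (d.length + 1) ∧ q' ≤ q + d.length ∧
      (∀ j, ct' (digitPos R r (q + j)) = digitLetter d' j) ∧
      (∀ p, (∀ j, p ≠ digitPos R r (q + j)) → ct' p = ct p) ∧
      At X (l, .left (Fin.ofNat (R + 1) r) b) (r + (R + 1) * q' : ℤ) ct' inp out σ
        ((simStep R prog start)^[n] x) := by
  have hpos : ∀ q ≤ W, 1 ≤ digitPos R r q ∧ digitPos R r q ≤ X := by
    intro q hq
    simp only [digitPos]
    have h1 : (R + 1) * q ≤ (R + 1) * W := Nat.mul_le_mul_left _ hq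
    have h2 : r + 1 + (R + 1) * q ≤ X := by rw [mul_add] at hXW; omega
    zify at h2
    have h3 : (0 : ℤ) ≤ (R + 1) * q := by positivity
    constructor <;> linarith
  -- a step that ends the pass
  have hlast : ∀ (q : ℕ) (ct : ℤ → Letter) (c' : Letter) (b : Bool)
      (x : Config (L × Micro R) × List Bool), q ≤ W →
      (prog l).onDigit (ct (digitPos R r q)) = (c', some b) →
      At X (l, .right 0) (digitPos R r q) ct inp out σ x →
      At X (l, .left (Fin.ofNat (R + 1) r) b) (r + (R + 1) * q : ℤ)
        (Function.update ct (digitPos R r q) c') inp out σ (simStep R prog start x) := by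
    intro q ct c' b x hqW hc hx
    have := hx.step_work (prog := prog) (start := start) (.inl (by simp)) (.inl (by simp))
      (q' := (l, .left (Fin.ofNat (R + 1) r) b)) (c' := c') (mv := -1)
      (fun _ => by simp [counterAction, hc, hr])
      (by have := (hpos q hqW).1; simp; omega) (by have := (hpos q hqW).2; simp; omega)
    convert this using 1
    simp [digitPos]
    ring
  induction hd generalizing q ct x with
  | nil_hash b h =>
    refine ⟨1, q, _, by simp, by simp, ?_, ?_, hlast q ct .hash b x (by simpa using hq) ?_ hx⟩
    · intro j
      have := hct j
      by_cases hj : digitPos R r (q + j) = digitPos R r q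
      · rw [hj]; simp
      · rw [Function.update_of_ne hj, this]
    · intro p hp
      rw [Function.update_of_ne (by simpa using hp 0)]
    · have := hct 0
      simp only [add_zero, digitLetter_nil] at this
      rw [this, h]
  | nil_one b h =>
    refine ⟨1, q, _, by simp, by simp, ?_, ?_, hlast q ct .one b x (by simpa using hq) ?_ hx⟩
    · intro j
      rcases j with _ | j
      · simp [Letter.ofBool]
      · rw [Function.update_of_ne (fun h => by have := (digitPos_inj hrR hrR h).2; omega), hct]
        simp
    · intro p hp
      rw [Function.update_of_ne (by simpa using hp 0)]
    · have := hct 0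
      simp only [add_zero, digitLetter_nil] at this
      rw [this, h]
  | terminal a y m b h =>
    simp only [List.length_cons] at hq
    refine ⟨1, q, _, ?_, by simp, ?_, ?_, hlast q ct (.ofBool y) b x (by omega) ?_ hx⟩
    · exact Nat.one_le_iff_ne_zero.2 (by positivity)
    · intro j
      rcases j with _ | j
      · simp
      · rw [Function.update_of_ne (fun h => by have := (digitPos_inj hrR hrR h).2; omega), hct]
        simp
    · intro p hp
      rw [Function.update_of_ne (by simpa using hp 0)]
    · have := hct 0
      simp only [add_zero, digitLetter_cons_zero] at this
      rw [this, h]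
  | next a y m m' b h _ ih =>
    simp only [List.length_cons] at hq
    have h0 := hct 0
    simp only [add_zero, digitLetter_cons_zero] at h0
    have hb := hpos q (by omega)
    have hb' := hpos (q + 1) (by omega)
    have hdiff : digitPos R r (q + 1) = digitPos R r q + 1 + R := by
      simp only [digitPos]; push_cast; ring
    have h1 := hx.step_work (prog := prog) (start := start) (.inl (by simp)) (.inl (by simp))
      (q' := (l, .right (Fin.last R))) (c' := .ofBool y) (mv := 1)
      (fun _ => by simp [counterAction, h0, h])
      (by simp; omega) (by simp; omega)
    have h2 := At.right (prog := prog) (start := start) R (by omega) h1 (by simp; omega)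
      (by simp; omega)
    obtain ⟨n, q', ct', hn, hq', hrow, hoth, hAt⟩ := ih (q + 1) (by omega)
      (Function.update ct (digitPos R r q) (Letter.ofBool y))
      (fun j => by
        rw [Function.update_of_ne (fun h => by have := (digitPos_inj hrR hrR h).2; omega)]
        have := hct (j + 1)
        rw [digitLetter_cons_succ] at this
        rw [← this]; congr 2; ring)
      (x := (simStep R prog start)^[R] (simStep R prog start x))
      (by convert h2 using 1; simp [hdiff])
    refine ⟨n + (R + 1), q', ct', ?_, ?_, ?_, ?_, ?_⟩
    · simp only [List.length_cons]; linarith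
    · simp only [List.length_cons]; omega
    · intro j
      rcases j with _ | j
      · rw [add_zero, hoth _ (fun j h => by have := (digitPos_inj hrR hrR h).2; omega)]
        simp
      · rw [digitLetter_cons_succ, ← hrow]; congr 2; ring
    · intro p hp
      rw [hoth p (fun j => by have := hp (j + 1); rwa [← add_assoc, add_right_comm] at this),
        Function.update_of_ne (by simpa using hp 0)]
    · rw [Function.iterate_add_apply, Function.iterate_succ_apply]
      exact hAt

/-- The tape holds the registers `s`, with at most `W` digits each. -/
def TapeRep (R W : ℕ) (ct : ℤ → Letter) (s : ℕ → ℕ) : Prop :=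
  (∀ j : ℕ, 1 ≤ j → ct ((R + 1) * j) ≠ .one) ∧
    ∃ D : ℕ → List Bool, ∀ r < R, bitsVal (D r) = s r ∧ (D r).length ≤ W ∧
      ∀ j, ct (digitPos R r j) = digitLetter (D r) j

/-- A full pass over the tape, from the cell `0` to the digits of a register and back. -/
theorem At.pass {X W : ℕ} {l : L} {inp out : List Letter} {σ : List Bool} {s : ℕ → ℕ} {r v : ℕ}
    {b : Bool} (hr : (prog l).register = r)
    (hreg : (∃ l', prog l = .inc r l') ∨ (∃ l', prog l = .dec r l') ∨
      ∃ lz lnz, prog l = .jz r lz lnz)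
    (hrR : r < R) (hXW : (R + 1) * (W + 1) ≤ X) {ct : ℤ → Letter} (hct : TapeRep R W ct s)
    (hrip : ∀ d : List Bool, bitsVal d = s r → d.length ≤ W → ∃ d',
      Ripple (prog l).onDigit d d' b ∧ bitsVal d' = v ∧ d'.length ≤ W)
    {x : Config (L × Micro R) × List Bool} (hx : At X (l, .home) 0 ct inp out σ x) :
    ∃ n ct', n ≤ 4 * ((R + 1) * (W + 1)) ∧ TapeRep R W ct' (Function.update s r v) ∧
      At X ((prog l).target l b, .home) 0 ct' inp out σ ((simStep R prog start)^[n] x) := by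
  obtain ⟨hmark, D, hD⟩ := hct
  obtain ⟨hval, hlen, hrow⟩ := hD r hrR
  obtain ⟨d', hd', hv, hlen'⟩ := hrip (D r) hval hlen
  have hRX : R + 1 ≤ X := by nlinarith
  have h1 := hx.step_work (prog := prog) (start := start)
    (.inr (by obtain ⟨_, h⟩ | ⟨_, h⟩ | ⟨_, _, h⟩ := hreg <;> rw [h] <;> rfl))
    (.inr (by obtain ⟨_, h⟩ | ⟨_, h⟩ | ⟨_, _, h⟩ := hreg <;> rw [h] <;> rfl))
    (q' := (l, .right ⟨r, by omega⟩)) (c' := .one) (mv := 1)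
    (fun _ => by
      have : (Fin.ofNat (R + 1) r) = ⟨r, by omega⟩ := by
        apply Fin.ext; simp; omega
      obtain ⟨_, h⟩ | ⟨_, h⟩ | ⟨_, _, h⟩ := hreg <;>
        simp [counterAction, h, Instr.register, ← this])
    (by simp) (by simp; omega)
  -- The first step writes the marker into the cell `0`, since the tape is blank at first.
  have h2 := At.right (prog := prog) (start := start) r (by omega) h1 (by simp) (by simp; omega)
  have hne0 : ∀ r' < R, ∀ j, digitPos R r' j ≠ 0 := fun r' _ j h => by
    have : (0 : ℤ) < digitPos R r' j := by simp only [digitPos]; positivity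
    omega
  obtain ⟨n, q', ct', hn, hq', hrow', hoth, hAt⟩ := At.ripple (start := start) (W := W) hd' r hr hrR
    hXW 0
    (by simpa using hlen) (Function.update ct 0 .one)
    (fun j => by rw [Function.update_of_ne (hne0 r hrR _)]; simpa only [zero_add] using hrow j)
    (x := (simStep R prog start)^[r] (simStep R prog start x))
    (by convert h2 using 1; simp [digitPos])
  have hofNat : (Fin.ofNat (R + 1) r) = ⟨r, by omega⟩ := by
    apply Fin.ext; simp; omega
  rw [hofNat] at hAt
  have hq'W : (R + 1) * q' ≤ (R + 1) * W := Nat.mul_le_mul_left _ (by omega)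
  have hq'X : (r : ℤ) + (R + 1) * q' ≤ X := by
    have : r + (R + 1) * q' ≤ X := by rw [mul_add] at hXW; omega
    zify at this; exact this
  have hnn : (0 : ℤ) ≤ (R + 1) * q' := by positivity
  have h3 := At.left (prog := prog) (start := start) r (by omega) hAt (by simp) hq'X
  rw [add_sub_cancel_left] at h3
  have hmark' : ∀ j : ℕ, ct' ((R + 1) * j) = Function.update ct 0 .one ((R + 1) * j) :=
    fun j => hoth _ (fun i h => digitPos_ne_marker hrR j h.symm)
  have hz : ct' 0 = .one := by simpa using hmark' 0
  have hmk : ∀ j : ℕ, 1 ≤ j → ct' ((R + 1) * j) ≠ .one := by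
    intro j hj
    rw [hmark', Function.update_of_ne]
    · exact hmark j hj
    · have : (0 : ℤ) < (R + 1) * j := by positivity
      omega
  have h4 := At.return_home (prog := prog) (start := start) q' h3 (by linarith) hz hmk
  refine ⟨((R + 1) * q' + 1) + (r + (n + (r + 1))), ct', ?_, ⟨hmk, Function.update D r d', ?_⟩, ?_⟩
  · have : (R + 1) * (List.length (D r) + 1) ≤ (R + 1) * (W + 1) := Nat.mul_le_mul_left _ (by omega)
    have hn' := hn.trans this
    rw [mul_add] at hn' ⊢
    omega
  · intro r' hr'
    by_cases h : r' = r
    · subst h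
      simp only [Function.update_self]
      exact ⟨hv, hlen', fun j => by simpa only [zero_add] using hrow' j⟩
    · simp only [Function.update_of_ne h]
      refine ⟨(hD r' hr').1, (hD r' hr').2.1, fun j => ?_⟩
      rw [hoth _ (fun i h' => h (digitPos_inj hr' hrR h').1),
        Function.update_of_ne (hne0 r' hr' _)]
      exact (hD r' hr').2.2 j
  · rw [Function.iterate_add_apply, Function.iterate_add_apply _ r, Function.iterate_add_apply _ n,
      Function.iterate_succ_apply]
    exact h4

/-- The simulation of one instruction. -/
theorem At.instr {X W : ℕ} {l l' : L} {s s' : Store} (hXW : (R + 1) * (W + 1) ≤ X)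
    (hbdd : (prog l).Bdd R) (hstep : (prog l).Step s l' s') {ct : ℤ → Letter}
    (hct : TapeRep R W ct s.reg) (hW : ∀ r, s.reg r + 1 < 2 ^ W)
    {x : Config (L × Micro R) × List Bool}
    (hx : At X (l, .home) 0 ct s.input s.out s.coins x) :
    ∃ n ct', n ≤ 4 * ((R + 1) * (W + 1)) ∧ TapeRep R W ct' s'.reg ∧
      At X (l', .home) 0 ct' s'.input s'.out s'.coins ((simStep R prog start)^[n] x) := by
  have hone : 1 ≤ 4 * ((R + 1) * (W + 1)) := Nat.one_le_iff_ne_zero.2 (by positivity)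
  generalize hi : prog l = i at hstep hbdd
  cases hstep with
  | inc r l' s =>
    have := At.pass (start := start) (b := true) (v := s.reg r + 1) (r := r) (by rw [hi]; rfl)
      (.inl ⟨_, hi⟩) hbdd hXW hct (fun d hd hdW => by
        obtain ⟨m, h1, h2, h3⟩ := ripple_inc r l' d
        exact ⟨m, by rwa [hi], by rw [h2, hd], h3 W hdW (by rw [h2, hd]; exact hW r)⟩) hx
    rwa [hi] at this
  | dec r l' s hne =>
    have := At.pass (start := start) (b := true) (v := s.reg r - 1) (r := r) (by rw [hi]; rfl)
      (.inr (.inl ⟨_, hi⟩)) hbdd hXW hct (fun d hd hdW => by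
        obtain ⟨m, h1, h2, h3⟩ := ripple_dec r l' d (by rwa [hd])
        exact ⟨m, by rwa [hi], by rw [h2, hd], by omega⟩) hx
    rwa [hi] at this
  | jz_zero r _ lnz s hz =>
    have := At.pass (start := start) (b := false) (v := s.reg r) (r := r) (by rw [hi]; rfl)
      (.inr (.inr ⟨_, _, hi⟩)) hbdd hXW hct (fun d hd hdW => by
        have := ripple_jz r l' lnz d
        rw [hd] at this
        simp only [hz, ne_eq, not_true_eq_false, decide_false] at this
        exact ⟨d, by rwa [hi], hd, hdW⟩) hx
    rw [Function.update_eq_self, hi] at this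
    exact this
  | jz_pos r lz _ s hz =>
    have := At.pass (start := start) (b := true) (v := s.reg r) (r := r) (by rw [hi]; rfl)
      (.inr (.inr ⟨_, _, hi⟩)) hbdd hXW hct (fun d hd hdW => by
        have := ripple_jz r lz l' d
        rw [hd] at this
        simp only [ne_eq, hz, not_false_eq_true, decide_true] at this
        exact ⟨d, by rwa [hi], hd, hdW⟩) hx
    rw [Function.update_eq_self, hi] at this
    exact this
  | flip l0 l1 s =>
    refine ⟨1, ct, hone, hct, ?_⟩
    have := hx.step_of_eq (prog := prog) (start := start) (by simp [hi, Instr.isHalt])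
      (a := ⟨(if s.coins.headD false then l1 else l0, .home), ct 0, 0, false, none⟩)
      (by simp [counterAction, hi, coinState, Instr.isFlip]) (by simp) (by simp)
    simpa [coinState, hi, Instr.isFlip] using this
  | out a l' s =>
    refine ⟨1, ct, hone, hct, ?_⟩
    have := hx.step_of_eq (prog := prog) (start := start) (by simp [hi, Instr.isHalt])
      (a := ⟨(l', .home), ct 0, 0, false, some a⟩)
      (by simp [counterAction, hi]) (by simp) (by simp)
    simpa [coinState, hi, Instr.isFlip] using this
  | read_nil le f s h =>
    refine ⟨1, ct, hone, hct, ?_⟩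
    have := hx.step_of_eq (prog := prog) (start := start) (by simp [hi, Instr.isHalt])
      (a := ⟨(l', .home), ct 0, 0, false, none⟩)
      (by simp [counterAction, hi, h]) (by simp) (by simp)
    simpa [coinState, hi, Instr.isFlip] using this
  | read_cons le f s a u h =>
    refine ⟨1, ct, hone, hct, ?_⟩
    have := hx.step_of_eq (prog := prog) (start := start) (by simp [hi, Instr.isHalt])
      (a := ⟨(f a, .home), ct 0, 0, true, none⟩)
      (by simp [counterAction, hi, h]) (by simp) (by simp)
    simpa [coinState, hi, Instr.isFlip, h] using this

omit [Fintype L] in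
theorem Instr.Step.reg_le {i : Instr L} {l' : L} {s s' : Store} (h : i.Step s l' s') {v : ℕ}
    (hv : ∀ r, s.reg r ≤ v) (r : ℕ) : s'.reg r ≤ v + 1 := by
  have h0 : s.reg r ≤ v := hv r
  cases h with
  | inc r' _ _ =>
    by_cases h : r = r'
    · subst h; simpa [Store.set] using h0
    · simp only [Store.set, Function.update_of_ne h]; omega
  | dec r' _ _ _ =>
    by_cases h : r = r'
    · subst h; simp only [Store.set, Function.update_self]; omega
    · simp only [Store.set, Function.update_of_ne h]; omega
  | _ => exact h0.trans (Nat.le_succ _)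

/-- The simulation of a run of the register machine. The registers are bounded by the number of
steps, so that `W` digits are enough for fewer than `2 ^ W` steps. -/
theorem At.flow {X W : ℕ} (hXW : (R + 1) * (W + 1) ≤ X) (hbdd : ∀ l, (prog l).Bdd R)
    {n : ℕ} {l l' : L} {s s' : Store} (hflow : Flow prog n l s l' s') {v : ℕ}
    (hv : ∀ r, s.reg r ≤ v) (hW : v + n < 2 ^ W) {ct : ℤ → Letter} (hct : TapeRep R W ct s.reg)
    {x : Config (L × Micro R) × List Bool}
    (hx : At X (l, .home) 0 ct s.input s.out s.coins x) :
    ∃ N ct', N ≤ n * (4 * ((R + 1) * (W + 1))) ∧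
      At X (l', .home) 0 ct' s'.input s'.out s'.coins ((simStep R prog start)^[N] x) := by
  induction hflow generalizing v ct x with
  | refl l s => exact ⟨0, ct, by simp, hx⟩
  | head h _ ih =>
    obtain ⟨N₁, ct₁, hN₁, hct₁, hx₁⟩ := At.instr (start := start) hXW (hbdd _) h hct
      (fun r => by have := hv r; omega) hx
    obtain ⟨N₂, ct₂, hN₂, hx₂⟩ := ih (h.reg_le hv) (by omega) hct₁ hx₁
    refine ⟨N₂ + N₁, ct₂, by rw [add_mul]; omega, ?_⟩
    rwa [Function.iterate_add_apply]

/-- A configuration that halts is not changed by further steps. -/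
theorem simStep_of_halt {x : Config (L × Micro R) × List Bool}
    (h : (counterMachine R prog start).halting x.1.state = true) (n : ℕ) :
    (simStep R prog start)^[n] x = x := by
  have h1 : simStep R prog start x = x := by
    have hc : coinState R prog x.1.state = false := by
      simp only [Bool.and_eq_true, decide_eq_true_eq] at h
      obtain ⟨h1, h2⟩ := h
      cases h3 : prog x.1.state.1 <;> simp_all [coinState, Instr.isFlip, Instr.isHalt]
    rw [simStep, OPTM.demandStep, if_neg (by simp [hc]), OPTM.step, if_pos h]
  exact Function.iterate_fixed h1 n

end Simulation

/-- Register machines are simulated by online probabilistic Turing machines. If, with any coins,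
the program halts on the input `w` after fewer than `2 ^ W` steps with the output `o`, then the
simulating machine halts with an output of the same distribution. -/
theorem exists_optm_of_flow {L : Type} [Fintype L] (R : ℕ) (prog : L → Instr L) (start : L)
    (hbdd : ∀ l, (prog l).Bdd R) :
    ∃ M : OPTM, ∀ (w : List Letter) (T W n : ℕ) (o : List Bool → List Letter),
      (∀ σ : List Bool, ∃ n' ≤ n, ∃ (l' : L) (s' : Store),
        Flow prog n' start ⟨fun _ => 0, w, σ, []⟩ l' s' ∧ (prog l').isHalt = true ∧
        s'.out = o σ) →
      n < 2 ^ W → n * (4 * ((R + 1) * (W + 1))) ≤ T →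
      (∀ ρ : Fin T → Bool, M.halting (M.run w ρ).state = true ∧
        (M.run w ρ).visited.card ≤ (R + 1) * (W + 1) + 1) ∧
      ∀ E : List Letter → Prop,
        coinProb (fun ρ : Fin T → Bool => E (M.run w ρ).output) =
          coinProb (fun σ : Fin T → Bool => E (o (List.ofFn σ))) := by
  classical
  refine ⟨counterMachine R prog start, fun w T W n o hrun hW hT => ?_⟩
  -- The run with the coins `σ` on demand has halted after at most `T` steps.
  have key : ∀ σ : List Bool,
      let c := ((simStep R prog start)^[T] ((counterMachine R prog start).init w, σ)).1
      (counterMachine R prog start).halting c.state = true ∧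
        c.visited.card ≤ (R + 1) * (W + 1) + 1 ∧ c.output = o σ := by
    intro σ
    obtain ⟨n', hn', l', s', hflow, hhalt, ho⟩ := hrun σ
    obtain ⟨N, ct', hN, hx⟩ := At.flow (start := start) (X := (R + 1) * (W + 1)) (W := W) le_rfl
      hbdd
      hflow (v := 0) (fun r => le_rfl) (by omega) (ct := fun _ => .hash)
      ⟨fun _ _ => by simp, fun _ => [], fun r _ => ⟨rfl, by simp, fun j => by simp⟩⟩
      (x := ((counterMachine R prog start).init w, σ))
      ⟨rfl, rfl, fun _ => rfl, rfl, rfl, rfl, by simp [OPTM.init]; positivity⟩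
    have hhalt' : (counterMachine R prog start).halting
        ((simStep R prog start)^[N] ((counterMachine R prog start).init w, σ)).1.state = true := by
      rw [hx.state]; simp [hhalt]
    have hNT : N ≤ T := hN.trans ((Nat.mul_le_mul_right _ hn').trans hT)
    obtain ⟨d, rfl⟩ := Nat.exists_eq_add_of_le hNT
    rw [add_comm N d, Function.iterate_add_apply, simStep_of_halt hhalt']
    refine ⟨hhalt', ?_, by rw [hx.output, ho]⟩
    refine (Finset.card_le_card hx.visited).trans ?_
    rw [Int.card_Icc]
    simp
  -- Only states that flip depend on the coin, so that coins on demand may replace coins in every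
  -- step.
  have hprob : ∀ E : Config (counterMachine R prog start).Q → Prop,
      coinProb (fun ρ : Fin T → Bool => E ((counterMachine R prog start).run w ρ)) =
      coinProb (fun σ : Fin T → Bool =>
        E ((simStep R prog start)^[T] ((counterMachine R prog start).init w, List.ofFn σ)).1) :=
    fun E => OPTM.coinProb_foldl_step_eq (counterMachine R prog start) (coinState R prog)
      (fun c hc => counterMachine_step_coin R prog start c hc) E T T le_rfl _
  constructor
  -- A statement about all runs says that an event has probability `1`, and such a statement carries
  -- over from coins on demand.
  · refine fun ρ => forall_of_coinProb_eq_one (E := fun ρ : Fin T → Bool =>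
      (counterMachine R prog start).halting ((counterMachine R prog start).run w ρ).state = true ∧
        ((counterMachine R prog start).run w ρ).visited.card ≤ (R + 1) * (W + 1) + 1) ?_ ρ
    rw [hprob (fun c => (counterMachine R prog start).halting c.state = true ∧
        c.visited.card ≤ (R + 1) * (W + 1) + 1)]
    exact coinProb_of_forall fun σ => ⟨(key _).1, (key _).2.1⟩
  · intro E
    rw [hprob (fun c => E c.output)]
    congr 1
    funext σ
    rw [(key (List.ofFn σ)).2.2]

end OnlineQuantum

namespace OnlineQuantum

/-! ### Structured programs for register machines -/

instance : Fintype Letter := ⟨{.zero, .one, .hash}, fun a => by cases a <;> simp⟩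

/-- Structured programs. `jz r a b` runs `a` if the register `r` holds `0` and `b` otherwise,
`loop r c` decrements `r` and runs `c` until `r` holds `0`, `flip a b` runs `a` or `b` according to
a coin, and `scan f` runs `f a` for each letter `a` of the rest of the input. -/
inductive Cmd where
  | skip
  | seq (a b : Cmd)
  | inc (r : ℕ)
  | dec (r : ℕ)
  | jz (r : ℕ) (a b : Cmd)
  | loop (r : ℕ) (c : Cmd)
  | flip (a b : Cmd)
  | out (a : Letter)
  | scan (f : Letter → Cmd)

namespace Cmd

/-- The number of instructions executed by a structured program, and its effect. -/
inductive Exec : Cmd → Store → ℕ → Store → Prop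
  | skip (s : Store) : Exec .skip s 0 s
  | seq {a b : Cmd} {s s' s'' : Store} {n m : ℕ} (h : Exec a s n s') (h' : Exec b s' m s'') :
      Exec (.seq a b) s (n + m) s''
  | inc (r : ℕ) (s : Store) : Exec (.inc r) s 1 (s.set r (s.reg r + 1))
  | dec (r : ℕ) (s : Store) (h : s.reg r ≠ 0) : Exec (.dec r) s 1 (s.set r (s.reg r - 1))
  | jz_zero {r : ℕ} {a b : Cmd} {s s' : Store} {n : ℕ} (h : s.reg r = 0) (h' : Exec a s n s') :
      Exec (.jz r a b) s (n + 1) s'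
  | jz_pos {r : ℕ} {a b : Cmd} {s s' : Store} {n : ℕ} (h : s.reg r ≠ 0) (h' : Exec b s n s') :
      Exec (.jz r a b) s (n + 1) s'
  | loop_zero {r : ℕ} {c : Cmd} {s : Store} (h : s.reg r = 0) : Exec (.loop r c) s 1 s
  | loop_pos {r : ℕ} {c : Cmd} {s s' s'' : Store} {n m : ℕ} (h : s.reg r ≠ 0)
      (h' : Exec c (s.set r (s.reg r - 1)) n s') (h'' : Exec (.loop r c) s' m s'') :
      Exec (.loop r c) s (n + m + 1 + 1) s''
  | flip_false {a b : Cmd} {s s' : Store} {n : ℕ} (h : s.coins.headD false = false)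
      (h' : Exec a { s with coins := s.coins.tail } n s') : Exec (.flip a b) s (n + 1) s'
  | flip_true {a b : Cmd} {s s' : Store} {n : ℕ} (h : s.coins.headD false = true)
      (h' : Exec b { s with coins := s.coins.tail } n s') : Exec (.flip a b) s (n + 1) s'
  | out (a : Letter) (s : Store) : Exec (.out a) s 1 { s with out := s.out ++ [a] }
  | scan_nil {f : Letter → Cmd} {s : Store} (h : s.input = []) : Exec (.scan f) s 1 s
  | scan_cons {f : Letter → Cmd} {s s' s'' : Store} {a : Letter} {u : List Letter} {n m : ℕ}
      (h : s.input = a :: u) (h' : Exec (f a) { s with input := u } n s')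
      (h'' : Exec (.scan f) s' m s'') : Exec (.scan f) s (n + m + 1) s''

/-- The labels of a structured program. -/
def Lab : Cmd → Type
  | skip => Empty
  | seq a b => Lab a ⊕ Lab b
  | inc _ => Unit
  | dec _ => Unit
  | jz _ a b => Option (Lab a ⊕ Lab b)
  | loop _ c => Bool ⊕ Lab c
  | flip a b => Option (Lab a ⊕ Lab b)
  | out _ => Unit
  | scan f => Option (Σ a, Lab (f a))

instance finite_lab (c : Cmd) : Finite c.Lab := by
  induction c with
  | skip => exact inferInstanceAs (Finite Empty)
  | seq a b _ _ => exact inferInstanceAs (Finite (Lab a ⊕ Lab b))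
  | inc _ => exact inferInstanceAs (Finite Unit)
  | dec _ => exact inferInstanceAs (Finite Unit)
  | jz _ a b _ _ => exact inferInstanceAs (Finite (Option (Lab a ⊕ Lab b)))
  | loop _ c _ => exact inferInstanceAs (Finite (Bool ⊕ Lab c))
  | flip a b _ _ => exact inferInstanceAs (Finite (Option (Lab a ⊕ Lab b)))
  | out _ => exact inferInstanceAs (Finite Unit)
  | scan f _ => exact inferInstanceAs (Finite (Option (Σ a, Lab (f a))))

/-- The first label of a program whose labels are embedded in `L` by `e`; this is the label after
the program if there is nothing to do. -/
def entry {L : Type} : (c : Cmd) → (e : Lab c → L) → (exit : L) → L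
  | skip, _, exit => exit
  | seq a b, e, exit => entry a (fun x => e (.inl x)) (entry b (fun x => e (.inr x)) exit)
  | inc _, e, _ => e ()
  | dec _, e, _ => e ()
  | jz _ _ _, e, _ => e none
  | loop _ _, e, _ => e (.inl false)
  | flip _ _, e, _ => e none
  | out _, e, _ => e ()
  | scan _, e, _ => e none

/-- The instructions of a program at its labels. -/
def code {L : Type} : (c : Cmd) → (e : Lab c → L) → (exit : L) → Lab c → Instr L
  | skip, _, _ => fun x => nomatch (x : Empty)
  | seq a b, e, exit => fun x => match (x : Lab a ⊕ Lab b) with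
    | .inl x => code a (fun x => e (.inl x)) (entry b (fun x => e (.inr x)) exit) x
    | .inr x => code b (fun x => e (.inr x)) exit x
  | inc r, _, exit => fun _ => .inc r exit
  | dec r, _, exit => fun _ => .dec r exit
  | jz r a b, e, exit => fun x => match (x : Option (Lab a ⊕ Lab b)) with
    | none => .jz r (entry a (fun x => e (some (.inl x))) exit)
        (entry b (fun x => e (some (.inr x))) exit)
    | some (.inl x) => code a (fun x => e (some (.inl x))) exit x
    | some (.inr x) => code b (fun x => e (some (.inr x))) exit x
  | loop r c, e, exit => fun x => match (x : Bool ⊕ Lab c) with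
    | .inl false => .jz r exit (e (.inl true))
    | .inl true => .dec r (entry c (fun x => e (.inr x)) (e (.inl false)))
    | .inr x => code c (fun x => e (.inr x)) (e (.inl false)) x
  | flip a b, e, exit => fun x => match (x : Option (Lab a ⊕ Lab b)) with
    | none => .flip (entry a (fun x => e (some (.inl x))) exit)
        (entry b (fun x => e (some (.inr x))) exit)
    | some (.inl x) => code a (fun x => e (some (.inl x))) exit x
    | some (.inr x) => code b (fun x => e (some (.inr x))) exit x
  | out a, _, exit => fun _ => .out a exit
  | scan f, e, exit => fun x => match (x : Option (Σ a, Lab (f a))) with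
    | none => .read exit fun a => entry (f a) (fun x => e (some ⟨a, x⟩)) (e none)
    | some x => code (f x.1) (fun y => e (some ⟨x.1, y⟩)) (e none) x.2

/-- The registers of the program are below `R`. -/
def Bdd (R : ℕ) : Cmd → Prop
  | skip => True
  | seq a b => Bdd R a ∧ Bdd R b
  | inc r => r < R
  | dec r => r < R
  | jz r a b => r < R ∧ Bdd R a ∧ Bdd R b
  | loop r c => r < R ∧ Bdd R c
  | flip a b => Bdd R a ∧ Bdd R b
  | out _ => True
  | scan f => ∀ a, Bdd R (f a)

theorem Bdd.mono {R R' : ℕ} (h : R ≤ R') {c : Cmd} (hc : c.Bdd R) : c.Bdd R' := by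
  induction c with
  | skip => trivial
  | seq a b iha ihb => exact ⟨iha hc.1, ihb hc.2⟩
  | inc r => exact lt_of_lt_of_le hc h
  | dec r => exact lt_of_lt_of_le hc h
  | jz r a b iha ihb => exact ⟨lt_of_lt_of_le hc.1 h, iha hc.2.1, ihb hc.2.2⟩
  | loop r c ih => exact ⟨lt_of_lt_of_le hc.1 h, ih hc.2⟩
  | flip a b iha ihb => exact ⟨iha hc.1, ihb hc.2⟩
  | out _ => trivial
  | scan f ih => exact fun a => ih a (hc a)

theorem exists_bdd (c : Cmd) : ∃ R, c.Bdd R := by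
  induction c with
  | skip => exact ⟨0, trivial⟩
  | seq a b iha ihb =>
    obtain ⟨R, hR⟩ := iha
    obtain ⟨R', hR'⟩ := ihb
    exact ⟨max R R', hR.mono (le_max_left _ _), hR'.mono (le_max_right _ _)⟩
  | inc r => exact ⟨r + 1, Nat.lt_succ_self r⟩
  | dec r => exact ⟨r + 1, Nat.lt_succ_self r⟩
  | jz r a b iha ihb =>
    obtain ⟨R, hR⟩ := iha
    obtain ⟨R', hR'⟩ := ihb
    exact ⟨max (max R R') (r + 1), lt_of_lt_of_le (Nat.lt_succ_self r) (le_max_right _ _),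
      hR.mono ((le_max_left _ _).trans (le_max_left _ _)),
      hR'.mono ((le_max_right _ _).trans (le_max_left _ _))⟩
  | loop r c ih =>
    obtain ⟨R, hR⟩ := ih
    exact ⟨max R (r + 1), lt_of_lt_of_le (Nat.lt_succ_self r) (le_max_right _ _),
      hR.mono (le_max_left _ _)⟩
  | flip a b iha ihb =>
    obtain ⟨R, hR⟩ := iha
    obtain ⟨R', hR'⟩ := ihb
    exact ⟨max R R', hR.mono (le_max_left _ _), hR'.mono (le_max_right _ _)⟩
  | out _ => exact ⟨0, trivial⟩
  | scan f ih =>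
    choose R hR using ih
    exact ⟨Finset.univ.sup R, fun a => (hR a).mono (Finset.le_sup (Finset.mem_univ a))⟩

theorem code_bdd {L : Type} {R : ℕ} {c : Cmd} (hc : c.Bdd R) (e : Lab c → L) (exit : L)
    (x : Lab c) : (code c e exit x).Bdd R := by
  induction c generalizing exit with
  | skip => exact nomatch (x : Empty)
  | seq a b iha ihb => rcases x with x | x; exacts [iha hc.1 _ _ x, ihb hc.2 _ _ x]
  | inc r => exact hc
  | dec r => exact hc
  | jz r a b iha ihb => rcases x with _ | x | x; exacts [hc.1, iha hc.2.1 _ _ x, ihb hc.2.2 _ _ x]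
  | loop r c ih => rcases x with (_ | _) | x; exacts [hc.1, hc.1, ih hc.2 _ _ x]
  | flip a b iha ihb => rcases x with _ | x | x; exacts [trivial, iha hc.1 _ _ x, ihb hc.2 _ _ x]
  | out _ => trivial
  | scan f ih =>
    rcases x with _ | ⟨a, x⟩
    · rw [code]; trivial
    · rw [code]; exact ih a (hc a) _ _ x

/-- The code of a program performs its execution: from the label at its entry to the label behind
it. -/
theorem Exec.flow {c : Cmd} {s s' : Store} {n : ℕ} (h : Exec c s n s') {L : Type}
    {prog : L → Instr L} {e : Lab c → L} {exit : L} (hp : ∀ x, prog (e x) = code c e exit x) :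
    Flow prog n (entry c e exit) s exit s' := by
  induction h generalizing exit with
  | skip s => exact .refl _ _
  | seq _ _ ih ih' => exact (ih fun x => hp (.inl x)).trans (ih' fun x => hp (.inr x))
  | inc r s =>
    refine .head ?_ (.refl _ _)
    have := hp ()
    simp only [entry, this, code]
    exact .inc _ _ _
  | dec r s h =>
    refine .head ?_ (.refl _ _)
    have := hp ()
    simp only [entry, this, code]
    exact .dec _ _ _ h
  | jz_zero h _ ih =>
    refine .head ?_ (ih fun x => hp (some (.inl x)))
    have := hp none
    simp only [entry, this, code]
    exact .jz_zero _ _ _ _ h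
  | jz_pos h _ ih =>
    refine .head ?_ (ih fun x => hp (some (.inr x)))
    have := hp none
    simp only [entry, this, code]
    exact .jz_pos _ _ _ _ h
  | loop_zero h =>
    refine .head ?_ (.refl _ _)
    have := hp (.inl false)
    simp only [entry, this, code]
    exact .jz_zero _ _ _ _ h
  | @loop_pos r c s _ _ n m h _ _ ih ih' =>
    have h1 := hp (.inl false)
    have h2 := hp (.inl true)
    have h3 := Flow.trans (ih fun x => hp (.inr x)) (ih' hp)
    have h4 : (prog (e (.inl false))).Step s (e (.inl true)) s := by
      rw [h1, code]
      exact .jz_pos _ _ _ _ h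
    refine .head h4 (.head ?_ h3)
    rw [h2, code]
    exact .dec _ _ _ h
  | @flip_false a b s s' n h _ ih =>
    refine .head ?_ (ih fun x => hp (some (.inl x)))
    have h1 := hp none
    have h2 := Instr.Step.flip (entry a (fun x => e (some (.inl x))) exit)
      (entry b (fun x => e (some (.inr x))) exit) s
    rw [h] at h2
    simp only [entry, h1, code]
    exact h2
  | @flip_true a b s s' n h _ ih =>
    refine .head ?_ (ih fun x => hp (some (.inr x)))
    have h1 := hp none
    have h2 := Instr.Step.flip (entry a (fun x => e (some (.inl x))) exit)
      (entry b (fun x => e (some (.inr x))) exit) s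
    rw [h] at h2
    simp only [entry, h1, code]
    exact h2
  | out a s =>
    refine .head ?_ (.refl _ _)
    have := hp ()
    simp only [entry, this, code]
    exact .out _ _ _
  | scan_nil h =>
    refine .head ?_ (.refl _ _)
    have := hp none
    simp only [entry, this, code]
    exact .read_nil _ _ _ h
  | @scan_cons f s s' s'' a u n m h _ _ ih ih' =>
    have := hp none
    refine .head (l' := entry (f a) (fun x => e (some ⟨a, x⟩)) (e none))
      (s' := { s with input := u }) ?_ ((ih fun x => ?_).trans (ih' hp))
    · simp only [entry, this, code]
      exact .read_cons _ _ _ _ _ h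
    · rw [hp (some ⟨a, x⟩), code]

end Cmd

/-- Structured programs are simulated by online probabilistic Turing machines. -/
theorem exists_optm_of_cmd (c : Cmd) :
    ∃ (M : OPTM) (R : ℕ), ∀ (w : List Letter) (T W n : ℕ) (o : List Bool → List Letter),
      (∀ σ : List Bool, ∃ n' ≤ n, ∃ s' : Store,
        Cmd.Exec c ⟨fun _ => 0, w, σ, []⟩ n' s' ∧ s'.out = o σ) →
      n < 2 ^ W → n * (4 * ((R + 1) * (W + 1))) ≤ T →
      (∀ ρ : Fin T → Bool, M.halting (M.run w ρ).state = true ∧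
        (M.run w ρ).visited.card ≤ (R + 1) * (W + 1) + 1) ∧
      ∀ E : List Letter → Prop,
        coinProb (fun ρ : Fin T → Bool => E (M.run w ρ).output) =
          coinProb (fun σ : Fin T → Bool => E (o (List.ofFn σ))) := by
  classical
  obtain ⟨R, hR⟩ := c.exists_bdd
  have : Fintype c.Lab := Fintype.ofFinite _
  -- The label `none` behind the program halts.
  let prog : Option c.Lab → Instr (Option c.Lab) := fun l => l.elim .halt (c.code some none)
  obtain ⟨M, hM⟩ := exists_optm_of_flow R prog (c.entry some none) (by
    rintro (_ | x)
    · trivial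
    · exact Cmd.code_bdd hR _ _ _)
  refine ⟨M, R, fun w T W n o h hW hT => hM w T W n o (fun σ => ?_) hW hT⟩
  obtain ⟨n', hn', s', hs', ho⟩ := h σ
  exact ⟨n', hn', none, s', hs'.flow fun _ => rfl, rfl, ho⟩

end OnlineQuantum

namespace OnlineQuantum

/-! ### Programs with arithmetic expressions -/

/-- Arithmetic expressions over the variables `ν`. -/
inductive Expr (ν : Type) where
  | const (n : ℕ)
  | var (x : ν)
  | add (a b : Expr ν)
  | sub (a b : Expr ν)
  | mul (a b : Expr ν)
  | div (a b : Expr ν)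
  | mod (a b : Expr ν)

namespace Expr

variable {ν : Type}

/-- The value of an expression. -/
def val (s : ν → ℕ) : Expr ν → ℕ
  | const n => n
  | var x => s x
  | add a b => val s a + val s b
  | sub a b => val s a - val s b
  | mul a b => val s a * val s b
  | div a b => val s a / val s b
  | mod a b => val s a % val s b

/-- The values of all subexpressions are at most `B`, and all divisors are positive. -/
def Ok (B : ℕ) (s : ν → ℕ) : Expr ν → Prop
  | const n => n ≤ B
  | var _ => True
  | add a b => Ok B s a ∧ Ok B s b ∧ val s a + val s b ≤ B
  | sub a b => Ok B s a ∧ Ok B s b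
  | mul a b => Ok B s a ∧ Ok B s b ∧ val s a * val s b ≤ B
  | div a b => Ok B s a ∧ Ok B s b ∧ 0 < val s b
  | mod a b => Ok B s a ∧ Ok B s b ∧ 0 < val s b

instance : Coe ν (Expr ν) := ⟨var⟩
instance (n : ℕ) : OfNat (Expr ν) n := ⟨const n⟩
instance : Add (Expr ν) := ⟨add⟩
instance : Sub (Expr ν) := ⟨sub⟩
instance : Mul (Expr ν) := ⟨mul⟩
instance : Div (Expr ν) := ⟨div⟩
instance : Mod (Expr ν) := ⟨mod⟩

variable (s : ν → ℕ) (a b : Expr ν) (B : ℕ)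

@[simp] theorem val_const (n : ℕ) : (const n : Expr ν).val s = n := rfl
@[simp] theorem val_var (x : ν) : (var x).val s = s x := rfl
@[simp] theorem val_ofNat (n : ℕ) : (no_index (OfNat.ofNat n) : Expr ν).val s = n := rfl
@[simp] theorem val_add : (a + b).val s = a.val s + b.val s := rfl
@[simp] theorem val_sub : (a - b).val s = a.val s - b.val s := rfl
@[simp] theorem val_mul : (a * b).val s = a.val s * b.val s := rfl
@[simp] theorem val_div : (a / b).val s = a.val s / b.val s := rfl
@[simp] theorem val_mod : (a % b).val s = a.val s % b.val s := rfl
@[simp] theorem ok_const (n : ℕ) : (const n : Expr ν).Ok B s ↔ n ≤ B := Iff.rfl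
@[simp] theorem ok_var (x : ν) : (var x).Ok B s ↔ True := Iff.rfl
@[simp] theorem ok_ofNat (n : ℕ) : (no_index (OfNat.ofNat n) : Expr ν).Ok B s ↔ n ≤ B := Iff.rfl
@[simp] theorem ok_add : (a + b).Ok B s ↔ a.Ok B s ∧ b.Ok B s ∧ a.val s + b.val s ≤ B := Iff.rfl
@[simp] theorem ok_sub : (a - b).Ok B s ↔ a.Ok B s ∧ b.Ok B s := Iff.rfl
@[simp] theorem ok_mul : (a * b).Ok B s ↔ a.Ok B s ∧ b.Ok B s ∧ a.val s * b.val s ≤ B := Iff.rfl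
@[simp] theorem ok_div : (a / b).Ok B s ↔ a.Ok B s ∧ b.Ok B s ∧ 0 < b.val s := Iff.rfl
@[simp] theorem ok_mod : (a % b).Ok B s ↔ a.Ok B s ∧ b.Ok B s ∧ 0 < b.val s := Iff.rfl

end Expr

/-- Programs with assignments. `ifz e a b` runs `a` if the value of `e` is `0` and `b` otherwise,
`rep e c` repeats `c` as often as the value of `e` at the beginning says, and `flip x` assigns a
random bit to `x`. -/
inductive Imp (ν : Type) where
  | skip
  | seq (a b : Imp ν)
  | assign (x : ν) (e : Expr ν)
  | ifz (e : Expr ν) (a b : Imp ν)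
  | rep (e : Expr ν) (c : Imp ν)
  | flip (x : ν)
  | out (a : Letter)

/-- The variables, the coins not used so far, and the output. -/
structure Mem (ν : Type) where
  val : ν → ℕ
  coins : List Bool
  out : List Letter

namespace Imp

variable {ν : Type} [DecidableEq ν]

/-- The effect of a program. -/
def run : Imp ν → Mem ν → Mem ν
  | skip, s => s
  | seq a b, s => run b (run a s)
  | assign x e, s => { s with val := Function.update s.val x (e.val s.val) }
  | ifz e a b, s => if e.val s.val = 0 then run a s else run b s
  | rep e c, s => (run c)^[e.val s.val] s
  | flip x, s => { s with
      val := Function.update s.val x (s.coins.headD false).toNat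
      coins := s.coins.tail }
  | out a, s => { s with out := s.out ++ [a] }

/-- No value that occurs in the execution exceeds `B`. -/
def Ok (B : ℕ) : Imp ν → Mem ν → Prop
  | skip, _ => True
  | seq a b, s => Ok B a s ∧ Ok B b (run a s)
  | assign _ e, s => e.Ok B s.val
  | ifz e a b, s => e.Ok B s.val ∧ (e.val s.val = 0 → Ok B a s) ∧ (e.val s.val ≠ 0 → Ok B b s)
  | rep e c, s => e.Ok B s.val ∧ ∀ i < e.val s.val, Ok B c ((run c)^[i] s)
  | flip _, _ => 1 ≤ B
  | out _, _ => True

end Imp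

/-! ### Compilation of expressions -/

namespace Cmd

/-- The program `c` terminates within `n` steps, in a memory that satisfies `Q`. -/
def Runs (c : Cmd) (s : Store) (n : ℕ) (Q : Store → Prop) : Prop :=
  ∃ m s', Exec c s m s' ∧ m ≤ n ∧ Q s'

theorem Runs.mono {c : Cmd} {s : Store} {n n' : ℕ} {Q Q' : Store → Prop} (h : Runs c s n Q)
    (hn : n ≤ n') (hQ : ∀ s', Q s' → Q' s') : Runs c s n' Q' := by
  obtain ⟨m, s', h1, h2, h3⟩ := h
  exact ⟨m, s', h1, h2.trans hn, hQ _ h3⟩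

theorem Runs.skip {s : Store} {n : ℕ} {Q : Store → Prop} (h : Q s) : Runs .skip s n Q :=
  ⟨0, s, .skip s, Nat.zero_le _, h⟩

theorem Runs.seq {a b : Cmd} {s : Store} {n n' : ℕ} {P Q : Store → Prop} (h : Runs a s n P)
    (h' : ∀ s', P s' → Runs b s' n' Q) : Runs (.seq a b) s (n + n') Q := by
  obtain ⟨m, s', h1, h2, h3⟩ := h
  obtain ⟨m', s'', h1', h2', h3'⟩ := h' s' h3
  exact ⟨m + m', s'', .seq h1 h1', by omega, h3'⟩

theorem Runs.inc {r : ℕ} {s : Store} {Q : Store → Prop} (h : Q (s.set r (s.reg r + 1))) :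
    Runs (.inc r) s 1 Q := ⟨1, _, .inc r s, le_rfl, h⟩

theorem Runs.dec {r : ℕ} {s : Store} {Q : Store → Prop} (h0 : s.reg r ≠ 0)
    (h : Q (s.set r (s.reg r - 1))) : Runs (.dec r) s 1 Q := ⟨1, _, .dec r s h0, le_rfl, h⟩

theorem Runs.jz {r : ℕ} {a b : Cmd} {s : Store} {n : ℕ} {Q : Store → Prop}
    (ha : s.reg r = 0 → Runs a s n Q) (hb : s.reg r ≠ 0 → Runs b s n Q) :
    Runs (.jz r a b) s (n + 1) Q := by
  by_cases h : s.reg r = 0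
  · obtain ⟨m, s', h1, h2, h3⟩ := ha h
    exact ⟨m + 1, s', .jz_zero h h1, by omega, h3⟩
  · obtain ⟨m, s', h1, h2, h3⟩ := hb h
    exact ⟨m + 1, s', .jz_pos h h1, by omega, h3⟩

/-- The rule for loops, with an invariant that is indexed by the number of rounds to come. -/
theorem Runs.loop {r : ℕ} {c : Cmd} {s : Store} {n k : ℕ} {Q : Store → Prop}
    (I : ℕ → Store → Prop) (hr : ∀ j s, I j s → s.reg r = j)
    (hc : ∀ j s, j < k → I (j + 1) s → Runs c (s.set r j) n (I j)) (h0 : I k s)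
    (hQ : ∀ s, I 0 s → Q s) : Runs (.loop r c) s (k * (n + 2) + 1) Q := by
  induction k generalizing s with
  | zero => exact ⟨1, s, .loop_zero (hr _ _ h0), by simp, hQ s h0⟩
  | succ k ih =>
    have h1 := hr _ _ h0
    obtain ⟨m, s', h2, h3, h4⟩ := hc k s (by omega) h0
    obtain ⟨m', s'', h5, h6, h7⟩ := ih (fun j s hj => hc j s (by omega)) h4
    refine ⟨m + m' + 1 + 1, s'', .loop_pos (by omega) (by rw [h1]; exact h2) h5, ?_, h7⟩
    rw [add_mul]; omega

end Cmd

/-- The memories `f` and `f'` agree on the registers below `N`, on the input, on the coins and on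
the output, and the registers in `f'` are bounded by `B`. -/
structure Keeps (B N : ℕ) (f f' : Store) : Prop where
  reg : ∀ r < N, f'.reg r = f.reg r
  le : ∀ r, f'.reg r ≤ B
  input : f'.input = f.input
  coins : f'.coins = f.coins
  out : f'.out = f.out

namespace Keeps

variable {B N : ℕ} {f f' f'' : Store}

theorem refl (h : ∀ r, f.reg r ≤ B) : Keeps B N f f := ⟨fun _ _ => rfl, h, rfl, rfl, rfl⟩

theorem trans (h : Keeps B N f f') (h' : Keeps B N f' f'') : Keeps B N f f'' :=
  ⟨fun r hr => (h'.reg r hr).trans (h.reg r hr), h'.le, h'.input.trans h.input,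
    h'.coins.trans h.coins, h'.out.trans h.out⟩

theorem mono {N' : ℕ} (h : Keeps B N f f') (hN : N' ≤ N) : Keeps B N' f f' :=
  ⟨fun r hr => h.reg r (by omega), h.le, h.input, h.coins, h.out⟩

theorem set (h : Keeps B N f f') {r v : ℕ} (hr : N ≤ r) (hv : v ≤ B) :
    Keeps B N f (f'.set r v) := by
  refine ⟨fun r' hr' => ?_, fun r' => ?_, h.input, h.coins, h.out⟩
  · simp only [Store.set]
    rw [Function.update_of_ne (by omega), h.reg r' hr']
  · by_cases h' : r' = r
    · subst h'; simpa [Store.set] using hv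
    · simpa [Store.set, Function.update_of_ne h'] using h.le r'

end Keeps

@[simp] theorem Store.set_reg_self (s : Store) (r v : ℕ) : (s.set r v).reg r = v := by
  simp [Store.set]

theorem Store.set_reg_of_ne (s : Store) {r r' : ℕ} (v : ℕ) (h : r' ≠ r) :
    (s.set r v).reg r' = s.reg r' := by
  simp [Store.set, Function.update_of_ne h]

theorem Store.set_set (s : Store) (r v v' : ℕ) : (s.set r v).set r v' = s.set r v' := by
  simp [Store.set]

theorem Store.set_reg_eq (s : Store) (r v : ℕ) (h : s.reg r = v) : s.set r v = s := by
  subst h; simp [Store.set]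

namespace Cmd

/-- Set a register to `0`. -/
def clear (r : ℕ) : Cmd := .loop r .skip

theorem runs_clear {B r : ℕ} {s : Store} (h : s.reg r ≤ B) {Q : Store → Prop} (hQ : Q (s.set r 0)) :
    Runs (clear r) s (B * 2 + 1) Q := by
  refine (Runs.loop (n := 0) (k := s.reg r) (fun j s' => s' = s.set r j) ?_ ?_ ?_ ?_).mono ?_
    (fun _ h => h)
  · rintro j _ rfl; simp
  · rintro j _ _ rfl; exact .skip (by rw [Store.set_set])
  · simp [Store.set_reg_eq]
  · rintro _ rfl; exact hQ
  · simpa using h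

/-- Add the register `r` to `t`, and set `r` to `0`. -/
def move (r t : ℕ) : Cmd := .loop r (.inc t)

theorem runs_move {B r t : ℕ} (hrt : r ≠ t) {s : Store} (h : s.reg r ≤ B) {Q : Store → Prop}
    (hQ : Q ((s.set t (s.reg t + s.reg r)).set r 0)) : Runs (move r t) s (B * 3 + 1) Q := by
  refine (Runs.loop (n := 1) (k := s.reg r)
    (fun j s' => j ≤ s.reg r ∧ s' = (s.set t (s.reg t + (s.reg r - j))).set r j) ?_ ?_ ?_ ?_).mono
      ?_
    (fun _ h => h)
  · rintro j _ ⟨_, rfl⟩; simp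
  · rintro j _ hj ⟨_, rfl⟩
    refine .inc ⟨by omega, ?_⟩
    ext x
    · simp only [Store.set, Function.update_apply]
      split_ifs <;> simp_all; omega
    all_goals simp [Store.set]
  · refine ⟨le_rfl, ?_⟩
    simp only [Nat.sub_self, add_zero]
    rw [Store.set_reg_eq s t _ rfl, Store.set_reg_eq s r _ rfl]
  · rintro _ ⟨_, rfl⟩; exact hQ
  · omega

/-- Add the register `r` to `t` by means of the register `u`, which has to be `0` and is `0` in the
end. -/
def addTo (r t u : ℕ) : Cmd := .seq (.loop r (.seq (.inc t) (.inc u))) (move u r)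

theorem runs_addTo {B r t u : ℕ} (hrt : r ≠ t) (hru : r ≠ u) (htu : t ≠ u) {s : Store}
    (h : s.reg r ≤ B) (hu : s.reg u = 0) {Q : Store → Prop}
    (hQ : Q (s.set t (s.reg t + s.reg r))) : Runs (addTo r t u) s (B * 7 + 2) Q := by
  refine Runs.mono (.seq (n := B * 4 + 1) (n' := B * 3 + 1)
    (P := fun s' => s' = ((s.set t (s.reg t + s.reg r)).set u (s.reg r)).set r 0) ?_ ?_)
    (by omega) (fun _ h => h)
  · refine (Runs.loop (n := 2) (k := s.reg r) (fun j s' => j ≤ s.reg r ∧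
      s' = ((s.set t (s.reg t + (s.reg r - j))).set u (s.reg r - j)).set r j) ?_ ?_ ?_ ?_).mono ?_
      (fun _ h => h)
    · rintro j _ ⟨_, rfl⟩; simp
    · rintro j _ hj ⟨_, rfl⟩
      refine .seq (n := 1) (n' := 1) (.inc rfl) ?_
      rintro _ rfl
      refine .inc ⟨by omega, ?_⟩
      ext x
      · simp only [Store.set, Function.update_apply]
        split_ifs <;> simp_all <;> omega
      all_goals simp [Store.set]
    · refine ⟨le_rfl, ?_⟩
      simp only [Nat.sub_self, add_zero]
      rw [Store.set_reg_eq s t _ rfl, Store.set_reg_eq s u _ hu, Store.set_reg_eq s r _ rfl]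
    · rintro _ ⟨_, rfl⟩; simp
    · omega
  · rintro _ rfl
    refine runs_move hru.symm ?_ ?_
    · rw [Store.set_reg_of_ne _ _ hru.symm]; simpa using h
    · convert hQ using 1
      ext x
      · simp only [Store.set, Function.update_apply]
        split_ifs <;> simp_all
      all_goals simp [Store.set]

end Cmd

/-- The value of the expression is computed in the register `d`, with the help of the registers
above `d`. The variable `x` is kept in the register `i x`. -/
def Expr.comp {ν : Type} (i : ν → ℕ) : Expr ν → ℕ → Cmd
  | const n, d => .seq (.clear d) (n.rec .skip fun _ c => .seq c (.inc d))
  | var x, d => .seq (.clear d) (.seq (.clear (d + 1)) (.addTo (i x) d (d + 1)))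
  | add a b, d => .seq (comp i a d) (.seq (comp i b (d + 1)) (.move (d + 1) d))
  | sub a b, d => .seq (comp i a d) (.seq (comp i b (d + 1))
      (.loop (d + 1) (.jz d .skip (.dec d))))
  | mul a b, d => .seq (comp i a d) (.seq (comp i b (d + 1)) (.seq (.clear (d + 2))
      (.seq (.clear (d + 3)) (.seq (.loop d (.addTo (d + 1) (d + 2) (d + 3)))
        (.move (d + 2) d)))))
  | div a b, d => .seq (comp i a d) (.seq (comp i b (d + 1)) (.seq (.clear (d + 2))
      (.seq (.clear (d + 3)) (.seq (.loop d (.seq (.inc (d + 3)) (.seq (.dec (d + 1))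
        (.jz (d + 1) (.seq (.inc (d + 2)) (.move (d + 3) (d + 1))) .skip))))
        (.move (d + 2) d)))))
  | mod a b, d => .seq (comp i a d) (.seq (comp i b (d + 1)) (.seq (.clear (d + 2))
      (.seq (.clear (d + 3)) (.seq (.loop d (.seq (.inc (d + 3)) (.seq (.dec (d + 1))
        (.jz (d + 1) (.seq (.inc (d + 2)) (.move (d + 3) (d + 1))) .skip))))
        (.move (d + 3) d)))))

/-- A bound for the time to evaluate an expression without values above `B`. -/
def Expr.cost {ν : Type} (B : ℕ) : Expr ν → ℕ
  | const n => B * 2 + 1 + n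
  | var _ => B * 11 + 4
  | add a b | sub a b => cost B a + cost B b + (B * 5 + 1)
  | mul a b | div a b | mod a b => cost B a + cost B b + (B * (B * 7 + 10) + B * 10 + 10)

open Cmd in
/-- Division with remainder by counting: the register `d` is counted down, `d + 3` counts the
remainder, `d + 1` the difference between divisor and remainder, and `d + 2` the quotient. -/
theorem Cmd.runs_divMod {B d : ℕ} {s : Store} (hs : ∀ r, s.reg r ≤ B) (hb : 0 < s.reg (d + 1))
    (h2 : s.reg (d + 2) = 0) (h3 : s.reg (d + 3) = 0) :
    Runs (.loop d (.seq (.inc (d + 3)) (.seq (.dec (d + 1))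
        (.jz (d + 1) (.seq (.inc (d + 2)) (.move (d + 3) (d + 1))) .skip)))) s
      (B * (B * 3 + 7) + 1) fun s' => Keeps B d s s' ∧ s'.reg d = 0 ∧
        s'.reg (d + 2) = s.reg d / s.reg (d + 1) ∧ s'.reg (d + 3) = s.reg d % s.reg (d + 1) := by
  set A := s.reg d with hA
  set b := s.reg (d + 1) with hb'
  have hAB : A ≤ B := hs _
  have hbB : b ≤ B := hs _
  -- When `j` rounds are left, `A - j` has been divided by `b`.
  refine (Runs.loop (n := 1 + (1 + (1 + (B * 3 + 1) + 1))) (k := A)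
    (fun j s' => j ≤ A ∧ Keeps B d s s' ∧ s'.reg d = j ∧ s'.reg (d + 1) = b - (A - j) % b ∧
      s'.reg (d + 2) = (A - j) / b ∧ s'.reg (d + 3) = (A - j) % b) ?_ ?_ ?_ ?_).mono ?_
    (fun _ h => h)
  · exact fun j s' h => h.2.2.1
  · rintro j s' hj ⟨hjA, hk, h0, h1, h2, h3⟩
    have hlt : (A - (j + 1)) % b < b := Nat.mod_lt _ hb
    have hle : (A - (j + 1)) / b ≤ A - (j + 1) := Nat.div_le_self _ _
    have e : A - j = A - (j + 1) + 1 := by omega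
    refine .seq (.inc rfl) ?_
    rintro _ rfl
    refine .seq (.dec ?_ rfl) ?_
    · simp only [Store.set_reg_of_ne _ _ (show d + 1 ≠ d + 3 by omega),
        Store.set_reg_of_ne _ _ (show d + 1 ≠ d by omega), h1]
      omega
    rintro _ rfl
    simp only [Store.set_reg_of_ne _ _ (show d + 1 ≠ d + 3 by omega),
      Store.set_reg_of_ne _ _ (show d + 1 ≠ d by omega),
      Store.set_reg_of_ne _ _ (show d + 3 ≠ d by omega), h1, h3]
    have hkeep : Keeps B d s (((s'.set d j).set (d + 3) ((A - (j + 1)) % b + 1)).set (d + 1)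
        (b - (A - (j + 1)) % b - 1)) :=
      ((hk.set le_rfl (by omega)).set (by omega) (by omega)).set (by omega) (by omega)
    refine .jz (fun hz => ?_) (fun hz => ?_)
    · simp only [Store.set_reg_self] at hz
      have hm : (A - (j + 1)) % b + 1 = b := by omega
      refine .seq (.inc rfl) ?_
      rintro _ rfl
      refine runs_move (by omega) ?_ ?_
      · rw [Store.set_reg_of_ne _ _ (by omega), Store.set_reg_of_ne _ _ (by omega)]
        simp; omega
      simp only [Store.set_reg_of_ne _ _ (show d + 1 ≠ d + 2 by omega),
        Store.set_reg_of_ne _ _ (show d + 2 ≠ d + 1 by omega),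
        Store.set_reg_of_ne _ _ (show d + 2 ≠ d + 3 by omega),
        Store.set_reg_of_ne _ _ (show d + 2 ≠ d by omega),
        Store.set_reg_of_ne _ _ (show d + 3 ≠ d + 2 by omega),
        Store.set_reg_of_ne _ _ (show d + 3 ≠ d + 1 by omega), Store.set_reg_self, h2, hz, zero_add]
      have hmod : (A - (j + 1) + 1) % b = 0 := by
        rw [← Nat.mod_add_mod, hm, Nat.mod_self]
      have hd : (A - (j + 1) + 1) / b = (A - (j + 1)) / b + 1 :=
        Nat.succ_div_of_dvd (Nat.dvd_of_mod_eq_zero hmod)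
      refine ⟨by omega, ?_, ?_, ?_, ?_, ?_⟩
      · rw [hz] at hkeep
        exact ((hkeep.set (by omega) (by omega)).set (by omega) (by omega)).set (by omega)
          (by omega)
      · rw [Store.set_reg_of_ne _ _ (by omega), Store.set_reg_of_ne _ _ (by omega),
          Store.set_reg_of_ne _ _ (by omega), Store.set_reg_of_ne _ _ (by omega),
          Store.set_reg_of_ne _ _ (by omega), Store.set_reg_self]
      · rw [Store.set_reg_of_ne _ _ (by omega), Store.set_reg_self, e, hmod, hm]; rfl
      · rw [e, hd]
      · rw [e, hmod]
    · simp only [Store.set_reg_self] at hz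
      have hm : (A - (j + 1) + 1) % b = (A - (j + 1)) % b + 1 := by
        rw [← Nat.mod_add_mod, Nat.mod_eq_of_lt (by omega)]
      have hd : (A - (j + 1) + 1) / b = (A - (j + 1)) / b :=
        Nat.succ_div_of_not_dvd (fun h => by rw [Nat.dvd_iff_mod_eq_zero, hm] at h; omega)
      refine .skip ⟨by omega, hkeep, ?_, ?_, ?_, ?_⟩
      · rw [Store.set_reg_of_ne _ _ (by omega), Store.set_reg_of_ne _ _ (by omega),
          Store.set_reg_self]
      · rw [Store.set_reg_self, e, hm]; omega
      · rw [Store.set_reg_of_ne _ _ (by omega), Store.set_reg_of_ne _ _ (by omega),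
          Store.set_reg_of_ne _ _ (by omega), h2, e, hd]
      · rw [Store.set_reg_of_ne _ _ (by omega), Store.set_reg_self, e, hm]
  · refine ⟨le_rfl, .refl hs, rfl, ?_, ?_, ?_⟩ <;> simp [h2, h3, hb']
  · rintro s' ⟨_, hk, h0, _, h2, h3⟩
    exact ⟨hk, h0, h2, h3⟩
  · have h7 : 1 + (1 + (1 + (B * 3 + 1) + 1)) + 2 = B * 3 + 7 := by ring
    rw [h7]
    exact Nat.add_le_add_right (Nat.mul_le_mul_right _ hAB) _

/-- The compiled expression leaves its value in the register `d`, and changes no register below. -/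
theorem Expr.runs_comp {ν : Type} {i : ν → ℕ} {V B : ℕ} (hi : ∀ x, i x < V) (e : Expr ν) {d : ℕ}
    (hd : V ≤ d) {s : Store} {v : ν → ℕ} (hv : ∀ x, s.reg (i x) = v x) (hs : ∀ r, s.reg r ≤ B)
    (he : e.Ok B v) :
    (e.comp i d).Runs s (e.cost B) fun s' => Keeps B d s s' ∧ s'.reg d = e.val v := by
  -- the evaluation of two operands
  have two : ∀ (a b : Expr ν) (_ : ∀ {d : ℕ} (_ : V ≤ d) {s : Store} (_ : ∀ x, s.reg (i x) = v x)
      (_ : ∀ r, s.reg r ≤ B), (a.comp i d).Runs s (a.cost B) fun s' => Keeps B d s s' ∧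
        s'.reg d = a.val v) (_ : ∀ {d : ℕ} (_ : V ≤ d) {s : Store} (_ : ∀ x, s.reg (i x) = v x)
      (_ : ∀ r, s.reg r ≤ B), (b.comp i d).Runs s (b.cost B) fun s' => Keeps B d s s' ∧
        s'.reg d = b.val v) (c : Cmd) (k : ℕ) {d : ℕ} (_ : V ≤ d) {s : Store}
      (_ : ∀ x, s.reg (i x) = v x) (_ : ∀ r, s.reg r ≤ B) (Q : Store → Prop)
      (_ : ∀ s', Keeps B d s s' → s'.reg d = a.val v → s'.reg (d + 1) = b.val v → c.Runs s' k Q),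
      (Cmd.seq (a.comp i d) (.seq (b.comp i (d + 1)) c)).Runs s (a.cost B + b.cost B + k) Q := by
    intro a b iha ihb c k d hd s hv hs Q hc
    refine (Cmd.Runs.seq (n' := b.cost B + k) (iha hd hv hs) ?_).mono (by omega) (fun _ h => h)
    rintro s₁ ⟨hk₁, h₁⟩
    refine Cmd.Runs.seq (ihb (by omega)
      (fun x => (hk₁.reg _ ((hi x).trans_le hd)).trans (hv x)) hk₁.le) ?_
    rintro s₂ ⟨hk₂, h₂⟩
    exact hc s₂ (hk₁.trans (hk₂.mono (by omega))) ((hk₂.reg d (by omega)).trans h₁) h₂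
  induction e generalizing d s with
  | const n =>
    refine Cmd.Runs.seq (Cmd.runs_clear (hs d) (Q := fun s' => s' = s.set d 0) rfl) ?_
    rintro _ rfl
    have hn : n ≤ B := he
    have : ∀ m ≤ n, Cmd.Runs (m.rec .skip fun _ c => .seq c (.inc d)) (s.set d 0) m
        fun s' => s' = s.set d m := by
      intro m
      induction m with
      | zero => exact fun _ => .skip rfl
      | succ m ih =>
        intro hm
        refine Cmd.Runs.seq (ih (by omega)) ?_
        rintro _ rfl
        exact .inc (by rw [Store.set_set, Store.set_reg_self])
    refine (this n le_rfl).mono le_rfl ?_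
    rintro _ rfl
    exact ⟨(Keeps.refl hs).set le_rfl hn, by simp [val]⟩
  | var x =>
    have hx : i x < d := (hi x).trans_le hd
    refine Cmd.Runs.mono (.seq (n := B * 2 + 1) (n' := (B * 2 + 1) + (B * 7 + 2))
      (Cmd.runs_clear (hs d) (Q := fun s' => s' = s.set d 0) rfl) ?_) (by simp only [cost]; omega)
      (fun _ h => h)
    rintro _ rfl
    refine .seq (Cmd.runs_clear (B := B) (by rw [Store.set_reg_of_ne _ _ (by omega)]; exact hs _)
      (Q := fun s' => s' = (s.set d 0).set (d + 1) 0) rfl) ?_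
    rintro _ rfl
    refine Cmd.runs_addTo (by omega) (by omega) (by omega) ?_ (by simp) ?_
    · rw [Store.set_reg_of_ne _ _ (by omega), Store.set_reg_of_ne _ _ (by omega)]; exact hs _
    · rw [Store.set_reg_of_ne _ _ (by omega), Store.set_reg_self,
        Store.set_reg_of_ne _ _ (by omega), Store.set_reg_of_ne _ _ (by omega), zero_add]
      exact ⟨(((Keeps.refl hs).set le_rfl (Nat.zero_le _)).set (by omega) (Nat.zero_le _)).set
        le_rfl
        (hs _), by simp [hv, val]⟩
  | add a b iha ihb =>
    refine (two a b (fun hd _ hv hs => iha hd hv hs he.1) (fun hd _ hv hs => ihb hd hv hs he.2.1)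
      _ (B * 3 + 1) hd hv hs _ ?_).mono (by simp only [cost]; omega) (fun _ h => h)
    intro s' hk ha hb
    refine Cmd.runs_move (by omega) (hk.le _) ⟨(hk.set le_rfl ?_).set (by omega) (Nat.zero_le _),
      ?_⟩
    · rw [ha, hb]; exact he.2.2
    · rw [Store.set_reg_of_ne _ _ (by omega), Store.set_reg_self, ha, hb]; rfl
  | sub a b iha ihb =>
    refine (two a b (fun hd _ hv hs => iha hd hv hs he.1) (fun hd _ hv hs => ihb hd hv hs he.2)
      _ (B * 4 + 1) hd hv hs _ ?_).mono (by simp only [cost]; omega) (fun _ h => h)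
    intro s' hk ha hb
    -- The subtraction is truncated: the register `d` is decremented only while it is positive.
    refine (Cmd.Runs.loop (n := 2) (k := b.val v) (fun j s'' => Keeps B d s s'' ∧
      s''.reg (d + 1) = j ∧ j ≤ b.val v ∧ s''.reg d = a.val v - (b.val v - j)) ?_ ?_ ?_ ?_).mono ?_
      (fun _ h => h)
    · exact fun j s h => h.2.1
    · rintro j s₁ hj ⟨hk₁, h1, hjb, h2⟩
      have hjB : j ≤ B := by have := hk₁.le (d + 1); omega
      refine .jz (fun hz => .skip ⟨hk₁.set (by omega) hjB, by simp, by omega, ?_⟩)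
        (fun hz => .dec hz ⟨(hk₁.set (by omega) hjB).set le_rfl ?_, ?_, by omega, ?_⟩)
      · rw [Store.set_reg_of_ne _ _ (by omega)] at hz ⊢
        omega
      · rw [Store.set_reg_of_ne _ _ (by omega)]
        have := hk₁.le d
        omega
      · rw [Store.set_reg_of_ne _ _ (by omega), Store.set_reg_self]
      · rw [Store.set_reg_self, Store.set_reg_of_ne _ _ (by omega)]
        omega
    · exact ⟨hk, hb, le_rfl, by omega⟩
    · rintro s₁ ⟨hk₁, _, _, h2⟩
      exact ⟨hk₁, by rw [h2]; rfl⟩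
    · have : b.val v ≤ B := hb ▸ hk.le _
      omega
  | mul a b iha ihb =>
    refine (two a b (fun hd _ hv hs => iha hd hv hs he.1) (fun hd _ hv hs => ihb hd hv hs he.2.1)
      _ ((B * 2 + 1) + ((B * 2 + 1) + ((B * (B * 7 + 2 + 2) + 1) + (B * 3 + 1)))) hd hv hs _
        ?_).mono
      (by simp only [cost]; nlinarith) (fun _ h => h)
    intro s' hk ha hb
    have hprod : a.val v * b.val v ≤ B := he.2.2
    refine .seq (Cmd.runs_clear (hk.le _) (Q := fun s₁ => s₁ = s'.set (d + 2) 0) rfl) ?_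
    rintro _ rfl
    refine .seq (Cmd.runs_clear (B := B)
      (by rw [Store.set_reg_of_ne _ _ (by omega)]; exact hk.le _)
      (Q := fun s₁ => s₁ = (s'.set (d + 2) 0).set (d + 3) 0) rfl) ?_
    rintro _ rfl
    refine .seq (P := fun s₁ => Keeps B d s s₁ ∧ s₁.reg d = 0 ∧
      s₁.reg (d + 2) = a.val v * b.val v) ?_ ?_
    · refine (Cmd.Runs.loop (n := B * 7 + 2) (k := a.val v) (fun j s₁ => j ≤ a.val v ∧
        Keeps B d s s₁ ∧ s₁.reg d = j ∧ s₁.reg (d + 1) = b.val v ∧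
        s₁.reg (d + 2) = (a.val v - j) * b.val v ∧ s₁.reg (d + 3) = 0) ?_ ?_ ?_ ?_).mono ?_
        (fun _ h => h)
      · exact fun j s h => h.2.2.1
      · rintro j s₁ hj ⟨hja, hk₁, h0, h1, h2, h3⟩
        have hjB : j ≤ B := by have := hk₁.le d; omega
        have hsum : (a.val v - (j + 1)) * b.val v + b.val v = (a.val v - j) * b.val v := by
          rw [show a.val v - j = a.val v - (j + 1) + 1 by omega, add_mul, one_mul]
        have hle : (a.val v - j) * b.val v ≤ B :=
          (Nat.mul_le_mul_right _ (Nat.sub_le _ _)).trans hprod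
        refine Cmd.runs_addTo (by omega) (by omega) (by omega) ?_ ?_ ⟨by omega, ?_, ?_, ?_, ?_, ?_⟩
        · rw [Store.set_reg_of_ne _ _ (by omega)]; exact hk₁.le _
        · rw [Store.set_reg_of_ne _ _ (by omega)]; exact h3
        · rw [Store.set_reg_of_ne _ _ (by omega), Store.set_reg_of_ne _ _ (by omega), h1, h2, hsum]
          exact (hk₁.set le_rfl hjB).set (by omega) hle
        · rw [Store.set_reg_of_ne _ _ (by omega), Store.set_reg_self]
        · rw [Store.set_reg_of_ne _ _ (by omega), Store.set_reg_of_ne _ _ (by omega), h1]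
        · rw [Store.set_reg_self, Store.set_reg_of_ne _ _ (by omega),
            Store.set_reg_of_ne _ _ (by omega), h1, h2, hsum]
        · rw [Store.set_reg_of_ne _ _ (by omega), Store.set_reg_of_ne _ _ (by omega), h3]
      · refine ⟨le_rfl, (hk.set (by omega) (Nat.zero_le _)).set (by omega) (Nat.zero_le _),
          ?_, ?_, ?_, ?_⟩
        · rw [Store.set_reg_of_ne _ _ (by omega), Store.set_reg_of_ne _ _ (by omega), ha]
        · rw [Store.set_reg_of_ne _ _ (by omega), Store.set_reg_of_ne _ _ (by omega), hb]
        · rw [Store.set_reg_of_ne _ _ (by omega), Store.set_reg_self]; simp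
        · rw [Store.set_reg_self]
      · rintro s₁ ⟨_, hk₁, h0, _, h2, _⟩
        exact ⟨hk₁, h0, by rw [h2, Nat.sub_zero]⟩
      · have : a.val v ≤ B := ha ▸ hk.le _
        gcongr
    · rintro s₁ ⟨hk₁, h0, h2⟩
      refine Cmd.runs_move (by omega) (hk₁.le _)
        ⟨(hk₁.set le_rfl (by omega)).set (by omega) (Nat.zero_le _), ?_⟩
      rw [Store.set_reg_of_ne _ _ (by omega), Store.set_reg_self, h0, h2, zero_add]; rfl
  | div a b iha ihb =>
    refine (two a b (fun hd _ hv hs => iha hd hv hs he.1) (fun hd _ hv hs => ihb hd hv hs he.2.1)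
      _ ((B * 2 + 1) + ((B * 2 + 1) + ((B * (B * 3 + 7) + 1) + (B * 3 + 1)))) hd hv hs _ ?_).mono
      (by simp only [cost]; nlinarith) (fun _ h => h)
    intro s' hk ha hb
    refine .seq (Cmd.runs_clear (hk.le _) (Q := fun s₁ => s₁ = s'.set (d + 2) 0) rfl) ?_
    rintro _ rfl
    refine .seq (Cmd.runs_clear (B := B)
      (by rw [Store.set_reg_of_ne _ _ (by omega)]; exact hk.le _)
      (Q := fun s₁ => s₁ = (s'.set (d + 2) 0).set (d + 3) 0) rfl) ?_
    rintro _ rfl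
    have hk' := (hk.set (r := d + 2) (v := 0) (by omega) (Nat.zero_le _)).set (r := d + 3) (v := 0)
      (by omega) (Nat.zero_le _)
    have h0 : ((s'.set (d + 2) 0).set (d + 3) 0).reg d = a.val v := by
      rw [Store.set_reg_of_ne _ _ (by omega), Store.set_reg_of_ne _ _ (by omega), ha]
    have h1 : ((s'.set (d + 2) 0).set (d + 3) 0).reg (d + 1) = b.val v := by
      rw [Store.set_reg_of_ne _ _ (by omega), Store.set_reg_of_ne _ _ (by omega), hb]
    refine .seq (Cmd.runs_divMod hk'.le (by rw [h1]; exact he.2.2)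
      (by rw [Store.set_reg_of_ne _ _ (by omega), Store.set_reg_self]) (by simp)) ?_
    rintro s₁ ⟨hk₁, e0, e2, e3⟩
    refine Cmd.runs_move (by omega) (hk₁.le _) ⟨((hk'.trans hk₁).set le_rfl ?_).set (by omega)
      (Nat.zero_le _), ?_⟩
    · rw [e0, zero_add]; exact hk₁.le _
    · rw [Store.set_reg_of_ne _ _ (by omega), Store.set_reg_self, e0, e2, zero_add, h0, h1]; rfl
  | mod a b iha ihb =>
    refine (two a b (fun hd _ hv hs => iha hd hv hs he.1) (fun hd _ hv hs => ihb hd hv hs he.2.1)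
      _ ((B * 2 + 1) + ((B * 2 + 1) + ((B * (B * 3 + 7) + 1) + (B * 3 + 1)))) hd hv hs _ ?_).mono
      (by simp only [cost]; nlinarith) (fun _ h => h)
    intro s' hk ha hb
    refine .seq (Cmd.runs_clear (hk.le _) (Q := fun s₁ => s₁ = s'.set (d + 2) 0) rfl) ?_
    rintro _ rfl
    refine .seq (Cmd.runs_clear (B := B)
      (by rw [Store.set_reg_of_ne _ _ (by omega)]; exact hk.le _)
      (Q := fun s₁ => s₁ = (s'.set (d + 2) 0).set (d + 3) 0) rfl) ?_
    rintro _ rfl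
    have hk' := (hk.set (r := d + 2) (v := 0) (by omega) (Nat.zero_le _)).set (r := d + 3) (v := 0)
      (by omega) (Nat.zero_le _)
    have h0 : ((s'.set (d + 2) 0).set (d + 3) 0).reg d = a.val v := by
      rw [Store.set_reg_of_ne _ _ (by omega), Store.set_reg_of_ne _ _ (by omega), ha]
    have h1 : ((s'.set (d + 2) 0).set (d + 3) 0).reg (d + 1) = b.val v := by
      rw [Store.set_reg_of_ne _ _ (by omega), Store.set_reg_of_ne _ _ (by omega), hb]
    refine .seq (Cmd.runs_divMod hk'.le (by rw [h1]; exact he.2.2)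
      (by rw [Store.set_reg_of_ne _ _ (by omega), Store.set_reg_self]) (by simp)) ?_
    rintro s₁ ⟨hk₁, e0, e2, e3⟩
    refine Cmd.runs_move (by omega) (hk₁.le _) ⟨((hk'.trans hk₁).set le_rfl ?_).set (by omega)
      (Nat.zero_le _), ?_⟩
    · rw [e0, zero_add]; exact hk₁.le _
    · rw [Store.set_reg_of_ne _ _ (by omega), Store.set_reg_self, e0, e3, zero_add, h0, h1]; rfl

/-! ### Compilation of programs -/

namespace Imp

variable {ν : Type} [DecidableEq ν]

/-- The register machine program for a program with variables. The registers from `d` on are free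
for intermediate results. -/
def comp (i : ν → ℕ) : Imp ν → ℕ → Cmd
  | skip, _ => .skip
  | seq a b, d => .seq (comp i a d) (comp i b d)
  | assign x e, d => .seq (e.comp i d) (.seq (.clear (i x)) (.move d (i x)))
  | ifz e a b, d => .seq (e.comp i d) (.jz d (comp i a d) (comp i b d))
  | rep e c, d => .seq (e.comp i d) (.loop d (comp i c (d + 1)))
  | flip x, _ => .seq (.clear (i x)) (.flip .skip (.inc (i x)))
  | out a, _ => .out a

/-- A bound for the running time of a program without values above `B`. -/
def cost (B : ℕ) : Imp ν → ℕ
  | skip => 0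
  | seq a b => cost B a + cost B b
  | assign _ e => e.cost B + (B * 5 + 2)
  | ifz e a b => e.cost B + (cost B a + cost B b + 1)
  | rep e c => e.cost B + (B * (cost B c + 2) + 1)
  | flip _ => B * 2 + 1 + 2
  | out _ => 1

/-- The memory of the register machine represents the variables, the coins and the output. -/
structure Rep (i : ν → ℕ) (m : Mem ν) (s : Store) : Prop where
  val : ∀ x, s.reg (i x) = m.val x
  coins : s.coins = m.coins
  out : s.out = m.out

omit [DecidableEq ν] in
theorem Rep.of_keeps {i : ν → ℕ} {m : Mem ν} {s s' : Store} {B V d : ℕ} (hi : ∀ x, i x < V)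
    (hd : V ≤ d) (h : Rep i m s) (hk : Keeps B d s s') : Rep i m s' :=
  ⟨fun x => (hk.reg _ ((hi x).trans_le hd)).trans (h.val x), hk.coins.trans h.coins,
    hk.out.trans h.out⟩

/-- The compiled program performs the program, within the time `cost` and with registers at most
`B`. The registers between `V` and `d` are kept, since they hold the counters of the surrounding
loops. -/
theorem runs_comp {i : ν → ℕ} (hinj : Function.Injective i) {V B : ℕ} (hi : ∀ x, i x < V)
    (c : Imp ν) {d : ℕ} (hd : V ≤ d) {s : Store} {m : Mem ν} (hm : Rep i m s)
    (hs : ∀ r, s.reg r ≤ B) (hc : c.Ok B m) :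
    (c.comp i d).Runs s (c.cost B) fun s' => Rep i (c.run m) s' ∧
      (∀ r, V ≤ r → r < d → s'.reg r = s.reg r) ∧ (∀ r, s'.reg r ≤ B) ∧ s'.input = s.input := by
  induction c generalizing d s m with
  | skip => exact .skip ⟨hm, fun _ _ _ => rfl, hs, rfl⟩
  | seq a b iha ihb =>
    refine .seq (iha hd hm hs hc.1) ?_
    rintro s₁ ⟨h1, h2, h3, h4⟩
    refine (ihb hd h1 h3 hc.2).mono le_rfl ?_
    rintro s₂ ⟨h1', h2', h3', h4'⟩
    exact ⟨h1', fun r hr hr' => (h2' r hr hr').trans (h2 r hr hr'), h3', h4'.trans h4⟩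
  | assign x e =>
    have hx : i x < d := (hi x).trans_le hd
    refine (Cmd.Runs.seq (n' := (B * 2 + 1) + (B * 3 + 1)) (e.runs_comp hi hd hm.val hs hc) ?_).mono
      (by simp only [cost]; omega) (fun _ h => h)
    rintro s₁ ⟨hk, h1⟩
    refine .seq (Cmd.runs_clear (hk.le _) (Q := fun s' => s' = s₁.set (i x) 0) rfl) ?_
    rintro _ rfl
    have hdr : (s₁.set (i x) 0).reg d = e.val m.val := by
      rw [Store.set_reg_of_ne _ _ (by omega), h1]
    have hB : e.val m.val ≤ B := h1 ▸ hk.le _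
    refine Cmd.runs_move (by omega) (by rw [hdr]; exact hB) ?_
    rw [hdr, Store.set_reg_self, Store.set_set, zero_add]
    have hm' := hm.of_keeps hi hd hk
    refine ⟨⟨fun y => ?_, hm'.coins, hm'.out⟩, fun r hr hr' => ?_, fun r => ?_, hk.input⟩
    · rw [Store.set_reg_of_ne _ _ (by have := hi y; omega)]
      by_cases hy : y = x
      · subst hy; simp [run]
      · rw [Store.set_reg_of_ne _ _ (fun h => hy (hinj h)), hm'.val]
        simp [run, Function.update_of_ne hy]
    · rw [Store.set_reg_of_ne _ _ (by omega), Store.set_reg_of_ne _ _ (by have := hi x; omega),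
        hk.reg r hr']
    · exact (((Keeps.refl hk.le (N := 0)).set (Nat.zero_le _) hB).set (Nat.zero_le _)
        (Nat.zero_le _)).le r
  | ifz e a b iha ihb =>
    refine Cmd.Runs.seq (e.runs_comp hi hd hm.val hs hc.1) ?_
    rintro s₁ ⟨hk, h1⟩
    have hm' := hm.of_keeps hi hd hk
    refine Cmd.Runs.jz (fun h0 => ?_) (fun h0 => ?_)
    · rw [h1] at h0
      refine (iha hd hm' hk.le (hc.2.1 h0)).mono (by omega) ?_
      rintro s₂ ⟨h1', h2', h3', h4'⟩
      exact ⟨by rw [run, if_pos h0]; exact h1', fun r hr hr' => (h2' r hr hr').trans (hk.reg r hr'),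
        h3', h4'.trans hk.input⟩
    · rw [h1] at h0
      refine (ihb hd hm' hk.le (hc.2.2 h0)).mono (by omega) ?_
      rintro s₂ ⟨h1', h2', h3', h4'⟩
      exact ⟨by rw [run, if_neg h0]; exact h1', fun r hr hr' => (h2' r hr hr').trans (hk.reg r hr'),
        h3', h4'.trans hk.input⟩
  | rep e c ih =>
    refine Cmd.Runs.seq (e.runs_comp hi hd hm.val hs hc.1) ?_
    rintro s₁ ⟨hk, h1⟩
    have hm' := hm.of_keeps hi hd hk
    set N := e.val m.val with hN
    have hB : N ≤ B := h1 ▸ hk.le _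
    refine (Cmd.Runs.loop (n := c.cost B) (k := N) (fun j s' => j ≤ N ∧ s'.reg d = j ∧
      Rep i ((run c)^[N - j] m) s' ∧ (∀ r, V ≤ r → r < d → s'.reg r = s.reg r) ∧
      (∀ r, s'.reg r ≤ B) ∧ s'.input = s.input) ?_ ?_ ?_ ?_).mono ?_ (fun _ h => h)
    · exact fun j s h => h.2.1
    · rintro j s' hj ⟨hjN, hd', hr, hf, hle, hin⟩
      have hr' : Rep i ((run c)^[N - (j + 1)] m) (s'.set d j) :=
        ⟨fun x => by rw [Store.set_reg_of_ne _ _ (by have := hi x; omega)]; exact hr.val x,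
          hr.coins, hr.out⟩
      have hle' : ∀ r, (s'.set d j).reg r ≤ B :=
        ((Keeps.refl hle (N := 0)).set (Nat.zero_le _) (by omega)).le
      refine (ih (d := d + 1) (by omega) hr' hle' (hc.2 _ (by omega))).mono le_rfl ?_
      rintro s₂ ⟨h1', h2', h3', h4'⟩
      refine ⟨by omega, ?_, ?_, fun r hr hr' => ?_, h3', h4'.trans hin⟩
      · rw [h2' d (by omega) (by omega), Store.set_reg_self]
      · rw [show N - j = (N - (j + 1)) + 1 by omega, Function.iterate_succ_apply']
        exact h1'
      · rw [h2' r hr (by omega), Store.set_reg_of_ne _ _ (by omega), hf r hr hr']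
    · exact ⟨le_rfl, h1, by simpa using hm', fun r _ hr => hk.reg r hr, hk.le, hk.input⟩
    · rintro s' ⟨_, _, hr, hf, hle, hin⟩
      exact ⟨by rw [run]; simpa using hr, hf, hle, hin⟩
    · gcongr
  | flip x =>
    have h1B : 1 ≤ B := hc
    refine Cmd.Runs.seq (n' := 2) (Cmd.runs_clear (hs _)
      (Q := fun s' => s' = s.set (i x) 0) rfl) ?_
    rintro _ rfl
    have key : ∀ b : Bool, m.coins.headD false = b →
        Rep i ((flip x).run m) { s.set (i x) b.toNat with coins := s.coins.tail } ∧
        (∀ r, V ≤ r → r < d → (s.set (i x) b.toNat).reg r = s.reg r) ∧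
        (∀ r, (s.set (i x) b.toNat).reg r ≤ B) := by
      intro b hb
      refine ⟨⟨fun y => ?_, by simp [run, hm.coins], by simp [run, Store.set, hm.out]⟩,
        fun r hr _ => Store.set_reg_of_ne _ _ (by have := hi x; omega),
        ((Keeps.refl hs (N := 0)).set (Nat.zero_le _) ((Bool.toNat_le b).trans h1B)).le⟩
      by_cases hy : y = x
      · subst hy; rw [← hb]; simp [run, Store.set]
      · simp only [run, Function.update_of_ne hy]
        rw [← hm.val y]
        exact Store.set_reg_of_ne _ _ (fun h => hy (hinj h))
    cases hb : m.coins.headD false with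
    | false =>
      obtain ⟨k1, k2, k3⟩ := key false hb
      refine ⟨_, _, .flip_false ?_ (.skip _), by omega, k1, k2, k3, rfl⟩
      simpa [Store.set, hm.coins] using hb
    | true =>
      obtain ⟨k1, k2, k3⟩ := key true hb
      refine ⟨_, _, .flip_true ?_ (.inc _ _), by omega, ?_⟩
      · simpa [Store.set, hm.coins] using hb
      · convert (⟨k1, k2, k3, rfl⟩ : Rep i ((flip x).run m)
          { s.set (i x) true.toNat with coins := s.coins.tail } ∧
          (∀ r, V ≤ r → r < d → (s.set (i x) true.toNat).reg r = s.reg r) ∧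
          (∀ r, (s.set (i x) true.toNat).reg r ≤ B) ∧ s.input = s.input) using 2 <;>
        simp [Store.set]
  | out a =>
    exact ⟨1, _, .out a s, le_rfl, ⟨hm.val, hm.coins, by simp [run, hm.out]⟩, fun _ _ _ => rfl, hs,
      rfl⟩

end Imp

end OnlineQuantum

namespace OnlineQuantum

/-! ### Programs that read a stream of letters -/

/-- `f` is bounded by a polynomial. -/
def PolyBdd (f : ℕ → ℕ) : Prop := ∃ C k, ∀ B, f B ≤ C * (B + 1) ^ k

namespace PolyBdd

theorem const (n : ℕ) : PolyBdd fun _ => n := ⟨n, 0, fun B => by simp⟩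

theorem id : PolyBdd fun B => B := ⟨1, 1, fun B => by simp⟩

theorem add {f g : ℕ → ℕ} (hf : PolyBdd f) (hg : PolyBdd g) : PolyBdd fun B => f B + g B := by
  obtain ⟨C, k, h⟩ := hf
  obtain ⟨D, l, h'⟩ := hg
  refine ⟨C + D, max k l, fun B => ?_⟩
  rw [add_mul]
  refine Nat.add_le_add ((h B).trans ?_) ((h' B).trans ?_)
  · exact Nat.mul_le_mul_left _ (Nat.pow_le_pow_right (by omega) (le_max_left _ _))
  · exact Nat.mul_le_mul_left _ (Nat.pow_le_pow_right (by omega) (le_max_right _ _))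

theorem mul {f g : ℕ → ℕ} (hf : PolyBdd f) (hg : PolyBdd g) : PolyBdd fun B => f B * g B := by
  obtain ⟨C, k, h⟩ := hf
  obtain ⟨D, l, h'⟩ := hg
  refine ⟨C * D, k + l, fun B => (Nat.mul_le_mul (h B) (h' B)).trans (le_of_eq ?_)⟩
  ring

end PolyBdd

theorem Expr.polyBdd_cost {ν : Type} (e : Expr ν) : PolyBdd fun B => e.cost B := by
  have lin : ∀ a b, PolyBdd fun B => B * a + b := fun a b =>
    (PolyBdd.id.mul (.const a)).add (.const b)
  induction e with
  | const n => exact (lin 2 1).add (.const n)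
  | var x => exact lin 11 4
  | add a b iha ihb => exact (iha.add ihb).add (lin 5 1)
  | sub a b iha ihb => exact (iha.add ihb).add (lin 5 1)
  | mul a b iha ihb =>
    exact (iha.add ihb).add (((PolyBdd.id.mul (lin 7 10)).add (lin 10 0)).add (.const 10))
  | div a b iha ihb =>
    exact (iha.add ihb).add (((PolyBdd.id.mul (lin 7 10)).add (lin 10 0)).add (.const 10))
  | mod a b iha ihb =>
    exact (iha.add ihb).add (((PolyBdd.id.mul (lin 7 10)).add (lin 10 0)).add (.const 10))

theorem Imp.polyBdd_cost {ν : Type} (c : Imp ν) : PolyBdd fun B => c.cost B := by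
  have lin : ∀ a b, PolyBdd fun B => B * a + b := fun a b =>
    (PolyBdd.id.mul (.const a)).add (.const b)
  induction c with
  | skip => exact .const 0
  | seq a b iha ihb => exact iha.add ihb
  | assign x e => exact e.polyBdd_cost.add (lin 5 2)
  | ifz e a b iha ihb => exact e.polyBdd_cost.add ((iha.add ihb).add (.const 1))
  | rep e c ih =>
    exact e.polyBdd_cost.add ((PolyBdd.id.mul (ih.add (.const 2))).add (.const 1))
  | flip x => exact (lin 2 1).add (.const 2)
  | out a => exact .const 1

/-- A program that is run before the input is read, a program for each letter of the input, and a
program for the end of the input. -/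
structure StreamProgram (ν : Type) where
  init : Imp ν
  step : Letter → Imp ν
  final : Imp ν

namespace StreamProgram

variable {ν : Type} [DecidableEq ν] (p : StreamProgram ν)

/-- The memory before the input is read. -/
def start (σ : List Bool) : Mem ν := p.init.run ⟨fun _ => 0, σ, []⟩

/-- The effect of reading the word `w`. -/
def feed (m : Mem ν) (w : List Letter) : Mem ν := w.foldl (fun m a => (p.step a).run m) m

@[simp] theorem feed_nil (m : Mem ν) : p.feed m [] = m := rfl

@[simp] theorem feed_cons (m : Mem ν) (a : Letter) (w : List Letter) :
    p.feed m (a :: w) = p.feed ((p.step a).run m) w := rfl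

theorem feed_append (m : Mem ν) (v w : List Letter) :
    p.feed m (v ++ w) = p.feed (p.feed m v) w := List.foldl_append

/-- The output on the input `w` with the coins `σ`. -/
def output (w : List Letter) (σ : List Bool) : List Letter :=
  (p.final.run (p.feed (p.start σ) w)).out

/-- No value above `B` occurs. -/
def Ok (B : ℕ) (w : List Letter) (σ : List Bool) : Prop :=
  p.init.Ok B ⟨fun _ => 0, σ, []⟩ ∧
    (∀ v a v', w = v ++ a :: v' → (p.step a).Ok B (p.feed (p.start σ) v)) ∧
    p.final.Ok B (p.feed (p.start σ) w)

/-- Reading the word `u` letter by letter performs `feed`. -/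
theorem runs_scan {i : ν → ℕ} (hinj : Function.Injective i) {V B K : ℕ} (hi : ∀ x, i x < V)
    (hK : ∀ a, (p.step a).cost B ≤ K) (u : List Letter) {s : Store} {m : Mem ν}
    (hu : s.input = u) (hm : Imp.Rep i m s) (hs : ∀ r, s.reg r ≤ B)
    (hok : ∀ v a v', u = v ++ a :: v' → (p.step a).Ok B (p.feed m v)) :
    Cmd.Runs (.scan fun a => (p.step a).comp i V) s (u.length * (K + 1) + 1) fun s' =>
      Imp.Rep i (p.feed m u) s' ∧ ∀ r, s'.reg r ≤ B := by
  induction u generalizing s m with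
  | nil => exact ⟨1, s, .scan_nil hu, by simp, hm, hs⟩
  | cons a u ih =>
    obtain ⟨n₁, s₁, e₁, hn₁, h1, -, h3, h4⟩ := (p.step a).runs_comp hinj hi (d := V) le_rfl
      (s := { s with input := u }) (m := m) ⟨hm.val, hm.coins, hm.out⟩ hs (hok [] a u rfl)
    obtain ⟨n₂, s₂, e₂, hn₂, h5⟩ := ih h4 h1 h3 fun v b v' h => by
      have := hok (a :: v) b v' (by rw [h]; rfl)
      simpa using this
    refine ⟨n₁ + n₂ + 1, s₂, .scan_cons hu e₁ e₂, ?_, h5⟩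
    have := hK a
    simp only [List.length_cons, add_mul]
    omega

/-- Stream programs with polynomially bounded values can be run in logarithmic space. -/
theorem exists_optm [Fintype ν] (b : ℕ) : ∃ (M : OPTM) (c₀ : ℕ), ∀ c ≥ c₀, ∀ w : List Letter,
    (∀ σ, p.Ok ((w.length + 2) ^ b) w σ) →
      (∀ ρ : Fin (2 ^ logSpace c w.length) → Bool, M.halting (M.run w ρ).state = true ∧
        (M.run w ρ).visited.card ≤ logSpace c w.length) ∧
      ∀ E : List Letter → Prop,
        coinProb (fun ρ : Fin (2 ^ logSpace c w.length) → Bool => E (M.run w ρ).output) =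
          coinProb (fun σ : Fin (2 ^ logSpace c w.length) → Bool =>
            E (p.output w (List.ofFn σ))) := by
  set V := Fintype.card ν with hV
  let i : ν → ℕ := fun x => (Fintype.equivFin ν x).val
  have hinj : Function.Injective i := fun x y h => (Fintype.equivFin ν).injective (Fin.ext h)
  have hi : ∀ x, i x < V := fun x => (Fintype.equivFin ν x).isLt
  obtain ⟨M, R, hM⟩ := exists_optm_of_cmd
    (.seq (p.init.comp i V) (.seq (.scan fun a => (p.step a).comp i V) (p.final.comp i V)))
  let K : ℕ → ℕ := fun B =>
    (p.step .zero).cost B + (p.step .one).cost B + (p.step .hash).cost B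
  have hK : ∀ B a, (p.step a).cost B ≤ K B := by
    intro B a
    cases a <;> simp only [K] <;> omega
  obtain ⟨C, k, hC⟩ : PolyBdd fun B => p.init.cost B + K B + p.final.cost B + 2 :=
    ((p.init.polyBdd_cost.add
      (((p.step .zero).polyBdd_cost.add (p.step .one).polyBdd_cost).add
        (p.step .hash).polyBdd_cost)).add p.final.polyBdd_cost).add (.const 2)
  -- With `ℓ = ⌊log₂ (max n 2)⌋` the running time is at most `2 ^ (L * ℓ)`, so that registers of
  -- `L * ℓ + 1` digits are enough.
  set L := C + 3 * ((b + 1) * k + 1) with hL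
  refine ⟨M, L + 4 * ((R + 1) * (L + 2)) + 1, fun c hc w hok => ?_⟩
  set n := w.length with hn
  set B := (n + 2) ^ b with hB
  set ℓ := Nat.log 2 (max n 2) with hℓ
  have hℓ1 : 1 ≤ ℓ := Nat.log_pos (by norm_num) (le_max_right _ _)
  -- The additional `2 * ℓ` makes up for the rounding of the logarithm and for small `n`.
  have hn2 : n + 2 ≤ 2 ^ (3 * ℓ) := by
    have h1 : max n 2 < 2 ^ (ℓ + 1) := Nat.lt_pow_succ_log_self (by norm_num) _
    have h2 : 2 ^ (ℓ + 2) ≤ 2 ^ (3 * ℓ) := Nat.pow_le_pow_right (by norm_num) (by omega)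
    have h3 : n ≤ max n 2 := le_max_left _ _
    have h4 : 2 ≤ max n 2 := le_max_right _ _
    rw [pow_succ] at h1 h2
    rw [pow_succ] at h2
    omega
  have hops : (n + 2) * (C * (B + 1) ^ k) ≤ 2 ^ (L * ℓ) := by
    have h1 : B + 1 ≤ (n + 2) ^ (b + 1) := by
      have : 1 ≤ B := Nat.one_le_pow _ _ (by omega)
      rw [pow_succ, ← hB]
      nlinarith
    have h2 : C ≤ 2 ^ (C * ℓ) :=
      Nat.lt_two_pow_self.le.trans (Nat.pow_le_pow_right (by norm_num) (by nlinarith))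
    calc (n + 2) * (C * (B + 1) ^ k)
        ≤ (n + 2) * (2 ^ (C * ℓ) * ((n + 2) ^ (b + 1)) ^ k) := by gcongr
      _ = 2 ^ (C * ℓ) * (n + 2) ^ ((b + 1) * k + 1) := by rw [← pow_mul]; ring
      _ ≤ 2 ^ (C * ℓ) * (2 ^ (3 * ℓ)) ^ ((b + 1) * k + 1) := by gcongr
      _ = 2 ^ (L * ℓ) := by rw [← pow_mul, ← pow_add, hL]; ring_nf
  have hW : 2 ^ (L * ℓ) < 2 ^ (L * ℓ + 1) := Nat.pow_lt_pow_right (by norm_num) (by omega)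
  have hspace : (R + 1) * (L * ℓ + 1 + 1) ≤ ((R + 1) * (L + 2)) * ℓ := by
    rw [mul_assoc]
    exact Nat.mul_le_mul_left _ (by nlinarith)
  have hcℓ : (L + 4 * ((R + 1) * (L + 2)) + 1) * ℓ ≤ c * ℓ := Nat.mul_le_mul_right _ hc
  have key := hM w (2 ^ logSpace c n) (L * ℓ + 1) (2 ^ (L * ℓ)) (p.output w) ?_ hW ?_
  · refine ⟨fun ρ => ⟨(key.1 ρ).1, (key.1 ρ).2.trans ?_⟩, key.2⟩
    have : logSpace c n = c * ℓ := rfl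
    rw [this]
    nlinarith
  · intro σ
    have h0 : ∀ r : ℕ, (0 : ℕ) ≤ B := fun _ => Nat.zero_le _
    have hrun : Cmd.Runs (.seq (p.init.comp i V) (.seq (.scan fun a => (p.step a).comp i V)
        (p.final.comp i V))) ⟨fun _ => 0, w, σ, []⟩
        (p.init.cost B + ((w.length * (K B + 1) + 1) + p.final.cost B))
        fun s' => s'.out = p.output w σ := by
      refine .seq (p.init.runs_comp hinj hi (B := B) (d := V) le_rfl
        (m := ⟨fun _ => 0, σ, []⟩) ⟨fun _ => rfl, rfl, rfl⟩ h0 (hok σ).1) ?_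
      rintro s₁ ⟨h1, -, h3, h4⟩
      refine .seq (p.runs_scan hinj hi (hK B) w h4 h1 h3 (hok σ).2.1) ?_
      rintro s₂ ⟨h1, h3⟩
      exact (p.final.runs_comp hinj hi (d := V) le_rfl h1 h3 (hok σ).2.2).mono le_rfl
        fun _ h => h.1.out
    obtain ⟨n', s', h1, h2, h3⟩ := hrun
    refine ⟨n', h2.trans (le_trans ?_ hops), s', h1, h3⟩
    refine le_trans ?_ (Nat.mul_le_mul_left _ (hC B))
    rw [← hn]
    nlinarith [Nat.zero_le (n * p.init.cost B), Nat.zero_le (n * p.final.cost B)]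
  · calc 2 ^ (L * ℓ) * (4 * ((R + 1) * (L * ℓ + 1 + 1)))
        ≤ 2 ^ (L * ℓ) * 2 ^ (4 * ((R + 1) * (L + 2) * ℓ)) := by
          refine Nat.mul_le_mul_left _ (le_trans ?_ Nat.lt_two_pow_self.le)
          omega
      _ = 2 ^ ((L + 4 * ((R + 1) * (L + 2))) * ℓ) := by rw [← pow_add]; ring_nf
      _ ≤ 2 ^ (c * ℓ) := Nat.pow_le_pow_right (by norm_num)
          ((Nat.mul_le_mul_right _ (by omega)).trans hcℓ)

end StreamProgram

end OnlineQuantum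

namespace OnlineQuantum

/-! ### Rules for the execution of programs -/

namespace Imp

variable {ν : Type} [DecidableEq ν]

/-- The program `c` turns the memory `m` into `m'`, without values above `B`. -/
def To (B : ℕ) (c : Imp ν) (m m' : Mem ν) : Prop := c.Ok B m ∧ c.run m = m'

variable {B : ℕ} {m m' m'' : Mem ν}

theorem To.skip : To B skip m m := ⟨trivial, rfl⟩

theorem To.seq {a b : Imp ν} (h : To B a m m') (h' : To B b m' m'') : To B (seq a b) m m'' :=
  ⟨⟨h.1, by rw [h.2]; exact h'.1⟩, by rw [run, h.2, h'.2]⟩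

theorem To.assign {x : ν} {e : Expr ν} (h : e.Ok B m.val) :
    To B (assign x e) m ⟨Function.update m.val x (e.val m.val), m.coins, m.out⟩ := ⟨h, rfl⟩

theorem To.ifz {e : Expr ν} {a b : Imp ν} (h : e.Ok B m.val)
    (ha : e.val m.val = 0 → To B a m m') (hb : e.val m.val ≠ 0 → To B b m m') :
    To B (ifz e a b) m m' := by
  refine ⟨⟨h, fun h0 => (ha h0).1, fun h0 => (hb h0).1⟩, ?_⟩
  rw [run]
  split_ifs with h0
  · exact (ha h0).2
  · exact (hb h0).2

theorem To.ifz_zero {e : Expr ν} {a b : Imp ν} (h : e.Ok B m.val) (h0 : e.val m.val = 0)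
    (ha : To B a m m') : To B (Imp.ifz e a b) m m' := .ifz h (fun _ => ha) (fun h => absurd h0 h)

theorem To.ifz_pos {e : Expr ν} {a b : Imp ν} (h : e.Ok B m.val) (h0 : e.val m.val ≠ 0)
    (hb : To B b m m') : To B (Imp.ifz e a b) m m' := .ifz h (fun h => absurd h h0) (fun _ => hb)

theorem To.out {a : Letter} : To B (out a) m ⟨m.val, m.coins, m.out ++ [a]⟩ := ⟨trivial, rfl⟩

/-- The rule for repetitions, with an invariant. -/
theorem rep_spec {e : Expr ν} {c : Imp ν} (I : ℕ → Mem ν → Prop) (he : e.Ok B m.val) (h0 : I 0 m)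
    (h : ∀ j < e.val m.val, ∀ m', I j m' → c.Ok B m' ∧ I (j + 1) (c.run m')) :
    (rep e c).Ok B m ∧ I (e.val m.val) ((rep e c).run m) := by
  have key : ∀ j ≤ e.val m.val, I j ((run c)^[j] m) := by
    intro j
    induction j with
    | zero => exact fun _ => h0
    | succ j ih =>
      intro hj
      rw [Function.iterate_succ_apply']
      exact (h j hj _ (ih (by omega))).2
  exact ⟨⟨he, fun j hj => (h j hj _ (key j hj.le)).1⟩, key _ le_rfl⟩

theorem To.rep {e : Expr ν} {c : Imp ν} (f : ℕ → Mem ν) (he : e.Ok B m.val) (h0 : f 0 = m)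
    {n : ℕ} (hn : e.val m.val = n) (h : ∀ j < n, To B c (f j) (f (j + 1))) (hm : f n = m') :
    To B (rep e c) m m' := by
  subst hn hm
  refine rep_spec (fun j m' => m' = f j) he h0.symm ?_
  rintro j hj _ rfl
  exact h j hj

end Imp

/-! ### The variables -/

/-- The variables of the program for the complement of `L_DISJ`. -/
inductive Var where
  | mode | fail | k | i | N | P | p | a | G | h | F | Fx | Fy | nb | J
  | q | pw | d | ok | t | rev | len
  deriving DecidableEq

instance : Fintype Var where
  elems := {.mode, .fail, .k, .i, .N, .P, .p, .a, .G, .h, .F, .Fx, .Fy, .nb, .J, .q, .pw, .d, .ok,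
    .t, .rev, .len}
  complete x := by cases x <;> simp

/-- The values of the variables, except for those that are used to write numbers. Up to the first
`#`, the mode is `0`; in the first block, the mode is `1`; then it is `2`. The variables `i` and
`nb` count the letters of the current block and the blocks, `k` is the number of leading letters
`1`, and `N` is the length of the blocks; `fail` is `1` if the word was found not to be in `L_DISJ`.
The seed of the hash function is `a`, with `G` as the power of `2` above it, `P` and `p` are its
current scale and prime, `h` and `F` its current values, and `Fx` and `Fy` the hash values to
compare with. The number of Grover iterations is `J`, and `q`, `pw`, `d` and `ok` are auxiliary. -/
@[ext] structure Ctl where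
  mode : ℕ := 0
  fail : ℕ := 0
  k : ℕ := 0
  i : ℕ := 0
  N : ℕ := 0
  P : ℕ := 0
  p : ℕ := 0
  a : ℕ := 0
  G : ℕ := 0
  h : ℕ := 0
  F : ℕ := 0
  Fx : ℕ := 0
  Fy : ℕ := 0
  nb : ℕ := 0
  J : ℕ := 0
  q : ℕ := 0
  pw : ℕ := 0
  d : ℕ := 0
  ok : ℕ := 0

namespace Ctl

/-- The values of all variables; those that are used to write numbers are `0`. -/
def toVal (c : Ctl) : Var → ℕ
  | .mode => c.mode | .fail => c.fail | .k => c.k | .i => c.i | .N => c.N | .P => c.P | .p => c.p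
  | .a => c.a | .G => c.G | .h => c.h | .F => c.F | .Fx => c.Fx | .Fy => c.Fy | .nb => c.nb
  | .J => c.J | .q => c.q | .pw => c.pw | .d => c.d | .ok => c.ok | .t => 0 | .rev => 0 | .len => 0

variable (c : Ctl) (v : ℕ)

@[simp] theorem toVal_mode : c.toVal .mode = c.mode := rfl
@[simp] theorem toVal_fail : c.toVal .fail = c.fail := rfl
@[simp] theorem toVal_k : c.toVal .k = c.k := rfl
@[simp] theorem toVal_i : c.toVal .i = c.i := rfl
@[simp] theorem toVal_N : c.toVal .N = c.N := rfl
@[simp] theorem toVal_P : c.toVal .P = c.P := rfl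
@[simp] theorem toVal_p : c.toVal .p = c.p := rfl
@[simp] theorem toVal_a : c.toVal .a = c.a := rfl
@[simp] theorem toVal_G : c.toVal .G = c.G := rfl
@[simp] theorem toVal_h : c.toVal .h = c.h := rfl
@[simp] theorem toVal_F : c.toVal .F = c.F := rfl
@[simp] theorem toVal_Fx : c.toVal .Fx = c.Fx := rfl
@[simp] theorem toVal_Fy : c.toVal .Fy = c.Fy := rfl
@[simp] theorem toVal_nb : c.toVal .nb = c.nb := rfl
@[simp] theorem toVal_J : c.toVal .J = c.J := rfl
@[simp] theorem toVal_q : c.toVal .q = c.q := rfl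
@[simp] theorem toVal_pw : c.toVal .pw = c.pw := rfl
@[simp] theorem toVal_d : c.toVal .d = c.d := rfl
@[simp] theorem toVal_ok : c.toVal .ok = c.ok := rfl

open Function

@[simp] theorem update_mode : update c.toVal .mode v = { c with mode := v }.toVal := by
  funext x; cases x <;> rfl
@[simp] theorem update_fail : update c.toVal .fail v = { c with fail := v }.toVal := by
  funext x; cases x <;> rfl
@[simp] theorem update_k : update c.toVal .k v = { c with k := v }.toVal := by
  funext x; cases x <;> rfl
@[simp] theorem update_i : update c.toVal .i v = { c with i := v }.toVal := by
  funext x; cases x <;> rfl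
@[simp] theorem update_N : update c.toVal .N v = { c with N := v }.toVal := by
  funext x; cases x <;> rfl
@[simp] theorem update_P : update c.toVal .P v = { c with P := v }.toVal := by
  funext x; cases x <;> rfl
@[simp] theorem update_p : update c.toVal .p v = { c with p := v }.toVal := by
  funext x; cases x <;> rfl
@[simp] theorem update_a : update c.toVal .a v = { c with a := v }.toVal := by
  funext x; cases x <;> rfl
@[simp] theorem update_G : update c.toVal .G v = { c with G := v }.toVal := by
  funext x; cases x <;> rfl
@[simp] theorem update_h : update c.toVal .h v = { c with h := v }.toVal := by
  funext x; cases x <;> rfl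
@[simp] theorem update_F : update c.toVal .F v = { c with F := v }.toVal := by
  funext x; cases x <;> rfl
@[simp] theorem update_Fx : update c.toVal .Fx v = { c with Fx := v }.toVal := by
  funext x; cases x <;> rfl
@[simp] theorem update_Fy : update c.toVal .Fy v = { c with Fy := v }.toVal := by
  funext x; cases x <;> rfl
@[simp] theorem update_nb : update c.toVal .nb v = { c with nb := v }.toVal := by
  funext x; cases x <;> rfl
@[simp] theorem update_J : update c.toVal .J v = { c with J := v }.toVal := by
  funext x; cases x <;> rfl
@[simp] theorem update_q : update c.toVal .q v = { c with q := v }.toVal := by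
  funext x; cases x <;> rfl
@[simp] theorem update_pw : update c.toVal .pw v = { c with pw := v }.toVal := by
  funext x; cases x <;> rfl
@[simp] theorem update_d : update c.toVal .d v = { c with d := v }.toVal := by
  funext x; cases x <;> rfl
@[simp] theorem update_ok : update c.toVal .ok v = { c with ok := v }.toVal := by
  funext x; cases x <;> rfl

end Ctl

/-! ### Writing gates -/

theorem binary_zero : binary 0 = [Letter.zero] := rfl

theorem binary_one : binary 1 = [Letter.one] := by simp [binary, Letter.ofBool]

theorem binary_of_two_le {n : ℕ} (h : 2 ≤ n) :
    binary n = binary (n / 2) ++ [Letter.ofBool (n % 2 == 1)] := by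
  have h1 : n / 2 ≠ 0 := by omega
  rw [binary, if_neg (by omega), binary, if_neg h1, Nat.digits_def' (by norm_num) (by omega)]
  simp

/-- The `l` least significant bits of `r`, the least significant one first. -/
def lowBits : ℕ → ℕ → List Letter
  | 0, _ => []
  | l + 1, r => Letter.ofBool (r % 2 == 1) :: lowBits l (r / 2)

namespace Imp

/-- Write the value of `e` in binary. The bits of the number, except for the leading one, are
first transferred to `rev`, in the reverse order. -/
def num (e : Expr Var) : Imp Var :=
  .seq (.assign .t e) (.seq (.ifz (.var .t) (.out .zero)
    (.seq (.rep (.var .t) (.ifz (.var .t / 2) .skip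
      (.seq (.assign .rev (2 * .var .rev + .var .t % 2))
        (.seq (.assign .len (.var .len + 1)) (.assign .t (.var .t / 2))))))
    (.seq (.out .one) (.rep (.var .len)
      (.seq (.ifz (.var .rev % 2) (.out .zero) (.out .one)) (.assign .rev (.var .rev / 2)))))))
    (.seq (.assign .t 0) (.seq (.assign .rev 0) (.assign .len 0))))

/-- The program for numbers writes the binary representation and restores the memory. -/
theorem to_num {B : ℕ} (hB : 2 ≤ B) {e : Expr Var} {m : Mem Var} (he : e.Ok B m.val)
    (hv : e.val m.val ≤ B) (ht : m.val .t = 0) (hr : m.val .rev = 0) (hl : m.val .len = 0) :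
    To B (num e) m ⟨m.val, m.coins, m.out ++ binary (e.val m.val)⟩ := by
  obtain ⟨v, σ, o⟩ := m
  simp only at he hv ht hr hl ⊢
  set T := e.val v with hT
  -- The values of the variables, with `x`, `y` and `z` for `t`, `rev` and `len`.
  let nv : ℕ → ℕ → ℕ → Var → ℕ := fun x y z =>
    Function.update (Function.update (Function.update v .t x) .rev y) .len z
  have nv0 : nv 0 0 0 = v := by
    funext x
    cases x <;> simp_all [nv]
  have nvT : Function.update v .t T = nv T 0 0 := by
    funext x
    cases x <;> simp_all [nv]
  have ut : ∀ x y z x', Function.update (nv x y z) .t x' = nv x' y z := by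
    intros; funext w; cases w <;> simp [nv]
  have ur : ∀ x y z y', Function.update (nv x y z) .rev y' = nv x y' z := by
    intros; funext w; cases w <;> simp [nv]
  have ul : ∀ x y z z', Function.update (nv x y z) .len z' = nv x y z' := by
    intros; funext w; cases w <;> simp [nv]
  have gt : ∀ x y z, nv x y z .t = x := by intros; simp [nv]
  have gr : ∀ x y z, nv x y z .rev = y := by intros; simp [nv]
  have gl : ∀ x y z, nv x y z .len = z := by intros; simp [nv]
  have reset : ∀ x y z o, To B (.seq (.assign .t 0) (.seq (.assign .rev 0) (.assign .len 0)))
      ⟨nv x y z, σ, o⟩ ⟨v, σ, o⟩ := by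
    intro x y z o
    refine ⟨by simp [Ok], ?_⟩
    simp [run, ut, ur, ul, nv0]
  suffices h : ∃ x y z, To B (.ifz (.var .t) (.out .zero)
    (.seq (.rep (.var .t) (.ifz (.var .t / 2) .skip
      (.seq (.assign .rev (2 * .var .rev + .var .t % 2))
        (.seq (.assign .len (.var .len + 1)) (.assign .t (.var .t / 2))))))
    (.seq (.out .one) (.rep (.var .len)
      (.seq (.ifz (.var .rev % 2) (.out .zero) (.out .one)) (.assign .rev (.var .rev / 2)))))))
      ⟨nv T 0 0, σ, o⟩ ⟨nv x y z, σ, o ++ binary T⟩ by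
    obtain ⟨x, y, z, h⟩ := h
    refine .seq (.assign he) (.seq ?_ (reset x y z _))
    simpa only [nvT, ← hT] using h
  by_cases hT0 : T = 0
  · refine ⟨T, 0, 0, .ifz_zero (by simp) (by simp [gt, hT0]) ?_⟩
    rw [hT0, binary_zero]
    exact .out
  -- the first loop: the digits of `T` are those of `x`, followed by the `z` low bits of `y`
  have loop₁ := rep_spec (B := B) (m := ⟨nv T 0 0, σ, o⟩) (e := .var .t)
    (c := .ifz (.var .t / 2) .skip (.seq (.assign .rev (2 * .var .rev + .var .t % 2))
        (.seq (.assign .len (.var .len + 1)) (.assign .t (.var .t / 2)))))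
    (fun j m' => ∃ x y z, m' = ⟨nv x y z, σ, o⟩ ∧ binary T = binary x ++ lowBits z y ∧ 1 ≤ x ∧
      x * 2 ^ z ≤ T ∧ y < 2 ^ z ∧ (z = j ∨ x = 1)) (by simp)
    ⟨T, 0, 0, rfl, by simp [lowBits], by omega, by simp, by simp, by simp⟩ (by
      rintro j hj _ ⟨x, y, z, rfl, h1, h2, h3, h4, h5⟩
      have hxT : x ≤ T := le_trans (Nat.le_mul_of_pos_right _ (by positivity)) h3
      by_cases hx : x / 2 = 0
      · refine ⟨⟨by simp [hB], fun _ => trivial, fun h => absurd hx (by simpa [gt] using h)⟩,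
          x, y, z, ?_, h1, h2, h3, h4, by omega⟩
        rw [run, if_pos (by simpa [gt] using hx)]
        rfl
      · have h2z : x / 2 * 2 ^ (z + 1) ≤ T := by
          rw [pow_succ]
          calc x / 2 * (2 ^ z * 2) = (x / 2 * 2) * 2 ^ z := by ring
            _ ≤ x * 2 ^ z := Nat.mul_le_mul_right _ (Nat.div_mul_le_self _ _)
            _ ≤ T := h3
        have hy2 : 2 * y + x % 2 < 2 ^ (z + 1) := by rw [pow_succ]; omega
        have hzT : 2 ^ (z + 1) ≤ T :=
          le_trans (Nat.le_mul_of_pos_left _ (by omega)) h2z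
        have hz : z + 1 < 2 ^ (z + 1) := Nat.lt_two_pow_self
        have hrun : (Imp.seq (.assign .rev (2 * .var .rev + .var .t % 2))
            (.seq (.assign .len (.var .len + 1)) (.assign .t (.var .t / 2)))).run
              (⟨nv x y z, σ, o⟩ : Mem Var) = ⟨nv (x / 2) (2 * y + x % 2) (z + 1), σ, o⟩ := by
          simp [run, gt, gr, gl, ut, ur, ul]
        refine ⟨⟨by simp [hB], fun h => absurd (by simpa [gt] using h) hx, fun _ => ?_⟩,
          x / 2, 2 * y + x % 2, z + 1, ?_, ?_, by omega, h2z, hy2, by omega⟩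
        · simp [Ok, run, gt, gr, gl, ur, ul]
          omega
        · rw [run, if_neg (by simpa [gt] using hx)]
          exact hrun
        · rw [h1, binary_of_two_le (by omega), List.append_assoc]
          have e1 : (2 * y + x % 2) % 2 = x % 2 := by omega
          have e2 : (2 * y + x % 2) / 2 = y := by omega
          simp [lowBits, e1, e2])
  obtain ⟨ok₁, x, y, z, e₁, h1, h2, h3, h4, h5⟩ := loop₁
  -- As many rounds as the value of the number are enough, since a number has fewer digits.
  have hx : x = 1 := by
    rcases h5 with h5 | h5
    · simp only [Expr.val_var, gt] at h5
      have : T < 2 ^ T := Nat.lt_two_pow_self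
      rw [h5] at h3
      exfalso
      nlinarith
    · exact h5
  subst hx
  have hzT : 2 ^ z ≤ T := by omega
  refine ⟨1, 0, z, .ifz_pos (by simp) (by simpa [gt] using hT0) (.seq ⟨ok₁, e₁⟩ (.seq .out ?_))⟩
  simp only
  have hz : z < 2 ^ z := Nat.lt_two_pow_self
  -- The second loop: the output, followed by the remaining bits of `rev`, stays the same.
  obtain ⟨ok₂, y', z', e₂, h6, h7, h8⟩ := rep_spec (B := B)
    (m := ⟨nv 1 y z, σ, o ++ [.one]⟩) (e := .var .len)
    (c := .seq (.ifz (.var .rev % 2) (.out .zero) (.out .one)) (.assign .rev (.var .rev / 2)))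
    (fun j m' => ∃ y' o', m' = ⟨nv 1 y' z, σ, o'⟩ ∧
      o' ++ lowBits (z - j) y' = o ++ binary T ∧ y' ≤ B ∧ y' < 2 ^ (z - j)) (by simp)
    ⟨y, _, rfl, by simp [h1, binary_one], by omega, by simpa using h4⟩ (by
      rintro j hj _ ⟨y', o', rfl, h6, h7, h8⟩
      simp only [Expr.val_var, gl] at hj
      rw [show z - j = z - (j + 1) + 1 by omega] at h6 h8
      rw [pow_succ] at h8
      refine ⟨by simp [Ok, hB], y' / 2, o' ++ [Letter.ofBool (y' % 2 == 1)], ?_, ?_, ?_, ?_⟩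
      · rcases Nat.mod_two_eq_zero_or_one y' with h | h <;>
          simp [run, gr, ur, h, Letter.ofBool]
      · simpa [lowBits] using h6
      · omega
      · omega)
  simp only [Expr.val_var, gl, Nat.sub_self, pow_zero, lowBits, List.append_nil] at h6 h8
  have hy' : y' = 0 := by omega
  subst hy' h6
  exact ⟨ok₂, e₂⟩

end Imp

/-- The gate `c` on the qubits `a` and `b`, preceded by a separator. -/
def gateWord (g : ℕ × ℕ × ℕ) : List Letter :=
  Letter.hash :: binary g.1 ++ Letter.hash :: binary g.2.1 ++ Letter.hash :: binary g.2.2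

/-- The word for a sequence of gates, each of them preceded by a separator. -/
def gateWords (gs : List (ℕ × ℕ × ℕ)) : List Letter := gs.flatMap gateWord

theorem gateWords_append (gs gs' : List (ℕ × ℕ × ℕ)) :
    gateWords (gs ++ gs') = gateWords gs ++ gateWords gs' := List.flatMap_append

namespace Imp

/-- Write the gates whose qubits are given by expressions. -/
def emit : List (Expr Var × Expr Var × ℕ) → Imp Var
  | [] => .skip
  | g :: gs => .seq (.seq (.out .hash) (.seq (num g.1) (.seq (.out .hash) (.seq (num g.2.1)
      (.seq (.out .hash) (num (.const g.2.2))))))) (emit gs)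

theorem to_emit {B : ℕ} (hB : 2 ≤ B) (c : Ctl) (σ : List Bool) (o : List Letter)
    (gs : List (Expr Var × Expr Var × ℕ))
    (h : ∀ g ∈ gs, g.1.Ok B c.toVal ∧ g.1.val c.toVal ≤ B ∧ g.2.1.Ok B c.toVal ∧
      g.2.1.val c.toVal ≤ B ∧ g.2.2 ≤ B) {gs' : List (ℕ × ℕ × ℕ)}
    (hgs : gs.map (fun g => (g.1.val c.toVal, g.2.1.val c.toVal, g.2.2)) = gs') :
    To B (emit gs) ⟨c.toVal, σ, o⟩ ⟨c.toVal, σ, o ++ gateWords gs'⟩ := by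
  subst hgs
  induction gs generalizing o with
  | nil =>
    rw [List.map_nil, gateWords, List.flatMap_nil, List.append_nil]
    exact .skip
  | cons g gs ih =>
    obtain ⟨h1, h2, h3, h4, h5⟩ := h g (by simp)
    have := ih (o ++ gateWord (g.1.val c.toVal, g.2.1.val c.toVal, g.2.2))
      fun g hg => h g (by simp [hg])
    simp only [List.map_cons, gateWords, List.flatMap_cons] at this ⊢
    rw [← List.append_assoc]
    refine .seq (.seq .out (.seq (to_num hB h1 h2 rfl rfl rfl) (.seq .out
      (.seq (to_num hB h3 h4 rfl rfl rfl) (.seq .out ?_))))) this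
    convert to_num (m := ⟨c.toVal, σ, _⟩) hB (show (Expr.const g.2.2).Ok B c.toVal from h5)
      h5 rfl rfl rfl using 2
    simp [gateWord]

end Imp

end OnlineQuantum

namespace OnlineQuantum

/-! ### The circuits -/

section Gates

variable {α : Type*}

/-- The sign change of the basis states whose qubits `a`, `b` and `c` are all `1`. The phase
`exp (iπ/4)` is applied to the values `a`, `b`, `c` and `a ⊕ b ⊕ c`, and its inverse, which is the
seventh power, to `a ⊕ b`, `b ⊕ c` and `a ⊕ c`; the exponents add up to `4 * (a * b * c)`. -/
def cczGates (a b c : α) : List (α × α × ℕ) :=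
  [(a, b, 1), (b, a, 1), (c, a, 1), (a, b, 2)] ++ List.replicate 7 (b, a, 1) ++
    [(b, c, 2), (c, a, 1), (a, b, 2), (b, c, 2)] ++ List.replicate 7 (c, a, 1) ++
    [(a, c, 2), (b, c, 2)] ++ List.replicate 7 (c, a, 1) ++ [(b, c, 2)]

/-- The Toffoli gate with the target qubit `c`. -/
def tofGates (a b c : α) : List (α × α × ℕ) :=
  (c, a, 0) :: cczGates a b c ++ [(c, a, 0)]

theorem mem_tofGates {a b c : α} {g : α × α × ℕ} (h : g ∈ tofGates a b c) :
    (g.1 = a ∨ g.1 = b ∨ g.1 = c) ∧ (g.2.1 = a ∨ g.2.1 = b ∨ g.2.1 = c) ∧ g.2.2 ≤ 2 := by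
  simp only [tofGates, cczGates, List.replicate, List.cons_append, List.nil_append, List.mem_cons,
    List.not_mem_nil, or_false] at h
  rcases h with h | h | h | h | h | h | h | h | h | h | h | h | h | h | h | h | h | h | h | h | h |
    h | h | h | h | h | h | h | h | h | h | h | h | h <;> subst h <;> simp

theorem map_tofGates {β : Type*} (f : α → β) (a b c : α) :
    (tofGates a b c).map (fun g => (f g.1, f g.2.1, g.2.2)) = tofGates (f a) (f b) (f c) := by
  simp [tofGates, cczGates]

end Gates

/-- One step of the comparison of the address, in the qubits `4 + 2 * q`, with the number `i`: the
qubit `5 + 2 * q` is flipped if the qubit `3 + 2 * q` is `1` and the bit `q` of the address agrees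
with the one of `i`. -/
def stepGates (i q : ℕ) : List (ℕ × ℕ × ℕ) :=
  tofGates (3 + 2 * q) (4 + 2 * q) (5 + 2 * q) ++
    if i / 2 ^ q % 2 = 0 then [(3 + 2 * q, 5 + 2 * q, 2)] else []

/-- The comparison of an address of `D` bits with `i`, with the result in the qubit `3 + 2 * D`.
The qubit `3`, with which the comparison starts, is always `1`. -/
def chainUp (i D : ℕ) : List (ℕ × ℕ × ℕ) := (List.range D).flatMap (stepGates i)

/-- The inverse of `chainUp`. -/
def chainDown (i D : ℕ) : List (ℕ × ℕ × ℕ) :=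
  (List.range D).flatMap fun r => stepGates i (D - 1 - r)

/-- Hadamard gates on all address qubits. -/
def hadUp (D : ℕ) : List (ℕ × ℕ × ℕ) := (List.range D).map fun q => (4 + 2 * q, 3 + 2 * q, 0)

/-- Hadamard gates on all address qubits, in the reverse order. -/
def hadDown (D : ℕ) : List (ℕ × ℕ × ℕ) :=
  (List.range D).map fun r => (4 + 2 * (D - 1 - r), 3 + 2 * (D - 1 - r), 0)

/-- The qubit `2` is flipped if the address is `i`. -/
def xGates (D i : ℕ) : List (ℕ × ℕ × ℕ) := chainUp i D ++ [(3 + 2 * D, 2, 2)] ++ chainDown i D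

/-- The sign is changed if the address is `i` and the qubit `2` is `1`: a `CNOT` gate between two
Hadamard gates on its target is a controlled sign change. -/
def phaseGates (D i : ℕ) : List (ℕ × ℕ × ℕ) :=
  chainUp i D ++ [(2, 3, 0), (3 + 2 * D, 2, 2), (2, 3, 0)] ++ chainDown i D

/-- The qubit `1` is flipped if the address is `i` and the qubit `2` is `1`. -/
def flagGates (D i : ℕ) : List (ℕ × ℕ × ℕ) :=
  chainUp i D ++ tofGates (3 + 2 * D) 2 1 ++ chainDown i D

/-- The diffusion operator of Grover's algorithm, with the opposite sign: between Hadamard gates on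
the address, the sign of the address `0` is changed, by the fourth power of `T`. -/
def diffGates (D : ℕ) : List (ℕ × ℕ × ℕ) :=
  hadUp D ++ (chainUp 0 D ++ List.replicate 4 (3 + 2 * D, 2, 1) ++ chainDown 0 D) ++ hadDown D

/-- The gate `NOT` on the qubit `a`, as the product `H * T ^ 4 * H`, for any `b ≠ a`. -/
def notGates (a b : ℕ) : List (ℕ × ℕ × ℕ) :=
  (a, b, 0) :: List.replicate 4 (a, b, 1) ++ [(a, b, 0)]

/-- The preparation of the uniform superposition of the addresses. -/
def prepGates (D : ℕ) : List (ℕ × ℕ × ℕ) := notGates 3 2 ++ hadDown D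

/-! ### Programs that write circuits -/

theorem Ctl.set_q_eq {c : Ctl} (hq : c.q = 0) : { c with q := 0 } = c := by
  cases c; subst hq; rfl

theorem Ctl.set_q_pw_eq {c : Ctl} (hq : c.q = 0) (hpw : c.pw = 0) :
    { c with q := 0, pw := 0 } = c := by
  cases c; subst hq hpw; rfl

namespace Imp

/-- Write `stepGates`, where the number to compare with is given by `e`. -/
def stepProg (e : Expr Var) : Imp Var :=
  .seq (emit (tofGates (3 + 2 * .var .q) (4 + 2 * .var .q) (5 + 2 * .var .q)))
    (.ifz (e / .var .pw % 2) (emit [(3 + 2 * .var .q, 5 + 2 * .var .q, 2)]) .skip)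

/-- Write `chainUp`. -/
def upProg (e : Expr Var) : Imp Var :=
  .seq (.assign .pw 1) (.seq
    (.rep (2 * .var .k) (.seq (stepProg e)
      (.seq (.assign .q (.var .q + 1)) (.assign .pw (.var .pw * 2)))))
    (.seq (.assign .q 0) (.assign .pw 0)))

/-- Write `chainDown`. -/
def downProg (e : Expr Var) : Imp Var :=
  .seq (.seq (.assign .q (2 * .var .k)) (.assign .pw (.var .N))) (.seq
    (.rep (2 * .var .k) (.seq (.seq (.assign .q (.var .q - 1)) (.assign .pw (.var .pw / 2)))
      (stepProg e)))
    (.seq (.assign .q 0) (.assign .pw 0)))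

/-- Write `hadUp`. -/
def hadUpProg : Imp Var :=
  .seq (.rep (2 * .var .k) (.seq (emit [(4 + 2 * .var .q, 3 + 2 * .var .q, 0)])
    (.assign .q (.var .q + 1)))) (.assign .q 0)

/-- Write `hadDown`. -/
def hadDownProg : Imp Var :=
  .seq (.assign .q (2 * .var .k)) (.seq (.rep (2 * .var .k) (.seq (.assign .q (.var .q - 1))
    (emit [(4 + 2 * .var .q, 3 + 2 * .var .q, 0)]))) (.assign .q 0))

variable {B : ℕ} {c : Ctl} {σ : List Bool} {o : List Letter}

theorem to_stepProg {e : Expr Var} (he : e.Ok B c.toVal) (hq : 5 + 2 * c.q ≤ B)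
    (hpw : c.pw = 2 ^ c.q) :
    To B (stepProg e) ⟨c.toVal, σ, o⟩
      ⟨c.toVal, σ, o ++ gateWords (stepGates (e.val c.toVal) c.q)⟩ := by
  have hB : 2 ≤ B := by omega
  have h5 : 5 ≤ B := by omega
  have hpos : 0 < 2 ^ c.q := by positivity
  rw [stepGates, gateWords_append, ← List.append_assoc]
  refine .seq (to_emit hB c σ o _ ?_ (map_tofGates (Expr.val c.toVal) _ _ _)) ?_
  · intro g hg
    obtain ⟨h1, h2, h3⟩ := mem_tofGates hg
    refine ⟨?_, ?_, ?_, ?_, by omega⟩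
    · rcases h1 with h | h | h <;> rw [h] <;> simp <;> omega
    · rcases h1 with h | h | h <;> rw [h] <;> simp <;> omega
    · rcases h2 with h | h | h <;> rw [h] <;> simp <;> omega
    · rcases h2 with h | h | h <;> rw [h] <;> simp <;> omega
  · have hv : (e / Expr.var Var.pw % 2 : Expr Var).val c.toVal = e.val c.toVal / 2 ^ c.q % 2 := by
      simp [hpw]
    refine .ifz (by simp [he, hpw, hB]) (fun h => ?_) (fun h => ?_)
    · rw [hv] at h
      rw [if_pos h]
      refine to_emit hB c σ _ _ ?_ (by simp)
      intro g hg
      rw [List.mem_singleton] at hg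
      subst hg
      simp
      omega
    · rw [hv] at h
      rw [if_neg h]
      simpa [gateWords] using (To.skip (B := B) (m := (⟨c.toVal, σ, _⟩ : Mem Var)))

theorem to_upProg {e : Expr Var} {I : ℕ}
    (he : ∀ q pw, e.Ok B { c with q := q, pw := pw }.toVal ∧
      e.val { c with q := q, pw := pw }.toVal = I)
    (hk : 5 + 2 * (2 * c.k) ≤ B) (hN : 2 ^ (2 * c.k) ≤ B) (hq : c.q = 0) (hpw : c.pw = 0) :
    To B (upProg e) ⟨c.toVal, σ, o⟩ ⟨c.toVal, σ, o ++ gateWords (chainUp I (2 * c.k))⟩ := by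
  refine .seq (.assign (by simp; omega)) (.seq
    (m' := ⟨{ c with q := 2 * c.k, pw := 2 ^ (2 * c.k) }.toVal, σ, o ++ gateWords
      (chainUp I (2 * c.k))⟩) ?_ ?_)
  · refine .rep (fun j => ⟨{ c with q := j, pw := 2 ^ j }.toVal, σ,
      o ++ gateWords (chainUp I j)⟩) ?_ ?_ (n := 2 * c.k) ?_ ?_ rfl
    · simp; omega
    · simp [chainUp, gateWords, hq]
    · simp
    · intro j hj
      have h2 : 2 ^ (j + 1) ≤ B :=
        le_trans (Nat.pow_le_pow_right (by norm_num) (by omega)) hN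
      rw [pow_succ] at h2
      have := to_stepProg (σ := σ) (o := o ++ gateWords (chainUp I j))
        (he j (2 ^ j)).1 (show 5 + 2 * j ≤ B by omega) rfl
      rw [(he j (2 ^ j)).2] at this
      refine .seq this ⟨?_, ?_⟩
      · simp [Ok, run]; omega
      · simp [run, chainUp, List.range_succ, gateWords, pow_succ]
  · refine ⟨by simp [Ok], ?_⟩
    simp [run, Ctl.set_q_pw_eq hq hpw]

theorem to_downProg {e : Expr Var} {I : ℕ}
    (he : ∀ q pw, e.Ok B { c with q := q, pw := pw }.toVal ∧
      e.val { c with q := q, pw := pw }.toVal = I)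
    (hk : 5 + 2 * (2 * c.k) ≤ B) (hN : c.N = 2 ^ (2 * c.k)) (hq : c.q = 0) (hpw : c.pw = 0) :
    To B (downProg e) ⟨c.toVal, σ, o⟩ ⟨c.toVal, σ, o ++ gateWords (chainDown I (2 * c.k))⟩ := by
  refine .seq (m' := ⟨{ c with q := 2 * c.k, pw := c.N }.toVal, σ, o⟩) ⟨?_, by simp [run]⟩
    (.seq (m' := ⟨{ c with q := 0, pw := 1 }.toVal, σ, o ++ gateWords (chainDown I (2 * c.k))⟩) ?_
      ?_)
  · simp [Ok]; omega
  · refine .rep (fun j => ⟨{ c with q := 2 * c.k - j, pw := 2 ^ (2 * c.k - j) }.toVal, σ,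
      o ++ gateWords ((List.range j).flatMap fun r => stepGates I (2 * c.k - 1 - r))⟩)
      ?_ ?_ (n := 2 * c.k) ?_ ?_ ?_
    · simp; omega
    · simp [gateWords, hN]
    · simp
    · intro j hj
      have e1 : 2 * c.k - j = 2 * c.k - (j + 1) + 1 := by omega
      have e2 : 2 ^ (2 * c.k - j) / 2 = 2 ^ (2 * c.k - (j + 1)) := by
        rw [e1, pow_succ]; simp
      have e3 : 2 * c.k - j - 1 = 2 * c.k - (j + 1) := by omega
      have e4 : 2 * c.k - 1 - j = 2 * c.k - (j + 1) := by omega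
      have := to_stepProg (σ := σ)
        (o := o ++ gateWords ((List.range j).flatMap fun r => stepGates I (2 * c.k - 1 - r)))
        (he (2 * c.k - (j + 1)) (2 ^ (2 * c.k - (j + 1)))).1
        (show 5 + 2 * (2 * c.k - (j + 1)) ≤ B by omega) rfl
      rw [(he _ _).2] at this
      refine .seq (m' := ⟨{ c with q := 2 * c.k - (j + 1), pw := 2 ^ (2 * c.k - (j + 1)) }.toVal, σ,
        o ++ gateWords ((List.range j).flatMap fun r => stepGates I (2 * c.k - 1 - r))⟩)
        ⟨?_, ?_⟩ ?_
      · simp [Ok]; omega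
      · simp [run, e2, e3]
      · convert this using 2
        simp [List.range_succ, gateWords, e4]
    · simp [chainDown]
  · refine ⟨by simp [Ok], ?_⟩
    simp [run, Ctl.set_q_pw_eq hq hpw]

theorem to_hadUpProg (hk : 5 + 2 * (2 * c.k) ≤ B) (hq : c.q = 0) :
    To B hadUpProg ⟨c.toVal, σ, o⟩ ⟨c.toVal, σ, o ++ gateWords (hadUp (2 * c.k))⟩ := by
  refine .seq (m' := ⟨{ c with q := 2 * c.k }.toVal, σ, o ++ gateWords (hadUp (2 * c.k))⟩) ?_ ?_
  · refine .rep (fun j => ⟨{ c with q := j }.toVal, σ, o ++ gateWords (hadUp j)⟩) ?_ ?_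
      (n := 2 * c.k) ?_ ?_ rfl
    · simp; omega
    · simp [hadUp, gateWords, Ctl.set_q_eq hq]
    · simp
    · intro j hj
      refine .seq (to_emit (by omega) { c with q := j } σ _ _ ?_ rfl) ⟨?_, ?_⟩
      · simp; omega
      · simp [Ok]; omega
      · simp [run, hadUp, List.range_succ, gateWords]
  · refine ⟨by simp [Ok], ?_⟩
    simp [run, Ctl.set_q_eq hq]

theorem to_hadDownProg (hk : 5 + 2 * (2 * c.k) ≤ B) (hq : c.q = 0) :
    To B hadDownProg ⟨c.toVal, σ, o⟩ ⟨c.toVal, σ, o ++ gateWords (hadDown (2 * c.k))⟩ := by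
  refine .seq (.assign (by simp; omega)) (.seq (m' := ⟨{ c with q := 0 }.toVal, σ,
    o ++ gateWords (hadDown (2 * c.k))⟩) ?_ ?_)
  · refine .rep (fun j => ⟨{ c with q := 2 * c.k - j }.toVal, σ,
      o ++ gateWords ((List.range j).map fun r =>
        (4 + 2 * (2 * c.k - 1 - r), 3 + 2 * (2 * c.k - 1 - r), 0))⟩) ?_ ?_ (n := 2 * c.k) ?_ ?_ ?_
    · simp; omega
    · simp [gateWords]
    · simp
    · intro j hj
      have e3 : 2 * c.k - j - 1 = 2 * c.k - (j + 1) := by omega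
      have e4 : 2 * c.k - 1 - j = 2 * c.k - (j + 1) := by omega
      refine .seq (m' := ⟨{ c with q := 2 * c.k - (j + 1) }.toVal, σ,
        o ++ gateWords ((List.range j).map fun r =>
          (4 + 2 * (2 * c.k - 1 - r), 3 + 2 * (2 * c.k - 1 - r), 0))⟩) ⟨?_, ?_⟩ ?_
      · simp [Ok]; omega
      · simp [run, e3]
      · have := to_emit (B := B) (by omega) { c with q := 2 * c.k - (j + 1) } σ
          (o ++ gateWords ((List.range j).map fun r =>
            (4 + 2 * (2 * c.k - 1 - r), 3 + 2 * (2 * c.k - 1 - r), 0)))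
          [(4 + 2 * .var .q, 3 + 2 * .var .q, 0)] (by simp; omega) rfl
        convert this using 2
        simp [List.range_succ, gateWords, e4]
    · simp [hadDown]
  · refine ⟨by simp [Ok], ?_⟩
    simp [run, Ctl.set_q_eq hq]

/-- The qubit that holds the result of a comparison. -/
def topExpr : Expr Var := 3 + 2 * (2 * .var .k)

/-- Write `xGates`. -/
def xProg : Imp Var :=
  .seq (upProg (.var .i)) (.seq (emit [(topExpr, 2, 2)]) (downProg (.var .i)))

/-- Write `phaseGates`. -/
def phaseProg : Imp Var :=
  .seq (upProg (.var .i)) (.seq (emit [(2, 3, 0), (topExpr, 2, 2), (2, 3, 0)])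
    (downProg (.var .i)))

/-- Write `flagGates`. -/
def flagProg : Imp Var :=
  .seq (upProg (.var .i)) (.seq (emit (tofGates topExpr 2 1)) (downProg (.var .i)))

/-- Write `diffGates`. -/
def diffProg : Imp Var :=
  .seq hadUpProg (.seq (.seq (upProg 0) (.seq (emit (List.replicate 4 (topExpr, 2, 1)))
    (downProg 0))) hadDownProg)

/-- Write `prepGates`. -/
def prepProg : Imp Var :=
  .seq (emit ((3, 2, 0) :: List.replicate 4 (3, 2, 1) ++ [(3, 2, 0)])) hadDownProg

/-- A program `p` between a comparison and its inverse. -/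
theorem to_sandwich {p : Imp Var} {e : Expr Var} {I : ℕ} {gs : List (ℕ × ℕ × ℕ)}
    (he : ∀ q pw, e.Ok B { c with q := q, pw := pw }.toVal ∧
      e.val { c with q := q, pw := pw }.toVal = I)
    (hk : 5 + 2 * (2 * c.k) ≤ B) (hN : c.N = 2 ^ (2 * c.k)) (hNB : c.N ≤ B) (hq : c.q = 0)
    (hpw : c.pw = 0) (hp : ∀ o, To B p ⟨c.toVal, σ, o⟩ ⟨c.toVal, σ, o ++ gateWords gs⟩) :
    To B (.seq (upProg e) (.seq p (downProg e))) ⟨c.toVal, σ, o⟩ ⟨c.toVal, σ,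
      o ++ gateWords (chainUp I (2 * c.k) ++ gs ++ chainDown I (2 * c.k))⟩ := by
  rw [gateWords_append, gateWords_append, ← List.append_assoc, ← List.append_assoc]
  exact .seq (to_upProg he hk (hN ▸ hNB) hq hpw) (.seq (hp _) (to_downProg he hk hN hq hpw))

variable (hk : 5 + 2 * (2 * c.k) ≤ B) (hN : c.N = 2 ^ (2 * c.k)) (hNB : c.N ≤ B) (hq : c.q = 0)
    (hpw : c.pw = 0)
include hk hN hNB hq hpw

theorem to_xProg :
    To B xProg ⟨c.toVal, σ, o⟩ ⟨c.toVal, σ, o ++ gateWords (xGates (2 * c.k) c.i)⟩ := by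
  refine to_sandwich (fun _ _ => ⟨trivial, rfl⟩) hk hN hNB hq hpw fun o => ?_
  exact to_emit (by omega) c σ o _ (by simp [topExpr]; omega) rfl

theorem to_phaseProg :
    To B phaseProg ⟨c.toVal, σ, o⟩ ⟨c.toVal, σ, o ++ gateWords (phaseGates (2 * c.k) c.i)⟩ := by
  refine to_sandwich (fun _ _ => ⟨trivial, rfl⟩) hk hN hNB hq hpw fun o => ?_
  exact to_emit (by omega) c σ o _ (by simp [topExpr]; omega) rfl

theorem to_flagProg :
    To B flagProg ⟨c.toVal, σ, o⟩ ⟨c.toVal, σ, o ++ gateWords (flagGates (2 * c.k) c.i)⟩ := by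
  refine to_sandwich (fun _ _ => ⟨trivial, rfl⟩) hk hN hNB hq hpw fun o => ?_
  refine to_emit (by omega) c σ o _ (fun g hg => ?_) (map_tofGates (Expr.val c.toVal) _ _ _)
  obtain ⟨h1, h2, h3⟩ := mem_tofGates hg
  refine ⟨?_, ?_, ?_, ?_, by omega⟩
  · rcases h1 with h | h | h <;> rw [h] <;> simp [topExpr] <;> omega
  · rcases h1 with h | h | h <;> rw [h] <;> simp [topExpr] <;> omega
  · rcases h2 with h | h | h <;> rw [h] <;> simp [topExpr] <;> omega
  · rcases h2 with h | h | h <;> rw [h] <;> simp [topExpr] <;> omega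

theorem to_diffProg :
    To B diffProg ⟨c.toVal, σ, o⟩ ⟨c.toVal, σ, o ++ gateWords (diffGates (2 * c.k))⟩ := by
  rw [diffGates, gateWords_append, gateWords_append, ← List.append_assoc, ← List.append_assoc]
  refine .seq (to_hadUpProg hk hq) (.seq (to_sandwich (I := 0) (fun _ _ => ⟨by simp, rfl⟩) hk hN hNB
    hq hpw fun o => ?_) (to_hadDownProg hk hq))
  exact to_emit (by omega) c σ o _ (by simp [topExpr]; omega) rfl

omit hN hNB hpw in
theorem to_prepProg :
    To B prepProg ⟨c.toVal, σ, o⟩ ⟨c.toVal, σ, o ++ gateWords (prepGates (2 * c.k))⟩ := by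
  rw [prepGates, gateWords_append, ← List.append_assoc]
  refine .seq (to_emit (by omega) c σ o _ ?_ rfl) (to_hadDownProg hk hq)
  simp
  omega

end Imp

end OnlineQuantum

namespace OnlineQuantum

/-! ### Random seeds and primes -/

/-- The number given by the first `l` coins. -/
def seedVal (σ : List Bool) (l : ℕ) : ℕ := bitsVal (σ.take l)

theorem seedVal_zero (σ : List Bool) : seedVal σ 0 = 0 := rfl

theorem seedVal_succ (σ : List Bool) (l : ℕ) :
    seedVal σ (l + 1) = seedVal σ l + ((σ.drop l).headD false).toNat * 2 ^ l := by
  induction l generalizing σ with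
  | zero => cases σ <;> simp [seedVal, bitsVal]
  | succ l ih =>
    cases σ with
    | nil => simp [seedVal, bitsVal]
    | cons b σ =>
      have := ih σ
      simp only [seedVal, List.take_succ_cons, bitsVal, List.drop_succ_cons] at this ⊢
      rw [this, pow_succ]
      ring

theorem seedVal_lt (σ : List Bool) (l : ℕ) : seedVal σ l < 2 ^ l := by
  induction l with
  | zero => simp [seedVal_zero]
  | succ l ih =>
    have := Bool.toNat_le ((σ.drop l).headD false)
    rw [seedVal_succ, pow_succ]
    nlinarith

/-- A shorter seed consists of the last digits of a longer one. -/
theorem seedVal_mod (σ : List Bool) {s l : ℕ} (h : s ≤ l) :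
    seedVal σ l % 2 ^ s = seedVal σ s := by
  induction l, h using Nat.le_induction with
  | base => exact Nat.mod_eq_of_lt (seedVal_lt σ s)
  | succ l hl ih =>
    obtain ⟨r, rfl⟩ := Nat.exists_eq_add_of_le hl
    rw [seedVal_succ, pow_add, mul_left_comm, Nat.add_mul_mod_self_left, ih]

/-- The largest prime number up to `4 * P`. -/
def scalePrime (P : ℕ) : ℕ := Nat.findGreatest Nat.Prime (4 * P)

theorem scalePrime_le (P : ℕ) : scalePrime P ≤ 4 * P := Nat.findGreatest_le _

/-- This is Bertrand's postulate for `2 * P`. -/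
theorem lt_scalePrime {P : ℕ} (h : 0 < P) : 2 * P < scalePrime P := by
  obtain ⟨p, hp, h1, h2⟩ := Nat.exists_prime_lt_and_le_two_mul (2 * P) (by omega)
  exact h1.trans_le (Nat.le_findGreatest (by omega) hp)

theorem prime_scalePrime {P : ℕ} (h : 0 < P) : (scalePrime P).Prime := by
  obtain ⟨p, hp, h1, h2⟩ := Nat.exists_prime_lt_and_le_two_mul (2 * P) (by omega)
  exact Nat.findGreatest_spec (m := p) (by omega) hp

/-- The values of the seed: `a` consists of the first `l` coins, and `G` is `2 ^ l`. -/
def Ctl.setSeed (c : Ctl) (σ : List Bool) (l : ℕ) : Ctl :=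
  { c with a := seedVal σ l, G := 2 ^ l }

namespace Imp

variable {B : ℕ} {c : Ctl} {σ : List Bool} {o : List Letter}

/-- Extend the seed such that `G` is at least `2 * P`. -/
def drawProg : Imp Var :=
  .rep (2 * .var .P) (.ifz (2 * .var .P - .var .G) .skip (.seq (.flip .ok)
    (.seq (.assign .a (.var .a + .var .ok * .var .G))
      (.seq (.assign .G (.var .G * 2)) (.assign .ok 0)))))

/-- If the seed has enough digits already, the remaining coins may be anything. -/
theorem to_drawProg {e l : ℕ} (γ : ℕ → List Bool)
    (hγ : ∀ r, l ≤ r → r ≤ e + 1 → l < e + 1 → γ r = σ.drop r) (hP : c.P = 2 ^ e)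
    (hB : 2 * c.P ≤ B) (hok : c.ok = 0) :
    To B drawProg ⟨(c.setSeed σ l).toVal, γ l, o⟩
      ⟨(c.setSeed σ (max l (e + 1))).toVal, γ (max l (e + 1)), o⟩ := by
  have hP2 : 2 * c.P = 2 ^ (e + 1) := by rw [hP, pow_succ, mul_comm]
  have h1P : 1 ≤ 2 ^ e := Nat.one_le_two_pow
  refine .rep (fun j => ⟨(c.setSeed σ (max l (min (l + j) (e + 1)))).toVal,
    γ (max l (min (l + j) (e + 1))), o⟩) ?_ ?_ (n := 2 * c.P) ?_ ?_ ?_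
  · simp [Ctl.setSeed]; omega
  · rw [max_eq_left (by omega)]
  · simp [Ctl.setSeed]
  · intro j _
    set r := max l (min (l + j) (e + 1)) with hr
    refine .ifz (by simp [Ctl.setSeed]; omega) (fun h => ?_) (fun h => ?_)
    · have h' : 2 * c.P - 2 ^ r = 0 := by simpa [Ctl.setSeed] using h
      have hle : e + 1 ≤ r := (Nat.pow_le_pow_iff_right (a := 2) (by norm_num)).1 (by omega)
      have hr' : max l (min (l + (j + 1)) (e + 1)) = r := by omega
      rw [hr']
      exact .skip
    · have h' : 2 * c.P - 2 ^ r ≠ 0 := by simpa [Ctl.setSeed] using h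
      have hlt : r < e + 1 := (Nat.pow_lt_pow_iff_right (a := 2) (by norm_num)).1 (by omega)
      have hr' : max l (min (l + (j + 1)) (e + 1)) = r + 1 := by omega
      have h2 : 2 ^ (r + 1) ≤ B :=
        le_trans (Nat.pow_le_pow_right (by norm_num) (by omega)) (hP2 ▸ hB)
      have hs := seedVal_lt σ r
      have hb := Bool.toNat_le ((σ.drop r).headD false)
      have hmul : ((σ.drop r).headD false).toNat * 2 ^ r ≤ 2 ^ r := by nlinarith
      rw [pow_succ] at h2
      rw [hr', hγ r (by omega) (by omega) (by omega), hγ (r + 1) (by omega) (by omega) (by omega)]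
      refine ⟨?_, ?_⟩
      · simp only [Ctl.setSeed, Ok, run, Ctl.update_ok, Ctl.update_a, Ctl.update_G, Expr.ok_add,
          Expr.ok_mul, Expr.ok_var, Expr.val_var, Expr.val_mul, Expr.val_ofNat, Expr.ok_ofNat,
          Expr.val_add, Ctl.toVal_a, Ctl.toVal_G, Ctl.toVal_ok, true_and]
        omega
      · have h0 : { c with a := seedVal σ (r + 1), G := 2 ^ (r + 1), ok := 0 } =
            c.setSeed σ (r + 1) := by
          rw [← hok]; rfl
        rw [← h0]
        simp only [Ctl.setSeed, run, Ctl.update_ok, Ctl.update_a, Ctl.update_G, Expr.val_var,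
          Expr.val_mul, Expr.val_ofNat, Expr.val_add, Ctl.toVal_a, Ctl.toVal_G, Ctl.toVal_ok,
          List.tail_drop, ← seedVal_succ, pow_succ]
  · have : e + 1 < 2 ^ (e + 1) := Nat.lt_two_pow_self
    rw [min_eq_right (by omega)]

/-- Trial division: `ok` becomes nonzero if and only if `q` is a prime number. -/
def trialProg : Imp Var :=
  .seq (.assign .ok (.var .q - 1)) (.seq (.assign .d 1) (.rep (.var .q - 2)
    (.seq (.assign .d (.var .d + 1)) (.ifz (.var .q % .var .d) (.assign .ok 0) .skip))))

theorem run_trialProg (hq : c.q ≤ B) (hB : 2 ≤ B) :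
    trialProg.Ok B ⟨c.toVal, σ, o⟩ ∧ ∃ d v, (v ≠ 0 ↔ c.q.Prime) ∧
      trialProg.run ⟨c.toVal, σ, o⟩ = ⟨{ c with d := d, ok := v }.toVal, σ, o⟩ := by
  obtain ⟨ok, v, e, hv⟩ := rep_spec (B := B) (m := ⟨{ c with ok := c.q - 1, d := 1 }.toVal, σ, o⟩)
    (e := .var .q - 2)
    (c := .seq (.assign .d (.var .d + 1)) (.ifz (.var .q % .var .d) (.assign .ok 0) .skip))
    (fun j m' => ∃ v, m' = ⟨{ c with ok := v, d := j + 1 }.toVal, σ, o⟩ ∧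
      (v ≠ 0 ↔ 1 < c.q ∧ ∀ r, 2 ≤ r → r ≤ j + 1 → ¬ r ∣ c.q)) (by simp [hB])
    ⟨_, rfl, by
      constructor
      · exact fun h => ⟨by omega, fun r h1 h2 => by omega⟩
      · rintro ⟨h, -⟩; omega⟩ (by
      rintro j hj _ ⟨v, rfl, hv⟩
      have hj' : j < c.q - 2 := by simpa using hj
      refine ⟨⟨by simp [Ok]; omega, by simp [run], fun _ => by simp [Ok], fun _ => trivial⟩, ?_⟩
      by_cases h : c.q % (j + 2) = 0
      · refine ⟨0, by simp [run, h], ?_⟩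
        simp only [ne_eq, not_true_eq_false, false_iff, not_and, not_forall]
        exact fun _ => ⟨j + 2, by omega, by omega, by simpa using Nat.dvd_of_mod_eq_zero h⟩
      · refine ⟨v, by simp [run, h], ?_⟩
        rw [hv]
        refine and_congr_right fun _ => ⟨fun H r h1 h2 => ?_, fun H r h1 h2 => H r h1 (by omega)⟩
        rcases Nat.lt_or_ge r (j + 2) with h3 | h3
        · exact H r h1 (by omega)
        · obtain rfl : r = j + 2 := by omega
          exact fun hd => h (Nat.mod_eq_zero_of_dvd hd))
  simp only [Expr.val_sub, Expr.val_var, Expr.val_ofNat, Ctl.toVal_q] at hv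
  refine ⟨⟨by simp [Ok]; omega, by simp [Ok, run]; omega, ?_⟩, c.q - 2 + 1, v, ?_, ?_⟩
  · simpa [run] using ok
  · rw [hv, Nat.prime_def_lt']
    refine ⟨fun ⟨h1, h2⟩ => ⟨h1, fun m h3 h4 => h2 m h3 (by omega)⟩,
      fun ⟨h1, h2⟩ => ⟨h1, fun m h3 h4 => h2 m h3 (by omega)⟩⟩
  · rw [trialProg, run, run]
    simpa [run] using e

/-- Set `p` to the largest prime number up to `4 * P`. -/
def primeProg : Imp Var :=
  .seq (.assign .p 0) (.seq (.rep (4 * .var .P) (.seq (.assign .q (.var .q + 1))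
    (.seq trialProg (.ifz (.var .ok) .skip (.assign .p (.var .q))))))
    (.seq (.assign .q 0) (.seq (.assign .d 0) (.assign .ok 0))))

theorem to_primeProg (hP : 4 * c.P ≤ B) (hB : 4 ≤ B) (hq : c.q = 0) (hd : c.d = 0)
    (hok : c.ok = 0) :
    To B primeProg ⟨c.toVal, σ, o⟩ ⟨{ c with p := scalePrime c.P }.toVal, σ, o⟩ := by
  obtain ⟨ok, d, v, e⟩ := rep_spec (B := B) (m := ⟨{ c with p := 0 }.toVal, σ, o⟩)
    (e := 4 * .var .P) (c := .seq (.assign .q (.var .q + 1))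
    (.seq trialProg (.ifz (.var .ok) .skip (.assign .p (.var .q)))))
    (fun j m' => ∃ d v, m' =
      ⟨{ c with q := j, p := Nat.findGreatest Nat.Prime j, d := d, ok := v }.toVal, σ, o⟩)
        (by simp; omega) ⟨0, 0, by simp [hq, hd, hok]⟩ (by
      rintro j hj _ ⟨d, v, rfl⟩
      have hj' : j < 4 * c.P := by simpa using hj
      obtain ⟨h1, d', v', h2, h3⟩ := run_trialProg (B := B) (σ := σ) (o := o)
        (c := { c with q := j + 1, p := Nat.findGreatest Nat.Prime j, d := d, ok := v })
        (show j + 1 ≤ B by omega) (by omega)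
      have h4 : (Imp.assign .q (.var .q + 1)).run
          (⟨{ c with q := j, p := Nat.findGreatest Nat.Prime j, d := d, ok := v }.toVal, σ, o⟩ :
            Mem Var) =
          ⟨{ c with q := j + 1, p := Nat.findGreatest Nat.Prime j, d := d, ok := v }.toVal,
            σ, o⟩ := by
        simp [run]
      refine ⟨⟨by simp [Ok]; omega, by rw [h4]; exact h1, ?_⟩, d', v', ?_⟩
      · rw [h4, h3]; simp [Ok]
      · rw [run, run, h4, h3, Nat.findGreatest_succ]
        by_cases hv : v' = 0
        · rw [if_neg (fun h => h2.2 h hv)]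
          simp [run, hv]
        · rw [if_pos (h2.1 hv)]
          simp [run, hv])
  refine .seq (.assign (by simp)) (.seq
    (m' := ⟨{ c with q := 4 * c.P, p := scalePrime c.P, d := d, ok := v }.toVal, σ, o⟩)
      ⟨by simpa using ok, ?_⟩ ⟨?_, ?_⟩)
  · simpa [scalePrime] using e
  · simp [Ok]
  · simp [run, hq, hd, hok]

/-- Set `J` to a random number with `k - 1` digits. -/
def drawCountProg : Imp Var :=
  .seq (.assign .pw 1) (.seq (.rep (.var .k - 1) (.seq (.flip .ok)
    (.seq (.assign .J (.var .J + .var .ok * .var .pw))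
      (.seq (.assign .pw (.var .pw * 2)) (.assign .ok 0))))) (.assign .pw 0))

theorem to_drawCountProg (hk : 2 ^ c.k ≤ B) (hB : 2 ≤ B) (hJ : c.J = 0) (hpw : c.pw = 0)
    (hok : c.ok = 0) :
    To B drawCountProg ⟨c.toVal, σ, o⟩
      ⟨{ c with J := seedVal σ (c.k - 1) }.toVal, σ.drop (c.k - 1), o⟩ := by
  refine .seq (.assign (by simp; omega)) (.seq
    (m' := ⟨{ c with J := seedVal σ (c.k - 1), pw := 2 ^ (c.k - 1) }.toVal,
    σ.drop (c.k - 1), o⟩) ?_ ⟨by simp [Ok], by simp [run, ← hpw]⟩)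
  refine .rep (fun j => ⟨{ c with J := seedVal σ j, pw := 2 ^ j }.toVal, σ.drop j, o⟩) ?_ ?_
    (n := c.k - 1) ?_ ?_ rfl
  · simp; omega
  · simp [seedVal_zero, hJ]
  · simp
  · intro j hj
    have h2 : 2 ^ (j + 1) ≤ B :=
      le_trans (Nat.pow_le_pow_right (by norm_num) (by omega)) hk
    have hs := seedVal_lt σ j
    have hb := Bool.toNat_le ((σ.drop j).headD false)
    have hmul : ((σ.drop j).headD false).toNat * 2 ^ j ≤ 2 ^ j := by nlinarith
    rw [pow_succ] at h2
    refine ⟨?_, ?_⟩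
    · simp only [Ok, run, Ctl.update_ok, Ctl.update_J, Ctl.update_pw, Expr.ok_add,
          Expr.ok_mul, Expr.ok_var, Expr.val_var, Expr.val_mul, Expr.val_ofNat, Expr.ok_ofNat,
          Expr.val_add, Ctl.toVal_J, Ctl.toVal_pw, Ctl.toVal_ok, true_and]
      omega
    · simp only [run, Ctl.update_ok, Ctl.update_J, Ctl.update_pw, Expr.val_var, hok,
          Expr.val_mul, Expr.val_ofNat, Expr.val_add, Ctl.toVal_J, Ctl.toVal_pw, Ctl.toVal_ok,
          List.tail_drop, ← seedVal_succ, pow_succ]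

end Imp

end OnlineQuantum

namespace OnlineQuantum

/-! ### The hash function -/

/-- The length of the current block, the number of letters up to which the current prime is used,
the value of the current polynomial, and the combination of the values for the smaller primes.

The bits of a block are the coefficients of a polynomial, which is evaluated modulo a prime number
at a random point. The length of the block, and hence the size of the prime that is needed, is not
known in advance. Therefore the block is cut into pieces, and the scale `P` is squared when the
length reaches `P`; each piece is hashed modulo a prime between `2 * P` and `4 * P`. Since the scale
is squared, all the hash values together are still bounded by a polynomial in the length. -/
structure HashState where
  i : ℕ
  P : ℕ
  h : ℕ
  F : ℕ

/-- The hash state for the empty block. -/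
def HashState.empty : HashState := ⟨0, 2, 0, 0⟩

/-- The value of the current polynomial is combined with the values for the smaller primes, and
`P` is replaced by its square. -/
def HashState.rescale (s : HashState) : HashState :=
  ⟨s.i, s.P * s.P, 0, s.F * scalePrime s.P + s.h⟩

/-- The next bit is read. The point at which the polynomial is evaluated is given by `A`. -/
def HashState.push (A : ℕ → ℕ) (s : HashState) (b : Bool) : HashState :=
  let s' := if s.i = s.P then s.rescale else s
  ⟨s'.i + 1, s'.P, (s'.h * A s'.P + b.toNat) % scalePrime s'.P, s'.F⟩

/-- The hash state after the block `bs`. -/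
def hashState (A : ℕ → ℕ) (bs : List Bool) : HashState := bs.foldl (HashState.push A) .empty

/-- The hash value of a block. -/
def hashVal (A : ℕ → ℕ) (bs : List Bool) : ℕ :=
  (hashState A bs).F * scalePrime (hashState A bs).P + (hashState A bs).h

theorem hashState_nil (A : ℕ → ℕ) : hashState A [] = .empty := rfl

theorem hashState_append (A : ℕ → ℕ) (bs : List Bool) (b : Bool) :
    hashState A (bs ++ [b]) = (hashState A bs).push A b := by
  simp [hashState]

/-- The value of `P` after `n` letters. -/
def scaleAt : ℕ → ℕ
  | 0 => 2
  | n + 1 => if n = scaleAt n then scaleAt n * scaleAt n else scaleAt n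

theorem scaleAt_eq_pow (n : ℕ) : ∃ e, 1 ≤ e ∧ scaleAt n = 2 ^ e := by
  induction n with
  | zero => exact ⟨1, le_rfl, rfl⟩
  | succ n ih =>
    obtain ⟨e, he, h⟩ := ih
    rw [scaleAt]
    split_ifs
    · exact ⟨e + e, by omega, by rw [h, pow_add]⟩
    · exact ⟨e, he, h⟩

theorem two_le_scaleAt (n : ℕ) : 2 ≤ scaleAt n := by
  obtain ⟨e, he, h⟩ := scaleAt_eq_pow n
  rw [h]
  calc 2 = 2 ^ 1 := rfl
    _ ≤ 2 ^ e := Nat.pow_le_pow_right (by norm_num) he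

theorem scaleAt_eq_pow_log (n : ℕ) : scaleAt n = 2 ^ Nat.log 2 (scaleAt n) := by
  obtain ⟨e, -, h⟩ := scaleAt_eq_pow n
  rw [h, Nat.log_pow (by norm_num)]

theorem le_scaleAt (n : ℕ) : n ≤ scaleAt n := by
  induction n with
  | zero => exact Nat.zero_le _
  | succ n ih =>
    have := two_le_scaleAt n
    rw [scaleAt]
    split_ifs with h
    · nlinarith
    · omega

theorem scaleAt_le (n : ℕ) : scaleAt n ≤ (n + 2) ^ 2 := by
  induction n with
  | zero => simp [scaleAt]
  | succ n ih =>
    rw [scaleAt]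
    split_ifs with h
    · rw [← h]; nlinarith
    · exact ih.trans (Nat.pow_le_pow_left (by omega) 2)

theorem scaleAt_mono : Monotone scaleAt := by
  refine monotone_nat_of_le_succ fun n => ?_
  have := two_le_scaleAt n
  rw [scaleAt]
  split_ifs with h
  · nlinarith
  · exact le_rfl

section

variable (A : ℕ → ℕ) (bs : List Bool)

theorem hashState_i : (hashState A bs).i = bs.length := by
  induction bs using List.reverseRecOn with
  | nil => rfl
  | append_singleton bs b ih =>
    rw [hashState_append, HashState.push]
    split_ifs <;> simp [HashState.rescale, ih]

theorem hashState_P : (hashState A bs).P = scaleAt bs.length := by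
  induction bs using List.reverseRecOn with
  | nil => rfl
  | append_singleton bs b ih =>
    rw [hashState_append, HashState.push, hashState_i, ih, List.length_append,
      List.length_singleton,
      scaleAt]
    split_ifs <;> simp [HashState.rescale, ih]

theorem scalePrime_pos (n : ℕ) : 0 < scalePrime (scaleAt n) :=
  (prime_scalePrime (by have := two_le_scaleAt n; omega)).pos

theorem hashState_h : (hashState A bs).h < scalePrime (hashState A bs).P := by
  induction bs using List.reverseRecOn with
  | nil => exact scalePrime_pos 0
  | append_singleton bs b ih =>
    have := scalePrime_pos (bs ++ [b]).length
    rw [← hashState_P A] at this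
    rw [hashState_append] at this ⊢
    exact Nat.mod_lt _ this

/-- The estimate is preserved when the scale `P` becomes `P * P`, since the prime is at most `4 * P`
and `P` is at least `2`. -/
theorem hashState_F : (hashState A bs).F + 1 ≤ (hashState A bs).P ^ 3 := by
  induction bs using List.reverseRecOn with
  | nil => norm_num [hashState, HashState.empty]
  | append_singleton bs b ih =>
    have hh := hashState_h A bs
    have hp := scalePrime_le (hashState A bs).P
    have h2 := two_le_scaleAt bs.length
    rw [← hashState_P A] at h2
    rw [hashState_append, HashState.push]
    split_ifs with h
    · simp only [HashState.rescale]
      set s := hashState A bs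
      calc s.F * scalePrime s.P + s.h + 1 ≤ (s.F + 1) * scalePrime s.P := by linarith
        _ ≤ s.P ^ 3 * (4 * s.P) := Nat.mul_le_mul ih hp
        _ = 2 * 2 * s.P ^ 4 := by ring
        _ ≤ s.P * s.P * s.P ^ 4 := by gcongr
        _ = (s.P * s.P) ^ 3 := by ring
    · exact ih

theorem hashVal_le : hashVal A bs ≤ 4 * scaleAt bs.length ^ 4 := by
  have hh := hashState_h A bs
  have hp := scalePrime_le (hashState A bs).P
  have hF := hashState_F A bs
  rw [hashVal, ← hashState_P A bs]
  set s := hashState A bs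
  calc s.F * scalePrime s.P + s.h ≤ (s.F + 1) * scalePrime s.P := by linarith
    _ ≤ s.P ^ 3 * (4 * s.P) := Nat.mul_le_mul hF hp
    _ = 4 * s.P ^ 4 := by ring

end

/-- The evaluation points that are given by the seed. -/
def seedAt (σ : List Bool) (P : ℕ) : ℕ := seedVal σ (Nat.log 2 P + 1)

/-- The values of the variables for the hash state `s`. -/
def Ctl.setHash (c : Ctl) (s : HashState) : Ctl :=
  { c with i := s.i, P := s.P, p := scalePrime s.P, h := s.h, F := s.F }

namespace Imp

variable {B : ℕ} {c : Ctl} {σ : List Bool} {o : List Letter}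

/-- Start a new block. -/
def startProg : Imp Var :=
  .seq (.seq (.assign .i 0) (.seq (.assign .F 0) (.seq (.assign .h 0) (.assign .P 2))))
    (.seq drawProg primeProg)

/-- Proceed to the next prime. -/
def rescaleProg : Imp Var :=
  .seq (.seq (.assign .F (.var .F * .var .p + .var .h)) (.seq (.assign .h 0)
    (.assign .P (.var .P * .var .P)))) (.seq drawProg primeProg)

/-- Read one bit of a block. -/
def hashBitProg (b : Bool) : Imp Var :=
  .seq (.ifz (.var .P - .var .i) rescaleProg .skip)
    (.seq (.assign .h ((.var .h * (.var .a % (2 * .var .P)) + .const b.toNat) % .var .p))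
      (.assign .i (.var .i + 1)))

variable (γ : ℕ → List Bool) {l : ℕ} (hq : c.q = 0) (hd : c.d = 0) (hok : c.ok = 0)
include hq hd hok

theorem to_startProg (hγ : ∀ r, l ≤ r → r ≤ 2 → l < 2 → γ r = σ.drop r) (hB : 8 ≤ B) :
    To B startProg ⟨(c.setSeed σ l).toVal, γ l, o⟩
      ⟨((c.setHash .empty).setSeed σ (max l 2)).toVal, γ (max l 2), o⟩ := by
  refine .seq (m' := ⟨({ c with i := 0, F := 0, h := 0, P := 2 }.setSeed σ l).toVal, γ l, o⟩)
    ⟨by simp [Ok, run]; omega, by simp [run, Ctl.setSeed]⟩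
    (.seq (to_drawProg (c := { c with i := 0, F := 0, h := 0, P := 2 }) (e := 1) γ
      (by simpa using hγ) rfl (show 2 * 2 ≤ B by omega) hok) ?_)
  exact to_primeProg (by simp only [Ctl.setSeed]; omega) (by omega) hq hd hok

theorem to_rescaleProg {s : HashState} {e : ℕ} (hP : s.P * s.P = 2 ^ e)
    (hγ : ∀ r, l ≤ r → r ≤ e + 1 → l < e + 1 → γ r = σ.drop r)
    (hB : 4 * (s.P * s.P) ≤ B) (hB' : 4 ≤ B) (hF : s.F * scalePrime s.P + s.h ≤ B) :
    To B rescaleProg ⟨((c.setHash s).setSeed σ l).toVal, γ l, o⟩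
      ⟨((c.setHash s.rescale).setSeed σ (max l (e + 1))).toVal, γ (max l (e + 1)), o⟩ := by
  refine .seq (m' := ⟨({ c.setHash s with
      P := s.P * s.P, h := 0, F := s.F * scalePrime s.P + s.h }.setSeed σ l).toVal, γ l, o⟩)
        ⟨?_, by simp [run, Ctl.setSeed, Ctl.setHash]⟩
    (.seq (to_drawProg (c := { c.setHash s with
      P := s.P * s.P, h := 0, F := s.F * scalePrime s.P + s.h }) (e := e) γ hγ hP
        (show 2 * (s.P * s.P) ≤ B by omega) hok) ?_)
  · simp [Ok, run, Ctl.setSeed, Ctl.setHash]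
    omega
  · exact to_primeProg (by simp only [Ctl.setSeed]; omega) (by omega) hq hd hok

/-- The coins are kept general: while `l` digits of the seed suffice, nothing is known about `γ`. -/
theorem to_hashBitProg {s : HashState} {b : Bool} {e : ℕ} (hP : (s.push (seedAt σ) b).P = 2 ^ e)
    (hi : s.i ≤ s.P) (hh : s.h ≤ scalePrime s.P) (he : s.i ≠ s.P → e + 1 ≤ l)
    (hγ : ∀ r, l ≤ r → r ≤ e + 1 → l < e + 1 → γ r = σ.drop r)
    (hB : 8 * (2 ^ e) ^ 2 + 4 ≤ B) (hF : s.F * scalePrime s.P + s.h ≤ B) (hiB : s.i + 1 ≤ B) :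
    To B (hashBitProg b) ⟨((c.setHash s).setSeed σ l).toVal, γ l, o⟩
      ⟨((c.setHash (s.push (seedAt σ) b)).setSeed σ (max l (e + 1))).toVal,
        γ (max l (e + 1)), o⟩ := by
  have h1e : 1 ≤ 2 ^ e := Nat.one_le_two_pow
  have hle : 2 ^ e ≤ (2 ^ e) ^ 2 := by nlinarith
  have hb := Bool.toNat_le b
  have main : ∀ s' : HashState, s' = (if s.i = s.P then s.rescale else s) → s'.P = 2 ^ e →
      s'.h ≤ scalePrime s'.P →
      To B (.seq (.assign .h ((.var .h * (.var .a % (2 * .var .P)) + .const b.toNat) % .var .p))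
        (.assign .i (.var .i + 1)))
        ⟨((c.setHash s').setSeed σ (max l (e + 1))).toVal, γ (max l (e + 1)), o⟩
        ⟨((c.setHash (s.push (seedAt σ) b)).setSeed σ (max l (e + 1))).toVal,
          γ (max l (e + 1)), o⟩ := by
    intro s' hs' hP' hh'
    have hi' : s'.i = s.i := by rw [hs']; split_ifs <;> rfl
    -- Only the digits of the seed that belong to the scale are used, so that a seed that was drawn
    -- for longer blocks gives the same hash values.
    have hA : seedVal σ (max l (e + 1)) % (2 * s'.P) = seedAt σ s'.P := by
      rw [hP', seedAt, Nat.log_pow (by norm_num), ← seedVal_mod σ (le_max_right l (e + 1)),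
        pow_succ,
        mul_comm 2]
    have hA2 : seedAt σ s'.P < 2 * 2 ^ e := by
      rw [seedAt, hP', Nat.log_pow (by norm_num)]
      have := seedVal_lt σ (e + 1)
      rwa [pow_succ, mul_comm] at this
    have hp := scalePrime_le s'.P
    have hp0 := lt_scalePrime (P := s'.P) (by omega)
    have hm : s'.h * seedAt σ s'.P ≤ 4 * 2 ^ e * (2 * 2 ^ e) :=
      Nat.mul_le_mul (by rw [← hP']; omega) hA2.le
    have hm' : s'.h * seedAt σ s'.P + 1 ≤ B := by nlinarith
    refine ⟨?_, ?_⟩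
    · simp only [Ok, Ctl.setSeed, Ctl.setHash, run, Expr.ok_add, Expr.ok_mul, Expr.ok_var,
        Expr.val_var, Expr.val_mul, Expr.val_add, Ctl.toVal_P, Ctl.toVal_p, Ctl.toVal_h,
        Ctl.toVal_a, Ctl.toVal_i, Ctl.update_h, Expr.ok_ofNat, Expr.ok_mod, Expr.val_mod,
        Expr.val_ofNat, Expr.ok_const, Expr.val_const, hA, hi', true_and]
      omega
    · have hpush : s.push (seedAt σ) b = ⟨s'.i + 1, s'.P,
          (s'.h * seedAt σ s'.P + b.toNat) % scalePrime s'.P, s'.F⟩ := by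
        rw [HashState.push, ← hs']
      rw [hpush]
      simp [run, Ctl.setSeed, Ctl.setHash, hA]
  have hv : (Expr.var Var.P - Expr.var Var.i : Expr Var).val ((c.setHash s).setSeed σ l).toVal =
    s.P - s.i := rfl
  by_cases h : s.i = s.P
  · have hP' : s.P * s.P = 2 ^ e := by
      rw [← hP, HashState.push, if_pos h]; rfl
    refine .seq (.ifz_zero (by simp) (by rw [hv]; omega)
      (to_rescaleProg γ hq hd hok hP' hγ (by rw [hP']; omega) (by omega) hF)) ?_
    exact main _ (by rw [if_pos h]) hP' (Nat.zero_le _)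
  · have hP' : s.P = 2 ^ e := by
      rw [← hP, HashState.push, if_neg h]
    refine .seq (.ifz_pos (by simp) (by rw [hv]; omega) .skip) ?_
    have := main s (by rw [if_neg h]) hP' hh
    rwa [max_eq_left (he h)] at this ⊢

end Imp

end OnlineQuantum

namespace OnlineQuantum

/-! ### The program for the complement of `L_DISJ` -/

/-- The gates written for the bit `b` at the position `i` of the block `nb`, for blocks of length
`4 ^ k` and `J` Grover iterations. The three blocks with the numbers `3 * r`, `3 * r + 1` and
`3 * r + 2` belong to the `r`-th iteration; there is no iteration for `r = 0`, and the last one,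
for `r = J + 1`, writes the common elements to the qubit `1`. -/
def bitGates (k J nb i : ℕ) (b : Bool) : List (ℕ × ℕ × ℕ) :=
  if b = false then [] else if nb / 3 = 0 then [] else if nb / 3 - (J + 1) = 0 then
    (if nb % 3 % 2 = 0 then xGates (2 * k) i else if nb / 3 - J = 0 then phaseGates (2 * k) i
      else flagGates (2 * k) i) else []

/-- The gates written at the end of the block `nb`. -/
def hashGates (k J nb : ℕ) : List (ℕ × ℕ × ℕ) :=
  if nb / 3 = 0 then [] else if 2 - nb % 3 = 0 then
    (if nb / 3 - J = 0 then diffGates (2 * k) else []) else []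

/-- The gates written for the bits of the block `nb`. -/
def blockGates (k J nb : ℕ) (bs : List Bool) : List (ℕ × ℕ × ℕ) :=
  bs.zipIdx.flatMap fun x => bitGates k J nb x.2 x.1

/-- The gates written for the blocks `segs`. -/
def segsGates (k J : ℕ) (segs : List (List Bool)) : List (ℕ × ℕ × ℕ) :=
  segs.zipIdx.flatMap fun x => blockGates k J x.2 x.1 ++ hashGates k J x.2

namespace Imp

/-- Write `bitGates`. -/
def bitGatesProg (b : Bool) : Imp Var :=
  if b = false then .skip else .ifz (.var .nb / 3) .skip (.ifz (.var .nb / 3 - (.var .J + 1))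
    (.ifz (.var .nb % 3 % 2) xProg (.ifz (.var .nb / 3 - .var .J) phaseProg flagProg)) .skip)

/-- Write `hashGates`. -/
def hashGatesProg : Imp Var :=
  .ifz (.var .nb / 3) .skip (.ifz (2 - .var .nb % 3)
    (.ifz (.var .nb / 3 - .var .J) diffProg .skip) .skip)

/-- Compare the hash value with the one in `x`, and proceed to the next block if they agree. Two
numbers are equal if the sum of their truncated differences is `0`. -/
def nextProg (x : Var) : Imp Var :=
  .ifz ((.var .F - .var x) + (.var x - .var .F))
    (.seq hashGatesProg (.seq (.assign .nb (.var .nb + 1)) startProg)) (.assign .fail 1)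

/-- Read `#` at the end of the first block: check the length, choose the number of iterations. -/
def firstHashProg : Imp Var :=
  .seq (.assign .F (.var .F * .var .p + .var .h)) (.seq (.seq (.assign .pw 1)
    (.rep (.var .k) (.ifz (.var .pw - .var .i) (.assign .pw (.var .pw * 4)) .skip)))
    (.ifz ((.var .pw - .var .i) + (.var .i - .var .pw))
      (.seq (.seq (.assign .pw 0) (.seq (.assign .N (.var .i)) (.seq (.assign .Fx (.var .F))
        (.seq (.assign .mode 2) (.assign .nb 1)))))
        (.seq drawCountProg (.seq prepProg startProg)))
      (.assign .fail 1)))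

/-- Read `#` at the end of a later block. -/
def laterHashProg : Imp Var :=
  .ifz (.var .N - .var .i) (.seq (.assign .F (.var .F * .var .p + .var .h))
    (.seq (.ifz (.var .nb - 1) (.assign .Fy (.var .F)) .skip)
      (.ifz (.var .nb % 3 % 2) (nextProg .Fx) (nextProg .Fy)))) (.assign .fail 1)

/-- Read a letter. -/
def letterProg : Letter → Imp Var
  | .zero => .ifz (.var .fail) (.ifz (.var .mode) (.assign .fail 1) (.ifz (.var .mode - 1)
      (hashBitProg false) (.ifz (.var .N - .var .i) (.assign .fail 1)
        (.seq (bitGatesProg false) (hashBitProg false))))) .skip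
  | .one => .ifz (.var .fail) (.ifz (.var .mode) (.assign .k (.var .k + 1)) (.ifz (.var .mode - 1)
      (hashBitProg true) (.ifz (.var .N - .var .i) (.assign .fail 1)
        (.seq (bitGatesProg true) (hashBitProg true))))) .skip
  | .hash => .ifz (.var .fail) (.ifz (.var .mode) (.ifz (.var .k) (.assign .fail 1)
      (.seq (.assign .mode 1) startProg)) (.ifz (.var .mode - 1) firstHashProg laterHashProg)) .skip

/-- Write a final `NOT` gate on the qubit `0`. -/
def rejectProg : Imp Var := emit ((0, 1, 0) :: List.replicate 4 (0, 1, 1) ++ [(0, 1, 0)])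

/-- At the end of the input: copy the qubit `1` to the qubit `0` if the input has the right format,
and flip the qubit `0` otherwise. -/
def finalProg : Imp Var :=
  .ifz (.var .fail) (.ifz (.var .mode - 1) rejectProg (.ifz (.var .i)
    (.seq (.assign .pw 1) (.seq (.rep (.var .k) (.assign .pw (.var .pw * 2)))
      (.ifz ((3 * .var .pw - .var .nb) + (.var .nb - 3 * .var .pw)) (emit [(1, 0, 2)]) rejectProg)))
    rejectProg)) rejectProg

/-- The first gate, which has no effect. -/
def initProg : Imp Var :=
  .seq (.assign .G 1) (.seq (.out .zero) (.seq (.out .hash) (.seq (.out .zero) (.seq (.out .hash)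
    (.out .zero)))))

end Imp

/-- The program for the complement of `L_DISJ`. -/
def mainProgram : StreamProgram Var := ⟨Imp.initProg, Imp.letterProg, Imp.finalProg⟩

/-- The word for the first gate. -/
def dummyWord : List Letter := [.zero, .hash, .zero, .hash, .zero]

/-- The memory after the word `1^k`. -/
def mem₀ (k : ℕ) (σ : List Bool) : Mem Var := ⟨{ k := k, G := 1 : Ctl }.toVal, σ, dummyWord⟩

/-- The length of the seed for blocks of length `n`. -/
def seedLen (n : ℕ) : ℕ := Nat.log 2 (scaleAt n) + 1

theorem seedLen_zero : seedLen 0 = 2 := by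
  simpa [seedLen, scaleAt] using Nat.log_pow one_lt_two 1

/-- The memory after the word `1^k # bs`. The coins of the seed have been flipped as far as they
are needed for the length of `bs`. -/
def mem₁ (k : ℕ) (bs : List Bool) (σ : List Bool) : Mem Var :=
  ⟨(({ mode := 1, k := k : Ctl }.setHash (hashState (seedAt σ) bs)).setSeed σ
    (seedLen bs.length)).toVal, σ.drop (seedLen bs.length), dummyWord⟩

/-- The number of Grover iterations, which is given by the `k - 1` coins after the seed. -/
def iterCount (k : ℕ) (σ : List Bool) : ℕ := seedVal (σ.drop (seedLen (4 ^ k))) (k - 1)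

/-- The memory after `1^k #`, the blocks `segs`, each of them followed by `#`, and the bits `bs`. -/
def mem₂ (k : ℕ) (segs : List (List Bool)) (bs : List Bool) (σ : List Bool) : Mem Var :=
  ⟨(({ mode := 2, k := k, N := 4 ^ k, nb := segs.length, J := iterCount k σ,
       Fx := (segs[0]?).elim 0 (hashVal (seedAt σ)),
       Fy := (segs[1]?).elim 0 (hashVal (seedAt σ)) : Ctl }.setHash
        (hashState (seedAt σ) bs)).setSeed σ (seedLen (4 ^ k))).toVal,
    (σ.drop (seedLen (4 ^ k))).drop (k - 1),
    dummyWord ++ gateWords (prepGates (2 * k) ++ (segsGates k (iterCount k σ) segs ++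
      blockGates k (iterCount k σ) segs.length bs))⟩

namespace Imp

variable {B : ℕ} {c : Ctl} {τ σ : List Bool} {o : List Letter} {k b₀ : ℕ}

theorem to_bitGatesProg {b : Bool} (hB : 5 + 2 * (2 * c.k) ≤ B) (hN : c.N = 2 ^ (2 * c.k))
    (hNB : c.N ≤ B) (hJ : c.J + 1 ≤ B) (hq : c.q = 0) (hpw : c.pw = 0) :
    To B (bitGatesProg b) ⟨c.toVal, τ, o⟩
      ⟨c.toVal, τ, o ++ gateWords (bitGates c.k c.J c.nb c.i b)⟩ := by
  have skip' : To B skip ⟨c.toVal, τ, o⟩ ⟨c.toVal, τ, o ++ gateWords []⟩ := by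
    rw [gateWords, List.flatMap_nil, List.append_nil]; exact .skip
  rw [bitGatesProg, bitGates]
  split_ifs with h1 h2 h3 h4 h5
  · exact skip'
  · exact .ifz_zero (by simp; omega) h2 skip'
  · exact .ifz_pos (by simp; omega) h2 (.ifz_zero (by simp; omega) h3
      (.ifz_zero (by simp; omega) h4 (to_xProg hB hN hNB hq hpw)))
  · exact .ifz_pos (by simp; omega) h2 (.ifz_zero (by simp; omega) h3
      (.ifz_pos (by simp; omega) h4 (.ifz_zero (by simp; omega) h5
        (to_phaseProg hB hN hNB hq hpw))))
  · exact .ifz_pos (by simp; omega) h2 (.ifz_zero (by simp; omega) h3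
      (.ifz_pos (by simp; omega) h4 (.ifz_pos (by simp; omega) h5
        (to_flagProg hB hN hNB hq hpw))))
  · exact .ifz_pos (by simp; omega) h2 (.ifz_pos (by simp; omega) h3 skip')

theorem to_hashGatesProg (hB : 5 + 2 * (2 * c.k) ≤ B) (hN : c.N = 2 ^ (2 * c.k))
    (hNB : c.N ≤ B) (hq : c.q = 0) (hpw : c.pw = 0) :
    To B hashGatesProg ⟨c.toVal, τ, o⟩
      ⟨c.toVal, τ, o ++ gateWords (hashGates c.k c.J c.nb)⟩ := by
  have skip' : To B skip ⟨c.toVal, τ, o⟩ ⟨c.toVal, τ, o ++ gateWords []⟩ := by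
    rw [gateWords, List.flatMap_nil, List.append_nil]; exact .skip
  rw [hashGatesProg, hashGates]
  split_ifs with h1 h2 h3
  · exact .ifz_zero (by simp; omega) h1 skip'
  · exact .ifz_pos (by simp; omega) h1 (.ifz_zero (by simp; omega) h2
      (.ifz_zero (by simp; omega) h3 (to_diffProg hB hN hNB hq hpw)))
  · exact .ifz_pos (by simp; omega) h1 (.ifz_zero (by simp; omega) h2
      (.ifz_pos (by simp; omega) h3 skip'))
  · exact .ifz_pos (by simp; omega) h1 (.ifz_pos (by simp; omega) h2 skip')

/-- The effect of a program that detects that the input is not in `L_DISJ`. -/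
def Fails (B : ℕ) (p : Imp Var) (m : Mem Var) : Prop :=
  ∃ (c : Ctl) (τ : List Bool), c.fail = 1 ∧ To B p m ⟨c.toVal, τ, m.out⟩

theorem fails_assign (hB : 1 ≤ B) : Fails B (.assign .fail 1) ⟨c.toVal, τ, o⟩ :=
  ⟨{ c with fail := 1 }, τ, rfl, ⟨by simpa [Ok] using hB, by simp [run]⟩⟩

theorem Fails.ifz_zero {e : Expr Var} {a b : Imp Var} {m : Mem Var} (h : e.Ok B m.val)
    (h0 : e.val m.val = 0) (ha : Fails B a m) : Fails B (.ifz e a b) m := by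
  obtain ⟨c, τ, h1, h2⟩ := ha
  exact ⟨c, τ, h1, .ifz_zero h h0 h2⟩

theorem Fails.ifz_pos {e : Expr Var} {a b : Imp Var} {m : Mem Var} (h : e.Ok B m.val)
    (h0 : e.val m.val ≠ 0) (hb : Fails B b m) : Fails B (.ifz e a b) m := by
  obtain ⟨c, τ, h1, h2⟩ := hb
  exact ⟨c, τ, h1, .ifz_pos h h0 h2⟩

theorem Fails.seq {a b : Imp Var} {m m' : Mem Var} (ha : To B a m m') (hm : m'.out = m.out)
    (hb : Fails B b m') : Fails B (.seq a b) m := by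
  obtain ⟨c, τ, h1, h2⟩ := hb
  exact ⟨c, τ, h1, .seq ha (hm ▸ h2)⟩

/-! ### The first letters -/

theorem to_letter_one_mem₀ (hk : k + 1 ≤ B) (hB : 1 ≤ B) :
    To B (letterProg .one) (mem₀ k σ) (mem₀ (k + 1) σ) :=
  .ifz_zero (by simp [mem₀]) rfl (.ifz_zero (by simp [mem₀]) rfl
    ⟨by simp [mem₀, Ok]; omega, by simp [mem₀, run]⟩)

theorem fails_letter_zero_mem₀ (hB : 1 ≤ B) : Fails B (letterProg .zero) (mem₀ k σ) :=
  .ifz_zero (by simp [mem₀]) rfl (.ifz_zero (by simp [mem₀]) rfl (fails_assign hB))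

theorem fails_letter_hash_mem₀ (hB : 1 ≤ B) : Fails B (letterProg .hash) (mem₀ 0 σ) :=
  .ifz_zero (by simp [mem₀]) rfl (.ifz_zero (by simp [mem₀]) rfl
    (.ifz_zero (by simp [mem₀]) rfl (fails_assign hB)))

theorem to_letter_hash_mem₀ (hk : k ≠ 0) (hB : 8 ≤ B) :
    To B (letterProg .hash) (mem₀ k σ) (mem₁ k [] σ) := by
  refine .ifz_zero (by simp [mem₀]) rfl (.ifz_zero (by simp [mem₀]) rfl
    (.ifz_pos (by simp [mem₀]) (by simpa [mem₀] using hk) (.seq (m' :=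
      ⟨({ mode := 1, k := k : Ctl }.setSeed σ 0).toVal, σ.drop 0, dummyWord⟩)
      ⟨by simp [Ok]; omega, by simp [mem₀, run, Ctl.setSeed, seedVal_zero]⟩ ?_)))
  have := to_startProg (B := B) (c := { mode := 1, k := k }) (σ := σ) (o := dummyWord) (l := 0)
    (σ.drop ·) rfl rfl rfl (fun _ _ _ _ => rfl) hB
  simpa only [mem₁, List.length_nil, seedLen_zero, hashState_nil, Nat.zero_max] using this

end Imp

end OnlineQuantum

namespace OnlineQuantum

theorem seedLen_mono : Monotone seedLen := fun _ _ h =>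
  Nat.add_le_add_right (Nat.log_mono_right (scaleAt_mono h)) 1

theorem two_le_seedLen (n : ℕ) : 2 ≤ seedLen n := by
  rw [← seedLen_zero]
  exact seedLen_mono (Nat.zero_le n)

theorem blockGates_zero (k J : ℕ) (bs : List Bool) : blockGates k J 0 bs = [] := by
  have : ∀ i b, bitGates k J 0 i b = [] := by
    intro i b
    cases b <;> rfl
  simp [blockGates, this]

theorem blockGates_nil (k J nb : ℕ) : blockGates k J nb [] = [] := rfl

theorem blockGates_append (k J nb : ℕ) (bs : List Bool) (b : Bool) :
    blockGates k J nb (bs ++ [b]) = blockGates k J nb bs ++ bitGates k J nb bs.length b := by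
  simp [blockGates, List.zipIdx_append]

theorem segsGates_append (k J : ℕ) (segs : List (List Bool)) (bs : List Bool) :
    segsGates k J (segs ++ [bs]) =
      segsGates k J segs ++ (blockGates k J segs.length bs ++ hashGates k J segs.length) := by
  simp [segsGates, List.zipIdx_append]

namespace Imp

variable {B : ℕ} {c : Ctl} {τ σ : List Bool} {o : List Letter} {k b₀ : ℕ}

/-! ### The letters of the blocks -/

/-- The estimates for the values that occur in the computation of the hash function. -/
theorem hash_bounds {n : ℕ} (hn : n + 2 ≤ b₀) (hB : b₀ ^ 14 ≤ B) :
    8 * scaleAt n ^ 2 + 4 ≤ B ∧ 4 * scaleAt n ^ 4 ≤ B ∧ b₀ ≤ B ∧ 8 * b₀ ≤ B := by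
  have h1 : scaleAt n ≤ b₀ ^ 2 := (scaleAt_le n).trans (Nat.pow_le_pow_left hn 2)
  have h2 : 2 ≤ b₀ := by omega
  have pw : ∀ r, 2 ^ r ≤ b₀ ^ r := fun r => Nat.pow_le_pow_left h2 r
  have hle : ∀ r ≤ 14, b₀ ^ r ≤ B := fun r hr =>
    (Nat.pow_le_pow_right (by omega) hr).trans hB
  refine ⟨?_, ?_, ?_, ?_⟩
  · calc 8 * scaleAt n ^ 2 + 4 ≤ 8 * (b₀ ^ 2) ^ 2 + 4 * b₀ ^ 4 := by
          have := Nat.one_le_pow 4 b₀ (by omega)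
          gcongr
          omega
      _ ≤ 2 ^ 4 * b₀ ^ 4 := by ring_nf; omega
      _ ≤ b₀ ^ 4 * b₀ ^ 4 := Nat.mul_le_mul_right _ (pw 4)
      _ = b₀ ^ 8 := by ring
      _ ≤ B := hle 8 (by norm_num)
  · calc 4 * scaleAt n ^ 4 ≤ 2 ^ 2 * (b₀ ^ 2) ^ 4 := by gcongr; norm_num
      _ ≤ b₀ ^ 2 * (b₀ ^ 2) ^ 4 := Nat.mul_le_mul_right _ (pw 2)
      _ = b₀ ^ 10 := by ring
      _ ≤ B := hle 10 (by norm_num)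
  · simpa using hle 1 (by norm_num)
  · calc 8 * b₀ = 2 ^ 3 * b₀ := by norm_num
      _ ≤ b₀ ^ 3 * b₀ := Nat.mul_le_mul_right _ (pw 3)
      _ = b₀ ^ 4 := by ring
      _ ≤ B := hle 4 (by norm_num)

theorem to_hashBitProg_hashState (hq : c.q = 0) (hd : c.d = 0) (hok : c.ok = 0)
    (γ : ℕ → List Bool) {l : ℕ} {bs : List Bool} {b : Bool} (hl : seedLen bs.length ≤ l)
    (hγ : ∀ r, l ≤ r → r ≤ seedLen (bs.length + 1) → l < seedLen (bs.length + 1) → γ r = σ.drop r)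
    (hb : bs.length + 3 ≤ b₀) (hB : b₀ ^ 14 ≤ B) :
    To B (hashBitProg b) ⟨((c.setHash (hashState (seedAt σ) bs)).setSeed σ l).toVal, γ l, o⟩
      ⟨((c.setHash (hashState (seedAt σ) (bs ++ [b]))).setSeed σ
        (max l (seedLen (bs.length + 1)))).toVal, γ (max l (seedLen (bs.length + 1))), o⟩ := by
  have hP : ((hashState (seedAt σ) bs).push (seedAt σ) b).P =
      2 ^ Nat.log 2 (scaleAt (bs.length + 1)) := by
    rw [← hashState_append, hashState_P, List.length_append, List.length_singleton,
      ← scaleAt_eq_pow_log]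
  obtain ⟨b1, -, -, -⟩ := hash_bounds (n := bs.length + 1) (by omega) hB
  obtain ⟨-, b2, b3, -⟩ := hash_bounds (n := bs.length) (by omega) hB
  rw [hashState_append]
  refine to_hashBitProg γ hq hd hok hP ?_ (hashState_h _ _).le ?_ hγ ?_ ?_ ?_
  · rw [hashState_i, hashState_P]; exact le_scaleAt _
  · intro h
    rw [hashState_i, hashState_P] at h
    refine le_trans (le_of_eq ?_) hl
    rw [seedLen, scaleAt, if_neg h]
  · rw [← scaleAt_eq_pow_log]; exact b1
  · exact (hashVal_le _ _).trans b2
  · rw [hashState_i]; omega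

theorem to_letter_bit_mem₁ {bs : List Bool} {b : Bool} (hb : bs.length + 3 ≤ b₀)
    (hB : b₀ ^ 14 ≤ B) :
    To B (letterProg (Letter.ofBool b)) (mem₁ k bs σ) (mem₁ k (bs ++ [b]) σ) := by
  have h := to_hashBitProg_hashState (c := { mode := 1, k := k }) (b := b) (o := dummyWord)
    rfl rfl rfl (σ.drop ·) le_rfl (fun _ _ _ _ => rfl) hb hB
  rw [max_eq_right (seedLen_mono (Nat.le_succ _))] at h
  have h' : To B (hashBitProg b) (mem₁ k bs σ) (mem₁ k (bs ++ [b]) σ) := by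
    simpa only [mem₁, List.length_append, List.length_singleton] using h
  have h1 : 1 ≤ B := by
    have := (hash_bounds (n := 0) (by omega) hB).2.2.1
    omega
  cases b <;>
  exact .ifz_zero (by simp) rfl (.ifz_pos (by simp) (by simp [mem₁, Ctl.setHash, Ctl.setSeed])
    (.ifz_zero (by simpa using h1) rfl h'))

theorem four_pow_eq (k : ℕ) : 4 ^ k = 2 ^ (2 * k) := by rw [pow_mul]; norm_num

theorem lt_four_pow (k : ℕ) : k < 4 ^ k := Nat.lt_pow_self (by norm_num)

theorem to_letter_bit_mem₂ {segs : List (List Bool)} {bs : List Bool} {b : Bool}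
    (hlen : bs.length < 4 ^ k) (hk : 4 ^ k + 3 ≤ b₀) (hs : segs.length + 2 ≤ b₀)
    (hB : b₀ ^ 14 ≤ B) :
    To B (letterProg (Letter.ofBool b)) (mem₂ k segs bs σ) (mem₂ k segs (bs ++ [b]) σ) := by
  have hN := four_pow_eq k
  have hkN := lt_four_pow k
  obtain ⟨-, -, h3, h4⟩ := hash_bounds (n := 0) (by omega) hB
  have hJ : iterCount k σ < 4 ^ k := by
    refine (seedVal_lt _ _).trans_le ?_
    rw [hN]
    exact Nat.pow_le_pow_right (by norm_num) (by omega)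
  have hi : (hashState (seedAt σ) bs).i = bs.length := hashState_i _ _
  have hl : seedLen (bs.length + 1) ≤ seedLen (4 ^ k) := seedLen_mono hlen
  have h' : To B (.seq (bitGatesProg b) (hashBitProg b)) (mem₂ k segs bs σ)
      (mem₂ k segs (bs ++ [b]) σ) := by
    refine .seq (to_bitGatesProg ?_ hN ?_ ?_ rfl rfl) ?_
    · change 5 + 2 * (2 * k) ≤ B; omega
    · change 4 ^ k ≤ B; omega
    · change iterCount k σ + 1 ≤ B; omega
    · have h := to_hashBitProg_hashState (B := B) (c :=
        { mode := 2, k := k, N := 4 ^ k, nb := segs.length, J := iterCount k σ,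
          Fx := (segs[0]?).elim 0 (hashVal (seedAt σ)),
          Fy := (segs[1]?).elim 0 (hashVal (seedAt σ)) })
        (bs := bs) (b := b) (σ := σ)
        (o := dummyWord ++ gateWords (prepGates (2 * k) ++ (segsGates k (iterCount k σ) segs ++
          blockGates k (iterCount k σ) segs.length bs)) ++
            gateWords (bitGates k (iterCount k σ) segs.length (hashState (seedAt σ) bs).i b))
        rfl rfl rfl (fun _ => (σ.drop (seedLen (4 ^ k))).drop (k - 1)) (l := seedLen (4 ^ k))
        (seedLen_mono hlen.le) (fun _ _ _ h => by omega) (b₀ := b₀) (by omega) hB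
      rw [max_eq_left hl, hi] at h
      have e : dummyWord ++ gateWords (prepGates (2 * k) ++ (segsGates k (iterCount k σ) segs ++
          blockGates k (iterCount k σ) segs.length bs)) ++
            gateWords (bitGates k (iterCount k σ) segs.length bs.length b) =
          dummyWord ++ gateWords (prepGates (2 * k) ++ (segsGates k (iterCount k σ) segs ++
            blockGates k (iterCount k σ) segs.length (bs ++ [b]))) := by
        simp only [blockGates_append, gateWords_append, List.append_assoc]
      rw [e] at h
      change To B (hashBitProg b) ⟨_, _, dummyWord ++ gateWords (prepGates (2 * k) ++
        (segsGates k (iterCount k σ) segs ++ blockGates k (iterCount k σ) segs.length bs)) ++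
          gateWords (bitGates k (iterCount k σ) segs.length (hashState (seedAt σ) bs).i b)⟩ _
      rw [hi, e]
      exact h
  cases b <;>
  · refine .ifz_zero (by simp) rfl (.ifz_pos (by simp) (by simp [mem₂, Ctl.setHash, Ctl.setSeed])
      (.ifz_pos (by simp; omega) (by simp [mem₂, Ctl.setHash, Ctl.setSeed])
      (.ifz_pos (by simp) ?_ h')))
    simp [mem₂, Ctl.setHash, Ctl.setSeed, hi]
    omega

/-- A block must not be longer than the first one. -/
theorem fails_letter_bit_mem₂ {segs : List (List Bool)} {bs : List Bool} {b : Bool}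
    (hlen : 4 ^ k ≤ bs.length) (hB : 1 ≤ B) :
    Fails B (letterProg (Letter.ofBool b)) (mem₂ k segs bs σ) := by
  have hi : (hashState (seedAt σ) bs).i = bs.length := hashState_i _ _
  cases b <;>
  · refine .ifz_zero (by simp) rfl (.ifz_pos (by simp) (by simp [mem₂, Ctl.setHash, Ctl.setSeed])
      (.ifz_pos (by simpa using hB) (by simp [mem₂, Ctl.setHash, Ctl.setSeed])
      (.ifz_zero (by simp) ?_ (fails_assign hB))))
    simp [mem₂, Ctl.setHash, Ctl.setSeed, hi]
    omega

/-! ### The ends of the blocks -/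

/-- The power `4 ^ k` is computed as long as it does not exceed `i`. -/
theorem to_powProg {i : ℕ} (hc : c.i = i) (hB : 4 * i + 4 ≤ B) :
    ∃ w ≤ 4 * i + 4, (w = i ↔ i = 4 ^ c.k) ∧ To B (.seq (.assign .pw 1)
      (.rep (.var .k) (.ifz (.var .pw - .var .i) (.assign .pw (.var .pw * 4)) .skip)))
      ⟨c.toVal, τ, o⟩ ⟨{ c with pw := w }.toVal, τ, o⟩ := by
  obtain ⟨ok, w, h1, h2, h3⟩ := rep_spec (B := B) (m := ⟨{ c with pw := 1 }.toVal, τ, o⟩)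
    (e := .var .k) (c := .ifz (.var .pw - .var .i) (.assign .pw (.var .pw * 4)) .skip)
    (fun j m' => ∃ w, m' = ⟨{ c with pw := w }.toVal, τ, o⟩ ∧ w ≤ 4 * i + 4 ∧
      (w = 4 ^ j ∨ i < w ∧ i < 4 ^ j)) (by simp) ⟨1, rfl, by omega, .inl rfl⟩ (by
      rintro j - _ ⟨w, rfl, h1, h2⟩
      by_cases h : w - i = 0
      · refine ⟨⟨by simp, fun _ => ?_, fun h' => absurd (by simpa [hc] using h) h'⟩, w * 4, ?_, ?_,
          ?_⟩
        · simp [Ok]; omega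
        · simp [run, hc, h]
        · omega
        · left
          rcases h2 with h2 | h2
          · rw [h2, pow_succ]
          · omega
      · refine ⟨⟨by simp, fun h' => absurd (by simpa [hc] using h') h, fun _ => trivial⟩, w, ?_, h1,
          ?_⟩
        · simp [run, hc, h]
        · right
          rw [pow_succ]
          rcases h2 with h2 | h2
          · rw [← h2]; omega
          · omega)
  simp only [Expr.val_var, Ctl.toVal_k] at h3
  refine ⟨w, h2, ?_, .seq (m' := ⟨{ c with pw := 1 }.toVal, τ, o⟩)
    ⟨by simp [Ok]; omega, by simp [run]⟩ ⟨ok, h1⟩⟩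
  rcases h3 with h3 | h3
  · rw [h3]; exact eq_comm
  · omega

/-- The control values at the end of the first block. -/
theorem to_firstHash_start {bs : List Bool} (hb : bs.length + 3 ≤ b₀) (hB : b₀ ^ 14 ≤ B) :
    To B (.assign .F (.var .F * .var .p + .var .h)) (mem₁ k bs σ)
      ⟨(({ mode := 1, k := k : Ctl }.setHash { hashState (seedAt σ) bs with
        F := hashVal (seedAt σ) bs }).setSeed σ (seedLen bs.length)).toVal,
        σ.drop (seedLen bs.length), dummyWord⟩ := by
  have h : hashVal (seedAt σ) bs ≤ B :=
    (hashVal_le _ _).trans (hash_bounds (n := bs.length) (by omega) hB).2.1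
  rw [hashVal] at h
  refine ⟨?_, ?_⟩
  · simp [mem₁, Ok, Ctl.setHash, Ctl.setSeed]
    omega
  · simp [mem₁, run, Ctl.setHash, Ctl.setSeed, hashVal]

theorem fails_letter_hash_mem₁ {bs : List Bool} (hlen : bs.length ≠ 4 ^ k)
    (hb : bs.length + 3 ≤ b₀) (hB : b₀ ^ 14 ≤ B) :
    Fails B (letterProg .hash) (mem₁ k bs σ) := by
  obtain ⟨-, -, h3, h4⟩ := hash_bounds (n := bs.length) (by omega) hB
  have hi : (hashState (seedAt σ) bs).i = bs.length := hashState_i _ _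
  refine .ifz_zero (by simp) rfl (.ifz_pos (by simp)
    (by simp [mem₁, Ctl.setHash, Ctl.setSeed]) (.ifz_zero (by simp; omega) rfl ?_))
  obtain ⟨w, hwB, hw, hpow⟩ := to_powProg (B := B) (c := ({ mode := 1, k := k : Ctl }.setHash
    { hashState (seedAt σ) bs with F := hashVal (seedAt σ) bs }).setSeed σ (seedLen bs.length))
    (i := bs.length) (τ := σ.drop (seedLen bs.length)) (o := dummyWord) hi (by omega)
  have hne : w ≠ bs.length := fun h => hlen (hw.1 h)
  refine .seq (to_firstHash_start hb hB) rfl (.seq hpow rfl (.ifz_pos ?_ ?_ (fails_assign ?_)))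
  · simp [Ctl.setHash, Ctl.setSeed, hi]
    omega
  · simp [Ctl.setHash, Ctl.setSeed, hi]
    omega
  · omega

theorem to_letter_hash_mem₁ {bs : List Bool} (hlen : bs.length = 4 ^ k)
    (hb : bs.length + 3 ≤ b₀) (hB : b₀ ^ 14 ≤ B) :
    To B (letterProg .hash) (mem₁ k bs σ) (mem₂ k [bs] [] σ) := by
  obtain ⟨-, -, h3, h4⟩ := hash_bounds (n := bs.length) (by omega) hB
  have hi : (hashState (seedAt σ) bs).i = bs.length := hashState_i _ _
  have hN := four_pow_eq k
  have hkN := lt_four_pow k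
  refine .ifz_zero (by simp) rfl (.ifz_pos (by simp)
    (by simp [mem₁, Ctl.setHash, Ctl.setSeed]) (.ifz_zero (by simp; omega) rfl ?_))
  obtain ⟨w, hwB, hw, hpow⟩ := to_powProg (B := B) (c := ({ mode := 1, k := k : Ctl }.setHash
    { hashState (seedAt σ) bs with F := hashVal (seedAt σ) bs }).setSeed σ (seedLen bs.length))
    (i := bs.length) (τ := σ.drop (seedLen bs.length)) (o := dummyWord) hi (by omega)
  have hwe : w = bs.length := hw.2 hlen
  let c₁ : Ctl := ({ mode := 2, k := k, N := 4 ^ k, nb := 1, Fx := hashVal (seedAt σ) bs :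
    Ctl }.setHash { hashState (seedAt σ) bs with F := hashVal (seedAt σ) bs }).setSeed σ
      (seedLen (4 ^ k))
  have h2k : 2 ^ k ≤ B := by
    have : 2 ^ k ≤ 4 ^ k := Nat.pow_le_pow_left (by norm_num) k
    omega
  refine .seq (to_firstHash_start hb hB) (.seq hpow (.ifz_zero ?_ ?_ (.seq (m' := ⟨c₁.toVal,
    σ.drop (seedLen (4 ^ k)), dummyWord⟩) ⟨?_, ?_⟩ (.seq
      (to_drawCountProg (c := c₁) h2k (by omega) rfl rfl rfl) (.seq
        (to_prepProg (c := { c₁ with J := seedVal (σ.drop (seedLen (4 ^ k))) (k - 1) })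
          (show 5 + 2 * (2 * k) ≤ B by omega) rfl) ?_)))))
  · simp [Ctl.setHash, Ctl.setSeed, hi]
    omega
  · simp [Ctl.setHash, Ctl.setSeed, hi]
    omega
  · simp [Ok]
    omega
  · simp [run, Ctl.setHash, Ctl.setSeed, hi, c₁, hlen]
  · have h := to_startProg (B := B) (c := { c₁ with
        J := seedVal (σ.drop (seedLen (4 ^ k))) (k - 1) }) (σ := σ) (l := seedLen (4 ^ k))
      (o := dummyWord ++ gateWords (prepGates (2 * k)))
      (fun _ => (σ.drop (seedLen (4 ^ k))).drop (k - 1)) rfl rfl rfl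
      (fun _ _ _ h => by have := two_le_seedLen (4 ^ k); omega) (by omega)
    rw [max_eq_left (two_le_seedLen _)] at h
    have e : prepGates (2 * k) ++ (segsGates k (iterCount k σ) [bs] ++
        blockGates k (iterCount k σ) [bs].length []) = prepGates (2 * k) := by
      simp [segsGates, blockGates_nil, blockGates_zero, hashGates]
    rw [mem₂, e]
    exact h

/-- The control values at the end of a later block, before the comparison. -/
def laterCtl (k : ℕ) (segs : List (List Bool)) (bs : List Bool) (σ : List Bool) (Fy : ℕ) : Ctl :=
  ({ mode := 2, k := k, N := 4 ^ k, nb := segs.length, J := iterCount k σ,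
     Fx := (segs[0]?).elim 0 (hashVal (seedAt σ)), Fy := Fy : Ctl }.setHash
      { hashState (seedAt σ) bs with F := hashVal (seedAt σ) bs }).setSeed σ (seedLen (4 ^ k))

variable {segs : List (List Bool)} {bs : List Bool}

theorem to_laterHash_start (hb : bs.length + 3 ≤ b₀) (hB : b₀ ^ 14 ≤ B) :
    To B (.assign .F (.var .F * .var .p + .var .h)) (mem₂ k segs bs σ)
      ⟨(laterCtl k segs bs σ ((segs[1]?).elim 0 (hashVal (seedAt σ)))).toVal,
        (mem₂ k segs bs σ).coins, (mem₂ k segs bs σ).out⟩ := by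
  have h : hashVal (seedAt σ) bs ≤ B :=
    (hashVal_le _ _).trans (hash_bounds (n := bs.length) (by omega) hB).2.1
  rw [hashVal] at h
  refine ⟨?_, ?_⟩
  · simp [mem₂, Ok, Ctl.setHash, Ctl.setSeed]
    omega
  · simp [mem₂, run, Ctl.setHash, Ctl.setSeed, hashVal, laterCtl]

theorem to_laterHash_first (hs : segs ≠ []) (hB : 1 ≤ B) :
    To B (.ifz (.var .nb - 1) (.assign .Fy (.var .F)) .skip)
      ⟨(laterCtl k segs bs σ ((segs[1]?).elim 0 (hashVal (seedAt σ)))).toVal, τ, o⟩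
      ⟨(laterCtl k segs bs σ (((segs ++ [bs])[1]?).elim 0 (hashVal (seedAt σ)))).toVal, τ, o⟩ := by
  have hpos : 0 < segs.length := List.length_pos_iff.2 hs
  refine .ifz (by simpa using hB) (fun h => ⟨by simp [Ok], ?_⟩) (fun h => ?_)
  · have h1 : segs.length = 1 := by
      have : segs.length - 1 = 0 := h
      omega
    rw [List.getElem?_append_right h1.le, h1]
    simp [run, laterCtl, Ctl.setHash, Ctl.setSeed]
  · have h1 : 1 < segs.length := by
      have : segs.length - 1 ≠ 0 := h
      omega
    rw [List.getElem?_append_left h1]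
    exact .skip

/-- The hash value of the block `bs` agrees with the first one of its kind. -/
def HashOk (σ : List Bool) (segs : List (List Bool)) (bs : List Bool) : Prop :=
  hashVal (seedAt σ) bs =
    ((segs ++ [bs])[segs.length % 3 % 2]?).elim 0 (hashVal (seedAt σ))

theorem to_nextProg {x : Var} {Fy : ℕ} (hk : 4 ^ k + 3 ≤ b₀) (hsb : segs.length + 2 ≤ b₀)
    (hB : b₀ ^ 14 ≤ B) (h : hashVal (seedAt σ) bs = (laterCtl k segs bs σ Fy).toVal x)
    (hFy : Fy = ((segs ++ [bs])[1]?).elim 0 (hashVal (seedAt σ))) (hs : segs ≠ []) :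
    To B (nextProg x) ⟨(laterCtl k segs bs σ Fy).toVal, (mem₂ k segs bs σ).coins,
      (mem₂ k segs bs σ).out⟩ (mem₂ k (segs ++ [bs]) [] σ) := by
  have hpos : 0 < segs.length := List.length_pos_iff.2 hs
  have hN := four_pow_eq k
  have hkN := lt_four_pow k
  obtain ⟨-, -, h3, h4⟩ := hash_bounds (n := 0) (by omega) hB
  have hval : (laterCtl k segs bs σ Fy).toVal .F = hashVal (seedAt σ) bs := rfl
  refine .ifz_zero ?_ ?_ (.seq (to_hashGatesProg (show 5 + 2 * (2 * k) ≤ B by omega) hN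
    (show 4 ^ k ≤ B by omega) rfl rfl) (.seq (.assign ?_) ?_))
  · refine ⟨⟨trivial, trivial⟩, ⟨trivial, trivial⟩, ?_⟩
    simp only [Expr.val_sub, Expr.val_var]
    omega
  · simp only [Expr.val_add, Expr.val_sub, Expr.val_var, hval]
    omega
  · simp [laterCtl, Ctl.setHash, Ctl.setSeed]
    omega
  · have h := to_startProg (B := B) (c := { laterCtl k segs bs σ Fy with nb := segs.length + 1 })
      (σ := σ) (l := seedLen (4 ^ k))
      (o := (mem₂ k segs bs σ).out ++ gateWords (hashGates k (iterCount k σ) segs.length))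
      (fun _ => (mem₂ k segs bs σ).coins) rfl rfl rfl
      (fun _ _ _ h => by have := two_le_seedLen (4 ^ k); omega) (by omega)
    rw [max_eq_left (two_le_seedLen _)] at h
    have e : (mem₂ k segs bs σ).out ++ gateWords (hashGates k (iterCount k σ) segs.length) =
        (mem₂ k (segs ++ [bs]) [] σ).out := by
      simp only [mem₂, segsGates_append, blockGates_nil, gateWords_append, List.append_assoc,
        List.append_nil]
    have e0 : (segs ++ [bs])[0]? = segs[0]? := List.getElem?_append_left hpos
    rw [e] at h
    convert h using 1
    · simp only [Ctl.update_nb, Expr.val_add, Expr.val_var, Ctl.toVal_nb, Expr.val_ofNat]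
      rw [← e]
      rfl
    · simp only [mem₂, laterCtl, Ctl.setHash, Ctl.setSeed, hFy, hashState_nil, e0,
        List.length_append, List.length_singleton]

theorem hashOk_iff {c : Ctl} (hFx : c.Fx = (segs[0]?).elim 0 (hashVal (seedAt σ)))
    (hFy : c.Fy = ((segs ++ [bs])[1]?).elim 0 (hashVal (seedAt σ))) (hs : segs ≠ []) :
    HashOk σ segs bs ↔
      hashVal (seedAt σ) bs = if segs.length % 3 % 2 = 0 then c.Fx else c.Fy := by
  have hpos : 0 < segs.length := List.length_pos_iff.2 hs
  rw [HashOk, hFx, hFy]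
  rcases Nat.mod_two_eq_zero_or_one (segs.length % 3) with h | h
  · rw [if_pos h, h, List.getElem?_append_left hpos]
  · rw [if_neg (by omega), h]

theorem elim_hashVal_le {l : List (List Bool)} {j : ℕ} (hl : ∀ bs ∈ l, bs.length ≤ 4 ^ k)
    (hk : 4 ^ k + 3 ≤ b₀) (hB : b₀ ^ 14 ≤ B) : (l[j]?).elim 0 (hashVal (seedAt σ)) ≤ B := by
  cases h : l[j]? with
  | none => exact Nat.zero_le _
  | some bs =>
    have := hl bs (List.mem_of_getElem? h)
    exact (hashVal_le _ _).trans (hash_bounds (n := bs.length) (by omega) hB).2.1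

/-- At the end of a block, the program goes on if and only if the block has the right length and the
right hash value. -/
theorem letter_hash_mem₂ (hs : segs ≠ []) (hsl : ∀ bs ∈ segs, bs.length ≤ 4 ^ k)
    (hlen : bs.length ≤ 4 ^ k) (hk : 4 ^ k + 3 ≤ b₀) (hsb : segs.length + 2 ≤ b₀)
    (hB : b₀ ^ 14 ≤ B) :
    (bs.length = 4 ^ k ∧ HashOk σ segs bs →
      To B (letterProg .hash) (mem₂ k segs bs σ) (mem₂ k (segs ++ [bs]) [] σ)) ∧
    (¬ (bs.length = 4 ^ k ∧ HashOk σ segs bs) →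
      Fails B (letterProg .hash) (mem₂ k segs bs σ)) := by
  obtain ⟨-, -, h3, h4⟩ := hash_bounds (n := 0) (by omega) hB
  have hi : (hashState (seedAt σ) bs).i = bs.length := hashState_i _ _
  have hNi : (Expr.var Var.N - Expr.var Var.i : Expr Var).val (mem₂ k segs bs σ).val =
      4 ^ k - bs.length := by
    simp [mem₂, Ctl.setHash, Ctl.setSeed, hi]
  set Fy := ((segs ++ [bs])[1]?).elim 0 (hashVal (seedAt σ)) with hFy
  have hF : hashVal (seedAt σ) bs ≤ B :=
    (hashVal_le _ _).trans (hash_bounds (n := bs.length) (by omega) hB).2.1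
  have hxB : (laterCtl k segs bs σ Fy).Fx ≤ B := elim_hashVal_le hsl hk hB
  have hyB : (laterCtl k segs bs σ Fy).Fy ≤ B := elim_hashVal_le (l := segs ++ [bs]) (by
    intro b hb
    rcases List.mem_append.1 hb with hb | hb
    · exact hsl b hb
    · rw [List.mem_singleton.1 hb]; exact hlen) hk hB
  have hiff := hashOk_iff (σ := σ) (bs := bs) (c := laterCtl k segs bs σ Fy) rfl rfl hs
  have hmode : (Expr.var Var.mode : Expr Var).val (mem₂ k segs bs σ).val ≠ 0 := by
    simp [mem₂, Ctl.setHash, Ctl.setSeed]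
  have hmode' : (Expr.var Var.mode - 1 : Expr Var).val (mem₂ k segs bs σ).val ≠ 0 := by
    simp [mem₂, Ctl.setHash, Ctl.setSeed]
  have hev : ∀ F, (Expr.var Var.nb % 3 % 2 : Expr Var).val (laterCtl k segs bs σ F).toVal =
      segs.length % 3 % 2 := fun _ => rfl
  constructor
  · rintro ⟨hl, hok⟩
    rw [hiff] at hok
    refine .ifz_zero (by simp) rfl (.ifz_pos (by simp) hmode (.ifz_pos (by simp; omega) hmode'
      (.ifz_zero (by simp) (by rw [hNi]; omega) (.seq (to_laterHash_start (by omega) hB)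
        (.seq (to_laterHash_first hs (by omega)) (.ifz (by simp; omega) (fun h => ?_)
          (fun h => ?_)))))))
    · rw [hev] at h
      rw [if_pos h] at hok
      exact to_nextProg hk hsb hB hok rfl hs
    · rw [hev] at h
      rw [if_neg h] at hok
      exact to_nextProg hk hsb hB hok rfl hs
  · intro hnot
    refine .ifz_zero (by simp) rfl (.ifz_pos (by simp) hmode (.ifz_pos (by simp; omega) hmode' ?_))
    by_cases hl : bs.length = 4 ^ k
    · have hok : ¬ HashOk σ segs bs := fun h => hnot ⟨hl, h⟩
      rw [hiff] at hok
      have hnext : ∀ x, (laterCtl k segs bs σ Fy).toVal x ≤ B →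
          hashVal (seedAt σ) bs ≠ (laterCtl k segs bs σ Fy).toVal x →
          Fails B (nextProg x) ⟨(laterCtl k segs bs σ Fy).toVal, (mem₂ k segs bs σ).coins,
            (mem₂ k segs bs σ).out⟩ := by
        intro x hx hne
        have hval : (laterCtl k segs bs σ Fy).toVal .F = hashVal (seedAt σ) bs := rfl
        refine .ifz_pos ?_ ?_ (fails_assign (by omega))
        · refine ⟨⟨trivial, trivial⟩, ⟨trivial, trivial⟩, ?_⟩
          simp only [Expr.val_sub, Expr.val_var]
          omega
        · simp only [Expr.val_add, Expr.val_sub, Expr.val_var, hval]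
          omega
      refine .ifz_zero (by simp) (by rw [hNi]; omega) (.seq (to_laterHash_start (by omega) hB) rfl
        (.seq (to_laterHash_first hs (by omega)) rfl ?_))
      by_cases h : segs.length % 3 % 2 = 0
      · rw [if_pos h] at hok
        exact .ifz_zero (by simp; omega) (by rw [hev]; exact h) (hnext .Fx hxB hok)
      · rw [if_neg h] at hok
        exact .ifz_pos (by simp; omega) (by rw [hev]; exact h) (hnext .Fy hyB hok)
    · exact .ifz_pos (by simp) (by rw [hNi]; omega) (fails_assign (by omega))

/-! ### The end of the input -/

theorem to_rejectProg (hB : 2 ≤ B) :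
    To B rejectProg ⟨c.toVal, τ, o⟩ ⟨c.toVal, τ, o ++ gateWords (notGates 0 1)⟩ :=
  to_emit hB c τ o _ (by simp; omega) rfl

theorem to_finalProg_pow (hk : 2 ^ c.k ≤ B) (hB : 2 ≤ B) :
    To B (.seq (.assign .pw 1) (.rep (.var .k) (.assign .pw (.var .pw * 2))))
      ⟨c.toVal, τ, o⟩ ⟨{ c with pw := 2 ^ c.k }.toVal, τ, o⟩ := by
  refine .seq (m' := ⟨{ c with pw := 1 }.toVal, τ, o⟩) ⟨by simp [Ok]; omega, by simp [run]⟩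
    (.rep (fun j => ⟨{ c with pw := 2 ^ j }.toVal, τ, o⟩) (by simp) rfl (n := c.k) rfl
      (fun j hj => ⟨?_, by simp [run, pow_succ]⟩) rfl)
  have : 2 ^ (j + 1) ≤ B := le_trans (Nat.pow_le_pow_right (by norm_num) hj) hk
  rw [pow_succ] at this
  simp [Ok]
  omega

theorem to_finalProg_reject (hB : 2 ≤ B) (h : c.fail ≠ 0 ∨ c.mode ≤ 1 ∨
    (3 * 2 ^ c.k + 2 ≤ B ∧ c.nb ≤ B ∧ (c.i ≠ 0 ∨ c.nb ≠ 3 * 2 ^ c.k))) :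
    ∃ c' : Ctl, To B finalProg ⟨c.toVal, τ, o⟩ ⟨c'.toVal, τ, o ++ gateWords (notGates 0 1)⟩ := by
  have hpos : 1 ≤ 2 ^ c.k := Nat.one_le_two_pow
  by_cases h1 : c.fail = 0
  swap
  · exact ⟨c, .ifz_pos (by simp) h1 (to_rejectProg (by omega))⟩
  by_cases h2 : c.mode - 1 = 0
  · exact ⟨c, .ifz_zero (by simp) h1 (.ifz_zero (by simp; omega) h2 (to_rejectProg (by omega)))⟩
  by_cases h3 : c.i = 0
  swap
  · exact ⟨c, .ifz_zero (by simp) h1 (.ifz_pos (by simp; omega) h2 (.ifz_pos (by simp) h3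
      (to_rejectProg (by omega))))⟩
  obtain ⟨hk, hnb, h⟩ := (h.resolve_left (not_not.2 h1)).resolve_left (by omega)
  have hpow := to_finalProg_pow (c := c) (τ := τ) (o := o) (B := B) (by omega) (by omega)
  refine ⟨{ c with pw := 2 ^ c.k }, .ifz_zero (by simp) h1 (.ifz_pos (by simp; omega) h2
    (.ifz_zero (by simp) h3 ?_))⟩
  obtain ⟨⟨ok1, ok2⟩, hr⟩ := hpow
  refine .seq ⟨ok1, rfl⟩ (.seq ⟨ok2, hr⟩ (.ifz_pos ?_ ?_ (to_rejectProg (by omega))))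
  · simp
    omega
  · simp
    omega

theorem to_finalProg_accept (hk : 3 * 2 ^ c.k + 2 ≤ B) (h1 : c.fail = 0) (h2 : c.mode = 2)
    (h3 : c.i = 0) (h4 : c.nb = 3 * 2 ^ c.k) :
    ∃ c' : Ctl, To B finalProg ⟨c.toVal, τ, o⟩ ⟨c'.toVal, τ, o ++ gateWords [(1, 0, 2)]⟩ := by
  have hpos : 1 ≤ 2 ^ c.k := Nat.one_le_two_pow
  obtain ⟨⟨ok1, ok2⟩, hr⟩ := to_finalProg_pow (c := c) (τ := τ) (o := o) (B := B) (by omega)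
    (by omega)
  refine ⟨{ c with pw := 2 ^ c.k }, .ifz_zero (by simp) h1 (.ifz_pos (by simp; omega)
    (by simp [h2]) (.ifz_zero (by simp) h3 (.seq ⟨ok1, rfl⟩ (.seq ⟨ok2, hr⟩ (.ifz_zero ?_ ?_
      (to_emit (by omega) _ τ o _ ?_ rfl))))))⟩
  · simp
    omega
  · simp [h4]
  · simp
    omega

end Imp

end OnlineQuantum

namespace OnlineQuantum

/-! ### Circuits on an infinite register -/

/-- A state of an infinite register of qubits. The states of `m` qubits are obtained by restriction
to the basis states that are `0` from the qubit `m` on. -/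
abbrev RegState : Type := (ℕ → Bool) → ℂ

/-- The number `exp (iπ/4)`. -/
noncomputable def tPhase : ℂ := Complex.exp (Complex.I * Real.pi / 4)

theorem tPhase_pow_four : tPhase ^ 4 = -1 := by
  rw [tPhase, ← Complex.exp_nat_mul, ← Complex.exp_pi_mul_I]
  congr 1
  push_cast
  ring

/-- The action of a gate on an infinite register. -/
noncomputable def gateOp (g : ℕ × ℕ × ℕ) (ψ : RegState) : RegState :=
  if g.1 = g.2.1 then ψ
  else if g.2.2 = 0 then fun v => ∑ q : Bool, hadamard (v g.1) q * ψ (Function.update v g.1 q)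
  else if g.2.2 = 1 then fun v => (if v g.1 then tPhase else 1) * ψ v
  else fun v => ψ (Function.update v g.2.1 (xor (v g.1) (v g.2.1)))

/-- The action of a circuit on an infinite register. -/
noncomputable def circOp (gs : List (ℕ × ℕ × ℕ)) (ψ : RegState) : RegState :=
  gs.foldl (fun ψ g => gateOp g ψ) ψ

@[simp] theorem circOp_nil (ψ : RegState) : circOp [] ψ = ψ := rfl

@[simp] theorem circOp_cons (g : ℕ × ℕ × ℕ) (gs : List (ℕ × ℕ × ℕ)) (ψ : RegState) :
    circOp (g :: gs) ψ = circOp gs (gateOp g ψ) := rfl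

theorem circOp_append (gs gs' : List (ℕ × ℕ × ℕ)) (ψ : RegState) :
    circOp (gs ++ gs') ψ = circOp gs' (circOp gs ψ) := List.foldl_append

theorem gateOp_add_mul (g : ℕ × ℕ × ℕ) (φ χ : RegState) (c : ℂ) (v : ℕ → Bool) :
    gateOp g (fun v => φ v + c * χ v) v = gateOp g φ v + c * gateOp g χ v := by
  unfold gateOp
  split_ifs
  · rfl
  · simp only [Fintype.sum_bool]; ring
  all_goals ring

theorem circOp_add_mul (gs : List (ℕ × ℕ × ℕ)) (φ χ : RegState) (c : ℂ) :
    circOp gs (fun v => φ v + c * χ v) = fun v => circOp gs φ v + c * circOp gs χ v := by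
  induction gs generalizing φ χ with
  | nil => rfl
  | cons g gs ih =>
    rw [circOp_cons, show gateOp g (fun v => φ v + c * χ v) =
      fun v => gateOp g φ v + c * gateOp g χ v from funext (gateOp_add_mul g φ χ c), ih]
    rfl

theorem gateOp_cnot {a b : ℕ} (h : a ≠ b) (ψ : RegState) (v : ℕ → Bool) :
    gateOp (a, b, 2) ψ v = ψ (Function.update v b (xor (v a) (v b))) := by
  simp [gateOp, h]

theorem gateOp_t {a b : ℕ} (h : a ≠ b) (ψ : RegState) (v : ℕ → Bool) :
    gateOp (a, b, 1) ψ v = (if v a then tPhase else 1) * ψ v := by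
  simp [gateOp, h]

theorem circOp_replicate_t {a b : ℕ} (h : a ≠ b) (n : ℕ) (ψ : RegState) (v : ℕ → Bool) :
    circOp (List.replicate n (a, b, 1)) ψ v = (if v a then tPhase ^ n else 1) * ψ v := by
  induction n generalizing ψ with
  | zero => simp
  | succ n ih =>
    rw [List.replicate_succ, circOp_cons, ih, gateOp_t h]
    split_ifs
    · ring
    · ring

/-- The number `1 / √2`. -/
noncomputable def invSqrtTwo : ℂ := ((1 / Real.sqrt 2 : ℝ) : ℂ)

theorem invSqrtTwo_mul_self : invSqrtTwo * invSqrtTwo = 1 / 2 := by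
  rw [invSqrtTwo, ← Complex.ofReal_mul, div_mul_div_comm, Real.mul_self_sqrt (by norm_num)]
  norm_num

theorem gateOp_had {a b : ℕ} (h : a ≠ b) (ψ : RegState) (v : ℕ → Bool) :
    gateOp (a, b, 0) ψ v = invSqrtTwo * (ψ (Function.update v a false) +
      (if v a then -1 else 1) * ψ (Function.update v a true)) := by
  simp only [gateOp, if_neg h, if_true, Fintype.sum_bool, hadamard, Matrix.of_apply, invSqrtTwo]
  cases v a <;> simp <;> ring

theorem gateOp_had_had {a b : ℕ} (h : a ≠ b) (ψ : RegState) :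
    gateOp (a, b, 0) (gateOp (a, b, 0) ψ) = ψ := by
  funext v
  simp only [gateOp_had h, Function.update_self, Function.update_idem, if_true, Bool.false_eq_true,
    if_false]
  have h2 := invSqrtTwo_mul_self
  cases hv : v a
  · have e : Function.update v a false = v := by rw [← hv, Function.update_eq_self]
    simp only [e, Bool.false_eq_true, if_false]
    linear_combination (2 * ψ v) * h2
  · have e : Function.update v a true = v := by rw [← hv, Function.update_eq_self]
    simp only [e, if_true]
    linear_combination (2 * ψ v) * h2

/-! ### The Toffoli gate and the controlled sign changes -/

theorem circOp_ccz {a b c : ℕ} (hab : a ≠ b) (hac : a ≠ c) (hbc : b ≠ c) (ψ : RegState)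
    (v : ℕ → Bool) :
    circOp (cczGates a b c) ψ v = (if v a && v b && v c then -1 else 1) * ψ v := by
  let S : Bool → Bool → Bool → ℕ → Bool := fun x y z =>
    Function.update (Function.update (Function.update v a x) b y) c z
  have hv : v = S (v a) (v b) (v c) := by
    simp [S]
  have ga : ∀ x y z, S x y z a = x := by intros; simp [S, hab, hac]
  have gb : ∀ x y z, S x y z b = y := by intros; simp [S, hbc]
  have gc : ∀ x y z, S x y z c = z := by intros; simp [S]
  have ub : ∀ x y z y', Function.update (S x y z) b y' = S x y' z := by
    intros; simp only [S]; rw [Function.update_comm hbc.symm, Function.update_idem]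
  have uc : ∀ x y z z', Function.update (S x y z) c z' = S x y z' := by
    intros; simp only [S]; rw [Function.update_idem]
  have h4 := tPhase_pow_four
  have h16 : tPhase ^ 16 = 1 := by
    rw [show 16 = 4 * 4 by norm_num, pow_mul, h4]; norm_num
  rw [hv]
  generalize v a = x
  generalize v b = y
  generalize v c = z
  -- The circuit is diagonal: it is evaluated on the eight values of the three qubits.
  simp only [cczGates, circOp_append, circOp_cons, circOp_nil, circOp_replicate_t hab.symm,
    circOp_replicate_t hac.symm, gateOp_cnot hab, gateOp_cnot hbc, gateOp_cnot hac, gateOp_t hab,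
    gateOp_t hab.symm, gateOp_t hac.symm, ga, gb, gc, ub, uc]
  cases x <;> cases y <;> cases z <;> simp <;> ring_nf <;> simp [h4, h16]

end OnlineQuantum

namespace OnlineQuantum

open Function in
/-- A sign change of the basis states that satisfy `f` becomes a flip of the qubit `c` if it is
conjugated with Hadamard gates; here `f` must not depend on this qubit. -/
theorem had_sign_had {c b : ℕ} (h : c ≠ b) (f : (ℕ → Bool) → Bool)
    (hf : ∀ v x, f (update v c x) = f v) (ψ : RegState) (v : ℕ → Bool) :
    gateOp (c, b, 0) (fun v => (if f v && v c then -1 else 1) * gateOp (c, b, 0) ψ v) v =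
      ψ (update v c (xor (f v) (v c))) := by
  have h2 := invSqrtTwo_mul_self
  simp only [gateOp_had h, update_self, update_idem, hf]
  cases hv : v c <;> cases f v <;> simp
  · linear_combination (2 * ψ (update v c false)) * h2
  · linear_combination (2 * ψ (update v c true)) * h2
  · linear_combination (2 * ψ (update v c true)) * h2
  · linear_combination (2 * ψ (update v c false)) * h2

theorem circOp_tof {a b c : ℕ} (hab : a ≠ b) (hac : a ≠ c) (hbc : b ≠ c) (ψ : RegState)
    (v : ℕ → Bool) :
    circOp (tofGates a b c) ψ v = ψ (Function.update v c (xor (v a && v b) (v c))) := by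
  have := had_sign_had hac.symm (fun v => v a && v b) (by
    intro v x; simp [Function.update_of_ne hac, Function.update_of_ne hbc]) ψ v
  rw [tofGates, List.cons_append, circOp_cons, circOp_append, circOp_cons, circOp_nil, ← this]
  congr 1
  funext v
  exact circOp_ccz hab hac hbc _ v

theorem circOp_not {a b : ℕ} (h : a ≠ b) (ψ : RegState) (v : ℕ → Bool) :
    circOp (notGates a b) ψ v = ψ (Function.update v a (!v a)) := by
  have := had_sign_had h (fun _ => true) (fun _ _ => rfl) ψ v
  rw [Bool.true_xor] at this
  rw [notGates, List.cons_append, circOp_cons, circOp_append, circOp_cons, circOp_nil, ← this]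
  congr 1
  funext v
  rw [circOp_replicate_t h, tPhase_pow_four, Bool.true_and]

theorem circOp_cz {c : ℕ} (hc2 : c ≠ 2) (ψ : RegState) (v : ℕ → Bool) :
    circOp [(2, 3, 0), (c, 2, 2), (2, 3, 0)] ψ v = (if v c && v 2 then -1 else 1) * ψ v := by
  have h2 := invSqrtTwo_mul_self
  have h23 : (2 : ℕ) ≠ 3 := by norm_num
  simp only [circOp_cons, circOp_nil, gateOp_had h23, gateOp_cnot hc2, Function.update_self,
    Function.update_idem, Function.update_of_ne hc2]
  cases hv : v 2
  · have e : Function.update v 2 false = v := by rw [← hv, Function.update_eq_self]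
    cases v c <;> simp [e] <;> linear_combination (2 * ψ v) * h2
  · have e : Function.update v 2 true = v := by rw [← hv, Function.update_eq_self]
    cases v c <;> simp [e]
    · linear_combination (2 * ψ v) * h2
    · linear_combination (-2 * ψ v) * h2

/-! ### The comparison of the address with a number -/

/-- The effect of `stepGates` on the basis states. -/
def stepFun (i q : ℕ) (v : ℕ → Bool) : ℕ → Bool :=
  Function.update v (5 + 2 * q)
    (xor (v (3 + 2 * q) && (v (4 + 2 * q) == i.testBit q)) (v (5 + 2 * q)))

theorem circOp_stepGates (i q : ℕ) (ψ : RegState) :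
    circOp (stepGates i q) ψ = fun v => ψ (stepFun i q v) := by
  funext v
  have e : (i / 2 ^ q % 2 = 0) ↔ i.testBit q = false := by
    rw [Nat.testBit_eq_decide_div_mod_eq]; simp
  have h35 : 3 + 2 * q ≠ 5 + 2 * q := by omega
  have h45 : 4 + 2 * q ≠ 5 + 2 * q := by omega
  rw [stepGates, circOp_append]
  split_ifs with h
  · rw [circOp_cons, circOp_nil, gateOp_cnot h35, circOp_tof (by omega) h35 h45, stepFun, e.1 h]
    simp only [Function.update_of_ne h35, Function.update_of_ne h45, Function.update_self,
      Function.update_idem]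
    congr 2
    cases v (3 + 2 * q) <;> cases v (4 + 2 * q) <;> cases v (5 + 2 * q) <;> rfl
  · rw [circOp_nil, circOp_tof (by omega) h35 h45, stepFun,
      show i.testBit q = true by simpa [e] using h]
    simp

theorem stepFun_stepFun (i q : ℕ) (v : ℕ → Bool) : stepFun i q (stepFun i q v) = v := by
  simp [stepFun]

/-- The effect of the first `D` steps of the comparison. -/
def chainFun (i : ℕ) : ℕ → (ℕ → Bool) → ℕ → Bool
  | 0, v => v
  | D + 1, v => stepFun i D (chainFun i D v)

/-- The inverse of `chainFun`. -/
def chainInv (i : ℕ) : ℕ → (ℕ → Bool) → ℕ → Bool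
  | 0, v => v
  | D + 1, v => chainInv i D (stepFun i D v)

theorem chainInv_chainFun (i D : ℕ) (v : ℕ → Bool) : chainInv i D (chainFun i D v) = v := by
  induction D with
  | zero => rfl
  | succ D ih => rw [chainInv, chainFun, stepFun_stepFun, ih]

theorem circOp_chainUp (i D : ℕ) (ψ : RegState) :
    circOp (chainUp i D) ψ = fun v => ψ (chainInv i D v) := by
  induction D with
  | zero => rfl
  | succ D ih =>
    rw [chainUp, List.range_succ, List.flatMap_append, circOp_append, ← chainUp, ih,
      List.flatMap_singleton, circOp_stepGates]
    rfl

theorem chainDown_succ (i D : ℕ) : chainDown i (D + 1) = stepGates i D ++ chainDown i D := by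
  rw [chainDown, List.range_succ_eq_map, List.flatMap_cons, List.flatMap_map, chainDown]
  congr 2
  funext r
  rw [Nat.succ_eq_add_one, show D + 1 - 1 - (r + 1) = D - 1 - r by omega]

theorem circOp_chainDown (i D : ℕ) (ψ : RegState) :
    circOp (chainDown i D) ψ = fun v => ψ (chainFun i D v) := by
  induction D generalizing ψ with
  | zero => rfl
  | succ D ih =>
    rw [chainDown_succ, circOp_append, circOp_stepGates, ih]
    rfl

/-- The circuit `gs` acts in the basis that is permuted by the comparison. -/
theorem circOp_sandwich (i D : ℕ) (gs : List (ℕ × ℕ × ℕ)) (ψ : RegState) (v : ℕ → Bool) :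
    circOp (chainUp i D ++ gs ++ chainDown i D) ψ v =
      circOp gs (fun v => ψ (chainInv i D v)) (chainFun i D v) := by
  rw [circOp_append, circOp_append, circOp_chainUp, circOp_chainDown]

theorem chainFun_apply (i D : ℕ) (v : ℕ → Bool) {j : ℕ} (hj : ∀ q < D, j ≠ 5 + 2 * q) :
    chainFun i D v j = v j := by
  induction D with
  | zero => rfl
  | succ D ih =>
    rw [chainFun, stepFun, Function.update_of_ne (hj D (by omega)), ih fun q hq => hj q (by omega)]

theorem chainInv_update (i D : ℕ) (v : ℕ → Bool) {j : ℕ} (hj : j < 3) (b : Bool) :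
    chainInv i D (Function.update v j b) = Function.update (chainInv i D v) j b := by
  induction D generalizing v with
  | zero => rfl
  | succ D ih =>
    rw [chainInv, chainInv, ← ih, stepFun, stepFun, Function.update_comm (by omega)]
    simp only [Function.update_of_ne (show 3 + 2 * D ≠ j by omega),
      Function.update_of_ne (show 4 + 2 * D ≠ j by omega),
      Function.update_of_ne (show 5 + 2 * D ≠ j by omega)]

/-- The auxiliary qubits have their initial values; these are all qubits except the qubits `1` and
`2` and the address in the qubits `4 + 2 * q`. -/
def Clean (D : ℕ) (v : ℕ → Bool) : Prop :=
  v 0 = false ∧ v 3 = true ∧ (∀ q < D, v (5 + 2 * q) = false) ∧ ∀ j, 4 + 2 * D ≤ j → v j = false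

/-- The address, a number with `D` binary digits. -/
def address (D : ℕ) (v : ℕ → Bool) : ℕ := Nat.ofBits fun q : Fin D => v (4 + 2 * q)

theorem address_lt (D : ℕ) (v : ℕ → Bool) : address D v < 2 ^ D := Nat.ofBits_lt_two_pow _

theorem testBit_address {D q : ℕ} (h : q < D) (v : ℕ → Bool) :
    (address D v).testBit q = v (4 + 2 * q) := Nat.testBit_ofBits_lt _ _ h

theorem address_eq_iff {D i : ℕ} (hi : i < 2 ^ D) (v : ℕ → Bool) :
    address D v = i ↔ ∀ q < D, v (4 + 2 * q) = i.testBit q := by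
  constructor
  · rintro rfl q hq
    rw [testBit_address hq]
  · intro h
    refine Nat.eq_of_testBit_eq fun q => ?_
    rcases Nat.lt_or_ge q D with hq | hq
    · rw [testBit_address hq, h q hq]
    · have hle : 2 ^ D ≤ 2 ^ q := Nat.pow_le_pow_right (by norm_num) hq
      rw [Nat.testBit_lt_two_pow ((address_lt D v).trans_le hle),
        Nat.testBit_lt_two_pow (hi.trans_le hle)]

/-- The last auxiliary qubit of the comparison tells whether the address is `i`. -/
theorem chainFun_top {i D : ℕ} (hi : i < 2 ^ D) {v : ℕ → Bool} (hv : Clean D v) :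
    chainFun i D v (3 + 2 * D) = decide (address D v = i) := by
  have key : ∀ r ≤ D, chainFun i r v (3 + 2 * r) =
      decide (∀ q < r, v (4 + 2 * q) = i.testBit q) := by
    intro r
    induction r with
    | zero => intro _; simpa [chainFun] using hv.2.1
    | succ r ih =>
      intro hr
      rw [chainFun, show 3 + 2 * (r + 1) = 5 + 2 * r by ring, stepFun, Function.update_self,
        ih (by omega), chainFun_apply i r v (j := 4 + 2 * r) (by intros; omega),
        chainFun_apply i r v (j := 5 + 2 * r) (by intros; omega), hv.2.2.1 r (by omega),
        Bool.xor_false, Bool.eq_iff_iff]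
      simp only [Bool.and_eq_true, decide_eq_true_eq, beq_iff_eq]
      exact ⟨fun h q hq => by
        rcases Nat.lt_succ_iff_lt_or_eq.1 hq with h' | rfl
        · exact h.1 q h'
        · exact h.2, fun h => ⟨fun q hq => h q (by omega), h r (by omega)⟩⟩
  rw [key D le_rfl, Bool.eq_iff_iff, decide_eq_true_eq, decide_eq_true_eq, address_eq_iff hi]

/-! ### The states of the algorithm -/

noncomputable instance (D : ℕ) : DecidablePred (Clean D) := fun _ => Classical.propDecidable _

/-- The superposition of the addresses with the amplitudes `α`, where the qubits `2` and `1` hold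
the values of `X` and `F` at the address. -/
noncomputable def addrState (D : ℕ) (α : ℕ → ℂ) (X F : ℕ → Bool) : RegState := fun v =>
  if Clean D v ∧ v 2 = X (address D v) ∧ v 1 = F (address D v) then α (address D v) else 0

theorem clean_update {D j : ℕ} (hj : j = 1 ∨ j = 2) (v : ℕ → Bool) (b : Bool) :
    Clean D (Function.update v j b) ↔ Clean D v := by
  have h : ∀ j', j' ≠ 1 → j' ≠ 2 → Function.update v j b j' = v j' := fun j' h1 h2 =>
    Function.update_of_ne (by omega) _ _
  unfold Clean
  rw [h 0 (by omega) (by omega), h 3 (by omega) (by omega)]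
  refine and_congr_right fun _ => and_congr_right fun _ => and_congr ?_ ?_
  · exact forall_congr' fun q => by rw [h _ (by omega) (by omega)]
  · exact forall_congr' fun q => forall_congr' fun hq => by rw [h _ (by omega) (by omega)]

theorem address_update {D j : ℕ} (hj : j = 1 ∨ j = 2) (v : ℕ → Bool) (b : Bool) :
    address D (Function.update v j b) = address D v := by
  unfold address
  congr 1
  funext q
  exact Function.update_of_ne (by omega) _ _

variable {D i : ℕ} (hi : i < 2 ^ D) (α : ℕ → ℂ) (X F : ℕ → Bool)
include hi

theorem circOp_xGates : circOp (xGates D i) (addrState D α X F) =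
    addrState D α (Function.update X i (!X i)) F := by
  funext v
  have h2 : 3 + 2 * D ≠ 2 := by omega
  rw [xGates, circOp_sandwich, circOp_cons, circOp_nil, gateOp_cnot h2,
    chainInv_update i D _ (by norm_num), chainInv_chainFun,
    chainFun_apply i D v (j := 2) (by intros; omega)]
  simp only [addrState, clean_update (j := 2) (.inr rfl),
    address_update (j := 2) (.inr rfl), Function.update_self,
    Function.update_of_ne (show (1 : ℕ) ≠ 2 by norm_num)]
  by_cases hv : Clean D v
  · rw [chainFun_top hi hv]
    by_cases ha : address D v = i
    · subst ha
      cases v 2 <;> cases X (address D v) <;> simp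
    · simp [ha]
  · simp [hv]

theorem circOp_phaseGates : circOp (phaseGates D i) (addrState D α X F) =
    addrState D (fun a => if a = i ∧ X i = true then -α a else α a) X F := by
  funext v
  have h2 : 3 + 2 * D ≠ 2 := by omega
  rw [phaseGates, circOp_sandwich, circOp_cz h2, chainInv_chainFun,
    chainFun_apply i D v (j := 2) (by intros; omega)]
  simp only [addrState]
  by_cases hv : Clean D v
  · rw [chainFun_top hi hv]
    by_cases ha : address D v = i
    · subst ha
      cases v 2 <;> cases X (address D v) <;> simp
    · simp [ha]
  · simp [hv]

theorem circOp_flagGates : circOp (flagGates D i) (addrState D α X F) =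
    addrState D α X (Function.update F i (xor (X i) (F i))) := by
  funext v
  rw [flagGates, circOp_sandwich, circOp_tof (by omega) (by omega) (by norm_num),
    chainInv_update i D _ (by norm_num), chainInv_chainFun,
    chainFun_apply i D v (j := 2) (by intros; omega),
    chainFun_apply i D v (j := 1) (by intros; omega)]
  simp only [addrState, clean_update (j := 1) (.inl rfl),
    address_update (j := 1) (.inl rfl), Function.update_self,
    Function.update_of_ne (show (2 : ℕ) ≠ 1 by norm_num)]
  by_cases hv : Clean D v
  · rw [chainFun_top hi hv]
    by_cases ha : address D v = i
    · subst ha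
      cases v 2 <;> cases v 1 <;> cases X (address D v) <;> cases F (address D v) <;> simp
    · simp [ha]
  · simp [hv]

end OnlineQuantum

namespace OnlineQuantum

/-! ### The diffusion operator -/

open Classical in
/-- The basis state `u`. -/
noncomputable def basisState (u : ℕ → Bool) : RegState := fun v => if v = u then 1 else 0

/-- All qubits except the address have their initial values. -/
def Reset (D : ℕ) (v : ℕ → Bool) : Prop := Clean D v ∧ v 2 = false ∧ v 1 = false

theorem clean_update_address {D q : ℕ} (hq : q < D) (v : ℕ → Bool) (b : Bool) :
    Clean D (Function.update v (4 + 2 * q) b) ↔ Clean D v := by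
  have h : ∀ j, j ≠ 4 + 2 * q → Function.update v (4 + 2 * q) b j = v j := fun j h1 =>
    Function.update_of_ne h1 _ _
  unfold Clean
  rw [h 0 (by omega), h 3 (by omega)]
  refine and_congr_right fun _ => and_congr_right fun _ => and_congr ?_ ?_
  · exact forall_congr' fun q => by rw [h _ (by omega)]
  · exact forall_congr' fun q => forall_congr' fun hq => by rw [h _ (by omega)]

theorem reset_update {D q : ℕ} (hq : q < D) (v : ℕ → Bool) (b : Bool) :
    Reset D (Function.update v (4 + 2 * q) b) ↔ Reset D v := by
  unfold Reset
  rw [clean_update_address hq, Function.update_of_ne (by omega), Function.update_of_ne (by omega)]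

theorem reset_iff {D : ℕ} {v : ℕ → Bool} :
    Reset D v ↔ ∀ j, (∀ q < D, j ≠ 4 + 2 * q) → v j = decide (j = 3) := by
  constructor
  · rintro ⟨⟨h0, h3, h5, h6⟩, h2, h1⟩ j hj
    by_cases hlt : 4 + 2 * D ≤ j
    · rw [h6 j hlt]
      simp
      omega
    · rcases Nat.even_or_odd' j with ⟨m, rfl | rfl⟩
      · rcases m with _ | _ | m
        · simpa using h0
        · simpa using h2
        · exact absurd (by ring) (hj m (by omega))
      · rcases m with _ | _ | m
        · simpa using h1
        · simpa using h3
        · rw [show 2 * (m + 1 + 1) + 1 = 5 + 2 * m by ring, h5 m (by omega)]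
          simp
          omega
  · intro h
    refine ⟨⟨?_, ?_, ?_, ?_⟩, ?_, ?_⟩
    · rw [h 0 (by omega)]; simp
    · rw [h 3 (by omega)]; simp
    · intro q hq
      rw [h _ (by omega)]
      simp
      omega
    · intro j hj
      rw [h j (by omega)]
      simp
      omega
    · rw [h 2 (by omega)]; simp
    · rw [h 1 (by omega)]; simp

theorem hadDown_succ (r : ℕ) :
    hadDown (r + 1) = (4 + 2 * r, 3 + 2 * r, 0) :: hadDown r := by
  rw [hadDown, List.range_succ_eq_map, List.map_cons, List.map_map, hadDown]
  congr 1
  refine List.map_congr_left fun j _ => ?_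
  rw [Function.comp, Nat.succ_eq_add_one, show r + 1 - 1 - (j + 1) = r - 1 - j by omega]

theorem hadUp_succ (r : ℕ) : hadUp (r + 1) = hadUp r ++ [(4 + 2 * r, 3 + 2 * r, 0)] := by
  simp [hadUp, List.range_succ]

theorem circOp_hadDown_hadUp (r : ℕ) (ψ : RegState) :
    circOp (hadDown r) (circOp (hadUp r) ψ) = ψ := by
  induction r with
  | zero => rfl
  | succ r ih =>
    rw [hadUp_succ, hadDown_succ, circOp_append, circOp_cons, circOp_cons, circOp_nil,
      gateOp_had_had (by omega), ih]

open Classical in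
theorem circOp_hadDown_basisState (D : ℕ) (u v : ℕ → Bool)
    (hu : ∀ q < D, u (4 + 2 * q) = false) :
    circOp (hadDown D) (basisState u) v =
      if ∀ j, (∀ q < D, j ≠ 4 + 2 * q) → v j = u j then invSqrtTwo ^ D else 0 := by
  have key : ∀ n ≤ D, ∀ v, circOp ((List.range n).map fun r =>
      (4 + 2 * (D - 1 - r), 3 + 2 * (D - 1 - r), 0)) (basisState u) v =
      if ∀ j, (∀ r < n, j ≠ 4 + 2 * (D - 1 - r)) → v j = u j then invSqrtTwo ^ n else 0 := by
    intro n
    induction n with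
    | zero =>
      intro _ v
      simp [basisState, funext_iff]
    | succ n ih =>
      intro hn v
      have hne : 4 + 2 * (D - 1 - n) ≠ 3 + 2 * (D - 1 - n) := by omega
      rw [List.range_succ, List.map_append, circOp_append, List.map_singleton, circOp_cons,
        circOp_nil, gateOp_had hne, ih (by omega), ih (by omega)]
      -- The qubit of the next Hadamard gate is `0` in `u`, so that only one of its two values
      -- contributes.
      have h1 : ¬∀ j, (∀ r < n, j ≠ 4 + 2 * (D - 1 - r)) →
          Function.update v (4 + 2 * (D - 1 - n)) true j = u j := by
        intro h
        have := h (4 + 2 * (D - 1 - n)) (by intro r hr; omega)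
        rw [Function.update_self, hu _ (by omega)] at this
        exact absurd this (by simp)
      have h0 : (∀ j, (∀ r < n, j ≠ 4 + 2 * (D - 1 - r)) →
          Function.update v (4 + 2 * (D - 1 - n)) false j = u j) ↔
          ∀ j, (∀ r < n + 1, j ≠ 4 + 2 * (D - 1 - r)) → v j = u j := by
        constructor
        · intro h j hj
          rw [← h j (fun r hr => hj r (by omega)), Function.update_of_ne (hj n (by omega))]
        · intro h j hj
          by_cases e : j = 4 + 2 * (D - 1 - n)
          · rw [e, Function.update_self, hu _ (by omega)]
          · rw [Function.update_of_ne e]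
            refine h j fun r hr => ?_
            rcases Nat.lt_succ_iff_lt_or_eq.1 hr with h' | rfl
            · exact hj r h'
            · exact e
      rw [if_neg h1, if_congr h0 rfl rfl, mul_zero, add_zero, mul_ite, mul_zero, pow_succ']
  rw [hadDown, key D le_rfl]
  refine if_congr (forall_congr' fun j => imp_congr_left ?_) rfl rfl
  constructor
  · intro h q hq
    have := h (D - 1 - q) (by omega)
    rwa [show D - 1 - (D - 1 - q) = q by omega] at this
  · intro h r hr
    exact h _ (by omega)

/-- The basis state `v` with the number `i` as its address. -/
def setAddress (r : ℕ) (v : ℕ → Bool) (i j : ℕ) : Bool :=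
  if 4 ≤ j ∧ j < 4 + 2 * r ∧ j % 2 = 0 then i.testBit ((j - 4) / 2) else v j

theorem circOp_hadUp_apply (r : ℕ) (φ : RegState) (v : ℕ → Bool)
    (hv : ∀ q < r, v (4 + 2 * q) = false) :
    circOp (hadUp r) φ v = invSqrtTwo ^ r * ∑ i ∈ Finset.range (2 ^ r), φ (setAddress r v i) := by
  induction r generalizing v with
  | zero =>
    simp only [hadUp, List.range_zero, List.map_nil, circOp_nil, pow_zero, one_mul,
      Finset.range_one, Finset.sum_singleton]
    congr 1
    funext j
    rw [setAddress, if_neg (by omega)]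
  | succ r ih =>
    have hvr := hv r (by omega)
    have e : Function.update v (4 + 2 * r) false = v := by rw [← hvr, Function.update_eq_self]
    rw [hadUp_succ, circOp_append, circOp_cons, circOp_nil, gateOp_had (by omega), e,
      ih v fun q hq => hv q (by omega), ih _ fun q hq => by
        rw [Function.update_of_ne (by omega)]; exact hv q (by omega), hvr, pow_succ 2, mul_two,
      Finset.sum_range_add, pow_succ']
    have h1 : ∀ i ∈ Finset.range (2 ^ r), φ (setAddress r v i) = φ (setAddress (r + 1) v i) := by
      intro i hi
      congr 1
      funext j
      unfold setAddress
      by_cases hj : j = 4 + 2 * r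
      · subst hj
        rw [if_neg (by omega), if_pos (by omega), hvr, show (4 + 2 * r - 4) / 2 = r by omega,
          Nat.testBit_lt_two_pow (Finset.mem_range.1 hi)]
      · exact if_congr (by omega) rfl rfl
    have h2 : ∀ i ∈ Finset.range (2 ^ r),
        φ (setAddress r (Function.update v (4 + 2 * r) true) i) =
          φ (setAddress (r + 1) v (2 ^ r + i)) := by
      intro i hi
      congr 1
      funext j
      unfold setAddress
      by_cases hj : j = 4 + 2 * r
      · subst hj
        rw [if_neg (by omega), if_pos (by omega), Function.update_self,
          show (4 + 2 * r - 4) / 2 = r by omega, Nat.testBit_two_pow_add_eq,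
          Nat.testBit_lt_two_pow (Finset.mem_range.1 hi)]
        rfl
      · rw [Function.update_of_ne hj]
        by_cases hc : 4 ≤ j ∧ j < 4 + 2 * r ∧ j % 2 = 0
        · rw [if_pos hc, if_pos (by omega), Nat.testBit_two_pow_add_gt (by omega)]
        · rw [if_neg hc, if_neg (by omega)]
    rw [Finset.sum_congr rfl h1, Finset.sum_congr rfl h2]
    simp
    ring

theorem circOp_hadUp_eq_zero (D : ℕ) (φ : RegState) (hφ : ∀ v, ¬Reset D v → φ v = 0) :
    ∀ v, ¬Reset D v → circOp (hadUp D) φ v = 0 := by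
  have key : ∀ r ≤ D, ∀ v, ¬Reset D v → circOp (hadUp r) φ v = 0 := by
    intro r
    induction r with
    | zero => exact fun _ => hφ
    | succ r ih =>
      intro hr v hv
      rw [hadUp_succ, circOp_append, circOp_cons, circOp_nil, gateOp_had (by omega),
        ih (by omega) _ (by rwa [reset_update (by omega)]),
        ih (by omega) _ (by rwa [reset_update (by omega)])]
      simp
  exact key D le_rfl

theorem addrState_false (D : ℕ) (α : ℕ → ℂ) (v : ℕ → Bool) [Decidable (Reset D v)] :
    addrState D α (fun _ => false) (fun _ => false) v =
      if Reset D v then α (address D v) else 0 := by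
  unfold addrState
  exact if_congr Iff.rfl rfl rfl

theorem circOp_prepGates (D : ℕ) : circOp (prepGates D) (basisState fun _ => false) =
    addrState D (fun _ => invSqrtTwo ^ D) (fun _ => false) fun _ => false := by
  classical
  have h : circOp (notGates 3 2) (basisState fun _ => false) =
      basisState fun j => decide (j = 3) := by
    funext v
    rw [circOp_not (by norm_num), basisState, basisState]
    refine if_congr ?_ rfl rfl
    simp only [funext_iff]
    refine forall_congr' fun j => ?_
    by_cases hj : j = 3
    · subst hj; simp
    · rw [Function.update_of_ne hj]; simp [hj]
  funext v
  rw [prepGates, circOp_append, h, circOp_hadDown_basisState D _ _ (by intros; simp; omega),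
    addrState_false]
  exact if_congr reset_iff.symm rfl rfl

theorem address_setAddress {D i : ℕ} (hi : i < 2 ^ D) (v : ℕ → Bool) :
    address D (setAddress D v i) = i := by
  rw [address_eq_iff hi]
  intro q hq
  rw [setAddress, if_pos (by omega), show (4 + 2 * q - 4) / 2 = q by omega]

theorem setAddress_of_forall {D i j : ℕ} (v : ℕ → Bool) (h : ∀ q < D, j ≠ 4 + 2 * q) :
    setAddress D v i j = v j := by
  rw [setAddress, if_neg]
  rintro ⟨h1, h2, h3⟩
  exact h ((j - 4) / 2) (by omega) (by omega)

theorem reset_setAddress {D : ℕ} (v : ℕ → Bool) (i : ℕ) :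
    Reset D (setAddress D v i) ↔ Reset D v := by
  rw [reset_iff, reset_iff]
  exact forall_congr' fun j => forall_congr' fun hj => by rw [setAddress_of_forall v hj]

/-- The diffusion operator sends `α a` to `α a - 2 * μ`, where `μ` is the mean of `α`. -/
theorem circOp_diffGates (D : ℕ) (α : ℕ → ℂ) :
    circOp (diffGates D) (addrState D α (fun _ => false) fun _ => false) =
      addrState D (fun a => α a - 2 * ((∑ i ∈ Finset.range (2 ^ D), α i) / 2 ^ D))
        (fun _ => false) fun _ => false := by
  classical
  set φ := addrState D α (fun _ => false) fun _ => false with hφ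
  set u : ℕ → Bool := fun j => decide (j = 3) with hu
  have hu4 : ∀ q < D, u (4 + 2 * q) = false := by intros; simp [u]; omega
  have hur : Reset D u := reset_iff.2 fun _ _ => rfl
  have hsupp := circOp_hadUp_eq_zero D φ fun v hv => by rw [hφ, addrState_false, if_neg hv]
  have hsum : circOp (hadUp D) φ u = invSqrtTwo ^ D * ∑ i ∈ Finset.range (2 ^ D), α i := by
    rw [circOp_hadUp_apply D φ u hu4]
    congr 1
    refine Finset.sum_congr rfl fun i hi => ?_
    rw [hφ, addrState_false, if_pos ((reset_setAddress u i).2 hur),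
      address_setAddress (Finset.mem_range.1 hi)]
  -- The sign change of the address `0` is the reflection that reverses the basis state `u`.
  have hmid : circOp (chainUp 0 D ++ List.replicate 4 (3 + 2 * D, 2, 1) ++ chainDown 0 D)
      (circOp (hadUp D) φ) = fun v => circOp (hadUp D) φ v +
        (-2 * circOp (hadUp D) φ u) * basisState u v := by
    funext v
    rw [circOp_sandwich, circOp_replicate_t (by omega), chainInv_chainFun, tPhase_pow_four]
    by_cases hv : Reset D v
    · rw [chainFun_top (by positivity) hv.1, basisState]
      have : address D v = 0 ↔ v = u := by
        rw [address_eq_iff (by positivity)]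
        constructor
        · intro h
          funext j
          by_cases hj : ∀ q < D, j ≠ 4 + 2 * q
          · rw [reset_iff.1 hv j hj]
          · push Not at hj
            obtain ⟨q, hq, rfl⟩ := hj
            rw [h q hq, hu4 q hq, Nat.zero_testBit]
        · rintro rfl q hq
          rw [hu4 q hq, Nat.zero_testBit]
      by_cases h0 : v = u
      · rw [decide_eq_true (this.2 h0), if_pos h0, h0, if_pos rfl]
        ring
      · simp [this, h0]
    · rw [hsupp v hv, basisState, if_neg (fun h : v = u => hv (h.symm ▸ hur))]
      simp
  have hpow : invSqrtTwo ^ D * invSqrtTwo ^ D = 1 / 2 ^ D := by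
    rw [← mul_pow, invSqrtTwo_mul_self, one_div, one_div, inv_pow]
  rw [diffGates, circOp_append, circOp_append, hmid, circOp_add_mul, circOp_hadDown_hadUp]
  funext v
  rw [circOp_hadDown_basisState D u v hu4, hφ, addrState_false, addrState_false, ← hφ, hsum,
    if_congr reset_iff.symm rfl rfl]
  split_ifs
  · linear_combination (-2 * ∑ i ∈ Finset.range (2 ^ D), α i) * hpow
  · ring

end OnlineQuantum

namespace OnlineQuantum

/-! ### Circuits on finitely many qubits -/

/-- A basis state of `m` qubits as a basis state of the infinite register. -/
def extendReg (m : ℕ) (v : Fin m → Bool) (j : ℕ) : Bool := if h : j < m then v ⟨j, h⟩ else false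

/-- The restriction of a state of the infinite register to `m` qubits. -/
def restrictReg (m : ℕ) (ψ : RegState) : QState m := fun v => ψ (extendReg m v)

/-- A gate given by natural numbers as a gate on `m` qubits; out-of-range numbers are reduced. -/
def toGate {m : ℕ} (hm : 0 < m) (g : ℕ × ℕ × ℕ) : Gate m :=
  ⟨⟨g.1 % m, Nat.mod_lt _ hm⟩, ⟨g.2.1 % m, Nat.mod_lt _ hm⟩,
    ⟨g.2.2 % 3, Nat.mod_lt _ (by norm_num)⟩⟩

theorem extendReg_update {m a : ℕ} (ha : a < m) (v : Fin m → Bool) (b : Bool) :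
    extendReg m (Function.update v ⟨a, ha⟩ b) = Function.update (extendReg m v) a b := by
  funext j
  by_cases hj : j = a
  · subst hj
    simp [extendReg, ha]
  · rw [Function.update_of_ne hj]
    unfold extendReg
    split_ifs
    · exact Function.update_of_ne (by simpa [Fin.ext_iff] using hj) _ _
    · rfl

theorem extendReg_apply {m a : ℕ} (ha : a < m) (v : Fin m → Bool) :
    extendReg m v a = v ⟨a, ha⟩ := by simp [extendReg, ha]

theorem apply_toGate {m : ℕ} (hm : 0 < m) {g : ℕ × ℕ × ℕ}
    (hg : g.1 < m ∧ g.2.1 < m ∧ g.2.2 ≤ 2) (ψ : RegState) :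
    (toGate hm g).apply (restrictReg m ψ) = restrictReg m (gateOp g ψ) := by
  obtain ⟨a, b, c⟩ := g
  obtain ⟨ha, hb, hc⟩ := hg
  dsimp only at ha hb hc
  have hG : toGate hm (a, b, c) = ⟨⟨a, ha⟩, ⟨b, hb⟩, ⟨c, by omega⟩⟩ := by
    simp [toGate, Nat.mod_eq_of_lt ha, Nat.mod_eq_of_lt hb, Nat.mod_eq_of_lt (show c < 3 by omega)]
  rw [hG]
  funext v
  unfold Gate.apply gateOp
  simp only [Fin.ext_iff]
  by_cases hab : a = b
  · simp [hab]
  · rw [if_neg hab, if_neg hab]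
    obtain rfl | rfl | rfl : c = 0 ∨ c = 1 ∨ c = 2 := by omega
    · simp [applyOne, restrictReg, extendReg_update, extendReg_apply ha]
    · simp only [Fin.val_zero, Fin.val_one, one_ne_zero, if_false, if_true, applyOne, restrictReg,
        extendReg_apply ha, tGate, Matrix.diagonal_apply, ite_mul, zero_mul, Finset.sum_ite_eq,
        Finset.mem_univ]
      rw [Function.update_eq_self]
      rfl
    · simp [applyCNOT, restrictReg, extendReg_update, extendReg_apply ha, extendReg_apply hb]

theorem circuitState_toGate {m : ℕ} (hm : 0 < m) (gs : List (ℕ × ℕ × ℕ))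
    (hgs : ∀ g ∈ gs, g.1 < m ∧ g.2.1 < m ∧ g.2.2 ≤ 2) :
    circuitState (gs.map (toGate hm)) =
      restrictReg m (circOp gs (basisState fun _ => false)) := by
  have h0 : zeroState m = restrictReg m (basisState fun _ => false) := by
    funext v
    classical
    unfold zeroState restrictReg basisState
    rw [Pi.single_apply]
    refine if_congr ?_ rfl rfl
    constructor
    · rintro rfl
      funext j
      simp [extendReg]
    · intro h
      funext j
      have := congrFun h j
      rwa [extendReg_apply j.2] at this
  rw [circuitState, h0]
  generalize (basisState fun _ => false) = ψ
  induction gs generalizing ψ with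
  | nil => rfl
  | cons g gs ih =>
    rw [List.map_cons, List.foldl_cons, apply_toGate hm (hgs g (by simp)),
      ih (fun g hg => hgs g (by simp [hg])), circOp_cons]

theorem binary_encodeCircuit {m : ℕ} (hm : 0 < m) (gs : List (ℕ × ℕ × ℕ))
    (hgs : ∀ g ∈ gs, g.1 < m ∧ g.2.1 < m ∧ g.2.2 ≤ 2) :
    encodeCircuit (((0, 0, 0) :: gs).map (toGate hm)) = dummyWord ++ gateWords gs := by
  have key : ∀ (x : List Letter) (xs : List (List Letter)),
      [Letter.hash].intercalate (x :: xs) = x ++ xs.flatMap fun y => Letter.hash :: y := by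
    intro x xs
    induction xs generalizing x with
    | nil => simp
    | cons y ys ih =>
      rw [List.intercalate_cons_cons, ih]
      simp
  rw [encodeCircuit, List.map_cons, List.flatMap_cons, List.cons_append, key, dummyWord,
    gateWords, List.cons_append, List.cons_append, List.nil_append, List.flatMap_cons,
    List.flatMap_cons, List.flatMap_assoc, List.flatMap_map]
  have h : (gs.flatMap fun a => [binary (toGate hm a).a.val, binary (toGate hm a).b.val,
      binary (toGate hm a).c.val].flatMap fun y => Letter.hash :: y) = gs.flatMap gateWord := by
    refine List.flatMap_congr fun g hg => ?_
    obtain ⟨h1, h2, h3⟩ := hgs g hg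
    simp [toGate, gateWord, Nat.mod_eq_of_lt h1, Nat.mod_eq_of_lt h2,
      Nat.mod_eq_of_lt (show g.2.2 < 3 by omega)]
  rw [h]
  simp [toGate, binary]

/-! ### Conservation of the norm -/

/-- The square of the Euclidean norm of a state. -/
noncomputable def normSq {m : ℕ} (ψ : QState m) : ℝ := ∑ v, ‖ψ v‖ ^ 2

theorem norm_invSqrtTwo_sq : ‖invSqrtTwo‖ ^ 2 = 1 / 2 := by
  rw [sq, ← norm_mul, invSqrtTwo_mul_self]
  norm_num

theorem norm_tPhase : ‖tPhase‖ = 1 := by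
  rw [tPhase, show Complex.I * Real.pi / 4 = ((Real.pi / 4 : ℝ) : ℂ) * Complex.I by push_cast; ring,
    Complex.norm_exp_ofReal_mul_I]

theorem applyOne_hadamard {m : ℕ} (a : Fin m) (ψ : QState m) (v : Fin m → Bool) :
    applyOne hadamard a ψ v = invSqrtTwo * (ψ (Function.update v a false) +
      (if v a then -1 else 1) * ψ (Function.update v a true)) := by
  simp only [applyOne, Fintype.sum_bool, hadamard, Matrix.of_apply, invSqrtTwo]
  cases v a <;> simp <;> ring

theorem normSq_applyOne_hadamard {m : ℕ} (a : Fin m) (ψ : QState m) :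
    normSq (applyOne hadamard a ψ) = normSq ψ := by
  have hinv : Function.Involutive fun v : Fin m → Bool => Function.update v a (!v a) := by
    intro v
    simp
  -- The basis states are paired by the flip of the qubit `a`, and the norm is conserved for each
  -- pair by the parallelogram law.
  have hdouble : ∀ f : (Fin m → Bool) → ℝ,
      2 * ∑ v, f v = ∑ v, (f v + f (Function.update v a (!v a))) := by
    intro f
    have := Equiv.sum_comp hinv.toPerm f
    simp only [Function.Involutive.coe_toPerm] at this
    rw [Finset.sum_add_distrib, two_mul, this]
  have hpar : ∀ x y : ℂ, ‖invSqrtTwo * (x + y)‖ ^ 2 + ‖invSqrtTwo * (x + -y)‖ ^ 2 =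
      ‖x‖ ^ 2 + ‖y‖ ^ 2 := by
    intro x y
    have := parallelogram_law_with_norm ℝ x y
    rw [norm_mul, norm_mul, mul_pow, mul_pow, norm_invSqrtTwo_sq, ← sub_eq_add_neg]
    linarith
  refine mul_left_cancel₀ (two_ne_zero (α := ℝ)) ?_
  unfold normSq
  rw [hdouble, hdouble]
  refine Finset.sum_congr rfl fun v _ => ?_
  rw [applyOne_hadamard, applyOne_hadamard]
  simp only [Function.update_self, Function.update_idem]
  cases hv : v a
  · have e : Function.update v a false = v := by rw [← hv, Function.update_eq_self]
    simpa [e] using hpar (ψ v) (ψ (Function.update v a true))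
  · have e : Function.update v a true = v := by rw [← hv, Function.update_eq_self]
    have := hpar (ψ (Function.update v a false)) (ψ v)
    simp only [e, Bool.not_true, if_true, Bool.false_eq_true, if_false, neg_mul, one_mul]
    linarith

theorem normSq_apply {m : ℕ} (g : Gate m) (ψ : QState m) : normSq (g.apply ψ) = normSq ψ := by
  unfold Gate.apply
  split_ifs with h1 h2 h3
  · rfl
  · exact normSq_applyOne_hadamard _ _
  · refine Finset.sum_congr rfl fun v _ => ?_
    simp only [applyOne, tGate, Matrix.diagonal_apply, ite_mul, zero_mul, Finset.sum_ite_eq,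
      Finset.mem_univ, if_true, Function.update_eq_self]
    split_ifs
    · rw [norm_mul]
      change (‖tPhase‖ * _) ^ 2 = _
      rw [norm_tPhase, one_mul]
    · rw [one_mul]
  · have hinv : Function.Involutive fun v : Fin m → Bool =>
        Function.update v g.b (xor (v g.a) (v g.b)) := by
      intro v
      simp [Function.update_of_ne h1]
    exact Equiv.sum_comp hinv.toPerm fun v => ‖ψ v‖ ^ 2

theorem normSq_circuitState {m : ℕ} (gs : List (Gate m)) : normSq (circuitState gs) = 1 := by
  have h : normSq (zeroState m) = 1 := by
    unfold normSq zeroState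
    rw [Finset.sum_eq_single (fun _ => false)]
    · simp
    · intro v _ hv
      simp [Pi.single_eq_of_ne hv]
    · simp
  unfold circuitState
  rw [← h]
  generalize zeroState m = ψ
  induction gs generalizing ψ with
  | nil => rfl
  | cons g gs ih => rw [List.foldl_cons, ih, normSq_apply]

/-- If the amplitudes with another value of the qubit `0` vanish, then the outcome `β` is certain,
since the norm of the state is `1`. -/
theorem measureFirst_eq_one {m : ℕ} (hm : 0 < m) (gs : List (ℕ × ℕ × ℕ))
    (hgs : ∀ g ∈ gs, g.1 < m ∧ g.2.1 < m ∧ g.2.2 ≤ 2) (β : Bool)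
    (h : ∀ v, v 0 ≠ β → circOp gs (basisState fun _ => false) v = 0) :
    measureFirst (circuitState (gs.map (toGate hm))) β = 1 := by
  rw [← normSq_circuitState (gs.map (toGate hm)), measureFirst, normSq]
  refine Finset.sum_congr rfl fun v _ => ?_
  rw [circuitState_toGate hm gs hgs]
  split_ifs with hv
  · rfl
  · rw [restrictReg, h]
    · simp
    · rw [extendReg_apply hm]
      exact fun h => hv ⟨hm, h⟩

/-! ### Measurements -/

theorem gateOp_eq_zero {g : ℕ × ℕ × ℕ} (hg : 1 ≤ g.1 ∧ 1 ≤ g.2.1) {ψ : RegState}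
    (hψ : ∀ v, v 0 ≠ false → ψ v = 0) (v : ℕ → Bool) (hv : v 0 ≠ false) : gateOp g ψ v = 0 := by
  unfold gateOp
  split_ifs
  · exact hψ v hv
  · refine Finset.sum_eq_zero fun q _ => ?_
    rw [hψ _ (by rwa [Function.update_of_ne (by omega)]), mul_zero]
  · exact mul_eq_zero_of_right _ (hψ v hv)
  · exact hψ _ (by rwa [Function.update_of_ne (by omega)])

/-- Gates that do not touch the qubit `0` leave it in the state `0`. -/
theorem circOp_eq_zero {gs : List (ℕ × ℕ × ℕ)} (hgs : ∀ g ∈ gs, 1 ≤ g.1 ∧ 1 ≤ g.2.1)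
    (v : ℕ → Bool) (hv : v 0 ≠ false) : circOp gs (basisState fun _ => false) v = 0 := by
  have key : ∀ ψ : RegState, (∀ v, v 0 ≠ false → ψ v = 0) →
      ∀ v, v 0 ≠ false → circOp gs ψ v = 0 := by
    induction gs with
    | nil => exact fun _ h => h
    | cons g gs ih =>
      intro ψ hψ
      exact ih (fun g hg => hgs g (by simp [hg])) _ (gateOp_eq_zero (hgs g (by simp)) hψ)
  refine key _ (fun v hv => if_neg ?_) v hv
  rintro rfl
  exact hv rfl

theorem circOp_append_notGates_eq_zero {gs : List (ℕ × ℕ × ℕ)}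
    (hgs : ∀ g ∈ gs, 1 ≤ g.1 ∧ 1 ≤ g.2.1) (v : ℕ → Bool) (hv : v 0 ≠ true) :
    circOp (gs ++ notGates 0 1) (basisState fun _ => false) v = 0 := by
  rw [circOp_append, circOp_not (by norm_num), circOp_eq_zero hgs]
  rw [Function.update_self]
  simpa using hv

variable {D : ℕ} {α : ℕ → ℂ} {F : ℕ → Bool} {gs : List (ℕ × ℕ × ℕ)}
  (h : circOp gs (basisState fun _ => false) = addrState D α (fun _ => false) F)
include h

theorem circOp_append_cnot_eq_zero (hF : ∀ i < 2 ^ D, F i = false) (v : ℕ → Bool)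
    (hv : v 0 ≠ false) : circOp (gs ++ [(1, 0, 2)]) (basisState fun _ => false) v = 0 := by
  rw [circOp_append, circOp_cons, circOp_nil, gateOp_cnot (by norm_num), h, addrState, if_neg]
  rintro ⟨h1, -, h2⟩
  have h3 := h1.1
  rw [Function.update_self] at h3
  rw [hF _ (address_lt _ _), Function.update_of_ne (by norm_num)] at h2
  rw [h2] at h3
  exact hv (by simpa using h3)

/-- The flagged addresses contribute to the probability of the outcome `1`. -/
theorem sum_le_measureFirst {m : ℕ} (hm : 0 < m) (hDm : 4 + 2 * D ≤ m)
    (hgs : ∀ g ∈ gs ++ [(1, 0, 2)], g.1 < m ∧ g.2.1 < m ∧ g.2.2 ≤ 2) :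
    ∑ i ∈ Finset.range (2 ^ D) with F i = true, ‖α i‖ ^ 2 ≤
      measureFirst (circuitState ((gs ++ [(1, 0, 2)]).map (toGate hm))) true := by
  classical
  -- The basis state in which the auxiliary qubits have their initial values, the address is flagged
  -- in the qubit `1`, and the flag has been copied to the qubit `0`.
  set u : ℕ → Bool := fun j => decide (j = 0 ∨ j = 1 ∨ j = 3) with hu
  set e : ℕ → Fin m → Bool := fun i j => setAddress D u i j with he
  have hext : ∀ i, extendReg m (e i) = setAddress D u i := by
    intro i
    funext j
    unfold extendReg
    split_ifs with hj
    · rfl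
    · rw [setAddress_of_forall u (by intros; omega)]
      simp [u]
      omega
  have hinj : Set.InjOn e {i | i < 2 ^ D} := by
    intro i hi i' hi' hii
    rw [← address_setAddress hi u, ← hext i, hii, hext i', address_setAddress hi' u]
  rw [measureFirst, circuitState_toGate hm _ hgs]
  refine le_trans ?_ (Finset.sum_le_univ_sum_of_nonneg
    (s := ((Finset.range (2 ^ D)).filter fun i => F i = true).image e) fun v => by positivity)
  rw [Finset.sum_image (hinj.mono fun i hi => by
    have := (Finset.mem_filter.1 hi).1
    exact Finset.mem_range.1 this)]
  refine le_of_eq (Finset.sum_congr rfl fun i hi => ?_)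
  obtain ⟨hi, hF⟩ := Finset.mem_filter.1 hi
  rw [Finset.mem_range] at hi
  have h0 : e i ⟨0, hm⟩ = true := by
    exact (setAddress_of_forall (i := i) (j := 0) u (by intros; omega)).trans (by simp [u])
  rw [if_pos ⟨hm, h0⟩, restrictReg, hext, circOp_append, circOp_cons, circOp_nil,
    gateOp_cnot (by norm_num), h]
  have e0 : setAddress D u i 0 = true := by
    rw [setAddress_of_forall u (by intros; omega)]; simp [u]
  have e1 : setAddress D u i 1 = true := by
    rw [setAddress_of_forall u (by intros; omega)]; simp [u]
  rw [e0, e1, Bool.xor_self]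
  set w := Function.update (setAddress D u i) 0 false with hw
  have hadr : address D w = i := by
    rw [address_eq_iff hi]
    intro q hq
    rw [hw, Function.update_of_ne (by omega), ← testBit_address hq (setAddress D u i),
      address_setAddress hi]
  have hwj : ∀ j, j ≠ 0 → (∀ q < D, j ≠ 4 + 2 * q) → w j = decide (j = 1 ∨ j = 3) := by
    intro j hj hq
    rw [hw, Function.update_of_ne hj, setAddress_of_forall u hq]
    simp [u, hj]
  have hclean : Clean D w := by
    refine ⟨by simp [w], ?_, ?_, ?_⟩
    · rw [hwj 3 (by norm_num) (by intros; omega)]; simp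
    · intro q _
      rw [hwj _ (by omega) (by intros; omega)]
      simp
      omega
    · intro j hj
      rw [hwj _ (by omega) (by intros; omega)]
      simp
      omega
  rw [addrState, if_pos, hadr]
  refine ⟨hclean, ?_, ?_⟩
  · rw [hwj 2 (by norm_num) (by intros; omega)]; simp
  · rw [hwj 1 (by norm_num) (by intros; omega), hadr, hF]; simp

end OnlineQuantum

namespace OnlineQuantum

/-! ### The number of good iteration counts -/

open Real

theorem le_sin_sq_of_mem {a : ℝ} (h1 : π / 6 ≤ a) (h2 : a ≤ 5 * π / 6) : 1 / 4 ≤ sin a ^ 2 := by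
  have h : 1 / 2 ≤ sin a := by
    rw [← sin_pi_div_six]
    rcases le_total a (π / 2) with h | h
    · exact sin_le_sin_of_le_of_le_pi_div_two (by linarith [pi_pos]) h h1
    · rw [← sin_pi_sub a]
      exact sin_le_sin_of_le_of_le_pi_div_two (by linarith [pi_pos]) (by linarith) (by linarith)
  nlinarith

/-- If `δ` is far from the multiples of `π`, and `a` is close to one, then `a + δ` is far. -/
theorem le_sin_add_sq {a δ : ℝ} (ha : sin a ^ 2 ≤ 1 / 4) (hδ : cos δ ^ 2 ≤ 1 / 4) :
    1 / 4 ≤ sin (a + δ) ^ 2 := by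
  have h1 := sin_sq_add_cos_sq a
  have h2 := sin_sq_add_cos_sq δ
  rw [sin_add]
  set x := sin a * cos δ with hx
  set y := cos a * sin δ with hy
  have hx2 : x ^ 2 ≤ (1 / 4) ^ 2 := by
    rw [hx, mul_pow]
    nlinarith [sq_nonneg (sin a), sq_nonneg (cos δ)]
  have hy2 : (3 / 4) ^ 2 ≤ y ^ 2 := by
    rw [hy, mul_pow]
    nlinarith
  have hxa : |x| ≤ 1 / 4 := by simpa using sq_le_sq.1 hx2
  have hya : 3 / 4 ≤ |y| := by
    have := sq_le_sq.1 hy2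
    rwa [abs_of_pos (by norm_num)] at this
  have h := abs_sub_abs_le_abs_sub y (-x)
  rw [abs_neg, sub_neg_eq_add, add_comm y x] at h
  rw [← sq_abs (x + y)]
  nlinarith

/-- If of any two numbers at distance `s` at least one satisfies `P`, then a third of the numbers
below `M` does: each number satisfies `P` or is at distance `s` to a number below `M` that does. -/
theorem card_le_three_mul {P : ℕ → Prop} [DecidablePred P] {s M : ℕ} (hs : 2 * s ≤ M)
    (h1 : ∀ j, ¬P j → P (j + s)) (h2 : ∀ j, ¬P (j + s) → P j) :
    M ≤ 3 * ((Finset.range M).filter P).card := by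
  set G := (Finset.range M).filter P with hG
  have hsub : Finset.range M ⊆ G ∪ G.image (· + s) ∪ G.image (· - s) := by
    intro j hj
    rw [Finset.mem_range] at hj
    simp only [Finset.mem_union, Finset.mem_image, hG, Finset.mem_filter, Finset.mem_range]
    by_cases hP : P j
    · exact .inl (.inl ⟨hj, hP⟩)
    · by_cases hjs : j + s < M
      · exact .inr ⟨j + s, ⟨hjs, h1 j hP⟩, by omega⟩
      · refine .inl (.inr ⟨j - s, ⟨by omega, h2 _ ?_⟩, by omega⟩)
        rwa [Nat.sub_add_cancel (by omega)]
  have := (Finset.card_le_card hsub).trans ((Finset.card_union_le _ _).trans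
    (Nat.add_le_add (Finset.card_union_le _ _) le_rfl))
  have := Finset.card_image_le (s := G) (f := (· + s))
  have := Finset.card_image_le (s := G) (f := (· - s))
  rw [Finset.card_range] at *
  omega

theorem card_le_three_mul_sin {θ : ℝ} {s M : ℕ} (hs : 2 * s ≤ M)
    (hδ : cos (2 * θ * s) ^ 2 ≤ 1 / 4) :
    M ≤ 3 * ((Finset.range M).filter fun j : ℕ => 1 / 4 ≤ sin ((2 * j + 1) * θ) ^ 2).card := by
  refine card_le_three_mul hs (fun j hj => ?_) fun j hj => ?_
  · have := le_sin_add_sq (not_le.1 hj).le hδ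
    push_cast
    convert this using 3
    ring
  · rw [← cos_neg] at hδ
    have := le_sin_add_sq (not_le.1 hj).le hδ
    push_cast at this
    convert this using 3
    ring

theorem cos_sq_le_of_mem {δ : ℝ} (h1 : π / 3 ≤ δ) (h2 : δ ≤ 2 * π / 3) : cos δ ^ 2 ≤ 1 / 4 := by
  have h3 : cos δ ≤ 1 / 2 := by
    rw [← cos_pi_div_three]
    exact cos_le_cos_of_nonneg_of_le_pi (by linarith [pi_pos]) (by linarith [pi_pos]) h1
  have h4 : -(1 / 2) ≤ cos δ := by
    rw [← cos_pi_div_three, ← cos_pi_sub]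
    exact cos_le_cos_of_nonneg_of_le_pi (by linarith [pi_pos]) (by linarith [pi_pos]) (by linarith)
  nlinarith

/-- A number of steps of length `2 * ψ` that lead approximately to `π / 2`. -/
theorem exists_shift {ψ : ℝ} (h0 : 0 < ψ) (h1 : ψ ≤ π / 6) :
    ∃ s : ℕ, 1 ≤ s ∧ 2 * ψ * (s - 1) < π / 3 ∧ cos (2 * ψ * s) ^ 2 ≤ 1 / 4 := by
  have hpos : 0 < π / 3 / (2 * ψ) := by positivity
  have hlt := Nat.ceil_lt_add_one hpos.le
  have hle := Nat.le_ceil (π / 3 / (2 * ψ))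
  rw [div_le_iff₀ (by positivity)] at hle
  rw [← sub_lt_iff_lt_add, lt_div_iff₀ (by positivity)] at hlt
  refine ⟨⌈π / 3 / (2 * ψ)⌉₊, Nat.ceil_pos.2 hpos, by linarith, cos_sq_le_of_mem ?_ ?_⟩
  · linarith
  · linarith

/-- For at least a quarter of the numbers `j` below `M`, the state after `j` Grover iterations has
a large overlap with the good addresses. -/
theorem le_four_mul_card_sin {θ : ℝ} {M : ℕ} (hM : 1 ≤ M) (h0 : 0 < θ) (h1 : θ ≤ π / 2)
    (hsin : 1 / (2 * M) ≤ sin θ) :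
    M ≤ 4 * ((Finset.range M).filter fun j : ℕ => 1 / 4 ≤ sin ((2 * j + 1) * θ) ^ 2).card := by
  set G := (Finset.range M).filter fun j : ℕ => 1 / 4 ≤ sin ((2 * j + 1) * θ) ^ 2 with hG
  have hM' : (1 : ℝ) ≤ M := by exact_mod_cast hM
  have hpi := pi_lt_d2
  have hpi' := pi_gt_three
  -- For `θ ≤ π / 6` there is a step `s` by which the angle changes by about `π / 2`. If it is small
  -- enough, then a third of the numbers is good; otherwise the angles stay below `5π / 6`, and
  -- those in the last quarter of the range are at least `π / 6`. For `θ` between `π / 6` and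
  -- `π / 3` the step is `1`. For larger `θ` the argument is repeated for the difference `φ` to
  -- `π / 2`, where now the angles at the beginning of the range are good.
  rcases le_or_gt θ (π / 3) with h3 | h3
  · rcases le_or_gt θ (π / 6) with h6 | h6
    · obtain ⟨s, hs1, hs2, hs3⟩ := exists_shift h0 h6
      rcases le_or_gt (2 * s) M with hsM | hsM
      · have : M ≤ 3 * G.card := card_le_three_mul_sin hsM hs3
        omega
      · have hup : ∀ j < M, (2 * (j : ℝ) + 1) * θ ≤ 5 * π / 6 := by
          intro j hj
          have h4 : (2 * (j : ℝ) + 1) ≤ 4 * (s - 1) + 1 := by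
            have : 2 * j + 1 + 4 ≤ 4 * s + 1 := by omega
            have : (2 * (j : ℝ) + 1 + 4) ≤ 4 * s + 1 := by exact_mod_cast this
            linarith
          have := mul_le_mul_of_nonneg_right h4 h0.le
          nlinarith
        rcases Nat.lt_or_ge 1 M with hM1 | hM1
        · have hM2 : (2 : ℝ) ≤ M := by exact_mod_cast hM1
          have hθ : 1 / (2 * M) ≤ θ := hsin.trans (sin_le h0.le)
          have hsub : Finset.Ico (M - (M + 3) / 4) M ⊆ G := by
            intro j hj
            rw [Finset.mem_Ico] at hj
            refine Finset.mem_filter.2 ⟨Finset.mem_range.2 hj.2, le_sin_sq_of_mem ?_ (hup j hj.2)⟩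
            have h5 : 3 * M ≤ 4 * j + 3 := by omega
            have h5' : 3 * (M : ℝ) ≤ 4 * j + 3 := by exact_mod_cast h5
            have h7 : (2 * (j : ℝ) + 1) * (1 / (2 * M)) ≤ (2 * (j : ℝ) + 1) * θ :=
              mul_le_mul_of_nonneg_left hθ (by positivity)
            refine le_trans ?_ h7
            rw [mul_one_div, le_div_iff₀ (by positivity)]
            nlinarith
          have := Finset.card_le_card hsub
          rw [Nat.card_Ico] at this
          omega
        · obtain rfl : M = 1 := by omega
          have : 0 ∈ G := by
            refine Finset.mem_filter.2 ⟨by simp, ?_⟩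
            have : 1 / 2 ≤ sin θ := by simpa using hsin
            simp only [Nat.cast_zero, mul_zero, zero_add, one_mul]
            nlinarith
          have := Finset.card_pos.2 ⟨0, this⟩
          omega
    · rcases Nat.lt_or_ge 1 M with hM1 | hM1
      · have : M ≤ 3 * G.card := card_le_three_mul_sin (θ := θ) (s := 1) (M := M) (by omega)
          (cos_sq_le_of_mem (by push_cast; linarith) (by push_cast; linarith))
        omega
      · have : 0 ∈ G := by
          refine Finset.mem_filter.2 ⟨Finset.mem_range.2 (by omega), le_sin_sq_of_mem ?_ ?_⟩
          · simpa using h6.le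
          · simp only [Nat.cast_zero, mul_zero, zero_add, one_mul]
            linarith
        have := Finset.card_pos.2 ⟨0, this⟩
        omega
  · set φ := π / 2 - θ with hφ
    have hcos : ∀ j : ℕ, sin ((2 * j + 1) * θ) ^ 2 = cos ((2 * j + 1) * φ) ^ 2 := by
      intro j
      have e : (2 * j + 1) * θ = (j * π + π / 2) - (2 * j + 1) * φ := by rw [hφ]; ring
      have hc : cos (j * π + π / 2) = 0 := by
        rw [cos_add_pi_div_two, sin_nat_mul_pi, neg_zero]
      have hs := sin_sq_add_cos_sq (j * π + π / 2)
      rw [hc] at hs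
      rw [e, sin_sub, hc]
      linear_combination cos ((2 * j + 1) * φ) ^ 2 * hs
    have hlow : ∀ j : ℕ, (2 * (j : ℝ) + 1) * φ ≤ π / 3 → 1 / 4 ≤ sin ((2 * j + 1) * θ) ^ 2 := by
      intro j hj
      have h5 : 0 ≤ (2 * (j : ℝ) + 1) * φ := mul_nonneg (by positivity) (by linarith)
      have h6 : 1 / 2 ≤ cos ((2 * j + 1) * φ) := by
        rw [← cos_pi_div_three]
        exact cos_le_cos_of_nonneg_of_le_pi h5 (by linarith) hj
      rw [hcos]
      nlinarith
    rcases eq_or_lt_of_le (show 0 ≤ φ by linarith) with hφ0 | hφ0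
    · have : G = Finset.range M := by
        refine Finset.filter_true_of_mem fun j _ => hlow j ?_
        rw [← hφ0, mul_zero]
        linarith
      rw [this, Finset.card_range]
      omega
    · obtain ⟨s, hs1, hs2, hs3⟩ := exists_shift hφ0 (by linarith)
      rcases le_or_gt (2 * s) M with hsM | hsM
      · have hδ : cos (2 * θ * s) ^ 2 ≤ 1 / 4 := by
          have e : 2 * θ * s = s * π - 2 * φ * s := by rw [hφ]; ring
          have hs := sin_sq_add_cos_sq (s * π)
          rw [sin_nat_mul_pi] at hs
          rw [e, cos_sub, sin_nat_mul_pi, zero_mul, add_zero, mul_pow]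
          nlinarith
        have : M ≤ 3 * G.card := card_le_three_mul_sin hsM hδ
        omega
      · have hsub : Finset.range (min M (max 1 (s - 1))) ⊆ G := by
          intro j hj
          rw [Finset.mem_range] at hj
          refine Finset.mem_filter.2 ⟨Finset.mem_range.2 (by omega), hlow j ?_⟩
          rcases Nat.eq_zero_or_pos j with rfl | hj0
          · simp only [Nat.cast_zero, mul_zero, zero_add, one_mul]
            linarith
          · have h5 : 2 * j + 1 + 2 ≤ 2 * s := by omega
            have h5' : 2 * (j : ℝ) + 1 + 2 ≤ 2 * s := by exact_mod_cast h5
            nlinarith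
        have := Finset.card_le_card hsub
        rw [Finset.card_range] at this
        omega

end OnlineQuantum

namespace OnlineQuantum

/-! ### The iterations -/

/-- The amplitudes of the good and of the bad addresses after `j` Grover iterations, up to the sign
and a common factor, where `p` is the fraction of the good addresses. -/
noncomputable def groverAmp (p : ℝ) : ℕ → ℝ × ℝ
  | 0 => (1, 1)
  | j + 1 => ((groverAmp p j).1 * (1 - 2 * p) + 2 * (1 - p) * (groverAmp p j).2,
      (groverAmp p j).2 * (1 - 2 * p) - 2 * p * (groverAmp p j).1)

/-- A Grover iteration is the rotation by `2 * θ`, where `sin θ ^ 2` is the fraction of the good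
addresses. -/
theorem sin_mul_groverAmp (θ : ℝ) (j : ℕ) :
    Real.sin θ * (groverAmp (Real.sin θ ^ 2) j).1 = Real.sin ((2 * j + 1) * θ) ∧
      Real.cos θ * (groverAmp (Real.sin θ ^ 2) j).2 = Real.cos ((2 * j + 1) * θ) := by
  induction j with
  | zero => simp [groverAmp]
  | succ j ih =>
    obtain ⟨h1, h2⟩ := ih
    have e : (2 * ((j + 1 : ℕ) : ℝ) + 1) * θ = (2 * j + 1) * θ + 2 * θ := by push_cast; ring
    have hsc := Real.sin_sq_add_cos_sq θ
    rw [e, Real.sin_add, Real.cos_add, Real.sin_two_mul, Real.cos_two_mul', groverAmp, ← h1, ← h2]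
    dsimp only
    constructor
    · linear_combination (-Real.sin θ * (groverAmp (Real.sin θ ^ 2) j).1 -
        2 * Real.sin θ * (groverAmp (Real.sin θ ^ 2) j).2) * hsc
    · linear_combination (-Real.cos θ * (groverAmp (Real.sin θ ^ 2) j).2) * hsc

variable (x y : List Bool)

/-- Whether the number `i` belongs to both sets. -/
def common (i : ℕ) : Bool := x.getD i false && y.getD i false

/-- The amplitudes after `j` iterations on `D` address bits. -/
noncomputable def ampAt (D : ℕ) (p : ℝ) (j i : ℕ) : ℂ :=
  (-1) ^ j * invSqrtTwo ^ D *
    ((if common x y i then (groverAmp p j).1 else (groverAmp p j).2 : ℝ) : ℂ)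

/-- The fraction of the addresses that belong to both sets. -/
noncomputable def commonFraction (D : ℕ) : ℝ :=
  ((Finset.range (2 ^ D)).filter fun i => common x y i = true).card / 2 ^ D

theorem ampAt_zero (D : ℕ) (p : ℝ) (i : ℕ) : ampAt x y D p 0 i = invSqrtTwo ^ D := by
  simp [ampAt, groverAmp]

theorem sum_common (D : ℕ) (a b : ℂ) :
    (∑ i ∈ Finset.range (2 ^ D), if common x y i then a else b) / 2 ^ D =
      (commonFraction x y D : ℂ) * a + (1 - (commonFraction x y D : ℂ)) * b := by
  have hcard := Finset.card_filter_add_card_filter_not (s := Finset.range (2 ^ D))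
    (fun i => common x y i = true)
  rw [Finset.card_range] at hcard
  have hcard' : (((Finset.range (2 ^ D)).filter fun i => common x y i = true).card : ℂ) +
    ((Finset.range (2 ^ D)).filter fun i => ¬common x y i = true).card = 2 ^ D := by
    exact_mod_cast hcard
  have h2 : (2 : ℂ) ^ D ≠ 0 := pow_ne_zero _ two_ne_zero
  rw [Finset.sum_ite, Finset.sum_const, Finset.sum_const, nsmul_eq_mul, nsmul_eq_mul,
    commonFraction]
  push_cast
  field_simp
  linear_combination b * hcard'

/-- One iteration: the sign of the common elements is changed, then the diffusion is applied. -/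
theorem ampAt_succ (D j i : ℕ) :
    (if common x y i then -ampAt x y D (commonFraction x y D) j i
      else ampAt x y D (commonFraction x y D) j i) -
      2 * ((∑ i ∈ Finset.range (2 ^ D), if common x y i then
        -ampAt x y D (commonFraction x y D) j i
        else ampAt x y D (commonFraction x y D) j i) / 2 ^ D) =
      ampAt x y D (commonFraction x y D) (j + 1) i := by
  set p := commonFraction x y D with hp
  set c : ℂ := (-1) ^ j * invSqrtTwo ^ D with hc
  have h : ∀ i, (if common x y i then -ampAt x y D p j i else ampAt x y D p j i) =
      if common x y i then -c * ((groverAmp p j).1 : ℂ) else c * ((groverAmp p j).2 : ℂ) := by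
    intro i
    unfold ampAt
    split_ifs <;> ring
  rw [h, Finset.sum_congr rfl fun i _ => h i, sum_common, ← hp, ampAt, groverAmp]
  split_ifs <;> push_cast <;> rw [pow_succ] <;> ring

/-! ### The effect of the blocks -/

/-- If the gates of each bit `b` take the state `S bs` to the state `S (bs ++ [b])`, then the gates
of the block `bs` take `S []` to `S bs`. -/
theorem circOp_blockGates {k J nb : ℕ} (S : List Bool → RegState)
    (hS : ∀ bs b, bs.length < 4 ^ k → circOp (bitGates k J nb bs.length b) (S bs) = S (bs ++ [b]))
    (bs : List Bool) (h : bs.length ≤ 4 ^ k) :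
    circOp (blockGates k J nb bs) (S []) = S bs := by
  induction bs using List.reverseRecOn with
  | nil => rfl
  | append_singleton bs b ih =>
    rw [List.length_append, List.length_singleton] at h
    rw [blockGates_append, circOp_append, ih (by omega), hS bs b (by omega)]

theorem getD_append_singleton (bs : List Bool) (b : Bool) (i : ℕ) :
    (bs ++ [b]).getD i false = if i = bs.length then b else bs.getD i false := by
  rcases lt_trichotomy i bs.length with h | h | h
  · rw [if_neg (by omega), List.getD_append _ _ _ _ h]
  · subst h
    simp
  · rw [if_neg (by omega), List.getD_eq_default _ _ (by simp; omega),
      List.getD_eq_default _ _ (by omega)]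

variable {k J r : ℕ} (bs : List Bool) (hbs : bs.length ≤ 4 ^ k) (hr : 1 ≤ r) (α : ℕ → ℂ)
  (X F : ℕ → Bool)
include hbs hr

/-- The block `x` is added to the qubit `2`, so that the second block `x` of an iteration removes
the first one. -/
theorem circOp_blockGates_x {a : ℕ} (ha : a = 0 ∨ a = 2) (hJ : r ≤ J + 1) :
    circOp (blockGates k J (3 * r + a) bs) (addrState (2 * k) α X F) =
      addrState (2 * k) α (fun i => xor (X i) (bs.getD i false)) F := by
  have := circOp_blockGates (k := k) (J := J) (nb := 3 * r + a)
    (fun bs => addrState (2 * k) α (fun i => xor (X i) (bs.getD i false)) F) (fun bs b hlt => ?_)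
    bs hbs
  · simpa using this
  · cases b
    · rw [bitGates, if_pos rfl, circOp_nil]
      congr 1
      funext i
      rw [getD_append_singleton]
      split_ifs with h
      · rw [List.getD_eq_default _ _ (by omega)]
      · rfl
    · rw [bitGates, if_neg (by simp), if_neg (by omega), if_pos (by omega), if_pos (by omega),
        circOp_xGates (by rwa [← Imp.four_pow_eq])]
      congr 1
      funext i
      rw [getD_append_singleton]
      by_cases h : i = bs.length
      · subst h
        simp
      · simp [h]

/-- The block `y` changes the signs of the addresses whose bits are `1` in `y` and in the qubit `2`.
-/
theorem circOp_blockGates_phase (hJ : r ≤ J) :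
    circOp (blockGates k J (3 * r + 1) bs) (addrState (2 * k) α X F) =
      addrState (2 * k) (fun i => if X i && bs.getD i false then -α i else α i) X F := by
  have := circOp_blockGates (k := k) (J := J) (nb := 3 * r + 1)
    (fun bs => addrState (2 * k) (fun i => if X i && bs.getD i false then -α i else α i) X F)
    (fun bs b hlt => ?_) bs hbs
  · simpa using this
  · cases b
    · rw [bitGates, if_pos rfl, circOp_nil]
      congr 1
      funext i
      rw [getD_append_singleton]
      by_cases h : i = bs.length
      · subst h
        simp
      · simp [h]
    · rw [bitGates, if_neg (by simp), if_neg (by omega), if_pos (by omega), if_neg (by omega),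
        if_pos (by omega), circOp_phaseGates (by rwa [← Imp.four_pow_eq])]
      congr 1
      funext i
      rw [getD_append_singleton]
      by_cases h : i = bs.length
      · subst h
        simp
      · simp [h]

/-- After the last iteration, the block `y` flags the common elements in the qubit `1`. -/
theorem circOp_blockGates_flag (hJ : r = J + 1) :
    circOp (blockGates k J (3 * r + 1) bs) (addrState (2 * k) α X F) =
      addrState (2 * k) α X fun i => xor (X i && bs.getD i false) (F i) := by
  have := circOp_blockGates (k := k) (J := J) (nb := 3 * r + 1)
    (fun bs => addrState (2 * k) α X fun i => xor (X i && bs.getD i false) (F i))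
    (fun bs b hlt => ?_) bs hbs
  · simpa using this
  · cases b
    · rw [bitGates, if_pos rfl, circOp_nil]
      congr 1
      funext i
      rw [getD_append_singleton]
      by_cases h : i = bs.length
      · subst h
        simp
      · simp [h]
    · rw [bitGates, if_neg (by simp), if_neg (by omega), if_pos (by omega), if_neg (by omega),
        if_neg (by omega), circOp_flagGates (by rwa [← Imp.four_pow_eq])]
      congr 1
      funext i
      rw [getD_append_singleton]
      by_cases h : i = bs.length
      · subst h
        simp
      · simp [h]

omit hbs hr in
theorem blockGates_late {nb : ℕ} (h : J + 2 ≤ nb / 3) : blockGates k J nb bs = [] := by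
  have : ∀ i b, bitGates k J nb i b = [] := by
    intro i b
    cases b
    · rfl
    · rw [bitGates, if_neg (by simp), if_neg (by omega), if_neg (by omega)]
  simp [blockGates, this]

/-! ### The state after all blocks -/

omit hbs hr in
theorem segsGates_append_three (segs : List (List Bool)) (z : List Bool) :
    segsGates k J (segs ++ [x, y, z]) = segsGates k J segs ++
      (blockGates k J segs.length x ++ hashGates k J segs.length) ++
      (blockGates k J (segs.length + 1) y ++ hashGates k J (segs.length + 1)) ++
      (blockGates k J (segs.length + 2) z ++ hashGates k J (segs.length + 2)) := by
  rw [show segs ++ [x, y, z] = segs ++ [x] ++ [y] ++ [z] by simp, segsGates_append,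
    segsGates_append, segsGates_append]
  simp [List.append_assoc]

variable {x y}

omit hbs hr in
/-- After the blocks of the iterations `0, …, n`, the state is the one after `min n J` Grover
iterations, and the common elements are flagged if `n > J`. -/
theorem circOp_segsGates (hx : x.length ≤ 4 ^ k) (hy : y.length ≤ 4 ^ k) (n : ℕ) :
    circOp (prepGates (2 * k) ++ segsGates k J (List.replicate (n + 1) [x, y, x]).flatten)
        (basisState fun _ => false) =
      addrState (2 * k) (ampAt x y (2 * k) (commonFraction x y (2 * k)) (min n J))
        (fun _ => false) (fun i => decide (J < n) && common x y i) := by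
  set p := commonFraction x y (2 * k) with hp
  have hlen : ∀ n, ((List.replicate n [x, y, x]).flatten).length = 3 * n := by
    intro n
    simp [mul_comm]
  induction n with
  | zero =>
    have h := segsGates_append_three x y (k := k) (J := J) [] x
    rw [List.nil_append] at h
    rw [List.replicate_one, List.flatten_singleton, h, circOp_append, circOp_prepGates]
    simp only [List.length_nil, blockGates_zero, hashGates, segsGates, List.zipIdx_nil,
      List.flatMap_nil]
    have e : ∀ nb < 3, blockGates k J nb y = [] ∧ blockGates k J nb x = [] := by
      intro nb hnb
      have : ∀ i b, bitGates k J nb i b = [] := by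
        intro i b
        cases b
        · rfl
        · rw [bitGates, if_neg (by simp), if_pos (by omega)]
      simp [blockGates, this]
    simp [(e 1 (by norm_num)).1, (e 2 (by norm_num)).2, funext (ampAt_zero x y (2 * k) p)]
  | succ n ih =>
    rw [List.replicate_succ', List.flatten_append, List.flatten_singleton, segsGates_append_three,
      hlen]
    rw [circOp_append] at ih
    simp only [circOp_append, ih]
    have hh : ∀ a < 2, hashGates k J (3 * (n + 1) + a) = [] := by
      intro a ha
      rw [hashGates, if_neg (by omega), if_neg (by omega)]
    have hh0 := hh 0 (by norm_num)
    rw [add_zero] at hh0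
    rw [hh0, hh 1 (by norm_num), circOp_nil, circOp_nil]
    -- For `n > J` nothing is written any more. For `n < J` the three blocks are one more Grover
    -- iteration, and for `n = J` they flag the common elements.
    rcases Nat.lt_or_ge J n with h | h
    · rw [blockGates_late _ (by omega), blockGates_late _ (by omega), blockGates_late _ (by omega),
        hashGates, if_neg (by omega), if_pos (by omega), if_neg (by omega)]
      simp only [circOp_nil]
      rw [min_eq_right (by omega), min_eq_right (by omega), decide_eq_true h,
        decide_eq_true (by omega : J < n + 1)]
    · have hx0 := circOp_blockGates_x (J := J) (r := n + 1) x hx (by omega)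
        (ampAt x y (2 * k) p (min n J)) (fun _ => false)
        (fun i => decide (J < n) && common x y i) (.inl rfl) (by omega)
      rw [add_zero] at hx0
      rw [hx0]
      simp only [Bool.false_xor, decide_eq_false (show ¬J < n by omega), Bool.false_and]
      rcases Nat.lt_or_ge n J with h' | h'
      · rw [circOp_blockGates_phase _ hy (by omega) _ _ _ (by omega),
          circOp_blockGates_x _ hx (by omega) _ _ _ (.inr rfl) (by omega), hashGates,
          if_neg (by omega), if_pos (by omega), if_pos (by omega)]
        simp only [Bool.xor_self, decide_eq_false (show ¬J < n + 1 by omega), Bool.false_and]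
        rw [circOp_diffGates, min_eq_left (by omega), min_eq_left (by omega)]
        congr 1
        funext i
        exact ampAt_succ x y (2 * k) n i
      · obtain rfl : n = J := by omega
        rw [circOp_blockGates_flag _ hy (by omega) _ _ _ rfl,
          circOp_blockGates_x _ hx (by omega) _ _ _ (.inr rfl) (by omega), hashGates,
          if_neg (by omega), if_pos (by omega), if_neg (by omega), circOp_nil]
        simp only [Bool.xor_self, Bool.xor_false, decide_eq_true (show n < n + 1 by omega),
          Bool.true_and, min_self, min_eq_right (show n ≤ n + 1 by omega)]
        rfl

end OnlineQuantum

namespace OnlineQuantum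

/-! ### The probability of a collision -/

theorem sum_range_two_mul {M : Type*} [AddCommMonoid M] (g : ℕ → M) (n : ℕ) :
    ∑ v ∈ Finset.range (n * 2), g v =
      (∑ v ∈ Finset.range n, g (2 * v)) + ∑ v ∈ Finset.range n, g (2 * v + 1) := by
  induction n with
  | zero => simp
  | succ n ih =>
    rw [show (n + 1) * 2 = n * 2 + 1 + 1 by ring, Finset.sum_range_succ, Finset.sum_range_succ, ih,
      Finset.sum_range_succ, Finset.sum_range_succ, mul_comm n 2]
    ac_rfl

/-- The numbers given by disjoint groups of coins are uniformly distributed. -/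
theorem coinProb_seedVal {T o l : ℕ} (h : o + l ≤ T) (Q : ℕ → Prop) [DecidablePred Q] :
    coinProb (fun σ : Fin T → Bool => Q (seedVal ((List.ofFn σ).drop o) l)) =
      ((Finset.range (2 ^ l)).filter Q).card / 2 ^ l := by
  have key : ∀ (T o l : ℕ), o + l ≤ T → ∀ (Q : ℕ → Prop) [DecidablePred Q],
      coinProb (fun σ : Fin T → Bool => Q (seedVal ((List.ofFn σ).drop o) l)) =
        (∑ v ∈ Finset.range (2 ^ l), if Q v then (1 : ℝ) else 0) / 2 ^ l := by
    intro T
    induction T with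
    | zero =>
      intro o l h Q _
      obtain rfl : l = 0 := by omega
      classical
      rw [coinProb_zero]
      simp only [seedVal_zero, pow_zero, Finset.range_one, Finset.sum_singleton, div_one]
      congr
    | succ T ih =>
      intro o l h Q _
      rw [coinProb_succ]
      simp only [List.ofFn_cons]
      rcases o with _ | o
      · rcases l with _ | l
        · simp only [seedVal_zero, pow_zero, Finset.range_one, Finset.sum_singleton, div_one]
          split_ifs with hQ
          · rw [coinProb_of_forall fun _ => hQ]
            norm_num
          · simp [coinProb, hQ]
        · have hs : ∀ (b : Bool) (σ : List Bool),
              seedVal ((b :: σ).drop 0) (l + 1) = 2 * seedVal (σ.drop 0) l + b.toNat := by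
            intro b σ
            simp only [seedVal, List.drop_zero, List.take_succ_cons, bitsVal]
            ring
          simp only [hs]
          rw [ih 0 l (by omega) fun v => Q (2 * v + false.toNat),
            ih 0 l (by omega) fun v => Q (2 * v + true.toNat), pow_succ, sum_range_two_mul,
            pow_succ, ← add_div, div_div]
          rfl
      · simp only [List.drop_succ_cons]
        rw [ih o l (by omega), add_self_div_two]
  rw [key T o l h Q, Finset.sum_boole]

open Polynomial

/-- Different blocks of the same length have the same hash value only for the roots of a nonzero
polynomial: at each scale, the difference of the hash states of two blocks is the value of a
polynomial, which is nonzero unless the blocks agree at this scale. -/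
theorem exists_polynomial_aux (n : ℕ) (bs bs' : List Bool) (h : bs.length = n)
    (h' : bs'.length = n) :
    ∃ q : (ZMod (scalePrime (scaleAt n)))[X], q.natDegree ≤ n ∧
      (∀ A, ((hashState A bs).h : ZMod (scalePrime (scaleAt n))) - (hashState A bs').h =
        q.eval (A (scaleAt n) : ZMod (scalePrime (scaleAt n)))) ∧
      (bs ≠ bs' → q = 0 → ∃ m ≤ n, ∃ f : (ZMod (scalePrime (scaleAt m)))[X], f ≠ 0 ∧
        f.natDegree ≤ scaleAt m ∧ ∀ A, (hashState A bs).F = (hashState A bs').F →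
          f.eval (A (scaleAt m) : ZMod (scalePrime (scaleAt m))) = 0) := by
  induction n generalizing bs bs' with
  | zero =>
    rw [List.length_eq_zero_iff] at h h'
    subst h h'
    exact ⟨0, by simp, by simp, by simp⟩
  | succ n ih =>
    obtain ⟨bs, b, rfl⟩ : ∃ l b, bs = l ++ [b] :=
      (List.eq_nil_or_concat' bs).resolve_left (by rintro rfl; simp at h)
    obtain ⟨bs', b', rfl⟩ : ∃ l b, bs' = l ++ [b] :=
      (List.eq_nil_or_concat' bs').resolve_left (by rintro rfl; simp at h')
    simp only [List.length_append, List.length_singleton, Nat.add_right_cancel_iff] at h h'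
    obtain ⟨q, hq1, hq2, hq3⟩ := ih bs bs' h h'
    have hP : ∀ A, (hashState A bs).P = scaleAt n := fun A => by rw [hashState_P, h]
    have hP' : ∀ A, (hashState A bs').P = scaleAt n := fun A => by rw [hashState_P, h']
    have hp2 : ∀ n, 1 < scalePrime (scaleAt n) := fun n =>
      (prime_scalePrime (by have := two_le_scaleAt n; omega)).one_lt
    have hb : ∀ n, (b.toNat : ZMod (scalePrime (scaleAt n))) - b'.toNat = 0 → b = b' := by
      intro n hb
      have : Fact (1 < scalePrime (scaleAt n)) := ⟨hp2 n⟩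
      cases b <;> cases b' <;> simp_all
    -- If the scale changes, the old value `h` is kept in the fingerprint `F`, and quotient and
    -- remainder modulo the prime of the old scale recover the old `F` and `h`. So either the blocks
    -- differ only at an earlier scale, or `q` is the required polynomial.
    by_cases hn : n = scaleAt n
    · have hS : scaleAt (n + 1) = scaleAt n * scaleAt n := by rw [scaleAt, if_pos hn]
      have hpush : ∀ A bs b, bs.length = n → (hashState A bs).P = scaleAt n →
          hashState A (bs ++ [b]) = ⟨n + 1, scaleAt (n + 1), b.toNat % scalePrime (scaleAt (n + 1)),
            (hashState A bs).F * scalePrime (scaleAt n) + (hashState A bs).h⟩ := by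
        intro A bs b hl hP
        rw [hashState_append, HashState.push, hashState_i, hP, hl, if_pos hn, HashState.rescale, hS,
          hP, hashState_i, hl]
        simp
      refine ⟨C ((b.toNat : ZMod (scalePrime (scaleAt (n + 1)))) - b'.toNat),
        (natDegree_C _).le.trans (Nat.zero_le _), ?_, ?_⟩
      · intro A
        rw [hpush A bs b h (hP A), hpush A bs' b' h' (hP' A)]
        simp
      · intro hne hq0
        rw [C_eq_zero] at hq0
        have hbb := hb _ hq0
        have hbs : bs ≠ bs' := by
          rintro rfl
          exact hne (by rw [hbb])
        have hF : ∀ A, (hashState A (bs ++ [b])).F = (hashState A (bs' ++ [b'])).F →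
            (hashState A bs).F = (hashState A bs').F ∧
              (hashState A bs).h = (hashState A bs').h := by
          intro A hF
          rw [hpush A bs b h (hP A), hpush A bs' b' h' (hP' A)] at hF
          dsimp only at hF
          have h1 := hashState_h A bs
          have h2 := hashState_h A bs'
          rw [hP] at h1
          rw [hP'] at h2
          have hd := congrArg (· / scalePrime (scaleAt n)) hF
          have hm := congrArg (· % scalePrime (scaleAt n)) hF
          have hpos : 0 < scalePrime (scaleAt n) := by have := hp2 n; omega
          simp only [Nat.mul_add_mod_self_right, Nat.mod_eq_of_lt h1, Nat.mod_eq_of_lt h2] at hm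
          rw [hm] at hF
          exact ⟨Nat.eq_of_mul_eq_mul_right hpos (Nat.add_right_cancel hF), hm⟩
        by_cases hq : q = 0
        · obtain ⟨m, hm, f, hf1, hf2, hf3⟩ := hq3 hbs hq
          exact ⟨m, by omega, f, hf1, hf2, fun A hA => hf3 A (hF A hA).1⟩
        · refine ⟨n, by omega, q, hq, by omega, fun A hA => ?_⟩
          rw [← hq2 A, (hF A hA).2, sub_self]
    · have hS : scaleAt (n + 1) = scaleAt n := by rw [scaleAt, if_neg hn]
      have hpush : ∀ A bs b, bs.length = n → (hashState A bs).P = scaleAt n →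
          hashState A (bs ++ [b]) = ⟨n + 1, scaleAt n,
            ((hashState A bs).h * A (scaleAt n) + b.toNat) % scalePrime (scaleAt n),
            (hashState A bs).F⟩ := by
        intro A bs b hl hP
        rw [hashState_append, HashState.push, hashState_i, hP, hl, if_neg hn, hashState_i, hl, hP]
      have : Fact (Nat.Prime (scalePrime (scaleAt n))) :=
        ⟨prime_scalePrime (by have := two_le_scaleAt n; omega)⟩
      rw [hS]
      -- At the same scale this is one step of the Horner scheme, and the polynomial determines the
      -- difference of the last bits and `q`.
      refine ⟨q * X + C ((b.toNat : ZMod (scalePrime (scaleAt n))) - b'.toNat), ?_, ?_, ?_⟩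
      · refine natDegree_add_le_of_degree_le (natDegree_mul_le.trans ?_)
          ((natDegree_C _).le.trans (Nat.zero_le _))
        rw [natDegree_X]
        omega
      · intro A
        rw [hpush A bs b h (hP A), hpush A bs' b' h' (hP' A)]
        simp only [ZMod.natCast_mod, Nat.cast_add, Nat.cast_mul, eval_add, eval_mul, eval_X, eval_C,
          ← hq2 A]
        ring
      · intro hne hq0
        have hc : (b.toNat : ZMod (scalePrime (scaleAt n))) - b'.toNat = 0 := by
          have := congrArg (fun f => coeff f 0) hq0
          simpa using this
        rw [hc, C_0, add_zero] at hq0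
        have hq : q = 0 := by
          rcases mul_eq_zero.1 hq0 with h | h
          · exact h
          · exact absurd h X_ne_zero
        have hbb := hb _ hc
        have hbs : bs ≠ bs' := by
          rintro rfl
          exact hne (by rw [hbb])
        obtain ⟨m, hm, f, hf1, hf2, hf3⟩ := hq3 hbs hq
        refine ⟨m, by omega, f, hf1, hf2, fun A hA => hf3 A ?_⟩
        rwa [hpush A bs b h (hP A), hpush A bs' b' h' (hP' A)] at hA

/-- The polynomial does not depend on the seeds `A`, and its degree is at most the scale. -/
theorem exists_polynomial_of_ne {bs bs' : List Bool} (h : bs.length = bs'.length)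
    (hne : bs ≠ bs') :
    ∃ m ≤ bs.length, ∃ f : (ZMod (scalePrime (scaleAt m)))[X], f ≠ 0 ∧
      f.natDegree ≤ scaleAt m ∧ ∀ A, hashVal A bs = hashVal A bs' →
        f.eval (A (scaleAt m) : ZMod (scalePrime (scaleAt m))) = 0 := by
  obtain ⟨q, hq1, hq2, hq3⟩ := exists_polynomial_aux bs.length bs bs' rfl h.symm
  have hF : ∀ A, hashVal A bs = hashVal A bs' →
      (hashState A bs).F = (hashState A bs').F ∧ (hashState A bs).h = (hashState A bs').h := by
    intro A hF
    have h1 := hashState_h A bs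
    have h2 := hashState_h A bs'
    have hpos := scalePrime_pos bs.length
    rw [hashVal, hashVal] at hF
    rw [hashState_P] at h1 hF
    rw [hashState_P, ← h] at h2 hF
    have hm := congrArg (· % scalePrime (scaleAt bs.length)) hF
    simp only [Nat.mul_add_mod_self_right, Nat.mod_eq_of_lt h1, Nat.mod_eq_of_lt h2] at hm
    rw [hm] at hF
    exact ⟨Nat.eq_of_mul_eq_mul_right hpos (Nat.add_right_cancel hF), hm⟩
  by_cases hq : q = 0
  · obtain ⟨m, hm, f, hf1, hf2, hf3⟩ := hq3 hne hq
    exact ⟨m, hm, f, hf1, hf2, fun A hA => hf3 A (hF A hA).1⟩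
  · refine ⟨_, le_rfl, q, hq, hq1.trans (le_scaleAt _), fun A hA => ?_⟩
    rw [← hq2 A, (hF A hA).2, sub_self]

/-- Different blocks of the same length are distinguished with probability at least `1 / 2`. -/
theorem coinProb_hashVal_eq_le {T : ℕ} {bs bs' : List Bool} (h : bs.length = bs'.length)
    (hne : bs ≠ bs') (hT : seedLen bs.length ≤ T) :
    coinProb (fun σ : Fin T → Bool =>
      hashVal (seedAt (List.ofFn σ)) bs = hashVal (seedAt (List.ofFn σ)) bs') ≤ 1 / 2 := by
  classical
  obtain ⟨m, hm, f, hf0, hfd, hf⟩ := exists_polynomial_of_ne h hne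
  have hP2 := two_le_scaleAt m
  have : Fact (Nat.Prime (scalePrime (scaleAt m))) := ⟨prime_scalePrime (by omega)⟩
  have hpow : 2 ^ (Nat.log 2 (scaleAt m) + 1) = 2 * scaleAt m := by
    rw [pow_succ, ← scaleAt_eq_pow_log, mul_comm]
  have hlen : Nat.log 2 (scaleAt m) + 1 ≤ T := by
    refine le_trans ?_ hT
    exact Nat.add_le_add_right (Nat.log_mono_right (scaleAt_mono hm)) 1
  refine (coinProb_mono (E' := fun σ : Fin T → Bool =>
    f.eval (seedVal ((List.ofFn σ).drop 0) (Nat.log 2 (scaleAt m) + 1) :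
      ZMod (scalePrime (scaleAt m))) = 0) fun σ hσ => hf _ hσ).trans ?_
  rw [coinProb_seedVal (o := 0) (by omega)
    fun v => f.eval (v : ZMod (scalePrime (scaleAt m))) = 0, hpow]
  -- The polynomial has at most `scaleAt m` roots, and the seed is uniform among `2 * scaleAt m`
  -- numbers, which are distinct modulo the prime.
  have hcard : ((Finset.range (2 * scaleAt m)).filter fun v : ℕ =>
      f.eval (v : ZMod (scalePrime (scaleAt m))) = 0).card ≤ scaleAt m := by
    refine le_trans (Finset.card_le_card_of_injOn (t := f.roots.toFinset)
      (fun v : ℕ => (v : ZMod (scalePrime (scaleAt m)))) ?_ ?_)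
      ((Multiset.toFinset_card_le _).trans ((card_roots' f).trans hfd))
    · intro v hv
      have := (Finset.mem_filter.1 hv).2
      simpa [hf0] using this
    · intro v hv v' hv' hvv
      have h1 := Finset.mem_range.1 (Finset.mem_filter.1 hv).1
      have h2 := Finset.mem_range.1 (Finset.mem_filter.1 hv').1
      have hlt := lt_scalePrime (P := scaleAt m) (by omega)
      have := (ZMod.natCast_eq_natCast_iff' _ _ _).1 hvv
      rwa [Nat.mod_eq_of_lt (by omega), Nat.mod_eq_of_lt (by omega)] at this
  have hpowR : (2 : ℝ) ^ (Nat.log 2 (scaleAt m) + 1) = 2 * scaleAt m := by exact_mod_cast hpow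
  rw [hpowR, div_le_div_iff₀ (by positivity) (by norm_num), one_mul]
  have : (((Finset.range (2 * scaleAt m)).filter fun v : ℕ =>
      f.eval (v : ZMod (scalePrime (scaleAt m))) = 0).card : ℝ) ≤ scaleAt m := by
    exact_mod_cast hcard
  linarith

/-! ### The probability that a common element is found -/

theorem circOp_dummy (gs : List (ℕ × ℕ × ℕ)) (ψ : RegState) :
    circOp ((0, 0, 0) :: gs) ψ = circOp gs ψ := by
  rw [circOp_cons, gateOp, if_pos rfl]

/-- The circuit that is written for the blocks `x, y, x, x, y, x, …`. -/
def searchGates (k J : ℕ) (x y : List Bool) : List (ℕ × ℕ × ℕ) :=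
  (0, 0, 0) :: (prepGates (2 * k) ++ segsGates k J (List.replicate (2 ^ k) [x, y, x]).flatten)

variable {k : ℕ} {x y : List Bool} (hk : 1 ≤ k) (hx : x.length ≤ 4 ^ k) (hy : y.length ≤ 4 ^ k)
include hk hx hy

theorem circOp_searchGates {J : ℕ} (hJ : J < 2 ^ (k - 1)) :
    circOp (searchGates k J x y) (basisState fun _ => false) =
      addrState (2 * k) (ampAt x y (2 * k) (commonFraction x y (2 * k)) J) (fun _ => false)
        (common x y) := by
  obtain ⟨k, rfl⟩ : ∃ l, k = l + 1 := ⟨k - 1, by omega⟩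
  rw [Nat.add_sub_cancel] at hJ
  have h2 : 2 ^ (k + 1) = 2 ^ (k + 1) - 1 + 1 := by
    have : 0 < 2 ^ (k + 1) := by positivity
    omega
  have hlt : J < 2 ^ (k + 1) - 1 := by
    rw [pow_succ] at h2 ⊢
    omega
  rw [searchGates, circOp_dummy, h2, circOp_segsGates hx hy, min_eq_right hlt.le]
  simp [hlt]

/-- For at least a quarter of the iteration counts, the circuit finds a common element with
probability at least `1 / 4`, no matter how many common elements there are. -/
theorem card_search_good {m : ℕ} (hm : 0 < m) (hDm : 4 + 2 * (2 * k) ≤ m)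
    (hgs : ∀ J, ∀ g ∈ searchGates k J x y ++ [(1, 0, 2)], g.1 < m ∧ g.2.1 < m ∧ g.2.2 ≤ 2)
    {i : ℕ} (hi : i < 4 ^ k) (hc : common x y i = true) :
    (1 : ℝ) / 4 ≤ ((Finset.range (2 ^ (k - 1))).filter fun J => 1 / 4 ≤
      measureFirst (circuitState ((searchGates k J x y ++ [(1, 0, 2)]).map (toGate hm)))
        true).card / 2 ^ (k - 1) := by
  set G := (Finset.range (2 ^ (2 * k))).filter fun i => common x y i = true with hG
  set p := commonFraction x y (2 * k) with hp
  have hpG : p = G.card / 2 ^ (2 * k) := rfl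
  have hGpos : 1 ≤ G.card := Finset.card_pos.2
    ⟨i, Finset.mem_filter.2 ⟨Finset.mem_range.2 (by rwa [← Imp.four_pow_eq]), hc⟩⟩
  have hGle : G.card ≤ 2 ^ (2 * k) := (Finset.card_filter_le _ _).trans (by simp)
  have hGpos' : (1 : ℝ) ≤ G.card := by exact_mod_cast hGpos
  have hGle' : (G.card : ℝ) ≤ 2 ^ (2 * k) := by exact_mod_cast hGle
  have hp0 : 0 < p := by rw [hpG]; positivity
  have hp1 : p ≤ 1 := by rw [hpG, div_le_one (by positivity)]; exact hGle'
  -- After `J` iterations the success probability is `sin ((2 * J + 1) * θ) ^ 2`. One common element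
  -- among `4 ^ k` addresses suffices for `sin θ ≥ 1 / 2 ^ k`, and `2 ^ k` is twice the number of
  -- the possible iteration counts.
  set θ := Real.arcsin (Real.sqrt p) with hθ
  have hsq : Real.sqrt p ≤ 1 := Real.sqrt_le_one.2 hp1
  have hsin : Real.sin θ = Real.sqrt p :=
    Real.sin_arcsin (by linarith [Real.sqrt_nonneg p]) hsq
  have hsin2 : Real.sin θ ^ 2 = p := by rw [hsin, Real.sq_sqrt hp0.le]
  have hcard := le_four_mul_card_sin (θ := θ) (M := 2 ^ (k - 1)) (Nat.one_le_two_pow)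
    (Real.arcsin_pos.2 (Real.sqrt_pos.2 hp0)) (Real.arcsin_le_pi_div_two _) (by
      rw [hsin]
      refine Real.le_sqrt_of_sq_le ?_
      have e : (2 : ℝ) * ((2 ^ (k - 1) : ℕ) : ℝ) = 2 ^ k := by
        push_cast
        rw [← pow_succ', Nat.sub_add_cancel hk]
      rw [e, div_pow, one_pow, ← pow_mul, mul_comm k 2, hpG]
      gcongr)
  have hmeas : ∀ J ∈ Finset.range (2 ^ (k - 1)), Real.sin ((2 * J + 1) * θ) ^ 2 ≤
      measureFirst (circuitState ((searchGates k J x y ++ [(1, 0, 2)]).map (toGate hm))) true := by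
    intro J hJ
    refine le_trans (le_of_eq ?_) (sum_le_measureFirst
      (circOp_searchGates hk hx hy (Finset.mem_range.1 hJ)) hm hDm (hgs J))
    have hnorm : ∀ i ∈ G, ‖ampAt x y (2 * k) p J i‖ ^ 2 =
        (groverAmp p J).1 ^ 2 / 2 ^ (2 * k) := by
      intro i hi
      rw [ampAt, if_pos (Finset.mem_filter.1 hi).2, norm_mul, norm_mul, norm_pow, norm_pow,
        norm_neg,
        norm_one, one_pow, one_mul, mul_pow, ← pow_mul, mul_comm _ 2, pow_mul, norm_invSqrtTwo_sq,
        Complex.norm_real, Real.norm_eq_abs, sq_abs, div_pow, one_pow]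
      ring
    rw [Finset.sum_congr rfl hnorm, Finset.sum_const, nsmul_eq_mul, ← (sin_mul_groverAmp θ J).1,
      mul_pow, hsin2, hpG]
    ring
  have hle : ((Finset.range (2 ^ (k - 1))).filter fun J : ℕ =>
      1 / 4 ≤ Real.sin ((2 * J + 1) * θ) ^ 2).card ≤
      ((Finset.range (2 ^ (k - 1))).filter fun J => 1 / 4 ≤
        measureFirst (circuitState ((searchGates k J x y ++ [(1, 0, 2)]).map (toGate hm)))
          true).card := by
    refine Finset.card_le_card fun J hJ => ?_
    obtain ⟨h1, h2⟩ := Finset.mem_filter.1 hJ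
    exact Finset.mem_filter.2 ⟨h1, h2.trans (hmeas J h1)⟩
  rw [div_le_div_iff₀ (by norm_num) (by positivity), one_mul]
  have := hcard.trans (Nat.mul_le_mul_left 4 hle)
  have : ((2 ^ (k - 1) : ℕ) : ℝ) ≤ ((4 * _ : ℕ) : ℝ) := Nat.cast_le.2 this
  push_cast at this
  linarith

end OnlineQuantum

namespace OnlineQuantum

/-! ### The qubits that are used -/

/-- The gate acts on the qubits `1, …, 3 + 2 * D`. -/
def InRange (D : ℕ) (g : ℕ × ℕ × ℕ) : Prop :=
  (1 ≤ g.1 ∧ g.1 ≤ 3 + 2 * D) ∧ (1 ≤ g.2.1 ∧ g.2.1 ≤ 3 + 2 * D) ∧ g.2.2 ≤ 2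

theorem InRange.mono {D D' : ℕ} (h : D ≤ D') {g : ℕ × ℕ × ℕ} (hg : InRange D g) :
    InRange D' g := by
  unfold InRange at *
  omega

theorem inRange_tofGates {D a b c : ℕ} (ha : 1 ≤ a ∧ a ≤ 3 + 2 * D) (hb : 1 ≤ b ∧ b ≤ 3 + 2 * D)
    (hc : 1 ≤ c ∧ c ≤ 3 + 2 * D) : ∀ g ∈ tofGates a b c, InRange D g := by
  intro g hg
  have := mem_tofGates hg
  unfold InRange
  omega

theorem inRange_stepGates {D i q : ℕ} (hq : q < D) : ∀ g ∈ stepGates i q, InRange D g := by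
  rw [stepGates, List.forall_mem_append]
  refine ⟨inRange_tofGates (by omega) (by omega) (by omega), ?_⟩
  split_ifs
  · simp [InRange]
    omega
  · simp

theorem inRange_sandwich {D i : ℕ} {gs : List (ℕ × ℕ × ℕ)} (h : ∀ g ∈ gs, InRange D g) :
    ∀ g ∈ chainUp i D ++ gs ++ chainDown i D, InRange D g := by
  rw [List.forall_mem_append, List.forall_mem_append]
  refine ⟨⟨fun g hg => ?_, h⟩, fun g hg => ?_⟩
  · obtain ⟨q, hq, hg⟩ := List.mem_flatMap.1 hg
    exact inRange_stepGates (List.mem_range.1 hq) g hg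
  · obtain ⟨q, hq, hg⟩ := List.mem_flatMap.1 hg
    have := List.mem_range.1 hq
    exact inRange_stepGates (by omega) g hg

theorem inRange_hadDown (D : ℕ) : ∀ g ∈ hadDown D, InRange D g := by
  intro g hg
  obtain ⟨q, hq, rfl⟩ := List.mem_map.1 hg
  have := List.mem_range.1 hq
  simp [InRange]
  omega

theorem inRange_hadUp (D : ℕ) : ∀ g ∈ hadUp D, InRange D g := by
  intro g hg
  obtain ⟨q, hq, rfl⟩ := List.mem_map.1 hg
  have := List.mem_range.1 hq
  simp [InRange]
  omega

theorem inRange_prepGates (D : ℕ) : ∀ g ∈ prepGates D, InRange D g := by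
  rw [prepGates, List.forall_mem_append]
  refine ⟨?_, inRange_hadDown D⟩
  simp [notGates, InRange]
  omega

theorem inRange_bitGates (k J nb i : ℕ) (b : Bool) :
    ∀ g ∈ bitGates k J nb i b, InRange (2 * k) g := by
  unfold bitGates
  split_ifs
  · simp
  · simp
  · exact inRange_sandwich (by simp [InRange]; omega)
  · exact inRange_sandwich (by simp [InRange]; omega)
  · exact inRange_sandwich (inRange_tofGates (by omega) (by omega) (by omega))
  · simp

theorem inRange_hashGates (k J nb : ℕ) : ∀ g ∈ hashGates k J nb, InRange (2 * k) g := by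
  unfold hashGates
  split_ifs
  · simp
  · rw [diffGates, List.forall_mem_append, List.forall_mem_append]
    exact ⟨⟨inRange_hadUp _, inRange_sandwich (by simp [InRange]; omega)⟩, inRange_hadDown _⟩
  · simp
  · simp

theorem inRange_blockGates (k J nb : ℕ) (bs : List Bool) :
    ∀ g ∈ blockGates k J nb bs, InRange (2 * k) g := by
  intro g hg
  obtain ⟨x, -, hg⟩ := List.mem_flatMap.1 hg
  exact inRange_bitGates _ _ _ _ _ g hg

theorem inRange_segsGates (k J : ℕ) (segs : List (List Bool)) :
    ∀ g ∈ segsGates k J segs, InRange (2 * k) g := by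
  intro g hg
  obtain ⟨x, -, hg⟩ := List.mem_flatMap.1 hg
  rcases List.mem_append.1 hg with hg | hg
  · exact inRange_blockGates _ _ _ _ g hg
  · exact inRange_hashGates _ _ _ g hg

/-! ### The shape of a word -/

/-- What has been read: `1^k`; or `1^k #` and a part of the first block; or `1^k #`, some complete
blocks of length `4^k`, each with its `#`, and a part of the next block; or a word of which no
continuation belongs to `L_DISJ`. -/
inductive Shape where
  | start (k : ℕ)
  | first (k : ℕ) (bs : List Bool)
  | later (k : ℕ) (segs : List (List Bool)) (bs : List Bool)
  | bad

namespace Shape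

/-- The shape after a bit. -/
def bit (b : Bool) : Shape → Shape
  | start k => if b then start (k + 1) else bad
  | first k bs => first k (bs ++ [b])
  | later k segs bs => if bs.length < 4 ^ k then later k segs (bs ++ [b]) else bad
  | bad => bad

/-- The shape after `#`. -/
def hash : Shape → Shape
  | start k => if k = 0 then bad else first k []
  | first k bs => if bs.length = 4 ^ k then later k [bs] [] else bad
  | later k segs bs => if bs.length = 4 ^ k then later k (segs ++ [bs]) [] else bad
  | bad => bad

/-- The shape after one more letter. -/
def next (s : Shape) : Letter → Shape
  | .zero => s.bit false
  | .one => s.bit true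
  | .hash => s.hash

/-- Block contents as a word. -/
def bits (bs : List Bool) : List Letter := bs.map Letter.ofBool

theorem bits_append (bs : List Bool) (b : Bool) :
    bits (bs ++ [b]) = bits bs ++ [Letter.ofBool b] := List.map_append

/-- Complete blocks as a word. -/
def blocks (segs : List (List Bool)) : List Letter := segs.flatMap fun bs => bits bs ++ [.hash]

theorem blocks_append (segs segs' : List (List Bool)) :
    blocks (segs ++ segs') = blocks segs ++ blocks segs' := List.flatMap_append

/-- The properties of the shapes of words of length `n`. -/
def Valid (n : ℕ) : Shape → Prop
  | start k => k ≤ n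
  | first k bs => k ≠ 0 ∧ bs.length ≤ n
  | later k segs bs => k ≠ 0 ∧ segs ≠ [] ∧ (∀ bs ∈ segs, bs.length = 4 ^ k) ∧
      bs.length ≤ 4 ^ k ∧ 4 ^ k + segs.length ≤ n
  | bad => True

/-- The word `w` has the given shape. -/
def Describes (w : List Letter) : Shape → Prop
  | start k => w = List.replicate k .one
  | first k bs => w = List.replicate k .one ++ [.hash] ++ bits bs
  | later k segs bs => w = List.replicate k .one ++ [.hash] ++ blocks segs ++ bits bs
  | bad => True

theorem valid_bit {n : ℕ} {s : Shape} (h : s.Valid n) (b : Bool) : (s.bit b).Valid (n + 1) := by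
  cases s with
  | start k =>
    rw [bit]
    split_ifs
    · exact Nat.succ_le_succ h
    · trivial
  | first k bs =>
    obtain ⟨h1, h2⟩ := h
    exact ⟨h1, by simpa using h2⟩
  | later k segs bs =>
    obtain ⟨h1, h2, h3, h4, h5⟩ := h
    rw [bit]
    split_ifs with hl
    · exact ⟨h1, h2, h3, by simpa using hl, by omega⟩
    · trivial
  | bad => trivial

theorem valid_hash {n : ℕ} {s : Shape} (h : s.Valid n) : s.hash.Valid (n + 1) := by
  cases s with
  | start k =>
    rw [hash]
    split_ifs with hk
    · trivial
    · exact ⟨hk, Nat.zero_le _⟩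
  | first k bs =>
    obtain ⟨h1, h2⟩ := h
    rw [hash]
    split_ifs with hl
    · refine ⟨h1, by simp, by simpa using hl, Nat.zero_le _, ?_⟩
      simp
      omega
    · trivial
  | later k segs bs =>
    obtain ⟨h1, h2, h3, h4, h5⟩ := h
    rw [hash]
    split_ifs with hl
    · refine ⟨h1, by simp, ?_, Nat.zero_le _, ?_⟩
      · rw [List.forall_mem_append]
        exact ⟨h3, by simpa using hl⟩
      · simp
        omega
    · trivial
  | bad => trivial

theorem describes_bit {w : List Letter} {s : Shape} (h : s.Describes w) (b : Bool) :
    (s.bit b).Describes (w ++ [Letter.ofBool b]) := by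
  cases s with
  | start k =>
    rw [Describes] at h
    cases b
    · trivial
    · change w ++ [Letter.one] = List.replicate (k + 1) Letter.one
      rw [h, List.replicate_succ']
  | first k bs =>
    rw [Describes] at h
    simp only [bit, Describes, h, bits_append, List.append_assoc]
  | later k segs bs =>
    rw [Describes] at h
    rw [bit]
    split_ifs with hl
    · simp only [Describes, h, bits_append, List.append_assoc]
    · trivial
  | bad => trivial

theorem describes_hash {w : List Letter} {s : Shape} (h : s.Describes w) :
    s.hash.Describes (w ++ [.hash]) := by
  cases s with
  | start k =>
    rw [Describes] at h
    rw [hash]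
    split_ifs
    · trivial
    · simp [Describes, h, bits]
  | first k bs =>
    rw [Describes] at h
    rw [hash]
    split_ifs
    · simp [Describes, h, bits, blocks]
    · trivial
  | later k segs bs =>
    rw [Describes] at h
    rw [hash]
    split_ifs
    · simp [Describes, h, bits, blocks]
    · trivial
  | bad => trivial

end Shape

/-- The shape of a word. -/
def shapeOf (w : List Letter) : Shape := w.foldl Shape.next (.start 0)

theorem shapeOf_append (w w' : List Letter) :
    shapeOf (w ++ w') = w'.foldl Shape.next (shapeOf w) := List.foldl_append

theorem valid_shapeOf (w : List Letter) : (shapeOf w).Valid w.length := by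
  induction w using List.reverseRecOn with
  | nil => exact Nat.zero_le _
  | append_singleton w a ih =>
    rw [shapeOf_append, List.length_append, List.length_singleton]
    cases a
    · exact Shape.valid_bit ih _
    · exact Shape.valid_bit ih _
    · exact Shape.valid_hash ih

theorem describes_shapeOf (w : List Letter) : (shapeOf w).Describes w := by
  induction w using List.reverseRecOn with
  | nil => rfl
  | append_singleton w a ih =>
    rw [shapeOf_append]
    cases a
    · exact Shape.describes_bit ih false
    · exact Shape.describes_bit ih true
    · exact Shape.describes_hash ih

theorem shapeOf_append_ofBool (w : List Letter) (b : Bool) :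
    shapeOf (w ++ [Letter.ofBool b]) = (shapeOf w).bit b := by
  rw [shapeOf_append]
  cases b <;> rfl

theorem shapeOf_append_hash (w : List Letter) : shapeOf (w ++ [.hash]) = (shapeOf w).hash := by
  rw [shapeOf_append]
  rfl

theorem shapeOf_replicate (k : ℕ) : shapeOf (List.replicate k .one) = .start k := by
  induction k with
  | zero => rfl
  | succ k ih =>
    rw [List.replicate_succ', shapeOf_append, ih]
    rfl

theorem shapeOf_first {k : ℕ} (hk : k ≠ 0) (bs : List Bool) :
    shapeOf (List.replicate k .one ++ [.hash] ++ Shape.bits bs) = .first k bs := by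
  induction bs using List.reverseRecOn with
  | nil =>
    rw [Shape.bits, List.map_nil, List.append_nil, shapeOf_append_hash, shapeOf_replicate,
      Shape.hash, if_neg hk]
  | append_singleton bs b ih =>
    rw [Shape.bits_append, ← List.append_assoc, shapeOf_append_ofBool, ih]
    rfl

theorem shapeOf_append_bits {k : ℕ} {w : List Letter} {segs : List (List Bool)}
    (h : shapeOf w = .later k segs []) (bs : List Bool) (hl : bs.length ≤ 4 ^ k) :
    shapeOf (w ++ Shape.bits bs) = .later k segs bs := by
  induction bs using List.reverseRecOn with
  | nil => rwa [Shape.bits, List.map_nil, List.append_nil]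
  | append_singleton bs b ih =>
    rw [List.length_append, List.length_singleton] at hl
    rw [Shape.bits_append, ← List.append_assoc, shapeOf_append_ofBool, ih (by omega), Shape.bit,
      if_pos (by omega)]

theorem shapeOf_later {k : ℕ} (hk : k ≠ 0) {segs : List (List Bool)} (hs : segs ≠ [])
    (hl : ∀ bs ∈ segs, bs.length = 4 ^ k) :
    shapeOf (List.replicate k .one ++ [.hash] ++ Shape.blocks segs) = .later k segs [] := by
  induction segs using List.reverseRecOn with
  | nil => exact absurd rfl hs
  | append_singleton segs bs ih =>
    rw [List.forall_mem_append, List.forall_mem_singleton] at hl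
    have e : Shape.blocks [bs] = Shape.bits bs ++ [.hash] := by simp [Shape.blocks]
    rw [Shape.blocks_append, e, ← List.append_assoc, ← List.append_assoc, shapeOf_append_hash]
    by_cases hs' : segs = []
    · subst hs'
      rw [show Shape.blocks [] = [] from rfl, List.append_nil, shapeOf_first hk, Shape.hash,
        if_pos hl.2, List.nil_append]
    · rw [shapeOf_append_bits (ih hs' hl.1) bs hl.2.le, Shape.hash, if_pos hl.2]

/-! ### The run of the program -/

/-- The hash values of all blocks agree with the first ones of their kind. -/
def HashesOk (σ : List Bool) (segs : List (List Bool)) : Prop :=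
  ∀ j < segs.length, (segs[j]?).elim 0 (hashVal (seedAt σ)) =
    (segs[j % 3 % 2]?).elim 0 (hashVal (seedAt σ))

theorem hashesOk_append {σ : List Bool} {segs : List (List Bool)} {bs : List Bool} :
    HashesOk σ (segs ++ [bs]) ↔ HashesOk σ segs ∧ Imp.HashOk σ segs bs := by
  have hlt : ∀ j, j < segs.length → (segs ++ [bs])[j]? = segs[j]? := fun j hj =>
    List.getElem?_append_left hj
  have hlast : (segs ++ [bs])[segs.length]? = some bs := by simp
  constructor
  · intro h
    refine ⟨fun j hj => ?_, ?_⟩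
    · have := h j (by rw [List.length_append]; omega)
      rwa [hlt j hj, hlt _ (by omega)] at this
    · have := h segs.length (by simp)
      rwa [hlast] at this
  · rintro ⟨h1, h2⟩ j hj
    rw [List.length_append, List.length_singleton] at hj
    rcases Nat.lt_succ_iff_lt_or_eq.1 hj with hj | rfl
    · rw [hlt j hj, hlt _ (by omega)]
      exact h1 j hj
    · rw [hlast]
      exact h2

theorem hashesOk_singleton (σ : List Bool) (bs : List Bool) : HashesOk σ [bs] := by
  intro j hj
  obtain rfl : j = 0 := by simpa using hj
  rfl

/-- The memory after the program has detected that the input is not in `L_DISJ`. -/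
def Failed (D : ℕ) (m : Mem Var) : Prop :=
  ∃ (c : Ctl) (τ : List Bool) (gs : List (ℕ × ℕ × ℕ)), c.fail = 1 ∧ (∀ g ∈ gs, InRange D g) ∧
    m = ⟨c.toVal, τ, dummyWord ++ gateWords gs⟩

/-- The memory after a word of shape `s`. -/
def StateOf (D : ℕ) (σ : List Bool) (m : Mem Var) : Shape → Prop
  | .start k => m = mem₀ k σ
  | .first k bs => m = mem₁ k bs σ
  | .later k segs bs => (HashesOk σ segs ∧ m = mem₂ k segs bs σ) ∨ (¬HashesOk σ segs ∧ Failed D m)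
  | .bad => Failed D m

namespace Imp

variable {B D : ℕ} {m : Mem Var} {σ : List Bool} {k : ℕ}

theorem to_letter_of_failed (h : Failed D m) (a : Letter) : To B (letterProg a) m m := by
  obtain ⟨c, τ, gs, h1, h2, rfl⟩ := h
  cases a <;> exact .ifz_pos (by simp) (by simp [h1]) .skip

theorem Fails.exists_failed {p : Imp Var} (h : Fails B p m)
    (hm : ∃ gs, (∀ g ∈ gs, InRange D g) ∧ m.out = dummyWord ++ gateWords gs) :
    ∃ m', To B p m m' ∧ Failed D m' := by
  obtain ⟨c, τ, h1, h2⟩ := h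
  obtain ⟨gs, h3, h4⟩ := hm
  exact ⟨_, h2, c, τ, gs, h1, h3, by rw [h4]⟩

theorem mem₀_out : ∃ gs, (∀ g ∈ gs, InRange D g) ∧ (mem₀ k σ).out = dummyWord ++ gateWords gs :=
  ⟨[], by simp, by simp [mem₀, gateWords]⟩

theorem mem₁_out {bs : List Bool} :
    ∃ gs, (∀ g ∈ gs, InRange D g) ∧ (mem₁ k bs σ).out = dummyWord ++ gateWords gs :=
  ⟨[], by simp, by simp [mem₁, gateWords]⟩

theorem mem₂_out {segs : List (List Bool)} {bs : List Bool} (hD : 2 * k ≤ D) :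
    ∃ gs, (∀ g ∈ gs, InRange D g) ∧ (mem₂ k segs bs σ).out = dummyWord ++ gateWords gs := by
  refine ⟨_, ?_, rfl⟩
  rw [List.forall_mem_append, List.forall_mem_append]
  exact ⟨fun g hg => (inRange_prepGates _ g hg).mono hD,
    fun g hg => (inRange_segsGates _ _ _ g hg).mono hD,
    fun g hg => (inRange_blockGates _ _ _ _ g hg).mono hD⟩

/-- The program keeps track of the shape when a bit is read. -/
theorem exists_stateOf_bit {n : ℕ} (hB : (n + 3) ^ 14 ≤ B) {s : Shape} (hs : s.Valid n)
    (h : StateOf (Nat.log 2 n) σ m s) (b : Bool) :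
    ∃ m', To B (letterProg (Letter.ofBool b)) m m' ∧ StateOf (Nat.log 2 n) σ m' (s.bit b) := by
  obtain ⟨-, -, h3, h4⟩ := hash_bounds (n := 0) (b₀ := n + 3) (by omega) hB
  cases s with
  | start k =>
    have hs : k ≤ n := hs
    subst h
    cases b
    · exact (fails_letter_zero_mem₀ (by omega)).exists_failed mem₀_out
    · exact ⟨_, to_letter_one_mem₀ (by omega) (by omega), rfl⟩
  | first k bs =>
    subst h
    exact ⟨_, to_letter_bit_mem₁ (Nat.add_le_add_right hs.2 3) hB, rfl⟩
  | later k segs bs =>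
    obtain ⟨h1, h2, h5, h6, h7⟩ := hs
    have hD : 2 * k ≤ Nat.log 2 n := by
      refine Nat.le_log_of_pow_le (by norm_num) ?_
      rw [← four_pow_eq]
      omega
    rw [Shape.bit]
    rcases h with ⟨hok, rfl⟩ | ⟨hok, h⟩
    · split_ifs with hl
      · exact ⟨_, to_letter_bit_mem₂ hl (b₀ := n + 3) (by omega) (by omega) hB, .inl ⟨hok, rfl⟩⟩
      · exact (fails_letter_bit_mem₂ (by omega) (by omega)).exists_failed (mem₂_out hD)
    · refine ⟨m, to_letter_of_failed h _, ?_⟩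
      split_ifs
      · exact .inr ⟨hok, h⟩
      · exact h
  | bad => exact ⟨m, to_letter_of_failed h _, h⟩

/-- The program keeps track of the shape when `#` is read. -/
theorem exists_stateOf_hash {n : ℕ} (hB : (n + 3) ^ 14 ≤ B) {s : Shape} (hs : s.Valid n)
    (h : StateOf (Nat.log 2 n) σ m s) :
    ∃ m', To B (letterProg .hash) m m' ∧ StateOf (Nat.log 2 n) σ m' s.hash := by
  obtain ⟨-, -, h3, h4⟩ := hash_bounds (n := 0) (b₀ := n + 3) (by omega) hB
  cases s with
  | start k =>
    have hs : k ≤ n := hs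
    subst h
    rw [Shape.hash]
    split_ifs with hk
    · subst hk
      exact (fails_letter_hash_mem₀ (by omega)).exists_failed mem₀_out
    · exact ⟨_, to_letter_hash_mem₀ hk (by omega), rfl⟩
  | first k bs =>
    subst h
    rw [Shape.hash]
    split_ifs with hl
    · exact ⟨_, to_letter_hash_mem₁ hl (Nat.add_le_add_right hs.2 3) hB,
        .inl ⟨hashesOk_singleton _ _, rfl⟩⟩
    · exact (fails_letter_hash_mem₁ hl (Nat.add_le_add_right hs.2 3) hB).exists_failed mem₁_out
  | later k segs bs =>
    obtain ⟨h1, h2, h5, h6, h7⟩ := hs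
    have hD : 2 * k ≤ Nat.log 2 n := by
      refine Nat.le_log_of_pow_le (by norm_num) ?_
      rw [← four_pow_eq]
      omega
    rw [Shape.hash]
    rcases h with ⟨hok, rfl⟩ | ⟨hok, h⟩
    · have key := letter_hash_mem₂ (σ := σ) h2 (fun bs hbs => (h5 bs hbs).le) h6 (b₀ := n + 3)
        (by omega) (by omega) hB
      by_cases hc : bs.length = 4 ^ k ∧ HashOk σ segs bs
      · rw [if_pos hc.1]
        exact ⟨_, key.1 hc, .inl ⟨hashesOk_append.2 ⟨hok, hc.2⟩, rfl⟩⟩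
      · obtain ⟨m', h8, h9⟩ := (key.2 hc).exists_failed (mem₂_out hD)
        refine ⟨m', h8, ?_⟩
        split_ifs with hl
        · exact .inr ⟨fun h => hc ⟨hl, (hashesOk_append.1 h).2⟩, h9⟩
        · exact h9
    · refine ⟨m, to_letter_of_failed h _, ?_⟩
      split_ifs
      · exact .inr ⟨fun h => hok (hashesOk_append.1 h).1, h⟩
      · exact h
  | bad => exact ⟨m, to_letter_of_failed h _, h⟩

end Imp

end OnlineQuantum

namespace OnlineQuantum

namespace Imp

variable {B : ℕ} {σ : List Bool}

theorem to_initProg (hB : 1 ≤ B) : To B initProg ⟨fun _ => 0, σ, []⟩ (mem₀ 0 σ) := by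
  have h : ({ k := 0, G := 1 : Ctl }).toVal = Function.update (fun _ => 0) Var.G 1 := by
    funext v
    cases v <;> rfl
  refine .seq (.assign (by simpa using hB)) (.seq .out (.seq .out (.seq .out (.seq .out ?_))))
  rw [mem₀, h]
  exact .out

end Imp

theorem Shape.Valid.mono {n n' : ℕ} (hn : n ≤ n') {s : Shape} (h : s.Valid n) : s.Valid n' := by
  cases s with
  | start k => exact le_trans (show k ≤ n from h) hn
  | first k bs => exact ⟨h.1, h.2.trans hn⟩
  | later k segs bs => exact ⟨h.1, h.2.1, h.2.2.1, h.2.2.2.1, h.2.2.2.2.trans hn⟩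
  | bad => trivial

theorem exists_ctl_mem₂ (k : ℕ) (segs : List (List Bool)) (bs σ : List Bool) :
    ∃ c : Ctl, mem₂ k segs bs σ = ⟨c.toVal, (mem₂ k segs bs σ).coins, (mem₂ k segs bs σ).out⟩ ∧
      c.k = k ∧ c.fail = 0 ∧ c.mode = 2 ∧ c.nb = segs.length ∧ c.i = bs.length :=
  ⟨_, rfl, rfl, rfl, rfl, rfl, hashState_i _ _⟩

section

variable {n B : ℕ} (hB : (n + 3) ^ 14 ≤ B) (σ : List Bool) (w : List Letter)
include hB

/-- The memory after the program has read `w`. -/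
theorem stateOf_feed (hw : w.length ≤ n) :
    StateOf (Nat.log 2 n) σ (mainProgram.feed (mainProgram.start σ) w) (shapeOf w) := by
  induction w using List.reverseRecOn with
  | nil =>
    have hB1 : 1 ≤ B := (Nat.one_le_pow _ _ (by omega)).trans hB
    exact (Imp.to_initProg hB1).2
  | append_singleton w a ih =>
    rw [List.length_append, List.length_singleton] at hw
    have hv : (shapeOf w).Valid n := (valid_shapeOf w).mono (by omega)
    rw [StreamProgram.feed_append, shapeOf_append]
    cases a
    · obtain ⟨m', h1, h2⟩ := Imp.exists_stateOf_bit hB hv (ih (by omega)) false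
      rw [← h1.2] at h2
      exact h2
    · obtain ⟨m', h1, h2⟩ := Imp.exists_stateOf_bit hB hv (ih (by omega)) true
      rw [← h1.2] at h2
      exact h2
    · obtain ⟨m', h1, h2⟩ := Imp.exists_stateOf_hash hB hv (ih (by omega))
      rw [← h1.2] at h2
      exact h2

theorem ok_step (hw : w.length ≤ n) (a : Letter) :
    (mainProgram.step a).Ok B (mainProgram.feed (mainProgram.start σ) w) := by
  have hv : (shapeOf w).Valid n := (valid_shapeOf w).mono hw
  cases a
  · obtain ⟨m', h1, h2⟩ := Imp.exists_stateOf_bit hB hv (stateOf_feed hB σ w hw) false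
    exact h1.1
  · obtain ⟨m', h1, h2⟩ := Imp.exists_stateOf_bit hB hv (stateOf_feed hB σ w hw) true
    exact h1.1
  · obtain ⟨m', h1, h2⟩ := Imp.exists_stateOf_hash hB hv (stateOf_feed hB σ w hw)
    exact h1.1

end

/-! ### The output of the program -/

/-- The word consists of `1^k #` and the `3 * 2 ^ k` blocks `segs`. -/
def Complete (w : List Letter) (k : ℕ) (segs : List (List Bool)) : Prop :=
  shapeOf w = .later k segs [] ∧ segs.length = 3 * 2 ^ k

theorem Complete.unique {w : List Letter} {k k' : ℕ} {segs segs' : List (List Bool)}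
    (h : Complete w k segs) (h' : Complete w k' segs') : k = k' ∧ segs = segs' := by
  have := h.1.symm.trans h'.1
  injection this with h1 h2
  exact ⟨h1, h2⟩

/-- The circuit that is written for a complete word. -/
def acceptGates (k J : ℕ) (segs : List (List Bool)) : List (ℕ × ℕ × ℕ) :=
  prepGates (2 * k) ++ segsGates k J segs ++ [(1, 0, 2)]

/-- If the word is complete and no difference between its blocks is detected, the output is the
search circuit; otherwise the output is a circuit that ends with a `NOT` gate on the qubit `0`. -/
theorem exists_output {B : ℕ} (w : List Letter) (hB : (w.length + 3) ^ 14 ≤ B) (σ : List Bool) :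
    mainProgram.Ok B w σ ∧
      ((∃ k segs, Complete w k segs ∧ HashesOk σ segs ∧ mainProgram.output w σ =
          dummyWord ++ gateWords (acceptGates k (iterCount k σ) segs)) ∨
        ((∀ k segs, Complete w k segs → ¬HashesOk σ segs) ∧
          ∃ gs, (∀ g ∈ gs, InRange (Nat.log 2 w.length) g) ∧ mainProgram.output w σ =
            dummyWord ++ gateWords (gs ++ notGates 0 1))) := by
  obtain ⟨-, -, h3, h4⟩ := Imp.hash_bounds (n := 0) (b₀ := w.length + 3) (by omega) hB
  have hst := stateOf_feed hB σ w le_rfl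
  have hval := valid_shapeOf w
  have hstep : ∀ v a v', w = v ++ a :: v' →
      (mainProgram.step a).Ok B (mainProgram.feed (mainProgram.start σ) v) := by
    rintro v a v' rfl
    exact ok_step hB σ v (by simp) a
  set m := mainProgram.feed (mainProgram.start σ) w with hm
  have reject : (∀ k segs, Complete w k segs → ¬HashesOk σ segs) → ∀ (c : Ctl) (τ : List Bool)
      (gs : List (ℕ × ℕ × ℕ)), (∀ g ∈ gs, InRange (Nat.log 2 w.length) g) →
      m = ⟨c.toVal, τ, dummyWord ++ gateWords gs⟩ →
      (c.fail ≠ 0 ∨ c.mode ≤ 1 ∨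
        (3 * 2 ^ c.k + 2 ≤ B ∧ c.nb ≤ B ∧ (c.i ≠ 0 ∨ c.nb ≠ 3 * 2 ^ c.k))) →
      mainProgram.Ok B w σ ∧ ((∃ k segs, Complete w k segs ∧ HashesOk σ segs ∧
        mainProgram.output w σ =
          dummyWord ++ gateWords (acceptGates k (iterCount k σ) segs)) ∨
        ((∀ k segs, Complete w k segs → ¬HashesOk σ segs) ∧
          ∃ gs, (∀ g ∈ gs, InRange (Nat.log 2 w.length) g) ∧ mainProgram.output w σ =
            dummyWord ++ gateWords (gs ++ notGates 0 1))) := by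
    intro hno c τ gs hgs he hc
    obtain ⟨c', h5, h6⟩ := Imp.to_finalProg_reject (τ := τ) (o := dummyWord ++ gateWords gs)
      (by omega) hc
    rw [← he] at h5 h6
    refine ⟨⟨(Imp.to_initProg (by omega)).1, hstep, h5⟩, .inr ⟨hno, gs, hgs, ?_⟩⟩
    change (Imp.finalProg.run m).out = _
    rw [h6, gateWords_append, List.append_assoc]
  have failed : (∀ k segs, Complete w k segs → ¬HashesOk σ segs) →
      Failed (Nat.log 2 w.length) m → _ := fun hno ⟨c, τ, gs, h1, h2, h3⟩ =>
    reject hno c τ gs h2 h3 (.inl (by omega))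
  cases hs : shapeOf w with
  | start k =>
    have hno : ∀ k segs, Complete w k segs → ¬HashesOk σ segs := by
      intro k segs h
      exact absurd (hs.symm.trans h.1) (by simp)
    rw [hs] at hst
    exact reject hno { k := k, G := 1 } σ [] (by simp) hst
      (.inr (.inl (Nat.zero_le _)))
  | first k bs =>
    have hno : ∀ k segs, Complete w k segs → ¬HashesOk σ segs := by
      intro k segs h
      exact absurd (hs.symm.trans h.1) (by simp)
    rw [hs] at hst
    exact reject hno (({ mode := 1, k := k : Ctl }.setHash (hashState (seedAt σ) bs)).setSeed σ
      (seedLen bs.length)) _ [] (by simp) hst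
      (.inr (.inl le_rfl))
  | bad =>
    have hno : ∀ k segs, Complete w k segs → ¬HashesOk σ segs := by
      intro k segs h
      exact absurd (hs.symm.trans h.1) (by simp)
    rw [hs] at hst
    exact failed hno hst
  | later k segs bs =>
    have huniq : ∀ k' segs', Complete w k' segs' → k' = k ∧ segs' = segs ∧ bs = [] := by
      intro k' segs' h
      have := h.1.symm.trans hs
      injection this with h1 h2 h3
      exact ⟨h1, h2, h3.symm⟩
    rw [hs] at hst hval
    obtain ⟨hv1, hv2, hv3, hv4, hv5⟩ := hval
    have hD : 2 * k ≤ Nat.log 2 w.length := by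
      refine Nat.le_log_of_pow_le (by norm_num) ?_
      rw [← Imp.four_pow_eq]
      omega
    have h24 : 2 ^ k ≤ 4 ^ k := Nat.pow_le_pow_left (by norm_num) k
    rcases hst with ⟨hok, hst⟩ | ⟨hok, hst⟩
    · obtain ⟨c, hc1, rfl, hc3, hc4, hc5, hc6⟩ := exists_ctl_mem₂ k segs bs σ
      by_cases hc : bs = [] ∧ segs.length = 3 * 2 ^ c.k
      · obtain ⟨rfl, hlen⟩ := hc
        obtain ⟨c', h5, h6⟩ := Imp.to_finalProg_accept (B := B) (c := c)
          (τ := (mem₂ c.k segs [] σ).coins) (o := (mem₂ c.k segs [] σ).out) (by omega) hc3 hc4 hc6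
          (hc5.trans hlen)
        rw [← hc1, ← hst] at h5 h6
        refine ⟨⟨(Imp.to_initProg (by omega)).1, hstep, h5⟩,
          .inl ⟨c.k, segs, ⟨hs, hlen⟩, hok, ?_⟩⟩
        change (Imp.finalProg.run m).out = _
        rw [h6]
        simp only [hst, mem₂, acceptGates, blockGates_nil, List.append_nil, gateWords_append,
          List.append_assoc]
      · have hno : ∀ k segs, Complete w k segs → ¬HashesOk σ segs := by
          intro k' segs' h
          obtain ⟨rfl, rfl, rfl⟩ := huniq k' segs' h
          exact absurd ⟨rfl, h.2⟩ hc
        refine reject hno c (mem₂ c.k segs bs σ).coins (prepGates (2 * c.k) ++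
          (segsGates c.k (iterCount c.k σ) segs ++
            blockGates c.k (iterCount c.k σ) segs.length bs)) ?_ (hst.trans hc1)
          (.inr (.inr ⟨by omega, by omega, ?_⟩))
        · rw [List.forall_mem_append, List.forall_mem_append]
          exact ⟨fun g hg => (inRange_prepGates _ g hg).mono hD,
            fun g hg => (inRange_segsGates _ _ _ g hg).mono hD,
            fun g hg => (inRange_blockGates _ _ _ _ g hg).mono hD⟩
        · rw [hc5, hc6, Ne, ← not_and_or, List.length_eq_zero_iff]
          exact hc
    · refine failed (fun k' segs' h => ?_) hst
      obtain ⟨rfl, rfl, rfl⟩ := huniq k' segs' h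
      exact hok

/-! ### Membership in `L_DISJ` -/

theorem blocks_flatten_replicate (n : ℕ) (l : List (List Bool)) :
    Shape.blocks (List.replicate n l).flatten = (List.replicate n (Shape.blocks l)).flatten := by
  induction n with
  | zero => rfl
  | succ n ih =>
    rw [List.replicate_succ, List.replicate_succ, List.flatten_cons, List.flatten_cons,
      Shape.blocks_append, ih]

theorem bitWord_eq {n : ℕ} (x : Fin n → Bool) : bitWord x = Shape.bits (List.ofFn x) := by
  rw [bitWord, Shape.bits, List.map_ofFn]
  rfl

theorem disjWord_eq (k : ℕ) (x y : Fin (2 ^ (2 * k)) → Bool) :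
    disjWord k x y = List.replicate k .one ++ [.hash] ++ Shape.blocks
      (List.replicate (2 ^ k) [List.ofFn x, List.ofFn y, List.ofFn x]).flatten := by
  rw [disjWord, blocks_flatten_replicate, bitWord_eq, bitWord_eq]
  simp [Shape.blocks]

theorem DISJ_eq_true_iff {n : ℕ} (x y : Fin n → Bool) :
    DISJ x y = true ↔ ∀ i < n, common (List.ofFn x) (List.ofFn y) i = false := by
  rw [DISJ, decide_eq_true_iff]
  constructor
  · intro h i hi
    have := h ⟨i, hi⟩
    simp only [common, List.getD_eq_getElem?_getD, List.getElem?_ofFn, hi, dite_true,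
      Option.getD_some]
    revert this
    cases x ⟨i, hi⟩ <;> cases y ⟨i, hi⟩ <;> simp
  · intro h i
    have := h i i.2
    simp only [common, List.getD_eq_getElem?_getD, List.getElem?_ofFn, i.2, dite_true,
      Option.getD_some, Fin.eta] at this
    revert this
    cases x i <;> cases y i <;> simp

theorem mem_LDISJ_iff (w : List Letter) :
    w ∈ LDISJ ↔ ∃ (k : ℕ) (x y : List Bool), k ≠ 0 ∧ x.length = 4 ^ k ∧ y.length = 4 ^ k ∧
      (∀ i < 4 ^ k, common x y i = false) ∧
      Complete w k (List.replicate (2 ^ k) [x, y, x]).flatten := by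
  constructor
  · rintro ⟨k, hk, x, y, hd, rfl⟩
    have hx : (List.ofFn x).length = 4 ^ k := by rw [List.length_ofFn, Imp.four_pow_eq]
    have hy : (List.ofFn y).length = 4 ^ k := by rw [List.length_ofFn, Imp.four_pow_eq]
    refine ⟨k, List.ofFn x, List.ofFn y, by omega, hx, hy, ?_, ?_, ?_⟩
    · rw [Imp.four_pow_eq]
      exact (DISJ_eq_true_iff x y).1 hd
    · rw [disjWord_eq]
      refine shapeOf_later (by omega) ?_ ?_
      · intro h
        have := congrArg List.length h
        simp at this
      · intro bs hbs
        obtain ⟨l, hl, hbs⟩ := List.mem_flatten.1 hbs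
        rw [List.eq_of_mem_replicate hl] at hbs
        simp only [List.mem_cons, List.not_mem_nil, or_false] at hbs
        rcases hbs with rfl | rfl | rfl
        · exact hx
        · exact hy
        · exact hx
    · simp [mul_comm]
  · rintro ⟨k, x, y, hk, hx, hy, hd, hc, -⟩
    have hofFn : ∀ l : List Bool, l.length = 4 ^ k →
        ∃ f : Fin (2 ^ (2 * k)) → Bool, l = List.ofFn f := by
      intro l hl
      rw [Imp.four_pow_eq] at hl
      refine ⟨fun i => l.get (i.cast hl.symm), ?_⟩
      refine List.ext_getElem (by simp [hl]) fun i h1 h2 => by simp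
    obtain ⟨f, rfl⟩ := hofFn x hx
    obtain ⟨g, rfl⟩ := hofFn y hy
    rw [Imp.four_pow_eq] at hd
    refine ⟨k, by omega, f, g, (DISJ_eq_true_iff f g).2 hd, ?_⟩
    have := describes_shapeOf w
    rw [hc] at this
    rw [disjWord_eq]
    simpa [Shape.Describes, Shape.bits] using this

/-- Blocks that agree with the first ones of their kind. -/
theorem eq_flatten_replicate {n : ℕ} {x y : List Bool} (segs : List (List Bool))
    (hlen : segs.length = 3 * n)
    (h : ∀ j < segs.length, segs[j]? = [x, y][j % 3 % 2]?) :
    segs = (List.replicate n [x, y, x]).flatten := by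
  induction n generalizing segs with
  | zero => exact List.length_eq_zero_iff.1 (by omega)
  | succ n ih =>
    obtain ⟨a, b, c, rest, rfl⟩ : ∃ a b c rest, segs = a :: b :: c :: rest := by
      rcases segs with _ | ⟨a, _ | ⟨b, _ | ⟨c, rest⟩⟩⟩
      · simp at hlen
      · simp at hlen; omega
      · simp at hlen; omega
      · exact ⟨a, b, c, rest, rfl⟩
    have h0 := h 0 (by simp)
    have h1 := h 1 (by simp)
    have h2 := h 2 (by simp)
    simp only [List.length_cons] at hlen
    simp only [List.getElem?_cons_zero, List.getElem?_cons_succ, Option.some.injEq,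
      Nat.zero_mod, Nat.reduceMod] at h0 h1 h2
    rw [List.replicate_succ, List.flatten_cons, ← ih rest (by omega), h0, h1, h2]
    · rfl
    · intro j hj
      have := h (j + 3) (by simp only [List.length_cons]; omega)
      rwa [show (j + 3) % 3 = j % 3 by omega] at this

/-! ### The acceptance probabilities -/

section

variable {m : ℕ} (hm : 0 < m) {w : List Letter} (hD : 4 + 2 * Nat.log 2 w.length ≤ m)
include hm hD

omit hD in
theorem describesCircuit_gateWords (gs : List (ℕ × ℕ × ℕ))
    (hgs : ∀ g ∈ gs, g.1 < m ∧ g.2.1 < m ∧ g.2.2 ≤ 2) (P : QState m → Prop)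
    (h : P (circuitState (((0, 0, 0) :: gs).map (toGate hm)))) :
    DescribesCircuit m (dummyWord ++ gateWords gs) P :=
  ⟨_, by simp, (binary_encodeCircuit hm gs hgs).symm, h⟩

/-- The qubit `0` is not touched before the final `NOT` gate, so the outcome is always `1`. -/
theorem describesCircuit_reject {gs : List (ℕ × ℕ × ℕ)}
    (hgs : ∀ g ∈ gs, InRange (Nat.log 2 w.length) g) :
    DescribesCircuit m (dummyWord ++ gateWords (gs ++ notGates 0 1)) fun ψ =>
      measureFirst ψ true = 1 := by
  have hlt : ∀ g ∈ gs ++ notGates 0 1, g.1 < m ∧ g.2.1 < m ∧ g.2.2 ≤ 2 := by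
    rw [List.forall_mem_append]
    refine ⟨fun g hg => ?_, ?_⟩
    · have := hgs g hg
      unfold InRange at this
      omega
    · simp [notGates]
      omega
  refine describesCircuit_gateWords hm _ hlt _ (measureFirst_eq_one hm _ ?_ true fun v hv => ?_)
  · rw [List.forall_mem_cons]
    exact ⟨⟨hm, hm, by norm_num⟩, hlt⟩
  · rw [circOp_dummy]
    exact circOp_append_notGates_eq_zero (fun g hg => ⟨(hgs g hg).1.1, (hgs g hg).2.1.1⟩) v hv

variable {k : ℕ} {segs : List (List Bool)} (hc : Complete w k segs)
include hc

omit hm hD in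
theorem Complete.log_le : k ≠ 0 ∧ (∀ bs ∈ segs, bs.length = 4 ^ k) ∧
    2 * k ≤ Nat.log 2 w.length := by
  have hv := valid_shapeOf w
  rw [hc.1] at hv
  refine ⟨hv.1, hv.2.2.1, Nat.le_log_of_pow_le (by norm_num) ?_⟩
  rw [← Imp.four_pow_eq]
  exact le_trans (Nat.le_add_right _ _) hv.2.2.2.2

theorem acceptGates_lt (J : ℕ) :
    ∀ g ∈ acceptGates k J segs, g.1 < m ∧ g.2.1 < m ∧ g.2.2 ≤ 2 := by
  have hk := hc.log_le.2.2
  rw [acceptGates, List.forall_mem_append, List.forall_mem_append]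
  refine ⟨⟨fun g hg => ?_, fun g hg => ?_⟩, by simp; omega⟩
  · have := inRange_prepGates _ g hg
    unfold InRange at this
    omega
  · have := inRange_segsGates _ _ _ g hg
    unfold InRange at this
    omega

end

/-- For a word in `L_DISJ`, the outcome of the measurement is always `0`. -/
theorem describesCircuit_of_mem {m : ℕ} (hm : 0 < m) {w : List Letter}
    (hD : 4 + 2 * Nat.log 2 w.length ≤ m) (hw : w ∈ LDISJ) (σ : List Bool) :
    DescribesCircuit m (mainProgram.output w σ) fun ψ => measureFirst ψ false = 1 := by
  obtain ⟨k, x, y, hk, hx, hy, hd, hc⟩ := (mem_LDISJ_iff w).1 hw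
  have hok : HashesOk σ (List.replicate (2 ^ k) [x, y, x]).flatten := by
    have key : ∀ n j, j < 3 * n →
        ((List.replicate n [x, y, x]).flatten)[j]? = [x, y, x][j % 3]? := by
      intro n
      induction n with
      | zero => intro j hj; omega
      | succ n ih =>
        intro j hj
        rw [List.replicate_succ, List.flatten_cons]
        by_cases h3 : j < 3
        · rw [List.getElem?_append_left (by simpa using h3), Nat.mod_eq_of_lt h3]
        · rw [List.getElem?_append_right (by simpa using h3)]
          simp only [List.length_cons, List.length_nil]
          rw [ih (j - 3) (by omega), show (j - (0 + 1 + 1 + 1)) % 3 = j % 3 by omega]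
    intro j hj
    rw [hc.2] at hj
    rw [key _ _ hj, key _ _ (by omega)]
    have : j % 3 = 0 ∨ j % 3 = 1 ∨ j % 3 = 2 := by omega
    rcases this with h | h | h <;> simp [h]
  obtain ⟨-, ⟨k', segs', hc', -, hout⟩ | ⟨hno, -⟩⟩ := exists_output w le_rfl σ
  · obtain ⟨rfl, rfl⟩ := hc.unique hc'
    rw [hout]
    have hlt := acceptGates_lt hm hD hc (iterCount k σ)
    refine describesCircuit_gateWords hm _ hlt _
      (measureFirst_eq_one hm _ ?_ false fun v hv => ?_)
    · rw [List.forall_mem_cons]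
      exact ⟨⟨hm, hm, by norm_num⟩, hlt⟩
    · exact circOp_append_cnot_eq_zero
        (circOp_searchGates (by omega) hx.le hy.le (seedVal_lt _ _))
        (by rwa [← Imp.four_pow_eq]) v hv
  · exact absurd hok (hno k _ hc)

/-- For a word outside `L_DISJ`, the outcome of the measurement is `1` with a large probability. -/
theorem le_coinProb_of_not_mem {m T : ℕ} (hm : 0 < m) {w : List Letter}
    (hD : 4 + 2 * Nat.log 2 w.length ≤ m)
    (hT : ∀ k, 2 * k ≤ Nat.log 2 w.length → seedLen (4 ^ k) + (k - 1) ≤ T) (hw : w ∉ LDISJ) :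
    1 / 4 ≤ coinProb fun σ : Fin T → Bool =>
      DescribesCircuit m (mainProgram.output w (List.ofFn σ)) fun ψ =>
        1 / 4 ≤ measureFirst ψ true := by
  have reject : ∀ σ, (∀ k segs, Complete w k segs → ¬HashesOk σ segs) →
      DescribesCircuit m (mainProgram.output w σ) fun ψ => 1 / 4 ≤ measureFirst ψ true := by
    intro σ hσ
    obtain ⟨-, ⟨k, segs, hc, hok, -⟩ | ⟨-, gs, hgs, hout⟩⟩ := exists_output w le_rfl σ
    · exact absurd hok (hσ k segs hc)
    · rw [hout]
      obtain ⟨l, h1, h2, h3⟩ := describesCircuit_reject hm hD hgs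
      exact ⟨l, h1, h2, (by norm_num : (1 : ℝ) / 4 ≤ 1).trans h3.ge⟩
  -- A word of the wrong shape is always detected. If the blocks are consistent, the only difference
  -- to the words in `L_DISJ` is a common element, which is found for a quarter of the iteration
  -- counts. Otherwise, two different blocks have different hash values with probability at least
  -- `1 / 2`.
  by_cases hcw : ∃ k segs, Complete w k segs
  swap
  · rw [coinProb_of_forall fun σ => reject _ fun k segs h => absurd ⟨k, segs, h⟩ hcw]
    norm_num
  obtain ⟨k, segs, hc⟩ := hcw
  obtain ⟨hk, hlen, hlog⟩ := hc.log_le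
  have hTk := hT k hlog
  have hpos : 1 ≤ 2 ^ k := Nat.one_le_two_pow
  by_cases hcons : ∀ j < segs.length, segs[j]? = segs[j % 3 % 2]?
  · obtain ⟨x, y, rest, rfl⟩ : ∃ x y rest, segs = x :: y :: rest := by
      have := hc.2
      rcases segs with _ | ⟨a, _ | ⟨b, rest⟩⟩
      · simp at this
      · simp at this; omega
      · exact ⟨a, b, rest, rfl⟩
    have hx : x.length = 4 ^ k := hlen x (by simp)
    have hy : y.length = 4 ^ k := hlen y (by simp)
    have hsegs := eq_flatten_replicate (x := x) (y := y) (x :: y :: rest) hc.2 fun j hj => by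
      rw [hcons j hj]
      have : j % 3 % 2 = 0 ∨ j % 3 % 2 = 1 := by omega
      rcases this with h | h <;> rw [h] <;> rfl
    rw [hsegs] at hc
    obtain ⟨i, hi, hcom⟩ : ∃ i < 4 ^ k, common x y i = true := by
      by_contra hno
      push Not at hno
      exact hw ((mem_LDISJ_iff w).2 ⟨k, x, y, hk, hx, hy, fun i hi => by simpa using hno i hi, hc⟩)
    have hgs : ∀ J, ∀ g ∈ searchGates k J x y ++ [(1, 0, 2)], g.1 < m ∧ g.2.1 < m ∧ g.2.2 ≤ 2 := by
      intro J
      rw [searchGates, List.cons_append, List.forall_mem_cons]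
      exact ⟨⟨hm, hm, by norm_num⟩, acceptGates_lt hm hD hc J⟩
    have hgood := card_search_good (Nat.one_le_iff_ne_zero.2 hk) hx.le hy.le hm (by omega) hgs
      hi hcom
    rw [← coinProb_seedVal (T := T) (o := seedLen (4 ^ k)) hTk] at hgood
    refine hgood.trans (coinProb_mono fun σ hσ => ?_)
    by_cases hok : ∀ k segs, Complete w k segs → ¬HashesOk (List.ofFn σ) segs
    · exact reject _ hok
    · obtain ⟨-, ⟨k', segs', hc', -, hout⟩ | ⟨hno, -⟩⟩ := exists_output w le_rfl (List.ofFn σ)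
      · obtain ⟨rfl, rfl⟩ := hc.unique hc'
        rw [hout]
        exact describesCircuit_gateWords hm _ (acceptGates_lt hm hD hc _) _ hσ
      · exact absurd hno hok
  · push Not at hcons
    obtain ⟨j, hj, hne⟩ := hcons
    have hj' : j % 3 % 2 < segs.length := by omega
    rw [List.getElem?_eq_getElem hj, List.getElem?_eq_getElem hj', Ne, Option.some.injEq] at hne
    have h1 : segs[j].length = 4 ^ k := hlen _ (List.getElem_mem hj)
    have h2 : segs[j % 3 % 2].length = 4 ^ k := hlen _ (List.getElem_mem hj')
    have hcol := coinProb_hashVal_eq_le (T := T) (h1.trans h2.symm) hne (by rw [h1]; omega)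
    have hnot := coinProb_not (fun σ : Fin T → Bool => hashVal (seedAt (List.ofFn σ)) segs[j] =
      hashVal (seedAt (List.ofFn σ)) segs[j % 3 % 2])
    refine le_trans (by linarith) (hnot.symm.le.trans (coinProb_mono fun σ hσ => ?_))
    refine reject _ fun k' segs' h hok => hσ ?_
    obtain ⟨rfl, rfl⟩ := hc.unique h
    have := hok j hj
    rwa [List.getElem?_eq_getElem hj, List.getElem?_eq_getElem hj'] at this

/-- The number of coins that are used is at most logarithmic. -/
theorem seedLen_four_pow_add_le (k : ℕ) : seedLen (4 ^ k) + (k - 1) ≤ 5 * k + 5 := by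
  have h : Nat.log 2 (scaleAt (4 ^ k)) < 4 * k + 5 := by
    refine Nat.log_lt_of_lt_pow (by have := two_le_scaleAt (4 ^ k); omega) ?_
    have hk : 1 ≤ 4 ^ k := Nat.one_le_pow _ _ (by norm_num)
    calc scaleAt (4 ^ k) ≤ (4 ^ k + 2) ^ 2 := scaleAt_le _
      _ ≤ (4 * 4 ^ k) ^ 2 := Nat.pow_le_pow_left (by omega) 2
      _ = 2 ^ (4 * k + 4) := by
        rw [Imp.four_pow_eq, show 4 = 2 ^ 2 by norm_num, ← pow_add, ← pow_mul]
        ring_nf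
      _ < 2 ^ (4 * k + 5) := Nat.pow_lt_pow_right (by norm_num) (by omega)
  rw [seedLen]
  omega

/-- The program is compiled to a machine, with space for all the qubits that are used. -/
theorem compl_LDISJ_mem_OQRL : LDISJᶜ ∈ OQRL := by
  -- The program needs numbers up to `(w.length + 3) ^ 14`, which is at most `(w.length + 2) ^ 28`.
  -- The summand `6` makes room for the `4 + 2 * Nat.log 2 w.length` qubits.
  obtain ⟨M, c₀, hM⟩ := StreamProgram.exists_optm mainProgram 28
  refine Set.mem_iUnion₂.2 ⟨c₀ + 6, by omega, M, fun w => ?_⟩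
  set m := logSpace (c₀ + 6) w.length with hmdef
  have hℓ : 1 ≤ Nat.log 2 (max w.length 2) := Nat.log_pos (by norm_num) (le_max_right _ _)
  have hlog : Nat.log 2 w.length ≤ Nat.log 2 (max w.length 2) :=
    Nat.log_mono_right (le_max_left _ _)
  have hmul : m = (c₀ + 6) * Nat.log 2 (max w.length 2) := rfl
  have hm6 : 6 * Nat.log 2 (max w.length 2) ≤ m := by
    rw [hmul]
    exact Nat.mul_le_mul_right _ (by omega)
  have hm : 0 < m := by omega
  have hD : 4 + 2 * Nat.log 2 w.length ≤ m := by omega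
  have hB : (w.length + 3) ^ 14 ≤ (w.length + 2) ^ 28 := by
    calc (w.length + 3) ^ 14 ≤ ((w.length + 2) ^ 2) ^ 14 := Nat.pow_le_pow_left (by nlinarith) 14
      _ = (w.length + 2) ^ 28 := by rw [← pow_mul]
  obtain ⟨hspace, hprob⟩ := hM (c₀ + 6) (by omega) w fun σ => (exists_output w hB σ).1
  have hT : ∀ k, 2 * k ≤ Nat.log 2 w.length → seedLen (4 ^ k) + (k - 1) ≤ 2 ^ m := by
    intro k hk
    have := seedLen_four_pow_add_le k
    have : m < 2 ^ m := Nat.lt_two_pow_self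
    omega
  refine ⟨fun ρ => ?_, fun hw => ?_, fun hw => ?_⟩
  · have htrue := hprob fun u => DescribesCircuit m u fun _ => True
    rw [coinProb_of_forall (E := fun σ : Fin (2 ^ logSpace (c₀ + 6) w.length) → Bool =>
      DescribesCircuit m (mainProgram.output w (List.ofFn σ)) fun _ => True) fun σ => ?_] at htrue
    · exact ⟨(hspace ρ).1, (hspace ρ).2, forall_of_coinProb_eq_one htrue ρ⟩
    · obtain ⟨-, ⟨k, segs, hc, -, hout⟩ | ⟨-, gs, hgs, hout⟩⟩ :=
        exists_output w le_rfl (List.ofFn σ)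
      · rw [hout]
        exact describesCircuit_gateWords hm _ (acceptGates_lt hm hD hc _) _ trivial
      · rw [hout]
        obtain ⟨l, h1, h2, -⟩ := describesCircuit_reject hm hD hgs
        exact ⟨l, h1, h2, trivial⟩
  · rw [hprob fun u => DescribesCircuit m u fun ψ => 1 / 4 ≤ measureFirst ψ true]
    exact le_coinProb_of_not_mem hm hD hT hw
  · rw [hprob fun u => DescribesCircuit m u fun ψ => measureFirst ψ false = 1]
    exact coinProb_of_forall fun σ => describesCircuit_of_mem hm hD (not_not.1 hw) _

end OnlineQuantum

theorem mainTheorem1 : OnlineQuantum.LDISJᶜ ∈ OnlineQuantum.OQRL := by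
  exact OnlineQuantum.compl_LDISJ_mem_OQRL
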